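/- Let $\Delta$ be a complete unimodular fan in $N_{\mathbb R}=\mathbb R^n$ (with lattice $N=\mathbb Z^n$), let $N_{\mathbb R}(\Delta)=\coprod_{\tau\in\Delta}O(\tau)$, $O(\tau)=N_{\mathbb R}/\mathbb R\tau$, be the associated tropical toric variety (glued from the spaces $\mathrm{Hom}_{\mathbb R_{\ge 0}}(\sigma^\vee,\mathbb R\cup\{\infty\})$, $\sigma\in\Delta$), and let $\pi_\tau\colon N_{\mathbb R}\to O(\tau)$ be the projection; $O(\tau)$ carries the lattice $\pi_\tau(N)$. Conventions. A tropical cycle of dimension $k$ in a real vector space with a lattice is a finite balanced polyhedral complex of pure dimension $k$ with rational slopes and non-zero integral weights on its $k$-dimensional cells (possibly empty), up to refinement. A tropical cycle $\Sigma$ in $\mathbb R^n$ is compatible with $\Delta$ if, for some polyhedral structure on $\Sigma$, every cell $P$ and every cone $\sigma\in\Delta$ satisfy $\sigma\subset\rho(P)$ or $\mathrm{relint}(\sigma)\cap\rho(P)=\emptyset$, where $\rho(P)$ is the recession cone. In this case $\overline\Sigma\cap O(\tau)$ (closure in $N_{\mathbb R}(\Delta)$) is a tropical cycle in $O(\tau)$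 of the same codimension as $\Sigma$, with the induced structure: for suitable polyhedral structures, $\pi_\tau$ induces a bijection, preserving the weights, from the cells of $\Sigma$ whose recession cones contain $\tau$ to the cells of $\overline\Sigma\cap O(\tau)$. The stable intersection $A\cdot B$ of two tropical cycles in a vector space $W$ with lattice $L$ has dimension $\dim A+\dim B-\dim W$; its maximal cells are the intersections $F$ of a cell of $A$ and a cell of $B$ that have this dimension and non-zero multiplicity, where the multiplicity of $F$ is given by the fan displacement rule: it is the sum of $[L:L_P+L_Q]\,w(P)\,w(Q)$ over the maximal cells $P\supset F$ of $A$ and $Q\supset F$ of $B$ such that the cone of $P$ at $F$ meets the cone of $Q$ at $F$ translated by $v$, for generic $v$. A $k$-cycle $\gamma$ on $N_{\mathbb R}(\Delta)$ is a collection $(\gamma_\tau)_{\tau\in\Delta}$ of tropical cycles of dimension $k$ in the orbits $O(\tau)$, and for $\Sigma$ compatible with $\Delta$ the compactified stable intersection $\gamma\cdot\Sigma$ has the components $\gamma_\tau\cdot(\overline\Sigma\cap O(\tau))$. Proposition. Let $\Sigma_1,\Sigma_2$ be tropical cycles in $\mathbb R^n$ compatible with $\Delta$, of codimensions $l$ and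 $m$. Then all the stable intersections and boundaries below exist and are unique as tropical cycles, $\Sigma_1\cdot\Sigma_2$ is compatible with $\Delta$, and for every $\tau\in\Delta$ $$\overline{\Sigma_1\cdot\Sigma_2}\cap O(\tau)=(\overline{\Sigma_1}\cap O(\tau))\cdot(\overline{\Sigma_2}\cap O(\tau))$$ as tropical cycles in $O(\tau)$. Consequently, for every tropical cycle $\gamma$ on $N_{\mathbb R}(\Delta)$, $$(\gamma\cdot\Sigma_1)\cdot\Sigma_2=\gamma\cdot(\Sigma_1\cdot\Sigma_2).$$ -/

import Mathlib

noncomputable section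

open scoped Classical

namespace Tropical

/-! ### Rational polyhedra -/

section Polyhedra

variable {V : Type*} [AddCommGroup V] [Module ℝ V]

/-- A rational polyhedron in `V`, with respect to the lattice `L`: a non-empty intersection of
finitely many half spaces `⟨x, u⟩ ≥ b` with `u` in the dual lattice and `b` a real number. -/
def IsRationalPolyhedron (L : Submodule ℤ V) (P : Set V) : Prop :=
  P.Nonempty ∧ ∃ I : Finset (Module.Dual ℝ V × ℝ),
    (∀ p ∈ I, ∀ x ∈ L, ∃ z : ℤ, p.1 x = z) ∧ P = {x | ∀ p ∈ I, p.2 ≤ p.1 x}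

/-- `F` is a (non-empty) face of the polyhedron `P`: the set of points of `P` at which some linear
functional attains its minimum over `P`. -/
def IsFace (F P : Set V) : Prop :=
  F.Nonempty ∧ ∃ u : Module.Dual ℝ V, F = {x | x ∈ P ∧ ∀ y ∈ P, u x ≤ u y}

/-- The linear subspace parallel to the affine hull of `P`. -/
abbrev direction (P : Set V) : Submodule ℝ V := vectorSpan ℝ P

/-- The dimension of a non-empty polyhedron. -/
def polyDim (P : Set V) : ℤ := (Module.finrank ℝ (direction P) : ℤ)

/-- The recession cone `ρ(P)`. -/
def recession (P : Set V) : Set V := {v | ∀ x ∈ P, ∀ t : ℝ, 0 ≤ t → x + t • v ∈ P}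

/-- The cone `{t (x - y) : t ≥ 0, x ∈ P, y ∈ F}` of the star of `F` that belongs to `P`. -/
def starCone (F P : Set V) : Set V :=
  {z | ∃ t : ℝ, 0 ≤ t ∧ ∃ x ∈ P, ∃ y ∈ F, z = t • (x - y)}

/-- The lattice of the linear space parallel to `P`. -/
def latticeOf (L : Submodule ℤ V) (P : Set V) : Submodule ℤ V :=
  L ⊓ (direction P).restrictScalars ℤ

/-- For a facet `F` of `P`: `u` is a primitive generator of `P` relative to `F`, that is, it lies
in the cone of `P` at `F` and it generates the lattice of `P` together with the lattice of `F`. -/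
def IsPrimitiveGenerator (L : Submodule ℤ V) (P F : Set V) (u : V) : Prop :=
  u ∈ starCone F P ∧ u ∈ L ∧ latticeOf L P = latticeOf L F ⊔ Submodule.span ℤ {u}

end Polyhedra

/-! ### Tropical cycles in a real vector space with a lattice -/

/-- A balanced weighted rational polyhedral complex of pure dimension `dim`, with non-zero integral
weights on its cells of dimension `dim` (the values of `weight` on other sets are irrelevant).
The complex may be empty, and for `dim < 0` it has to be. -/
structure TropicalComplex {V : Type*} [AddCommGroup V] [Module ℝ V] (L : Submodule ℤ V) where
  dim : ℤ
  cells : Finset (Set V)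
  weight : Set V → ℤ
  rational : ∀ P ∈ cells, IsRationalPolyhedron L P
  face_mem : ∀ P ∈ cells, ∀ F, IsFace F P → F ∈ cells
  inter_face : ∀ P ∈ cells, ∀ Q ∈ cells, (P ∩ Q).Nonempty → IsFace (P ∩ Q) P
  pure : ∀ P ∈ cells, ∃ Q ∈ cells, P ⊆ Q ∧ polyDim Q = dim
  weight_ne_zero : ∀ P ∈ cells, polyDim P = dim → weight P ≠ 0
  balanced : ∀ F ∈ cells, polyDim F = dim - 1 → ∃ u : Set V → V,
    (∀ P ∈ cells, polyDim P = dim → F ⊆ P → IsPrimitiveGenerator L P F (u P)) ∧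
    ∑ P ∈ cells with (polyDim P = dim ∧ F ⊆ P), weight P • u P ∈ direction F

section Cycles

variable {V : Type*} [AddCommGroup V] [Module ℝ V] {L : Submodule ℤ V}

namespace TropicalComplex

/-- The cells of top dimension. -/
def maxCells (a : TropicalComplex L) : Finset (Set V) := a.cells.filter (fun P => polyDim P = a.dim)

/-- The support. -/
def support (a : TropicalComplex L) : Set V := ⋃ P ∈ a.cells, P

/-- `a'` is a refinement of `a`, with the induced weights. -/
def Refines (a' a : TropicalComplex L) : Prop :=
  a'.dim = a.dim ∧ a'.support = a.support ∧ (∀ P' ∈ a'.cells, ∃ P ∈ a.cells, P' ⊆ P) ∧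
    ∀ P' ∈ a'.maxCells, ∀ P ∈ a.maxCells, P' ⊆ P → a'.weight P' = a.weight P

/-- The vector `v` is generic for `a` and `b`: if the linear spaces of a cell of `a` and a cell of
`b` do not span `V`, then `v` is not in their sum. -/
def IsGeneric (a b : TropicalComplex L) (v : V) : Prop :=
  ∀ P ∈ a.cells, ∀ Q ∈ b.cells, direction P ⊔ direction Q ≠ ⊤ → v ∉ direction P ⊔ direction Q

/-- The multiplicity along `F` computed with the displacement vector `v`: the sum of
`[L : L_P + L_Q] w(P) w(Q)` over all maximal cells `P` of `a` and `Q` of `b` which contain `F` and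
for which the cone of `P` at `F` meets the translate by `v` of the cone of `Q` at `F`. -/
def displacedMult (a b : TropicalComplex L) (v : V) (F : Set V) : ℤ :=
  ∑ p ∈ a.maxCells ×ˢ b.maxCells with
      (F ⊆ p.1 ∧ F ⊆ p.2 ∧ (starCone F p.1 ∩ (fun x => x + v) '' starCone F p.2).Nonempty),
    ((latticeOf L p.1 ⊔ latticeOf L p.2).toAddSubgroup.relIndex L.toAddSubgroup : ℤ)
      * a.weight p.1 * b.weight p.2

/-- `c` is the stable intersection of `a` and `b`: it has the expected dimension, its maximal cells
are the intersections of a cell of `a` and a cell of `b` which have the expected dimension and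
non-zero multiplicity, and they are weighted by the multiplicities. The multiplicities are given by
the fan displacement rule, with any generic displacement vector. -/
def IsStableIntersection (a b c : TropicalComplex L) : Prop :=
  c.dim = a.dim + b.dim - Module.finrank ℝ V ∧
  ∀ v, IsGeneric a b v →
    (∀ F : Set V, F ∈ c.maxCells ↔
      ((∃ P ∈ a.cells, ∃ Q ∈ b.cells, F = P ∩ Q) ∧ F.Nonempty ∧ polyDim F = c.dim ∧
        displacedMult a b v F ≠ 0)) ∧
    ∀ F ∈ c.maxCells, c.weight F = displacedMult a b v F

end TropicalComplex

/-- A tropical cycle: a balanced weighted rational polyhedral complex up to the equivalence relation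
generated by refinement. -/
def TropicalCycle {V : Type*} [AddCommGroup V] [Module ℝ V] (L : Submodule ℤ V) :=
  Quot (TropicalComplex.Refines (L := L))

namespace TropicalCycle

/-- The cycle of a balanced weighted complex. -/
def mk (a : TropicalComplex L) : TropicalCycle L := Quot.mk _ a

/-- The dimension of a tropical cycle (there is one zero cycle in every dimension). -/
def dim : TropicalCycle L → ℤ := Quot.lift TropicalComplex.dim (fun _ _ h => h.1)

instance : Nonempty (TropicalCycle L) :=
  ⟨mk { dim := 0, cells := ∅, weight := 0, rational := by simp, face_mem := by simp,
        inter_face := by simp, pure := by simp, weight_ne_zero := by simp, balanced := by simp }⟩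

/-- `C` is the stable intersection of `A` and `B`. -/
def IsStableIntersection (A B C : TropicalCycle L) : Prop :=
  ∃ a b c : TropicalComplex L, mk a = A ∧ mk b = B ∧ mk c = C ∧ a.IsStableIntersection b c

/-- The stable intersection of two tropical cycles is well defined. -/
def HasStableIntersection (A B : TropicalCycle L) : Prop := ∃! C, IsStableIntersection A B C

/-- The stable intersection `A · B` of two tropical cycles. -/
def stableIntersection (A B : TropicalCycle L) : TropicalCycle L :=
  Classical.epsilon (IsStableIntersection A B)

end TropicalCycle

end Cycles

/-! ### Unimodular fans and their tropical toric varieties -/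

section Orbits

variable {V : Type*} [AddCommGroup V] [Module ℝ V]

/-- The orbit `O(τ) = V / ℝτ`. -/
abbrev Orbit (τ : PointedCone ℝ V) : Type _ := V ⧸ Submodule.span ℝ (τ : Set V)

/-- The projection `π_τ : V → O(τ)`. -/
def orbitProj (τ : PointedCone ℝ V) : V →ₗ[ℝ] Orbit τ := Submodule.mkQ _

/-- The image of the lattice `L` in `O(τ)`. -/
def orbitLattice (L : Submodule ℤ V) (τ : PointedCone ℝ V) : Submodule ℤ (Orbit τ) :=
  L.map ((orbitProj τ).restrictScalars ℤ)

end Orbits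

/-- A cone is unimodular if it is generated by a part of a basis of the lattice. -/
def IsUnimodularCone {V : Type*} [AddCommGroup V] [Module ℝ V] (L : Submodule ℤ V)
    (σ : PointedCone ℝ V) : Prop :=
  ∃ (r : ℕ) (b : Module.Basis (Fin r) ℤ L) (I : Set (Fin r)),
    σ = PointedCone.hull ℝ ((fun i => (b i : V)) '' I)

/-- A unimodular fan in `V`. -/
structure UnimodularFan {V : Type*} [AddCommGroup V] [Module ℝ V] (L : Submodule ℤ V) where
  cones : Set (PointedCone ℝ V)
  finite : cones.Finite
  bot_mem : ⊥ ∈ cones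
  unimodular : ∀ σ ∈ cones, IsUnimodularCone L σ
  face_mem : ∀ σ ∈ cones, ∀ τ : PointedCone ℝ V, τ.IsFaceOf σ → τ ∈ cones
  inter_face : ∀ σ ∈ cones, ∀ τ ∈ cones, (σ ⊓ τ).IsFaceOf σ

namespace UnimodularFan

variable {V : Type*} [AddCommGroup V] [Module ℝ V] {L : Submodule ℤ V}

/-- The fan covers the whole space. -/
def IsComplete (Δ : UnimodularFan L) : Prop := ∀ x : V, ∃ σ ∈ Δ.cones, x ∈ σ

/-- The fan `Δ` is compatible with the tropical cycle `A`: for some polyhedral structure on `A`,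
each cone of `Δ` is contained in the recession cone of a given cell, or its relative interior
is disjoint from it. -/
def IsCompatible [TopologicalSpace V] (Δ : UnimodularFan L) (A : TropicalCycle L) : Prop :=
  ∃ a : TropicalComplex L, TropicalCycle.mk a = A ∧ ∀ P ∈ a.cells, ∀ σ ∈ Δ.cones,
    (σ : Set V) ⊆ recession P ∨ intrinsicInterior ℝ (σ : Set V) ∩ recession P = ∅

/-- The tropical toric variety `N_ℝ(Δ)`, as the disjoint union of its orbits. -/
structure Variety (Δ : UnimodularFan L) where
  cone : Δ.cones
  point : Orbit cone.1

/-- The dual cone `σ^∨`. -/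
def dualCone (σ : PointedCone ℝ V) : Set (Module.Dual ℝ V) := {u | ∀ x ∈ σ, 0 ≤ u x}

/-- The value in `ℝ ∪ {∞}` of the functional `u` at a point of `O(τ)`: the usual one if `u` vanishes
on `τ`, and `∞` otherwise. -/
def evalOrbit (τ : PointedCone ℝ V) (y : Orbit τ) (u : Module.Dual ℝ V) : EReal :=
  if h : Submodule.span ℝ (τ : Set V) ≤ LinearMap.ker u then
    (((Submodule.span ℝ (τ : Set V)).liftQ u h y : ℝ) : EReal) else ⊤

/-- The affine piece `N_ℝ(σ)`: the union of the orbits `O(τ)` over all faces `τ` of `σ`. -/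
def chart (Δ : UnimodularFan L) (σ : Δ.cones) : Set Δ.Variety := {p | p.cone.1.IsFaceOf σ.1}

/-- The identification of `N_ℝ(σ)` with a set of functions `σ^∨ → ℝ ∪ {∞}`. -/
def chartMap (Δ : UnimodularFan L) (σ : Δ.cones) (p : Δ.chart σ) : dualCone σ.1 → EReal :=
  fun u => evalOrbit p.1.cone.1 p.1.point u.1

/-- The topology of pointwise convergence on `N_ℝ(σ)`. -/
abbrev chartTopology (Δ : UnimodularFan L) (σ : Δ.cones) : TopologicalSpace (Δ.chart σ) :=
  TopologicalSpace.induced (Δ.chartMap σ) Pi.topologicalSpace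

/-- The topology of `N_ℝ(Δ)` is glued from the affine pieces: a set is open if and only if
its intersection with each `N_ℝ(σ)` is open in `N_ℝ(σ)`. -/
instance (Δ : UnimodularFan L) : TopologicalSpace Δ.Variety :=
  ⨆ σ : Δ.cones, (Δ.chartTopology σ).coinduced Subtype.val

/-- The embedding of `V` in `N_ℝ(Δ)` as the orbit of the zero cone. -/
def embed (Δ : UnimodularFan L) (x : V) : Δ.Variety := ⟨⟨⊥, Δ.bot_mem⟩, orbitProj ⊥ x⟩

/-- The set `closure(S) ∩ O(τ)`, where the closure is taken in `N_ℝ(Δ)`. -/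
def boundarySet (Δ : UnimodularFan L) (τ : Δ.cones) (S : Set V) : Set (Orbit τ.1) :=
  {y | (⟨τ, y⟩ : Δ.Variety) ∈ closure (Δ.embed '' S)}

/-- `B` is the boundary `closure(A) ∩ O(τ)` of the tropical cycle `A`, with the induced structure:
the support of `B` is the trace on `O(τ)` of the closure of the support of `A`, and for suitable
polyhedral structures the projection `π_τ` induces a bijection from the cells of `A` whose recession
cone contains `τ` to the cells of `B`, which preserves the codimension and the weights. -/
def IsBoundary (Δ : UnimodularFan L) (τ : Δ.cones) (A : TropicalCycle L)
    (B : TropicalCycle (orbitLattice L τ.1)) : Prop :=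
  ∃ (a : TropicalComplex L) (b : TropicalComplex (orbitLattice L τ.1)),
    TropicalCycle.mk a = A ∧ TropicalCycle.mk b = B ∧
    b.support = Δ.boundarySet τ a.support ∧
    (Module.finrank ℝ (Orbit τ.1) : ℤ) - b.dim = Module.finrank ℝ V - a.dim ∧
    Set.BijOn (fun P : Set V => orbitProj τ.1 '' P)
      {P | P ∈ a.cells ∧ (τ.1 : Set V) ⊆ recession P} {Q | Q ∈ b.cells} ∧
    ∀ P ∈ a.maxCells, (τ.1 : Set V) ⊆ recession P → b.weight (orbitProj τ.1 '' P) = a.weight P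

/-- The boundary of `A` in `O(τ)` is well defined. -/
def HasBoundary (Δ : UnimodularFan L) (τ : Δ.cones) (A : TropicalCycle L) : Prop :=
  ∃! B, Δ.IsBoundary τ A B

/-- The boundary `closure(A) ∩ O(τ)` of a tropical cycle `A`, as a tropical cycle in `O(τ)`. -/
def boundary (Δ : UnimodularFan L) (τ : Δ.cones) (A : TropicalCycle L) :
    TropicalCycle (orbitLattice L τ.1) :=
  Classical.epsilon (Δ.IsBoundary τ A)

/-- A tropical cycle in `N_ℝ(Δ)`: a tropical cycle in each orbit. -/
def Cycle (Δ : UnimodularFan L) : Type _ := ∀ τ : Δ.cones, TropicalCycle (orbitLattice L τ.1)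

/-- A cycle of dimension `k` has dimension `k` in each orbit. -/
def Cycle.HasDim {Δ : UnimodularFan L} (γ : Δ.Cycle) (k : ℤ) : Prop := ∀ τ, (γ τ).dim = k

/-- All stable intersections in the definition of `γ · A` are well defined. -/
def Cycle.HasCompactifiedIntersection {Δ : UnimodularFan L} (γ : Δ.Cycle) (A : TropicalCycle L) :
    Prop :=
  ∀ τ, Δ.HasBoundary τ A ∧ (γ τ).HasStableIntersection (Δ.boundary τ A)

/-- The compactified stable intersection `γ · A`: in each orbit `O(τ)`, the stable intersection of
the component of `γ` and the boundary of `A`. -/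
def Cycle.compactifiedIntersection {Δ : UnimodularFan L} (γ : Δ.Cycle) (A : TropicalCycle L) :
    Δ.Cycle :=
  fun τ => (γ τ).stableIntersection (Δ.boundary τ A)

end UnimodularFan

/-- The lattice `ℤ^n` in `ℝ^n`. -/
def stdLattice (n : ℕ) : Submodule ℤ (Fin n → ℝ) :=
  Submodule.span ℤ (Set.range (Pi.basisFun ℝ (Fin n)))

end Tropical

end

open Tropical

/-! The multiplicities of stable intersections are degrees of linear maps. For complexes `a`, `b`
and a point `y`, the fan displacement rule counts, with lattice indices, the cells of `a × b`
through `(y, y)` whose cone meets the fibre over `v` of the difference map `(x, x') ↦ x - x'`; this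
is `localMult`. More generally, `degree` counts the cones at a point that meet a given fibre of a
linear map. Three facts about it carry the proof. On a balanced complex it does not depend on the
generic point of the target (`degree_eq_of_generic`): along a generic path it can only change at the
image of a cell of codimension one, and the jump there is a multiple of a functional evaluated at
the balancing sum. It does not change under refinement (`degree_eq_of_refines`). The degree of `(π₁,
π₂)` over `(ε v₁, v₂)` is computed by slicing with `ker π₁`, weighting the slices by degrees of
`π₁`, and then taking the degree of `π₂` (`eventually_degree_prod_eq`).

Conversely, a complex is balanced if every integral functional constant on a cell of codimension one
has equal degrees over `1` and `-1` there (`balanced_of_degree`). For a stable intersection these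
are degrees on the balanced complex `a × b`, so the stable intersection exists; the first two facts
make it a well defined product `stableCycle` of cycles. It is associative because the multiplicities
of `(a · b) · c` and `(b · c) · a` are degrees of one map on `a × b × c` over two generic points, up
to a lattice automorphism (`localMult_assoc`).

For boundaries, compatibility ensures that the closure of a cell `P` meets `O(τ)` in `π_τ(P)` if `τ
⊆ ρ(P)` and in nothing otherwise (`isClosed_extension`, `support_boundary`). On the cells with `τ ⊆
ρ(P)` the projection only collapses a subspace contained in all their directions; it respects
intersections, faces, codimensions, meeting of displaced cones, and lattice indices. Hence the
boundary of the stable intersection, displaced by `v`, and the stable intersection of the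
boundaries, displaced by `π_τ(v)`, have the same maximal cells and multiplicities
(`mk_boundary_stableComplex`). Boundaries are unique because a cycle is determined by its dimension,
support and weights (`Agrees.mk_eq`). The assertion about `γ` is then associativity in each orbit.
-/

noncomputable section

open scoped Classical

namespace Tropical

open Filter Topology

/-! ### Polyhedra, their cones of feasible directions, and faces -/

section Polyhedra

variable {V : Type*} [AddCommGroup V] [Module ℝ V]

/-- A polyhedron: a finite intersection of closed half spaces. -/
def IsPoly (P : Set V) : Prop :=
  ∃ I : Finset (Module.Dual ℝ V × ℝ), P = {x | ∀ p ∈ I, p.2 ≤ p.1 x}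

lemma IsRationalPolyhedron.isPoly {L : Submodule ℤ V} {P : Set V}
    (h : IsRationalPolyhedron L P) : IsPoly P := by
  obtain ⟨-, I, -, h⟩ := h
  exact ⟨I, h⟩

/-- The cone of directions in which one can move inside `P`, starting from `y`. -/
def tcone (y : V) (P : Set V) : Set V := {z | ∀ᶠ ε : ℝ in 𝓝[>] 0, y + ε • z ∈ P}

lemma mem_tcone {y z : V} {P : Set V} :
    z ∈ tcone y P ↔ ∀ᶠ ε : ℝ in 𝓝[>] 0, y + ε • z ∈ P := Iff.rfl

lemma tcone_mono (y : V) {P Q : Set V} (h : P ⊆ Q) : tcone y P ⊆ tcone y Q :=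
  fun _ hz => (mem_tcone.1 hz).mono fun _ he => h he

lemma tcone_inter (y : V) (P Q : Set V) : tcone y (P ∩ Q) = tcone y P ∩ tcone y Q := by
  ext z; simp only [Set.mem_inter_iff, mem_tcone, eventually_and]

lemma tcone_prod {W : Type*} [AddCommGroup W] [Module ℝ W] (y : V × W)
    (P : Set V) (Q : Set W) : tcone y (P ×ˢ Q) = tcone y.1 P ×ˢ tcone y.2 Q := by
  ext z; simp only [Set.mem_prod, mem_tcone, Prod.fst_add, Prod.snd_add, Prod.smul_fst,
    Prod.smul_snd, eventually_and]

/-- One inequality along a ray is decided for small `ε` by its slack or, if it is tight, by the sign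
of the slope. The description of `tcone` by active inequalities rests on this. -/
lemma eventually_le_add_mul_iff (a b c : ℝ) :
    ∀ᶠ ε : ℝ in 𝓝[>] 0, (b ≤ a + ε * c ↔ (b < a ∨ (b = a ∧ 0 ≤ c))) := by
  have hc : Tendsto (fun ε : ℝ => a + ε * c) (𝓝[>] 0) (𝓝 a) := by
    have : Continuous (fun ε : ℝ => a + ε * c) := by fun_prop
    simpa using (this.tendsto 0).mono_left nhdsWithin_le_nhds
  rcases lt_trichotomy b a with h | h | h
  · filter_upwards [hc.eventually_const_lt h] with ε he
    simp [h, he.le]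
  · filter_upwards [self_mem_nhdsWithin] with ε he
    have he : 0 < ε := he
    subst h
    simp [mul_nonneg_iff_of_pos_left he]
  · filter_upwards [hc.eventually_lt_const h] with ε he
    simp only [not_le.2 he, false_iff, not_or, not_lt, not_and]
    exact ⟨h.le, fun hh => absurd hh h.ne'⟩

lemma IsPoly.eventually_mem_iff {P : Set V} (hP : IsPoly P) (y z : V) :
    ∀ᶠ ε : ℝ in 𝓝[>] 0, (y + ε • z ∈ P ↔ z ∈ tcone y P) := by
  obtain ⟨I, rfl⟩ := hP
  have h : ∀ᶠ ε : ℝ in 𝓝[>] 0, (y + ε • z ∈ {x : V | ∀ p ∈ I, p.2 ≤ p.1 x} ↔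
      ∀ p ∈ I, p.2 < p.1 y ∨ (p.2 = p.1 y ∧ 0 ≤ p.1 z)) := by
    have := (Filter.eventually_all_finset I (l := 𝓝[>] (0 : ℝ))).2
      fun p _ => eventually_le_add_mul_iff (p.1 y) p.2 (p.1 z)
    filter_upwards [this] with ε he
    simp only [Set.mem_ofPred_eq, map_add, map_smul, smul_eq_mul]
    exact forall₂_congr he
  by_cases hz : ∀ p ∈ I, p.2 < p.1 y ∨ (p.2 = p.1 y ∧ 0 ≤ p.1 z)
  · have : z ∈ tcone y {x : V | ∀ p ∈ I, p.2 ≤ p.1 x} := by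
      filter_upwards [h] with ε he using he.2 hz
    filter_upwards [h] with ε he
    simp only [he, this, iff_true]; exact hz
  · have h2 : ∀ᶠ ε : ℝ in 𝓝[>] 0, y + ε • z ∉ {x : V | ∀ p ∈ I, p.2 ≤ p.1 x} := by
      filter_upwards [h] with ε he using fun hh => hz (he.1 hh)
    have : z ∉ tcone y {x : V | ∀ p ∈ I, p.2 ≤ p.1 x} := fun hh => by
      obtain ⟨ε, h3, h4⟩ := (h2.and hh).exists
      exact h3 h4
    filter_upwards [h2] with ε he
    simp only [this, iff_false]; exact he

lemma mem_tcone_iff (I : Finset (Module.Dual ℝ V × ℝ)) (y z : V) :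
    z ∈ tcone y {x : V | ∀ p ∈ I, p.2 ≤ p.1 x} ↔
      ∀ p ∈ I, p.2 < p.1 y ∨ (p.2 = p.1 y ∧ 0 ≤ p.1 z) := by
  have h := (Filter.eventually_all_finset I (l := 𝓝[>] (0 : ℝ))).2
      fun p _ => eventually_le_add_mul_iff (p.1 y) p.2 (p.1 z)
  have h2 := IsPoly.eventually_mem_iff (P := {x : V | ∀ p ∈ I, p.2 ≤ p.1 x}) ⟨I, rfl⟩ y z
  obtain ⟨ε, h3, h4⟩ := (h.and h2).exists
  rw [← h4]
  simp only [Set.mem_ofPred_eq, map_add, map_smul, smul_eq_mul]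
  exact forall₂_congr h3

/-- Polyhedra are closed, so `tcone y P` is empty unless `y ∈ P`; membership of a direction carries
membership of the base point along. -/
lemma IsPoly.mem_of_mem_tcone {P : Set V} (hP : IsPoly P) {y z : V} (hz : z ∈ tcone y P) :
    y ∈ P := by
  obtain ⟨I, rfl⟩ := hP
  rw [mem_tcone_iff] at hz
  intro p hp
  rcases hz p hp with h | h
  · exact h.le
  · exact h.1.le

lemma mem_tcone_iff_of_mem {I : Finset (Module.Dual ℝ V × ℝ)} {y : V}
    (hy : y ∈ {x : V | ∀ p ∈ I, p.2 ≤ p.1 x}) (z : V) :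
    z ∈ tcone y {x : V | ∀ p ∈ I, p.2 ≤ p.1 x} ↔ ∀ p ∈ I, p.2 = p.1 y → 0 ≤ p.1 z := by
  rw [mem_tcone_iff]
  refine forall₂_congr fun p hp => ?_
  have := hy p hp
  constructor
  · rintro (h | h) h2
    · exact absurd h2 h.ne
    · exact h.2
  · intro h
    rcases this.lt_or_eq with h2 | h2
    · exact Or.inl h2
    · exact Or.inr ⟨h2, h h2⟩

lemma IsPoly.inter {P Q : Set V} (hP : IsPoly P) (hQ : IsPoly Q) : IsPoly (P ∩ Q) := by
  obtain ⟨I, rfl⟩ := hP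
  obtain ⟨J, rfl⟩ := hQ
  refine ⟨I ∪ J, ?_⟩
  ext x
  simp only [Set.mem_inter_iff, Set.mem_ofPred_eq, Finset.mem_union]
  exact ⟨fun h p hp => hp.elim (h.1 p) (h.2 p),
    fun h => ⟨fun p hp => h p (Or.inl hp), fun p hp => h p (Or.inr hp)⟩⟩

lemma IsPoly.preimage {W : Type*} [AddCommGroup W] [Module ℝ W] {P : Set W} (hP : IsPoly P)
    (f : V →ₗ[ℝ] W) : IsPoly (f ⁻¹' P) := by
  obtain ⟨I, rfl⟩ := hP
  refine ⟨I.image fun p => (p.1 ∘ₗ f, p.2), ?_⟩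
  ext x
  simp only [Set.mem_preimage, Set.mem_ofPred_eq, Finset.mem_image]
  constructor
  · rintro h _ ⟨p, hp, rfl⟩
    exact h p hp
  · intro h p hp
    exact h _ ⟨p, hp, rfl⟩

lemma IsPoly.prod {W : Type*} [AddCommGroup W] [Module ℝ W] {P : Set V} {Q : Set W}
    (hP : IsPoly P) (hQ : IsPoly Q) : IsPoly (P ×ˢ Q) :=
  (hP.preimage (LinearMap.fst ℝ V W)).inter (hQ.preimage (LinearMap.snd ℝ V W))

lemma isPoly_ker {W : Type*} [AddCommGroup W] [Module ℝ W] [FiniteDimensional ℝ W]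
    (f : V →ₗ[ℝ] W) : IsPoly (LinearMap.ker f : Set V) := by
  have h0 : IsPoly ({0} : Set W) := by
    let b := Module.finBasis ℝ W
    refine ⟨Finset.univ.image (fun i => (b.coord i, (0:ℝ))) ∪
      Finset.univ.image (fun i => (-b.coord i, (0:ℝ))), ?_⟩
    ext x
    simp only [Set.mem_singleton_iff, Finset.mem_union, Finset.mem_image, Finset.mem_univ,
      true_and, Set.mem_ofPred_eq]
    constructor
    · rintro rfl p (⟨i, rfl⟩ | ⟨i, rfl⟩) <;> simp
    · intro h
      apply b.ext_elem
      intro i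
      have h1 := h (b.coord i, 0) (Or.inl ⟨i, rfl⟩)
      have h2 := h (-b.coord i, 0) (Or.inr ⟨i, rfl⟩)
      simp at h1 h2 ⊢
      linarith
  have := h0.preimage f
  convert this using 1
  ext x; simp

lemma IsPoly.zero_mem_tcone {P : Set V} {y : V} (hy : y ∈ P) : (0 : V) ∈ tcone y P := by
  simp [tcone, hy]

lemma IsPoly.add_mem_tcone {P : Set V} (hP : IsPoly P) {y z w : V} (hz : z ∈ tcone y P)
    (hw : w ∈ tcone y P) : z + w ∈ tcone y P := by
  have hy := hP.mem_of_mem_tcone hz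
  obtain ⟨I, rfl⟩ := hP
  rw [mem_tcone_iff_of_mem hy] at *
  intro p hp h
  rw [map_add]
  exact add_nonneg (hz p hp h) (hw p hp h)

lemma IsPoly.smul_mem_tcone {P : Set V} (hP : IsPoly P) {y z : V} (hz : z ∈ tcone y P)
    {t : ℝ} (ht : 0 ≤ t) : t • z ∈ tcone y P := by
  have hy := hP.mem_of_mem_tcone hz
  obtain ⟨I, rfl⟩ := hP
  rw [mem_tcone_iff_of_mem hy] at *
  intro p hp h
  rw [map_smul]
  exact mul_nonneg ht (hz p hp h)

lemma IsPoly.sub_mem_tcone {P : Set V} (hP : IsPoly P) {x y : V} (hx : x ∈ P) (hy : y ∈ P) :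
    x - y ∈ tcone y P := by
  obtain ⟨I, rfl⟩ := hP
  rw [mem_tcone_iff_of_mem hy]
  intro p hp h
  rw [map_sub, ← h]
  linarith [hx p hp]

lemma IsPoly.mem_direction_of_mem_tcone {P : Set V} (hP : IsPoly P) {y z : V}
    (hz : z ∈ tcone y P) : z ∈ direction P := by
  have hy := hP.mem_of_mem_tcone hz
  obtain ⟨ε, h1, h2⟩ := ((mem_tcone.1 hz).and self_mem_nhdsWithin).exists
  have h2 : 0 < ε := h2
  have := vsub_mem_vectorSpan ℝ h1 hy
  simp only [vsub_eq_sub, add_sub_cancel_left] at this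
  exact ((direction P).smul_mem_iff h2.ne').1 this

/-- Relative interior points of a polyhedron. -/
def RelInt (y : V) (P : Set V) : Prop := y ∈ P ∧ ∀ z ∈ direction P, z ∈ tcone y P

lemma RelInt.mem_tcone_iff {y : V} {P : Set V} (h : RelInt y P) (hP : IsPoly P) {z : V} :
    z ∈ tcone y P ↔ z ∈ direction P :=
  ⟨hP.mem_direction_of_mem_tcone, h.2 z⟩

lemma direction_le_of_forall {P : Set V} {y : V} {D : Submodule ℝ V}
    (h : ∀ x ∈ P, x - y ∈ D) : direction P ≤ D := by
  rw [direction, vectorSpan_def, Submodule.span_le]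
  rintro _ ⟨x, hx, x', hx', rfl⟩
  have := D.sub_mem (h x hx) (h x' hx')
  simpa using this

/-- The largest linear subspace of the cone of directions. -/
def lineality (y : V) (P : Set V) (hP : IsPoly P) (hy : y ∈ P) : Submodule ℝ V where
  carrier := {z | z ∈ tcone y P ∧ -z ∈ tcone y P}
  add_mem' := fun h h' => ⟨hP.add_mem_tcone h.1 h'.1, by
    rw [neg_add]; exact hP.add_mem_tcone h.2 h'.2⟩
  zero_mem' := by simp [IsPoly.zero_mem_tcone hy]
  smul_mem' := by
    rintro c z ⟨h, h'⟩
    rcases le_total 0 c with hc | hc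
    · exact ⟨hP.smul_mem_tcone h hc, by rw [← smul_neg]; exact hP.smul_mem_tcone h' hc⟩
    · have hc : 0 ≤ -c := by linarith
      refine ⟨?_, ?_⟩
      · have := hP.smul_mem_tcone h' hc
        simpa using this
      · have := hP.smul_mem_tcone h hc
        simpa using this

lemma relInt_of_neg {P : Set V} (hP : IsPoly P) {y : V} (hy : y ∈ P)
    (h : ∀ z ∈ tcone y P, -z ∈ tcone y P) : RelInt y P := by
  refine ⟨hy, fun z hz => ?_⟩
  have : direction P ≤ lineality y P hP hy := direction_le_of_forall (y := y) fun x hx =>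
    ⟨hP.sub_mem_tcone hx hy, h _ (hP.sub_mem_tcone hx hy)⟩
  exact (this hz).1

/-- Averaging points of `P` makes strict every inequality that is strict somewhere on `P`. An
inequality that is still tight is tight on all of `P`, so it does not restrict the directions in the
linear hull. -/
lemma IsPoly.exists_relInt {P : Set V} (hP : IsPoly P) (hne : P.Nonempty) :
    ∃ y, RelInt y P := by
  obtain ⟨I, rfl⟩ := hP
  set P : Set V := {x | ∀ p ∈ I, p.2 ≤ p.1 x} with hPdef
  have key : ∀ J : Finset (Module.Dual ℝ V × ℝ), J ⊆ I →
      ∃ y ∈ P, ∀ p ∈ J, (∃ x ∈ P, p.2 < p.1 x) → p.2 < p.1 y := by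
    intro J
    induction J using Finset.induction_on with
    | empty => intro _; obtain ⟨y, hy⟩ := hne; exact ⟨y, hy, by simp⟩
    | insert q J hq ih =>
      intro hJ
      obtain ⟨y, hy, h⟩ := ih (fun p hp => hJ (Finset.mem_insert_of_mem hp))
      by_cases hx : ∃ x ∈ P, q.2 < q.1 x
      · obtain ⟨x, hx, hxq⟩ := hx
        refine ⟨(1/2 : ℝ) • y + (1/2 : ℝ) • x, ?_, ?_⟩
        · intro p hp
          simp only [map_add, map_smul, smul_eq_mul]
          linarith [hy p hp, hx p hp]
        · intro p hp hh
          simp only [map_add, map_smul, smul_eq_mul]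
          rcases Finset.mem_insert.1 hp with rfl | hp'
          · linarith [hy p (hJ hp)]
          · linarith [h p hp' hh, hx p (hJ hp)]
      · refine ⟨y, hy, fun p hp hh => ?_⟩
        rcases Finset.mem_insert.1 hp with rfl | hp'
        · exact absurd hh hx
        · exact h p hp' hh
  obtain ⟨y, hy, h⟩ := key I subset_rfl
  refine ⟨y, relInt_of_neg ⟨I, rfl⟩ hy fun z hz => ?_⟩
  have hd := IsPoly.mem_direction_of_mem_tcone ⟨I, rfl⟩ hz
  rw [mem_tcone_iff_of_mem hy]
  intro p hp hpy
  have hx : ∀ x ∈ P, x - y ∈ LinearMap.ker p.1 := by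
    intro x hx
    have h1 : p.1 x ≤ p.2 := by
      by_contra hlt
      exact absurd hpy (h p hp ⟨x, hx, not_le.1 hlt⟩).ne
    have h2 := hx p hp
    simp only [LinearMap.mem_ker, map_sub]
    linarith
  have := direction_le_of_forall hx hd
  rw [LinearMap.mem_ker] at this
  simp [this]

/-- The smallest face of `P` that contains `y`. -/
def faceAt (y : V) (P : Set V) : Set V := {x | x ∈ P ∧ y - x ∈ tcone y P}

lemma faceAt_subset (y : V) (P : Set V) : faceAt y P ⊆ P := fun _ h => h.1

lemma mem_faceAt {y : V} {P : Set V} (hy : y ∈ P) : y ∈ faceAt y P :=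
  ⟨hy, by simpa using IsPoly.zero_mem_tcone hy⟩

lemma faceAt_inter (y : V) (P Q : Set V) : faceAt y (P ∩ Q) = faceAt y P ∩ faceAt y Q := by
  ext x
  simp only [faceAt, tcone_inter, Set.mem_inter_iff, Set.mem_ofPred_eq]
  tauto

lemma faceAt_prod {W : Type*} [AddCommGroup W] [Module ℝ W] (y : V × W)
    (P : Set V) (Q : Set W) : faceAt y (P ×ˢ Q) = faceAt y.1 P ×ˢ faceAt y.2 Q := by
  ext x
  simp only [faceAt, tcone_prod, Set.mem_prod, Set.mem_ofPred_eq, Prod.fst_sub, Prod.snd_sub]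
  tauto

/-- The supporting functional is the sum of the inequalities active at `y`: it is minimal on `P`
exactly where all of them are tight. -/
lemma IsPoly.isFace_faceAt {P : Set V} (hP : IsPoly P) {y : V} (hy : y ∈ P) :
    IsFace (faceAt y P) P := by
  refine ⟨⟨y, mem_faceAt hy⟩, ?_⟩
  obtain ⟨I, rfl⟩ := hP
  have hu : ∀ x ∈ {x : V | ∀ p ∈ I, p.2 ≤ p.1 x}, ∀ p ∈ I.filter (fun p => p.2 = p.1 y), p.2 ≤ p.1 x :=
    fun x hx p hp => hx p (Finset.mem_filter.1 hp).1
  refine ⟨∑ p ∈ I with p.2 = p.1 y, p.1, ?_⟩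
  have hmin : ∀ x, x ∈ faceAt y {x : V | ∀ p ∈ I, p.2 ≤ p.1 x} ↔
      x ∈ {x : V | ∀ p ∈ I, p.2 ≤ p.1 x} ∧ ∀ p ∈ I.filter (fun p => p.2 = p.1 y), p.1 x ≤ p.2 := by
    intro x
    refine and_congr_right fun hx => ?_
    rw [mem_tcone_iff_of_mem hy]
    simp only [Finset.mem_filter, and_imp, map_sub]
    refine forall₃_congr fun p hp h => ?_
    rw [h]; constructor <;> intro <;> linarith
  ext x
  rw [hmin]
  simp only [Set.mem_ofPred_eq, LinearMap.sum_apply]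
  refine and_congr_right fun hx => ?_
  constructor
  · intro h z hz
    exact Finset.sum_le_sum fun p hp => (h p hp).trans (hu z hz p hp)
  · intro h p hp
    by_contra hlt
    have h1 : ∑ p ∈ I with p.2 = p.1 y, p.2 < ∑ p ∈ I with p.2 = p.1 y, p.1 x :=
      Finset.sum_lt_sum (fun q hq => hu x hx q hq) ⟨p, hp, not_le.1 hlt⟩
    have h2 := h y hy
    have h3 : ∑ p ∈ I with p.2 = p.1 y, p.1 y = ∑ p ∈ I with p.2 = p.1 y, p.2 :=
      Finset.sum_congr rfl fun q hq => (Finset.mem_filter.1 hq).2.symm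
    linarith

lemma IsFace.subset {F P : Set V} (h : IsFace F P) : F ⊆ P := by
  obtain ⟨-, u, rfl⟩ := h
  exact fun _ hx => hx.1

lemma IsFace.isPoly {F P : Set V} (h : IsFace F P) (hP : IsPoly P) : IsPoly F := by
  obtain ⟨⟨x₀, hx₀⟩, u, rfl⟩ := h
  have : IsPoly {x : V | u x ≤ u x₀} := ⟨{(-u, -u x₀)}, by ext; simp⟩
  convert hP.inter this using 1
  ext x
  simp only [Set.mem_ofPred_eq, Set.mem_inter_iff]
  exact ⟨fun h => ⟨h.1, h.2 x₀ hx₀.1⟩, fun h => ⟨h.1, fun y hy => h.2.trans (hx₀.2 y hy)⟩⟩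

lemma IsPoly.isPoly_faceAt {P : Set V} (hP : IsPoly P) {y : V} (hy : y ∈ P) : IsPoly (faceAt y P) :=
  (hP.isFace_faceAt hy).isPoly hP

/-- The segment from a point `x` of `faceAt y P` to `y` can be prolonged inside `P` beyond `y`, so a
functional that is minimal at `y` cannot be larger at `x`. -/
lemma IsFace.faceAt_subset {F P : Set V} (h : IsFace F P) {y : V} (hy : y ∈ F) :
    faceAt y P ⊆ F := by
  obtain ⟨-, u, rfl⟩ := h
  rintro x ⟨hx, hxy⟩
  refine ⟨hx, fun z hz => ?_⟩
  obtain ⟨ε, h1, h2⟩ := ((mem_tcone.1 hxy).and self_mem_nhdsWithin).exists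
  have h2 : 0 < ε := h2
  have h3 := hy.2 _ h1
  have h4 := hy.2 _ hz
  simp only [map_add, map_smul, map_sub, smul_eq_mul] at h3
  have : 0 ≤ u y - u x := by
    by_contra hh
    nlinarith
  linarith

lemma RelInt.faceAt_eq {y : V} {P : Set V} (h : RelInt y P) : faceAt y P = P := by
  refine (Tropical.faceAt_subset y P).antisymm fun x hx => ⟨hx, h.2 _ ?_⟩
  exact vsub_mem_vectorSpan ℝ h.1 hx

lemma IsPoly.relInt_faceAt {P : Set V} (hP : IsPoly P) {y : V} (hy : y ∈ P) :
    RelInt y (faceAt y P) := by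
  have h1 : direction (faceAt y P) ≤ lineality y P hP hy :=
    direction_le_of_forall (y := y) fun x hx =>
      ⟨hP.sub_mem_tcone hx.1 hy, by simpa using hx.2⟩
  refine ⟨mem_faceAt hy, fun z hz => ?_⟩
  have h2 := h1 hz
  filter_upwards [h2.1, self_mem_nhdsWithin] with ε he hpos
  have hpos : 0 < ε := hpos
  refine ⟨he, ?_⟩
  have := hP.smul_mem_tcone h2.2 hpos.le
  simpa using this

lemma IsPoly.mem_direction_faceAt {P : Set V} (hP : IsPoly P) {y : V} (hy : y ∈ P) {z : V} :
    z ∈ direction (faceAt y P) ↔ z ∈ tcone y P ∧ -z ∈ tcone y P := by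
  have h := hP.relInt_faceAt hy
  constructor
  · intro hz
    exact ⟨tcone_mono y (Tropical.faceAt_subset y P) (h.2 z hz),
      tcone_mono y (Tropical.faceAt_subset y P) (h.2 _ (Submodule.neg_mem _ hz))⟩
  · rintro ⟨h1, h2⟩
    apply (hP.isPoly_faceAt hy).mem_direction_of_mem_tcone (y := y)
    filter_upwards [h1, self_mem_nhdsWithin] with ε he hpos
    have hpos : 0 < ε := hpos
    refine ⟨he, ?_⟩
    have := hP.smul_mem_tcone h2 hpos.le
    simpa using this

lemma IsFace.eq_faceAt {F P : Set V} (h : IsFace F P) {y : V} (hy : RelInt y F) :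
    F = faceAt y P := by
  refine subset_antisymm ?_ (h.faceAt_subset hy.1)
  intro x hx
  refine ⟨h.subset hx, tcone_mono y h.subset (hy.2 _ (vsub_mem_vectorSpan ℝ hy.1 hx))⟩

lemma IsFace.eq_of_relInt {F P : Set V} (h : IsFace F P) {y : V} (hy : RelInt y P)
    (hyF : y ∈ F) : F = P :=
  h.subset.antisymm (hy.faceAt_eq ▸ h.faceAt_subset hyF)

lemma IsFace.eq_of_direction_le {F P : Set V} (h : IsFace F P) (hP : IsPoly P)
    (hd : direction P ≤ direction F) : F = P := by
  obtain ⟨y, hy⟩ := (h.isPoly hP).exists_relInt h.1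
  exact h.eq_of_relInt ⟨h.subset hy.1, fun z hz => tcone_mono y h.subset (hy.2 z (hd hz))⟩ hy.1

lemma direction_mono {P Q : Set V} (h : P ⊆ Q) : direction P ≤ direction Q :=
  vectorSpan_mono ℝ h

lemma polyDim_mono [FiniteDimensional ℝ V] {P Q : Set V} (h : P ⊆ Q) :
    polyDim P ≤ polyDim Q := by
  unfold polyDim
  exact_mod_cast Submodule.finrank_mono (direction_mono h)

lemma direction_eq_of_polyDim [FiniteDimensional ℝ V] {P Q : Set V} (h : P ⊆ Q)
    (hd : polyDim Q ≤ polyDim P) : direction P = direction Q := by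
  unfold polyDim at hd
  exact Submodule.eq_of_le_of_finrank_le (direction_mono h) (by exact_mod_cast hd)

lemma IsFace.eq_of_polyDim [FiniteDimensional ℝ V] {F P : Set V} (h : IsFace F P)
    (hP : IsPoly P) (hd : polyDim P ≤ polyDim F) : F = P :=
  h.eq_of_direction_le hP (direction_eq_of_polyDim h.subset hd).ge

/-- Replaces the star cones of the definitions by cones at a single point, where intersections and
products are easy to handle. -/
lemma RelInt.starCone_eq {y : V} {F P : Set V} (hy : RelInt y F) (hFP : F ⊆ P) (hP : IsPoly P) :
    starCone F P = tcone y P := by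
  ext z
  constructor
  · rintro ⟨t, ht, x, hx, y', hy', rfl⟩
    refine hP.smul_mem_tcone ?_ ht
    have h1 := hP.sub_mem_tcone hx (hFP hy.1)
    have h2 := tcone_mono y hFP (hy.2 (y - y') (vsub_mem_vectorSpan ℝ hy.1 hy'))
    simpa using hP.add_mem_tcone h1 h2
  · intro hz
    obtain ⟨ε, h1, h2⟩ := ((mem_tcone.1 hz).and self_mem_nhdsWithin).exists
    have h2 : 0 < ε := h2
    refine ⟨ε⁻¹, by positivity, _, h1, y, hy.1, ?_⟩
    simp [smul_smul, inv_mul_cancel₀ h2.ne']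

lemma RelInt.tcone_eq {y y' : V} {F P : Set V} (hy : RelInt y F) (hy' : RelInt y' F)
    (hFP : F ⊆ P) (hP : IsPoly P) : tcone y P = tcone y' P := by
  rw [← hy.starCone_eq hFP hP, ← hy'.starCone_eq hFP hP]

lemma IsPoly.isPoly_tcone {P : Set V} (hP : IsPoly P) {y : V} (hy : y ∈ P) :
    IsPoly (tcone y P) := by
  obtain ⟨I, rfl⟩ := hP
  refine ⟨(I.filter fun p => p.2 = p.1 y).image fun p => (p.1, 0), ?_⟩
  ext z
  rw [mem_tcone_iff_of_mem hy]
  simp only [Finset.mem_image, Finset.mem_filter, Set.mem_ofPred_eq]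
  constructor
  · rintro h _ ⟨p, hp, rfl⟩
    exact h p hp.1 hp.2
  · intro h p hp hpy
    exact h _ ⟨p, ⟨hp, hpy⟩, rfl⟩

/-- Moving from `y` a little in the direction `z` and then infinitesimally in the direction `h`. -/
lemma IsPoly.eventually_tcone {P : Set V} (hP : IsPoly P) {y z : V} (hz : z ∈ tcone y P) :
    ∀ᶠ δ : ℝ in 𝓝[>] 0, tcone (y + δ • z) P = tcone z (tcone y P) := by
  have hy := hP.mem_of_mem_tcone hz
  obtain ⟨I, rfl⟩ := hP
  -- After a small step along `z`, an inequality is strict if it was strict at `y` or if its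
  -- functional grows along `z`; so the active inequalities at the new point are those active first
  -- at `y` and then at `z`.
  have h : ∀ p ∈ I, ∀ᶠ δ : ℝ in 𝓝[>] 0, ((p.2 < p.1 (y + δ • z) ↔ (p.2 < p.1 y ∨ 0 < p.1 z))) := by
    intro p hp
    filter_upwards [eventually_le_add_mul_iff (-p.1 y) (-p.2) (-p.1 z)] with δ hδ
    have hδ' := not_congr hδ
    rw [not_le] at hδ'
    simp only [map_add, map_smul, smul_eq_mul]
    have hyp := hy p hp
    have hzp := ((mem_tcone_iff_of_mem hy z).1 hz) p hp
    constructor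
    · intro h
      have := hδ'.1 (by linarith)
      by_contra hcon
      push Not at hcon
      apply this
      right
      exact ⟨by linarith, by linarith⟩
    · intro h
      have := hδ'.2 (by
        rintro (h2 | ⟨h2, h3⟩)
        · linarith
        · rcases h with h | h <;> linarith)
      linarith
  have hI := (Filter.eventually_all_finset I (l := 𝓝[>] (0 : ℝ))).2 h
  filter_upwards [hI, hz] with δ hδ hmem
  ext w
  rw [mem_tcone_iff_of_mem hmem]
  have hC : tcone y {x : V | ∀ p ∈ I, p.2 ≤ p.1 x} =
      {x : V | ∀ p ∈ (I.filter fun p => p.2 = p.1 y).image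
        (fun p : Module.Dual ℝ V × ℝ => (p.1, (0:ℝ))), p.2 ≤ p.1 x} := by
    ext z
    rw [mem_tcone_iff_of_mem hy]
    simp only [Finset.mem_image, Finset.mem_filter, Set.mem_ofPred_eq]
    constructor
    · rintro h _ ⟨p, hp, rfl⟩
      exact h p hp.1 hp.2
    · intro h p hp hpy
      exact h _ ⟨p, ⟨hp, hpy⟩, rfl⟩
  rw [hC] at hz ⊢
  rw [mem_tcone_iff_of_mem hz]
  simp only [Finset.mem_image, Finset.mem_filter]
  constructor
  · rintro h _ ⟨p, ⟨hp, hpy⟩, rfl⟩ hpz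
    refine h p hp ?_
    have hpz : 0 = p.1 z := hpz
    simp [hpy, ← hpz]
  · intro h p hp hpe
    have h1 := hδ p hp
    have h2 : ¬ (p.2 < p.1 y ∨ 0 < p.1 z) := fun hh => (h1.2 hh).ne hpe
    push Not at h2
    have h3 : p.2 = p.1 y := le_antisymm (hy p hp) h2.1
    refine h (p.1, 0) ⟨p, ⟨hp, h3⟩, rfl⟩ (le_antisymm ?_ h2.2)
    exact hz (p.1, 0) (Finset.mem_image.2 ⟨p, Finset.mem_filter.2 ⟨hp, h3⟩, rfl⟩)

lemma direction_prod {W : Type*} [AddCommGroup W] [Module ℝ W] {P : Set V} {Q : Set W}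
    (hP : P.Nonempty) (hQ : Q.Nonempty) :
    direction (P ×ˢ Q) = (direction P).prod (direction Q) := by
  obtain ⟨x, hx⟩ := hP
  obtain ⟨y, hy⟩ := hQ
  apply le_antisymm
  · refine direction_le_of_forall (y := (x, y)) fun p hp => ?_
    exact ⟨vsub_mem_vectorSpan ℝ hp.1 hx, vsub_mem_vectorSpan ℝ hp.2 hy⟩
  · have h1 : (direction P).map (LinearMap.inl ℝ V W) ≤ direction (P ×ˢ Q) := by
      rw [Submodule.map_le_iff_le_comap]
      refine direction_le_of_forall (y := x) fun p hp => ?_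
      have := vsub_mem_vectorSpan ℝ (s := P ×ˢ Q) (p₁ := (p, y)) (p₂ := (x, y)) ⟨hp, hy⟩ ⟨hx, hy⟩
      simpa using this
    have h2 : (direction Q).map (LinearMap.inr ℝ V W) ≤ direction (P ×ˢ Q) := by
      rw [Submodule.map_le_iff_le_comap]
      refine direction_le_of_forall (y := y) fun p hp => ?_
      have := vsub_mem_vectorSpan ℝ (s := P ×ˢ Q) (p₁ := (x, p)) (p₂ := (x, y)) ⟨hx, hp⟩ ⟨hx, hy⟩
      simpa using this
    rintro ⟨a, b⟩ ⟨ha, hb⟩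
    have := Submodule.add_mem _ (h1 ⟨a, ha, rfl⟩) (h2 ⟨b, hb, rfl⟩)
    simpa using this

lemma RelInt.inter {P Q : Set V} (hP : IsPoly P) (hQ : IsPoly Q) {y : V} (h1 : RelInt y P)
    (h2 : RelInt y Q) : RelInt y (P ∩ Q) := by
  have := (hP.inter hQ).relInt_faceAt (y := y) ⟨h1.1, h2.1⟩
  rwa [faceAt_inter, h1.faceAt_eq, h2.faceAt_eq] at this

lemma RelInt.direction_inter {P Q : Set V} (hP : IsPoly P) (hQ : IsPoly Q) {y : V}
    (h1 : RelInt y P) (h2 : RelInt y Q) : direction (P ∩ Q) = direction P ⊓ direction Q := by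
  ext z
  rw [← (h1.inter hP hQ h2).mem_tcone_iff (hP.inter hQ), tcone_inter, Submodule.mem_inf,
    ← h1.mem_tcone_iff hP, ← h2.mem_tcone_iff hQ]
  rfl

lemma relInt_submodule (D : Submodule ℝ V) {y : V} (hy : y ∈ D) : RelInt y (D : Set V) := by
  refine ⟨hy, fun z hz => ?_⟩
  have : direction (D : Set V) ≤ D := direction_le_of_forall (y := 0) (by simp)
  refine mem_tcone.2 (Eventually.of_forall fun ε => ?_)
  exact D.add_mem hy (D.smul_mem _ (this hz))

lemma direction_submodule (D : Submodule ℝ V) : direction (D : Set V) = D := by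
  apply le_antisymm
  · exact direction_le_of_forall (y := 0) (by simp)
  · intro z hz
    simpa using vsub_mem_vectorSpan ℝ (s := (D : Set V)) hz D.zero_mem

lemma RelInt.eventually {P : Set V} (hP : IsPoly P) {y x : V} (hy : y ∈ P) (hx : RelInt x P) :
    ∀ᶠ δ : ℝ in 𝓝[>] 0, RelInt (y + δ • (x - y)) P := by
  have : ∀ᶠ δ : ℝ in 𝓝[>] 0, δ < 1 :=
    nhdsWithin_le_nhds (gt_mem_nhds one_pos)
  filter_upwards [this, self_mem_nhdsWithin] with δ h1 h0
  have h0 : 0 < δ := h0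
  obtain ⟨I, rfl⟩ := hP
  have hm : y + δ • (x - y) ∈ {x : V | ∀ p ∈ I, p.2 ≤ p.1 x} := by
    intro p hp
    simp only [map_add, map_smul, map_sub, smul_eq_mul]
    nlinarith [hy p hp, hx.1 p hp]
  refine ⟨hm, fun z hz => ?_⟩
  have := hx.2 z hz
  rw [mem_tcone_iff_of_mem hx.1] at this
  rw [mem_tcone_iff_of_mem hm]
  intro p hp he
  refine this p hp ?_
  simp only [map_add, map_smul, map_sub, smul_eq_mul] at he
  nlinarith [hy p hp, hx.1 p hp]

end Polyhedra

/-! ### Full lattices and rational subspaces -/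

section Lattices

variable {V : Type*} [AddCommGroup V] [Module ℝ V]

/-- The functionals which take integral values on `L`. -/
def dualLattice (L : Submodule ℤ V) : Submodule ℤ (Module.Dual ℝ V) where
  carrier := {φ | ∀ x ∈ L, ∃ z : ℤ, φ x = z}
  add_mem' := by
    intro φ ψ h1 h2 x hx
    obtain ⟨a, ha⟩ := h1 x hx
    obtain ⟨b, hb⟩ := h2 x hx
    exact ⟨a + b, by simp [ha, hb]⟩
  zero_mem' := fun x _ => ⟨0, by simp⟩
  smul_mem' := by
    intro c φ h x hx
    obtain ⟨a, ha⟩ := h x hx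
    exact ⟨c * a, by simp [ha]⟩

/-- A subgroup which spans the space and whose dual lattice spans the dual space. -/
structure IsFullLattice (L : Submodule ℤ V) : Prop where
  span_eq : Submodule.span ℝ (L : Set V) = ⊤
  span_dual_eq : Submodule.span ℝ (dualLattice L : Set (Module.Dual ℝ V)) = ⊤

/-- A linear subspace which is spanned by lattice vectors. -/
def IsRationalSubspace (L : Submodule ℤ V) (D : Submodule ℝ V) : Prop :=
  D ≤ Submodule.span ℝ ((L : Set V) ∩ D)

/-- If `l₀` is a lattice vector of `D` with `φ l₀ = m ≠ 0`, then `x ↦ m x - φ(x) l₀` sends lattice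
vectors of `D` to lattice vectors of `D ∩ ker φ`, and it is multiplication by `m` on the kernel. -/
lemma IsRationalSubspace.inf_ker {L : Submodule ℤ V} {D : Submodule ℝ V}
    (hD : IsRationalSubspace L D) {φ : Module.Dual ℝ V} (hφ : φ ∈ dualLattice L) :
    IsRationalSubspace L (D ⊓ LinearMap.ker φ) := by
  by_cases h : ∀ l ∈ (L : Set V) ∩ D, φ l = 0
  · have : D ≤ LinearMap.ker φ := hD.trans (Submodule.span_le.2 h)
    rwa [inf_eq_left.2 this]
  · push Not at h
    obtain ⟨l₀, hl₀, hne⟩ := h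
    obtain ⟨m, hm⟩ := hφ l₀ hl₀.1
    set S := Submodule.span ℝ ((L : Set V) ∩ (D ⊓ LinearMap.ker φ : Submodule ℝ V)) with hS
    let T : V →ₗ[ℝ] V := (m : ℝ) • LinearMap.id - φ.smulRight l₀
    have hT : D ≤ S.comap T := by
      refine hD.trans (Submodule.span_le.2 ?_)
      rintro l ⟨hl, hlD⟩
      obtain ⟨k, hk⟩ := hφ l hl
      apply Submodule.subset_span
      have hTl : T l = m • l - k • l₀ := by
        simp [T, hk, Int.cast_smul_eq_zsmul]
      refine ⟨?_, ?_, ?_⟩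
      · rw [hTl]
        exact L.sub_mem (L.smul_mem _ hl) (L.smul_mem _ hl₀.1)
      · exact D.sub_mem (D.smul_mem _ hlD) (D.smul_mem _ hl₀.2)
      · simp [T, hm, mul_comm]
    rintro x ⟨hx, hx0⟩
    have h1 : T x ∈ S := hT hx
    have hx0' : φ x = 0 := hx0
    have h2 : T x = (m : ℝ) • x := by simp [T, hx0']
    rw [h2, Submodule.smul_mem_iff _ (by rw [← hm]; exact hne)] at h1
    exact h1

lemma IsFullLattice.isRationalSubspace_top {L : Submodule ℤ V} (hL : IsFullLattice L) :
    IsRationalSubspace L ⊤ := by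
  simp [IsRationalSubspace, hL.span_eq]

lemma IsRationalSubspace.inf_iInf_ker {L : Submodule ℤ V} {D : Submodule ℝ V}
    (hD : IsRationalSubspace L D) (I : Finset (Module.Dual ℝ V)) (hI : ∀ φ ∈ I, φ ∈ dualLattice L) :
    IsRationalSubspace L (D ⊓ ⨅ φ ∈ I, LinearMap.ker φ) := by
  induction I using Finset.induction_on with
  | empty => simpa using hD
  | insert φ I _ ih =>
    rw [Finset.iInf_insert, inf_comm (LinearMap.ker φ), ← inf_assoc]
    exact (ih fun ψ h => hI ψ (Finset.mem_insert_of_mem h)).inf_ker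
      (hI φ (Finset.mem_insert_self _ _))

lemma IsRationalPolyhedron.isRationalSubspace {L : Submodule ℤ V} (hL : IsFullLattice L)
    {P : Set V} (hP : IsRationalPolyhedron L P) : IsRationalSubspace L (direction P) := by
  obtain ⟨y, hy⟩ := hP.isPoly.exists_relInt hP.1
  obtain ⟨-, I, hI, rfl⟩ := hP
  have hy0 := hy.1
  have : direction {x : V | ∀ p ∈ I, p.2 ≤ p.1 x} =
      ⊤ ⊓ ⨅ φ ∈ (I.filter fun p => p.2 = p.1 y).image Prod.fst, LinearMap.ker φ := by
    ext z
    rw [top_inf_eq]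
    simp only [Finset.mem_image, Finset.mem_filter, Submodule.mem_iInf, LinearMap.mem_ker]
    constructor
    · rintro hz _ ⟨p, ⟨hp, hpy⟩, rfl⟩
      have h1 := (mem_tcone_iff_of_mem hy0 z).1 (hy.2 z hz) p hp hpy
      have h2 := (mem_tcone_iff_of_mem hy0 (-z)).1 (hy.2 _ (Submodule.neg_mem _ hz)) p hp hpy
      rw [map_neg] at h2
      linarith
    · intro h
      apply IsPoly.mem_direction_of_mem_tcone ⟨I, rfl⟩ (y := y)
      rw [mem_tcone_iff_of_mem hy0]
      intro p hp hpy
      exact (h p.1 ⟨p, ⟨hp, hpy⟩, rfl⟩).ge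
  rw [this]
  refine hL.isRationalSubspace_top.inf_iInf_ker _ fun φ hφ => ?_
  simp only [Finset.mem_image, Finset.mem_filter] at hφ
  obtain ⟨p, ⟨hp, -⟩, rfl⟩ := hφ
  exact hI p hp

variable [FiniteDimensional ℝ V]

/-- The annihilator of `D` is cut out in the dual space by evaluations at lattice vectors, so it is
itself spanned by integral functionals. If all of these vanished at `x`, so would the whole
annihilator. -/
lemma IsRationalSubspace.exists_functional {L : Submodule ℤ V} (hL : IsFullLattice L)
    {D : Submodule ℝ V} (hD : IsRationalSubspace L D) {x : V} (hx : x ∉ D) :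
    ∃ φ ∈ dualLattice L, (∀ z ∈ D, φ z = 0) ∧ φ x ≠ 0 := by
  obtain ⟨f, hf, hspan, -⟩ := Submodule.exists_fun_fin_finrank_span_eq ℝ ((L : Set V) ∩ D)
  have hDf : D ≤ Submodule.span ℝ (Set.range f) := by rw [hspan]; exact hD
  let I : Finset (Module.Dual ℝ (Module.Dual ℝ V)) :=
    Finset.univ.image fun i => Module.Dual.eval ℝ V (f i)
  have htop : IsRationalSubspace (dualLattice L) ⊤ := by
    simp [IsRationalSubspace, hL.span_dual_eq]
  have hrat := htop.inf_iInf_ker I (by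
    intro e he
    simp only [I, Finset.mem_image, Finset.mem_univ, true_and] at he
    obtain ⟨i, rfl⟩ := he
    intro φ hφ
    exact hφ _ (hf i).1)
  rw [top_inf_eq] at hrat
  have hmem : ∀ φ : Module.Dual ℝ V, φ ∈ (⨅ e ∈ I, LinearMap.ker e) ↔ ∀ z ∈ D, φ z = 0 := by
    intro φ
    simp only [I, Finset.mem_image, Finset.mem_univ, true_and, Submodule.mem_iInf,
      LinearMap.mem_ker]
    constructor
    · intro h z hz
      have : Submodule.span ℝ (Set.range f) ≤ LinearMap.ker φ := by
        rw [Submodule.span_le]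
        rintro _ ⟨i, rfl⟩
        exact h _ ⟨i, rfl⟩
      exact this (hDf hz)
    · rintro h _ ⟨i, rfl⟩
      exact h _ (hf i).2
  by_contra hcon
  push Not at hcon
  obtain ⟨φ, hφx, hφ⟩ := Submodule.exists_le_ker_of_notMem hx
  have h1 := hrat ((hmem φ).2 fun z hz => hφ hz)
  have h2 : Submodule.span ℝ ((dualLattice L : Set (Module.Dual ℝ V)) ∩
      (⨅ e ∈ I, LinearMap.ker e : Submodule ℝ (Module.Dual ℝ V))) ≤
      LinearMap.ker (Module.Dual.eval ℝ V x) := by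
    rw [Submodule.span_le]
    rintro ψ ⟨h3, h4⟩
    exact hcon ψ h3 ((hmem ψ).1 h4)
  exact hφx (h2 h1)

/-- The values on `L ∩ E` of an integral functional that vanishes on `D` form a cyclic group;
dividing by its generator makes `1` a value. -/
lemma IsRationalSubspace.exists_normalized_functional {L : Submodule ℤ V} (hL : IsFullLattice L)
    {D E : Submodule ℝ V} (hD : IsRationalSubspace L D) (hE : IsRationalSubspace L E)
    (hDE : D ≤ E) (hfin : Module.finrank ℝ E = Module.finrank ℝ D + 1) :
    ∃ φ : Module.Dual ℝ V, (∀ x ∈ L, x ∈ E → ∃ z : ℤ, φ x = z) ∧ E ⊓ LinearMap.ker φ = D ∧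
      ∃ u ∈ L, u ∈ E ∧ φ u = 1 := by
  have hlt : ¬ E ≤ D := fun h => by
    have := Submodule.finrank_mono h
    omega
  obtain ⟨l, ⟨hlL, hlE⟩, hlD⟩ : ∃ l ∈ (L : Set V) ∩ E, l ∉ D := by
    by_contra hcon
    push Not at hcon
    exact hlt (hE.trans (Submodule.span_le.2 hcon))
  obtain ⟨φ, hφL, hφD, hφl⟩ := hD.exists_functional hL hlD
  let A : AddSubgroup ℤ := ((L.toAddSubgroup ⊓ E.toAddSubgroup).map
    (φ.toAddMonoidHom)).comap (Int.castAddHom ℝ)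
  obtain ⟨g, hg⟩ := Int.subgroup_cyclic A
  have hA : ∀ z : ℤ, z ∈ A ↔ ∃ x, (x ∈ L ∧ x ∈ E) ∧ φ x = z := by
    intro z
    simp only [A, AddSubgroup.mem_comap, AddSubgroup.mem_map]
    rfl
  have hgA : g ∈ A := hg ▸ AddSubgroup.subset_closure rfl
  obtain ⟨u, ⟨huL, huE⟩, hu⟩ := (hA g).1 hgA
  have hmul : ∀ x, x ∈ L → x ∈ E → ∃ z : ℤ, φ x = z * g := by
    intro x hx hxE
    obtain ⟨a, ha⟩ := hφL x hx
    have : a ∈ A := (hA a).2 ⟨x, ⟨hx, hxE⟩, ha⟩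
    rw [hg, AddSubgroup.mem_closure_singleton] at this
    obtain ⟨z, hz⟩ := this
    refine ⟨z, ?_⟩
    rw [ha, ← hz]
    simp
  have hg0 : (g : ℝ) ≠ 0 := by
    intro h0
    obtain ⟨z, hz⟩ := hmul l hlL hlE
    rw [h0, mul_zero] at hz
    exact hφl hz
  refine ⟨(g : ℝ)⁻¹ • φ, ?_, ?_, u, huL, huE, ?_⟩
  · intro x hx hxE
    obtain ⟨z, hz⟩ := hmul x hx hxE
    exact ⟨z, by simp [hz]; field_simp⟩
  · symm
    apply Submodule.eq_of_le_of_finrank_le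
    · intro z hz
      exact ⟨hDE hz, by simp [hφD z hz]⟩
    · have hlt2 : E ⊓ LinearMap.ker ((g : ℝ)⁻¹ • φ) < E := by
        refine lt_of_le_of_ne inf_le_left fun h => ?_
        have : l ∈ E ⊓ LinearMap.ker ((g : ℝ)⁻¹ • φ) := by rw [h]; exact hlE
        have h3 := this.2
        simp [hg0, hφl] at h3
      have := Submodule.finrank_lt_finrank_of_lt hlt2
      omega
  · simp [hu, hg0]

end Lattices

/-! ### Multiplicativity of lattice indices -/

section Index

variable {V : Type*} [AddCommGroup V] [Module ℝ V]

/-- The index of a subgroup, for submodules over the integers. -/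
def latIndex {G : Type*} [AddCommGroup G] (A B : Submodule ℤ G) : ℤ :=
  (A.toAddSubgroup.relIndex B.toAddSubgroup : ℤ)

/-- The index splits into a part in `ker φ` and the index of `φ x` in `ℤ`. For `φ x = 0` both sides
are `0`, since an infinite index is recorded as `0`. It will show how the index of a cell depends on
its primitive generator at a wall. -/
lemma latIndex_sup_span {N J : Submodule ℤ V} {φ : Module.Dual ℝ V} (hφ : φ ∈ dualLattice N)
    (hsurj : ∃ u ∈ N, φ u = 1) (hJ : J ≤ N) (hJφ : ∀ x ∈ J, φ x = 0) {x : V} (hx : x ∈ N) :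
    (latIndex (J ⊔ Submodule.span ℤ {x}) N : ℝ) =
      latIndex J (N ⊓ (LinearMap.ker φ).restrictScalars ℤ) * |φ x| := by
  set K : Submodule ℤ V := N ⊓ (LinearMap.ker φ).restrictScalars ℤ with hK
  obtain ⟨u, huN, hu⟩ := hsurj
  have hJK : J ≤ K := fun z hz => ⟨hJ hz, hJφ z hz⟩
  have hxN : Submodule.span ℤ {x} ≤ N := by
    rw [Submodule.span_singleton_le_iff_mem]; exact hx
  have hmap : N.toAddSubgroup.map φ.toAddMonoidHom = (⊤ : AddSubgroup ℤ).map (Int.castAddHom ℝ) := by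
    ext r
    simp only [AddSubgroup.mem_map, AddSubgroup.mem_top, true_and]
    constructor
    · rintro ⟨z, hz, rfl⟩
      obtain ⟨a, ha⟩ := hφ z hz
      exact ⟨a, ha.symm⟩
    · rintro ⟨a, rfl⟩
      exact ⟨a • u, N.smul_mem _ huN, by simp [hu]⟩
  obtain ⟨m, hm⟩ := hφ x hx
  by_cases hm0 : m = 0
  · have hxφ : φ x = 0 := by rw [hm, hm0]; simp
    have hle : J ⊔ Submodule.span ℤ {x} ≤ K := by
      refine sup_le hJK ?_
      rw [Submodule.span_singleton_le_iff_mem]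
      exact ⟨hx, hxφ⟩
    have h0 : K.toAddSubgroup.relIndex N.toAddSubgroup = 0 := by
      have h1 : K.toAddSubgroup = N.toAddSubgroup ⊓ φ.toAddMonoidHom.ker := by
        ext z; rfl
      rw [h1, AddSubgroup.inf_relIndex_left, AddSubgroup.relIndex_ker, hmap]
      have : Infinite ((⊤ : AddSubgroup ℤ).map (Int.castAddHom ℝ)) := by
        refine Infinite.of_injective (fun a : ℤ => ⟨(a : ℝ), ⟨a, trivial, rfl⟩⟩) ?_
        intro a b hab
        have := congrArg Subtype.val hab
        exact Int.cast_injective (α := ℝ) this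
      exact Nat.card_eq_zero_of_infinite
    have h2 := AddSubgroup.relIndex_mul_relIndex _ _ _
      (Submodule.toAddSubgroup_mono hle) (Submodule.toAddSubgroup_mono (inf_le_left : K ≤ N))
    rw [h0, mul_zero] at h2
    rw [hxφ, abs_zero, mul_zero, latIndex, ← h2]
    simp
  · set K' : Submodule ℤ V := K ⊔ Submodule.span ℤ {x} with hK'
    have hK'N : K' ≤ N := sup_le inf_le_left hxN
    have hle : J ⊔ Submodule.span ℤ {x} ≤ K' := sup_le_sup_right hJK _
    have h2 := AddSubgroup.relIndex_mul_relIndex _ _ _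
      (Submodule.toAddSubgroup_mono hle) (Submodule.toAddSubgroup_mono hK'N)
    have h3 : K'.toAddSubgroup.relIndex N.toAddSubgroup = m.natAbs := by
      have h4 : K'.toAddSubgroup = N.toAddSubgroup ⊓
          ((AddSubgroup.zmultiples m).map (Int.castAddHom ℝ)).comap φ.toAddMonoidHom := by
        ext z
        simp only [Submodule.mem_toAddSubgroup, AddSubgroup.mem_inf, AddSubgroup.mem_comap,
          AddSubgroup.mem_map, AddSubgroup.mem_zmultiples_iff]
        constructor
        · intro hz
          refine ⟨hK'N hz, ?_⟩
          obtain ⟨a, ha, b, hb, rfl⟩ := Submodule.mem_sup.1 hz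
          obtain ⟨c, rfl⟩ := Submodule.mem_span_singleton.1 hb
          refine ⟨c • m, ⟨c, rfl⟩, ?_⟩
          have : φ a = 0 := ha.2
          simp [this, hm]
        · rintro ⟨hz, _, ⟨c, rfl⟩, hc⟩
          refine Submodule.mem_sup.2 ⟨z - c • x, ⟨N.sub_mem hz (N.smul_mem _ hx), ?_⟩, c • x,
            Submodule.mem_span_singleton.2 ⟨c, rfl⟩, by simp⟩
          have hc : ((c • m : ℤ) : ℝ) = φ z := hc
          simp [← hc, hm]
      rw [h4, AddSubgroup.inf_relIndex_left, AddSubgroup.relIndex_comap, hmap,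
        AddSubgroup.relIndex_map_map_of_injective _ _ (by intro a b hab; simpa using hab),
        AddSubgroup.relIndex_top_right, Int.index_zmultiples]
    have h5 : (J ⊔ Submodule.span ℤ {x}).toAddSubgroup.relIndex K'.toAddSubgroup =
        J.toAddSubgroup.relIndex K.toAddSubgroup := by
      have h6 : K' = K ⊔ (J ⊔ Submodule.span ℤ {x}) := by
        rw [← sup_assoc, sup_eq_left.2 hJK]
      rw [h6, Submodule.sup_toAddSubgroup K, AddSubgroup.relIndex_sup_right,
        ← AddSubgroup.inf_relIndex_right]
      congr 1
      ext z
      simp only [AddSubgroup.mem_inf, Submodule.mem_toAddSubgroup]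
      constructor
      · rintro ⟨hz, hzK⟩
        obtain ⟨a, ha, b, hb, rfl⟩ := Submodule.mem_sup.1 hz
        obtain ⟨c, rfl⟩ := Submodule.mem_span_singleton.1 hb
        have h7 : φ (a + c • x) = 0 := hzK.2
        have h8 : (c : ℝ) * m = 0 := by simpa [hJφ a ha, hm] using h7
        have : c = 0 := by
          have := mul_eq_zero.1 h8
          rcases this with h | h
          · exact_mod_cast h
          · exact absurd (by exact_mod_cast h) hm0
        simpa [this] using ha
      · intro hz
        exact ⟨Submodule.mem_sup_left hz, hJK hz⟩
    rw [latIndex, ← h2, h3, h5, hm, latIndex]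
    push_cast
    simp

/-- The intermediate group `f(A) × N₂` splits the index: above it one sees the first projection,
below it the part of the image lying over `0`. -/
lemma latIndex_map_prod {G G₁ G₂ : Type*} [AddCommGroup G] [AddCommGroup G₁] [AddCommGroup G₂]
    (A : Submodule ℤ G) (f : G →ₗ[ℤ] G₁) (g : G →ₗ[ℤ] G₂) {N₁ : Submodule ℤ G₁}
    {N₂ : Submodule ℤ G₂} (hf : A.map f ≤ N₁) (hg : A.map g ≤ N₂) :
    latIndex (A.map (f.prod g)) (N₁.prod N₂) =
      latIndex (A.map f) N₁ * latIndex ((A ⊓ LinearMap.ker f).map g) N₂ := by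
  set B := A.map (f.prod g)
  set C : Submodule ℤ (G₁ × G₂) := (A.map f).prod N₂ with hC
  have hBC : B ≤ C := by
    rintro _ ⟨a, ha, rfl⟩
    exact ⟨⟨a, ha, rfl⟩, hg ⟨a, ha, rfl⟩⟩
  have hCN : C ≤ N₁.prod N₂ := fun z hz => ⟨hf hz.1, hz.2⟩
  have h1 := AddSubgroup.relIndex_mul_relIndex _ _ _
      (Submodule.toAddSubgroup_mono hBC) (Submodule.toAddSubgroup_mono hCN)
  have h2 : C.toAddSubgroup.relIndex (N₁.prod N₂).toAddSubgroup =
      (A.map f).toAddSubgroup.relIndex N₁.toAddSubgroup := by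
    have h3 : C.toAddSubgroup = (N₁.prod N₂).toAddSubgroup ⊓
        (A.map f).toAddSubgroup.comap (AddMonoidHom.fst G₁ G₂) := by
      ext z
      simp only [AddSubgroup.mem_inf, Submodule.mem_toAddSubgroup, AddSubgroup.mem_comap, hC,
        Submodule.mem_prod]
      exact ⟨fun h => ⟨⟨hf h.1, h.2⟩, h.1⟩, fun h => ⟨h.2, h.1.2⟩⟩
    have h4 : (N₁.prod N₂).toAddSubgroup.map (AddMonoidHom.fst G₁ G₂) = N₁.toAddSubgroup := by
      ext z
      simp only [AddSubgroup.mem_map, Submodule.mem_toAddSubgroup]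
      exact ⟨by rintro ⟨w, hw, rfl⟩; exact hw.1, fun h => ⟨(z, 0), ⟨h, N₂.zero_mem⟩, rfl⟩⟩
    rw [h3, AddSubgroup.inf_relIndex_left, AddSubgroup.relIndex_comap, h4]
  have h5 : B.toAddSubgroup.relIndex C.toAddSubgroup =
      ((A ⊓ LinearMap.ker f).map g).toAddSubgroup.relIndex N₂.toAddSubgroup := by
    have h6 : C = N₂.map (LinearMap.inr ℤ G₁ G₂) ⊔ B := by
      apply le_antisymm
      · rintro ⟨a, b⟩ ⟨⟨c, hc, rfl⟩, hb⟩
        refine Submodule.mem_sup.2 ⟨(0, b - g c), ⟨b - g c, N₂.sub_mem hb (hg ⟨c, hc, rfl⟩), rfl⟩,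
          (f c, g c), ⟨c, hc, rfl⟩, by simp⟩
      · refine sup_le ?_ hBC
        rintro _ ⟨b, hb, rfl⟩
        exact ⟨Submodule.zero_mem _, hb⟩
    rw [h6, Submodule.sup_toAddSubgroup, AddSubgroup.relIndex_sup_right,
      Submodule.map_toAddSubgroup (LinearMap.inr ℤ G₁ G₂), ← AddSubgroup.relIndex_comap]
    congr 1
    ext z
    simp only [AddSubgroup.mem_comap, Submodule.mem_toAddSubgroup, B, Submodule.mem_map,
      Submodule.mem_inf, LinearMap.mem_ker]
    constructor
    · rintro ⟨a, ha, hz⟩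
      have h1 : f a = 0 := congrArg Prod.fst hz
      have h2 : g a = z := congrArg Prod.snd hz
      exact ⟨a, ⟨ha, h1⟩, h2⟩
    · rintro ⟨a, ⟨ha, h1⟩, rfl⟩
      exact ⟨a, ha, by simp [h1]⟩
  rw [latIndex, ← h1, h2, h5, latIndex, latIndex]
  push_cast
  ring

end Index

/-! ### Generic vectors and directions -/

section Generic

variable {V : Type*} [AddCommGroup V] [Module ℝ V]

lemma eventually_ne_zero_right (c : ℝ) : ∀ᶠ ε : ℝ in 𝓝[>] 0, ε ≠ c := by
  rcases le_or_gt c 0 with h | h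
  · filter_upwards [self_mem_nhdsWithin] with ε he
    have he : 0 < ε := he
    exact (h.trans_lt he).ne'
  · filter_upwards [nhdsWithin_le_nhds (gt_mem_nhds h)] with ε he using ne_of_lt he

lemma eventually_add_smul_notMem (D : Submodule ℝ V) (a : V) {z : V} (hz : z ∉ D) :
    ∀ᶠ ε : ℝ in 𝓝[>] 0, a + ε • z ∉ D := by
  by_cases h : ∃ c : ℝ, a + c • z ∈ D
  · obtain ⟨c, hc⟩ := h
    filter_upwards [eventually_ne_zero_right c] with ε he hmem
    have := D.sub_mem hmem hc
    rw [add_sub_add_left_eq_sub, ← sub_smul, D.smul_mem_iff (sub_ne_zero.2 he)] at this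
    exact hz this
  · push Not at h
    exact Eventually.of_forall fun ε => h ε

/-- A real vector space is not a finite union of proper subspaces. -/
lemma exists_forall_notMem (T : Finset (Submodule ℝ V)) : ∃ v : V, ∀ D ∈ T, D ≠ ⊤ → v ∉ D := by
  have h := Subspace.biUnion_ne_univ_of_top_notMem (s := (T.filter (· ≠ ⊤)))
    (by simp)
  rw [Set.ne_univ_iff_exists_notMem] at h
  obtain ⟨v, hv⟩ := h
  refine ⟨v, fun D hD hne hmem => hv ?_⟩
  simp only [Set.mem_iUnion]
  exact ⟨D, by simp [hD, hne], hmem⟩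

lemma exists_mem_forall_notMem (E : Submodule ℝ V) (T : Finset (Submodule ℝ V)) :
    ∃ v ∈ E, ∀ D ∈ T, ¬ E ≤ D → v ∉ D := by
  obtain ⟨v, hv⟩ := exists_forall_notMem (T.image fun D => D.comap E.subtype)
  refine ⟨v, v.2, fun D hD hE hmem => ?_⟩
  refine hv _ (Finset.mem_image_of_mem _ hD) ?_ hmem
  rw [Ne, Submodule.comap_subtype_eq_top]
  exact hE

lemma RelInt.eventually_add_smul {P : Set V} (hP : IsPoly P) {x z : V} (hx : RelInt x P)
    (hz : z ∈ direction P) : ∀ᶠ ε : ℝ in 𝓝[>] 0, RelInt (x + ε • z) P := by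
  have hmem := hx.2 z hz
  filter_upwards [hP.eventually_tcone hmem, mem_tcone.1 hmem] with ε he hm
  have h1 : tcone x P = (direction P : Set V) := by
    ext w; exact hx.mem_tcone_iff hP
  refine ⟨hm, fun w hw => ?_⟩
  rw [he, h1, (relInt_submodule _ hz).mem_tcone_iff (h1 ▸ hP.isPoly_tcone hx.1), direction_submodule]
  exact hw

/-- From any point of a polyhedron one can move to the relative interior in a direction which
avoids finitely many given subspaces. -/
lemma IsPoly.exists_generic_direction {P : Set V} (hP : IsPoly P) {y : V} (hy : y ∈ P)
    (T : Finset (Submodule ℝ V)) :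
    ∃ z ∈ tcone y P, (∀ D ∈ T, ¬ direction P ≤ D → z ∉ D) ∧
      ∀ᶠ δ : ℝ in 𝓝[>] 0, RelInt (y + δ • z) P := by
  obtain ⟨x, hx⟩ := hP.exists_relInt ⟨y, hy⟩
  obtain ⟨v, hv, hvT⟩ := exists_mem_forall_notMem (direction P) T
  -- The direction to an interior point `x` is perturbed by a generic vector of `direction P`, by so
  -- little that the end point stays in the relative interior.
  have h1 : ∀ᶠ ε : ℝ in 𝓝[>] 0, ∀ D ∈ T, ¬ direction P ≤ D → (x - y) + ε • v ∉ D := by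
    rw [Filter.eventually_all_finset]
    intro D hD
    by_cases hE : direction P ≤ D
    · exact Eventually.of_forall fun _ h => absurd hE h
    · filter_upwards [eventually_add_smul_notMem D (x - y) (hvT D hD hE)] with ε he _ using he
  obtain ⟨ε, h2, h3⟩ := (h1.and (hx.eventually_add_smul hP hv)).exists
  refine ⟨(x - y) + ε • v, ?_, h2, ?_⟩
  · rw [sub_add_eq_add_sub]
    exact hP.sub_mem_tcone h3.1 hy
  · rw [sub_add_eq_add_sub]
    exact h3.eventually hP hy

end Generic

/-! ### Complexes and the smallest cell through a point -/

section Complexes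

variable {V : Type*} [AddCommGroup V] [Module ℝ V]

/-- A finite complex of rational polyhedra. -/
structure IsPolyComplex (L : Submodule ℤ V) (S : Finset (Set V)) : Prop where
  rational : ∀ P ∈ S, IsRationalPolyhedron L P
  face_mem : ∀ P ∈ S, ∀ F, IsFace F P → F ∈ S
  inter_face : ∀ P ∈ S, ∀ Q ∈ S, (P ∩ Q).Nonempty → IsFace (P ∩ Q) P

lemma TropicalComplex.isPolyComplex {L : Submodule ℤ V} (a : TropicalComplex L) :
    IsPolyComplex L a.cells := ⟨a.rational, a.face_mem, a.inter_face⟩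

namespace IsPolyComplex

variable {L : Submodule ℤ V} {S : Finset (Set V)}

lemma isPoly (h : IsPolyComplex L S) {P : Set V} (hP : P ∈ S) : IsPoly P :=
  (h.rational P hP).isPoly

lemma faceAt_mem (h : IsPolyComplex L S) {P : Set V} (hP : P ∈ S) {y : V} (hy : y ∈ P) :
    faceAt y P ∈ S := h.face_mem P hP _ ((h.isPoly hP).isFace_faceAt hy)

lemma isFace_of_subset (h : IsPolyComplex L S) {P Q : Set V} (hP : P ∈ S) (hQ : Q ∈ S)
    (hPQ : P ⊆ Q) : IsFace P Q := by
  have := h.inter_face Q hQ P hP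
  rw [Set.inter_eq_right.2 hPQ] at this
  exact this (h.rational P hP).1

lemma subset_of_relInt (h : IsPolyComplex L S) {E P : Set V} (hE : E ∈ S) (hP : P ∈ S) {y : V}
    (hyE : RelInt y E) (hyP : y ∈ P) : E ⊆ P := by
  have h1 := (h.inter_face E hE P hP ⟨y, hyE.1, hyP⟩).eq_of_relInt hyE ⟨hyE.1, hyP⟩
  exact h1 ▸ Set.inter_subset_right

lemma eq_faceAt (h : IsPolyComplex L S) {E P : Set V} (hE : E ∈ S) (hP : P ∈ S) {y : V}
    (hyE : RelInt y E) (hyP : y ∈ P) : E = faceAt y P :=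
  (h.isFace_of_subset hE hP (h.subset_of_relInt hE hP hyE hyP)).eq_faceAt hyE

/-- The smallest face through `y` does not depend on the cell that is used: only one cell of a
complex has `y` in its relative interior. -/
lemma faceAt_eq (h : IsPolyComplex L S) {P Q : Set V} (hP : P ∈ S) (hQ : Q ∈ S) {y : V}
    (hyP : y ∈ P) (hyQ : y ∈ Q) : faceAt y P = faceAt y Q :=
  h.eq_faceAt (h.faceAt_mem hP hyP) hQ ((h.isPoly hP).relInt_faceAt hyP) hyQ

/-- A polyhedron inside some cell, with a relative interior point in a cell `P`, lies in `P`. -/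
lemma subset_of_relInt_of_subset (h : IsPolyComplex L S) {E P Q : Set V} (hP : P ∈ S)
    (hQ : Q ∈ S) {y : V} (hyE : RelInt y E) (hEQ : E ⊆ Q) (hyP : y ∈ P) : E ⊆ P := by
  have h1 : E ⊆ faceAt y Q := fun x hx =>
    ⟨hEQ hx, tcone_mono y hEQ (hyE.2 _ (vsub_mem_vectorSpan ℝ hyE.1 hx))⟩
  rw [h.faceAt_eq hQ hP (hEQ hyE.1) hyP] at h1
  exact h1.trans (faceAt_subset _ _)

lemma eq_of_polyDim [FiniteDimensional ℝ V] (h : IsPolyComplex L S) {P Q : Set V} (hP : P ∈ S)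
    (hQ : Q ∈ S) (hPQ : P ⊆ Q) (hd : polyDim Q ≤ polyDim P) : P = Q :=
  (h.isFace_of_subset hP hQ hPQ).eq_of_polyDim (h.isPoly hQ) hd

lemma eventually_mem_iff (h : IsPolyComplex L S) (y z : V) :
    ∀ᶠ ε : ℝ in 𝓝[>] 0, ∀ P ∈ S, (y + ε • z ∈ P ↔ z ∈ tcone y P) := by
  rw [Filter.eventually_all_finset]
  exact fun P hP => (h.isPoly hP).eventually_mem_iff y z

end IsPolyComplex

lemma TropicalComplex.isPoly {L : Submodule ℤ V} (a : TropicalComplex L) {P : Set V}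
    (hP : P ∈ a.cells) : IsPoly P := a.isPolyComplex.isPoly hP

lemma TropicalComplex.polyDim_le [FiniteDimensional ℝ V] {L : Submodule ℤ V}
    (a : TropicalComplex L) {P : Set V} (hP : P ∈ a.cells) : polyDim P ≤ a.dim := by
  obtain ⟨Q, hQ, hPQ, hd⟩ := a.pure P hP
  exact hd ▸ polyDim_mono hPQ

lemma TropicalComplex.mem_maxCells {L : Submodule ℤ V} (a : TropicalComplex L) {P : Set V} :
    P ∈ a.maxCells ↔ P ∈ a.cells ∧ polyDim P = a.dim := by
  simp [TropicalComplex.maxCells]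

end Complexes

/-! ### The degree of a linear map on a complex, and refinement -/

section Degree

variable {W U : Type*} [AddCommGroup W] [Module ℝ W] [AddCommGroup U] [Module ℝ U]

/-- The cells of dimension `k`. -/
def cellsOfDim (S : Finset (Set W)) (k : ℤ) : Finset (Set W) := S.filter (fun P => polyDim P = k)

lemma mem_cellsOfDim {S : Finset (Set W)} {k : ℤ} {P : Set W} :
    P ∈ cellsOfDim S k ↔ P ∈ S ∧ polyDim P = k := by simp [cellsOfDim]

/-- The index of the image of the lattice of `P`. -/
def mapIndex (M : Submodule ℤ W) (N : Submodule ℤ U) (π : W →ₗ[ℝ] U) (P : Set W) : ℤ :=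
  latIndex ((latticeOf M P).map (π.restrictScalars ℤ)) N

/-- The weighted number of cells whose cone at `y` has a point in the fibre of `π` over `u`. -/
def degree (S : Finset (Set W)) (w : Set W → ℤ) (M : Submodule ℤ W) (N : Submodule ℤ U)
    (π : W →ₗ[ℝ] U) (y : W) (u : U) : ℤ :=
  ∑ P ∈ S with (y ∈ P ∧ u ∈ π '' tcone y P), mapIndex M N π P * w P

/-- A vector which is not in the images of cells with small image. -/
def IsGenericFor (S : Finset (Set W)) (π : W →ₗ[ℝ] U) (u : U) : Prop :=
  ∀ P ∈ S, (direction P).map π ≠ ⊤ → u ∉ (direction P).map π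

/-- All cones at `y` contain the linear space `K`. -/
def HasLineality (S : Finset (Set W)) (y : W) (K : Submodule ℝ W) : Prop :=
  ∀ P ∈ S, y ∈ P → ∀ z ∈ K, z ∈ tcone y P

lemma IsGenericFor.map_eq_top {S : Finset (Set W)} {π : W →ₗ[ℝ] U} {u : U}
    (h : IsGenericFor S π u) {P : Set W} (hP : P ∈ S) (hPp : IsPoly P) {y : W}
    (hu : u ∈ π '' tcone y P) : (direction P).map π = ⊤ := by
  by_contra hne
  obtain ⟨z, hz, rfl⟩ := hu
  exact h P hP hne ⟨z, hPp.mem_direction_of_mem_tcone hz, rfl⟩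

variable [FiniteDimensional ℝ W]

lemma finrank_map_add_finrank_inf_ker (D : Submodule ℝ W) (π : W →ₗ[ℝ] U) :
    Module.finrank ℝ (D.map π) + Module.finrank ℝ (D ⊓ LinearMap.ker π : Submodule ℝ W) =
      Module.finrank ℝ D := by
  have h := LinearMap.finrank_range_add_finrank_ker (π.domRestrict D)
  have h1 : LinearMap.range (π.domRestrict D) = D.map π := by
    rw [LinearMap.domRestrict, LinearMap.range_comp, Submodule.range_subtype]
  have h2 : (LinearMap.ker (π.domRestrict D)).map D.subtype = D ⊓ LinearMap.ker π := by
    ext x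
    simp only [Submodule.mem_map, LinearMap.mem_ker, Submodule.mem_inf]
    constructor
    · rintro ⟨⟨z, hz⟩, h, rfl⟩; exact ⟨hz, h⟩
    · rintro ⟨hz, h⟩; exact ⟨⟨x, hz⟩, h, rfl⟩
  have h3 : Module.finrank ℝ (LinearMap.ker (π.domRestrict D)) =
      Module.finrank ℝ (D ⊓ LinearMap.ker π : Submodule ℝ W) := by
    rw [← h2]
    exact (LinearEquiv.finrank_eq (Submodule.equivMapOfInjective _ D.injective_subtype _))
  rw [h1, h3] at h
  exact h

lemma finrank_map_add_le {D K : Submodule ℝ W} {π : W →ₗ[ℝ] U} (hK : K ≤ LinearMap.ker π)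
    (hKD : K ≤ D) : Module.finrank ℝ (D.map π) + Module.finrank ℝ K ≤ Module.finrank ℝ D := by
  have := finrank_map_add_finrank_inf_ker D π
  have h2 := Submodule.finrank_mono (le_inf hKD hK)
  omega

lemma le_finrank_of_map_eq_top {D K : Submodule ℝ W} {π : W →ₗ[ℝ] U}
    (hK : K ≤ LinearMap.ker π) (hKD : K ≤ D) (htop : D.map π = ⊤) :
    Module.finrank ℝ U + Module.finrank ℝ K ≤ Module.finrank ℝ D := by
  have := finrank_map_add_le hK hKD
  rw [htop, finrank_top] at this
  exact this

/-- For these dimensions the fibres of `π` on `D` are translates of `K`. The cones at `y` absorb `K`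
when it is part of their lineality, so the choice of a preimage of `u` will never matter. -/
lemma inf_ker_eq_of_map_eq_top {D K : Submodule ℝ W} {π : W →ₗ[ℝ] U}
    (hK : K ≤ LinearMap.ker π) (hKD : K ≤ D) (htop : D.map π = ⊤)
    (hd : Module.finrank ℝ D = Module.finrank ℝ U + Module.finrank ℝ K) :
    D ⊓ LinearMap.ker π = K := by
  symm
  apply Submodule.eq_of_le_of_finrank_le (le_inf hKD hK)
  have := finrank_map_add_finrank_inf_ker D π
  rw [htop, finrank_top] at this
  omega

lemma HasLineality.le_direction {S : Finset (Set W)} {M : Submodule ℤ W} (hS : IsPolyComplex M S)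
    {y : W} {K : Submodule ℝ W} (h : HasLineality S y K) {P : Set W} (hP : P ∈ S) (hy : y ∈ P) :
    K ≤ direction P := fun z hz => (hS.isPoly hP).mem_direction_of_mem_tcone (h P hP hy z hz)

/-- The degree does not change under refinement. -/
theorem degree_eq_of_refines {S S' : Finset (Set W)} {w w' : Set W → ℤ} {M : Submodule ℤ W}
    (hS : IsPolyComplex M S) (hS' : IsPolyComplex M S') {k : ℤ}
    (hpure : ∀ P ∈ S, ∃ Q ∈ S, P ⊆ Q ∧ polyDim Q = k)
    (hsub : ∀ P' ∈ S', ∃ P ∈ S, P' ⊆ P) (hcov : ∀ P ∈ S, P ⊆ ⋃ P' ∈ S', P')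
    (hw : ∀ P' ∈ S', ∀ P ∈ S, polyDim P' = k → polyDim P = k → P' ⊆ P → w' P' = w P)
    {N : Submodule ℤ U} {π : W →ₗ[ℝ] U} {y : W} {K : Submodule ℝ W} (hK : K ≤ LinearMap.ker π)
    (hlin : HasLineality S' y K)
    (hk : k = Module.finrank ℝ U + Module.finrank ℝ K) {u : U} (hu : IsGenericFor S π u)
    (hu' : IsGenericFor S' π u) :
    degree (cellsOfDim S' k) w' M N π y u = degree (cellsOfDim S k) w M N π y u := by
  have hdim : ∀ P ∈ S, polyDim P ≤ k := by
    intro P hP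
    obtain ⟨Q, hQ, hPQ, hd⟩ := hpure P hP
    exact hd ▸ polyDim_mono hPQ
  -- Lineality passes from the refinement to `S`, because a cell of `S` through `y` contains the
  -- smallest cell of `S'` at `y`.
  have hlinS : HasLineality S y K := by
    intro P hP hy z hz
    obtain ⟨P', hP', hyP'⟩ := Set.mem_iUnion₂.1 (hcov P hP hy)
    obtain ⟨Q, hQ, hPQ⟩ := hsub P' hP'
    have h1 := hS'.faceAt_mem hP' hyP'
    have h2 := (hS'.isPoly hP').relInt_faceAt hyP'
    have h3 := hS.subset_of_relInt_of_subset hP hQ h2 ((faceAt_subset _ _).trans hPQ) hy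
    exact tcone_mono y h3 (hlin _ h1 h2.1 z hz)
  have hex : ∀ P' ∈ S', polyDim P' = k → ∃ P ∈ S, P' ⊆ P ∧ polyDim P = k := by
    intro P' hP' hd
    obtain ⟨P, hP, hPP⟩ := hsub P' hP'
    exact ⟨P, hP, hPP, le_antisymm (hdim P hP) (hd ▸ polyDim_mono hPP)⟩
  -- `f` maps a cell of dimension `k` of the refinement to one of `S` containing it; on the
  -- contributing cells it is a bijection.
  choose! f hfS hfsub hfd using hex
  -- Genericity of `u`: a cell whose directions meet the fibre over `u` has full image, hence
  -- dimension at least `k`. So no proper face of a cell of dimension `k` can take its place.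
  have hkey : ∀ {T : Finset (Set W)} (hT : IsPolyComplex M T) (hTu : IsGenericFor T π u)
      (hTl : HasLineality T y K) {E : Set W}, E ∈ T → y ∈ E → u ∈ (direction E).map π →
      k ≤ polyDim E := by
    intro T hT hTu hTl E hE hy hmem
    have htop : (direction E).map π = ⊤ := by
      by_contra hne; exact hTu E hE hne hmem
    have := le_finrank_of_map_eq_top hK (hTl.le_direction hT hE hy) htop
    rw [hk]; unfold polyDim; exact_mod_cast this
  unfold degree
  refine Finset.sum_nbij f ?_ ?_ ?_ ?_
  · intro P' hP'
    simp only [Finset.mem_filter, mem_cellsOfDim] at hP' ⊢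
    obtain ⟨⟨h1, h2⟩, h3, z, h4, h5⟩ := hP'
    exact ⟨⟨hfS P' h1 h2, hfd P' h1 h2⟩, hfsub P' h1 h2 h3, z, tcone_mono y (hfsub P' h1 h2) h4, h5⟩
  -- Two preimages of `u` in the directions of one cell of `S` differ by `K`, so `z` belongs to the
  -- cones of both `P` and `Q`; then `P ∩ Q` has dimension `k` and equals both.
  · intro P hP Q hQ hPQ
    simp only [Finset.coe_filter, mem_cellsOfDim, Set.mem_ofPred_eq] at hP hQ
    obtain ⟨⟨h1, h2⟩, h3, z, h4, h5⟩ := hP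
    obtain ⟨⟨g1, g2⟩, g3, z', g4, g5⟩ := hQ
    have hR := hfS P h1 h2
    have hyR : y ∈ f P := hfsub P h1 h2 h3
    have hzR : z ∈ direction (f P) := (hS.isPoly hR).mem_direction_of_mem_tcone
      (tcone_mono y (hfsub P h1 h2) h4)
    have hzR' : z' ∈ direction (f P) := (hS.isPoly hR).mem_direction_of_mem_tcone
      (tcone_mono y (by rw [hPQ]; exact hfsub Q g1 g2) g4)
    have htop : (direction (f P)).map π = ⊤ := by
      by_contra hne; exact hu _ hR hne ⟨z, hzR, h5⟩
    have hker := inf_ker_eq_of_map_eq_top hK (hlinS.le_direction hS hR hyR) htop (by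
      have := hfd P h1 h2
      rw [hk] at this; unfold polyDim at this; exact_mod_cast this)
    have hzK : z - z' ∈ K := by
      rw [← hker]
      exact ⟨Submodule.sub_mem _ hzR hzR', by simp [h5, g5]⟩
    have hzQ : z ∈ tcone y Q := by
      have := (hS'.isPoly g1).add_mem_tcone (hlin Q g1 g3 _ hzK) g4
      simpa using this
    have hPQmem : P ∩ Q ∈ S' := hS'.face_mem P h1 _ (hS'.inter_face P h1 Q g1 ⟨y, h3, g3⟩)
    have hzPQ : z ∈ tcone y (P ∩ Q) := by rw [tcone_inter]; exact ⟨h4, hzQ⟩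
    have hd := hkey hS' hu' hlin hPQmem ⟨h3, g3⟩
      ⟨z, (hS'.isPoly hPQmem).mem_direction_of_mem_tcone hzPQ, h5⟩
    rw [← hS'.eq_of_polyDim hPQmem h1 Set.inter_subset_left (by rw [h2]; exact hd),
      ← hS'.eq_of_polyDim (Q := Q) hPQmem g1 Set.inter_subset_right (by rw [g2]; exact hd)]
    simp [Set.inter_assoc]
  -- Surjectivity: follow `z` from `y` for a short time. By genericity the point reached is interior
  -- to `P`, and the smallest cell of `S'` there is a contributing cell inside `P`.
  · intro P hP
    simp only [Finset.coe_filter, mem_cellsOfDim, Set.mem_ofPred_eq] at hP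
    obtain ⟨⟨h1, h2⟩, h3, z, h4, h5⟩ := hP
    obtain ⟨δ, hδP, hδ'⟩ := ((mem_tcone.1 h4).and (hS'.eventually_mem_iff y z |>.and
      (hS.eventually_mem_iff y z))).exists
    obtain ⟨hδ', hδS⟩ := hδ'
    obtain ⟨Q', hQ', hxQ'⟩ := Set.mem_iUnion₂.1 (hcov P h1 hδP)
    set x := y + δ • z
    set E := faceAt x P
    have hE : E ∈ S := hS.faceAt_mem h1 hδP
    have hxE : RelInt x E := (hS.isPoly h1).relInt_faceAt hδP
    have hzE : z ∈ tcone y E := (hδS E hE).1 hxE.1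
    have hEP : E = P := hS.eq_of_polyDim hE h1 (faceAt_subset _ _) (by
      rw [h2]
      exact hkey hS hu hlinS hE ((hS.isPoly hE).mem_of_mem_tcone hzE)
        ⟨z, (hS.isPoly hE).mem_direction_of_mem_tcone hzE, h5⟩)
    set P' := faceAt x Q'
    have hP' : P' ∈ S' := hS'.faceAt_mem hQ' hxQ'
    have hxP' : RelInt x P' := (hS'.isPoly hQ').relInt_faceAt hxQ'
    have hzP' : z ∈ tcone y P' := (hδ' P' hP').1 hxP'.1
    have hyP' := (hS'.isPoly hP').mem_of_mem_tcone hzP'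
    obtain ⟨Q, hQ, hPQ⟩ := hsub P' hP'
    have hP'P : P' ⊆ P := hS.subset_of_relInt_of_subset h1 hQ hxP' hPQ hδP
    have hd : polyDim P' = k := le_antisymm (h2 ▸ polyDim_mono hP'P)
      (hkey hS' hu' hlin hP' hyP' ⟨z, (hS'.isPoly hP').mem_direction_of_mem_tcone hzP', h5⟩)
    refine ⟨P', ?_, ?_⟩
    · simp only [Finset.coe_filter, mem_cellsOfDim, Set.mem_ofPred_eq]
      exact ⟨⟨hP', hd⟩, hyP', z, hzP', h5⟩
    · have h6 : P ⊆ f P' := by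
        have := hS.subset_of_relInt hE (hfS P' hP' hd) hxE (hfsub P' hP' hd hxP'.1)
        rwa [hEP] at this
      exact (hS.eq_of_polyDim h1 (hfS P' hP' hd) h6 (by rw [h2, hfd P' hP' hd])).symm
  · intro P' hP'
    simp only [Finset.mem_filter, mem_cellsOfDim] at hP'
    obtain ⟨⟨h1, h2⟩, -⟩ := hP'
    rw [hw P' h1 (f P') (hfS P' h1 h2) h2 (hfd P' h1 h2) (hfsub P' h1 h2)]
    have : direction P' = direction (f P') :=
      direction_eq_of_polyDim (hfsub P' h1 h2) (by rw [h2, hfd P' h1 h2])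
    simp only [mapIndex, latticeOf, this]

end Degree

/-! ### Primitive generators -/

section PrimitiveGenerator

variable {V : Type*} [AddCommGroup V] [Module ℝ V] {L : Submodule ℤ V} {P G : Set V} {u : V}

lemma mem_latticeOf {x : V} : x ∈ latticeOf L P ↔ x ∈ L ∧ x ∈ direction P := Iff.rfl

lemma IsPrimitiveGenerator.mem_latticeOf (h : IsPrimitiveGenerator L P G u) :
    u ∈ latticeOf L P := by
  rw [h.2.2]
  exact Submodule.mem_sup_right (Submodule.mem_span_singleton_self u)

lemma IsPrimitiveGenerator.exists_eq_add (h : IsPrimitiveGenerator L P G u)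
    (hL : IsFullLattice L) (hP : IsRationalPolyhedron L P) {z : V} (hz : z ∈ direction P) :
    ∃ g ∈ direction G, ∃ t : ℝ, z = g + t • u := by
  have h1 : direction P ≤ direction G ⊔ Submodule.span ℝ {u} := by
    refine (hP.isRationalSubspace hL).trans (Submodule.span_le.2 ?_)
    rintro l ⟨hl, hlP⟩
    have : l ∈ latticeOf L P := ⟨hl, hlP⟩
    rw [h.2.2] at this
    obtain ⟨a, ha, b, hb, rfl⟩ := Submodule.mem_sup.1 this
    obtain ⟨c, rfl⟩ := Submodule.mem_span_singleton.1 hb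
    refine Submodule.add_mem _ (Submodule.mem_sup_left ha.2) (Submodule.mem_sup_right ?_)
    exact Submodule.mem_span_singleton.2 ⟨(c : ℝ), by simp [Int.cast_smul_eq_zsmul]⟩
  obtain ⟨g, hg, b, hb, rfl⟩ := Submodule.mem_sup.1 (h1 hz)
  obtain ⟨t, rfl⟩ := Submodule.mem_span_singleton.1 hb
  exact ⟨g, hg, t, rfl⟩

lemma IsPrimitiveGenerator.notMem_direction (h : IsPrimitiveGenerator L P G u)
    (hL : IsFullLattice L) (hP : IsRationalPolyhedron L P) (hG : IsFace G P) (hne : G ≠ P) :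
    u ∉ direction G := by
  intro hu
  refine hne (hG.eq_of_direction_le hP.isPoly fun z hz => ?_)
  obtain ⟨g, hg, t, rfl⟩ := h.exists_eq_add hL hP hz
  exact Submodule.add_mem _ hg (Submodule.smul_mem _ _ hu)

/-- The cone of `P` at an interior point of `G` is a half space of `direction P`: if `-u` were also
a feasible direction, `u` would lie in the lineality space, which is `direction G`. -/
lemma IsPrimitiveGenerator.add_smul_mem_tcone_iff (h : IsPrimitiveGenerator L P G u)
    (hL : IsFullLattice L) (hP : IsRationalPolyhedron L P) (hG : IsFace G P) (hne : G ≠ P)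
    {x : V} (hx : RelInt x G) {g : V} (hg : g ∈ direction G) (t : ℝ) :
    g + t • u ∈ tcone x P ↔ 0 ≤ t := by
  have hPp := hP.isPoly
  have hu : u ∈ tcone x P := by
    rw [← hx.starCone_eq hG.subset hPp]; exact h.1
  have hsub := tcone_mono x hG.subset
  constructor
  · intro hz
    by_contra ht
    push Not at ht
    refine h.notMem_direction hL hP hG hne ?_
    have h1 : t • u ∈ tcone x P := by
      have := hPp.add_mem_tcone hz (hsub (hx.2 _ (Submodule.neg_mem _ hg)))
      simpa using this
    have h2 : -u ∈ tcone x P := by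
      have := hPp.smul_mem_tcone h1 (t := (-t)⁻¹) (by simpa using ht.le)
      rw [smul_smul] at this
      have h3 : (-t)⁻¹ * t = -1 := by field_simp [ht.ne]
      rwa [h3, neg_one_smul] at this
    rw [hG.eq_faceAt hx, hPp.mem_direction_faceAt (hG.subset hx.1)]
    exact ⟨hu, h2⟩
  · intro ht
    exact hPp.add_mem_tcone (hsub (hx.2 g hg)) (hPp.smul_mem_tcone hu ht)

/-- A functional normalized on `L ∩ direction P` with kernel `direction G` takes the value `1` at a
lattice vector; that vector or its negative, whichever points into `P`, is the generator. -/
lemma exists_primitiveGenerator [FiniteDimensional ℝ V] (hL : IsFullLattice L)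
    (hP : IsRationalPolyhedron L P) (hGr : IsRationalPolyhedron L G) (hG : IsFace G P)
    (hd : polyDim P = polyDim G + 1) : ∃ u, IsPrimitiveGenerator L P G u := by
  have hPp := hP.isPoly
  obtain ⟨φ, hφ, hker, u₀, hu₀, hu₀P, hφu⟩ :=
    (hGr.isRationalSubspace hL).exists_normalized_functional hL (hP.isRationalSubspace hL)
      (direction_mono hG.subset) (by unfold polyDim at hd; exact_mod_cast hd)
  obtain ⟨y, hy⟩ := hGr.isPoly.exists_relInt hGr.1
  have hne : ¬ P ⊆ G := by
    intro h
    rw [hG.subset.antisymm h] at hd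
    omega
  obtain ⟨x, hxP, hxG⟩ := Set.not_subset.1 hne
  have hxy : x - y ∈ tcone y P := hPp.sub_mem_tcone hxP (hG.subset hy.1)
  have hxyG : x - y ∉ direction G := by
    intro hmem
    apply hxG
    rw [hG.eq_faceAt hy]
    refine ⟨hxP, tcone_mono y hG.subset (hy.2 _ ?_)⟩
    rw [← neg_sub]
    exact Submodule.neg_mem _ hmem
  have hxyP := hPp.mem_direction_of_mem_tcone hxy
  have hs : φ (x - y) ≠ 0 := by
    intro h0
    apply hxyG
    rw [← hker]
    exact ⟨hxyP, h0⟩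
  obtain ⟨c, hc, hcs⟩ : ∃ c : ℤ, (c = 1 ∨ c = -1) ∧ 0 < (c : ℝ) / φ (x - y) := by
    rcases hs.lt_or_gt with h | h
    · exact ⟨-1, Or.inr rfl, by push_cast; exact div_pos_of_neg_of_neg (by norm_num) h⟩
    · exact ⟨1, Or.inl rfl, by push_cast; positivity⟩
  have hcc : c * c = 1 := by rcases hc with rfl | rfl <;> norm_num
  have hφu' : φ (c • u₀) = c := by simp [hφu]
  have huP : c • u₀ ∈ direction P := by
    rw [← Int.cast_smul_eq_zsmul ℝ]
    exact Submodule.smul_mem _ _ hu₀P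
  have huL : c • u₀ ∈ L := L.smul_mem _ hu₀
  refine ⟨c • u₀, ?_, huL, ?_⟩
  · rw [hy.starCone_eq hG.subset hPp]
    have h1 : c • u₀ - ((c : ℝ) / φ (x - y)) • (x - y) ∈ direction G := by
      rw [← hker]
      refine ⟨Submodule.sub_mem _ huP (Submodule.smul_mem _ _ hxyP), ?_⟩
      rw [SetLike.mem_coe, LinearMap.mem_ker, map_sub, hφu', map_smul, smul_eq_mul, div_mul_cancel₀ _ hs, sub_self]
    have h2 := hPp.add_mem_tcone (tcone_mono y hG.subset (hy.2 _ h1))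
      (hPp.smul_mem_tcone hxy hcs.le)
    simpa using h2
  · apply le_antisymm
    · rintro l ⟨hl, hlP⟩
      obtain ⟨z, hz⟩ := hφ l hl hlP
      refine Submodule.mem_sup.2 ⟨l - (z * c) • c • u₀, ?_, (z * c) • c • u₀,
        Submodule.smul_mem _ _ (Submodule.mem_span_singleton_self _), by simp⟩
      refine ⟨L.sub_mem hl (L.smul_mem _ huL), ?_⟩
      change l - (z * c) • c • u₀ ∈ direction G
      rw [← hker]
      refine ⟨Submodule.sub_mem _ hlP ?_, ?_⟩
      · rw [← Int.cast_smul_eq_zsmul ℝ]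
        exact Submodule.smul_mem _ _ huP
      · rw [SetLike.mem_coe, LinearMap.mem_ker, map_sub, hz, map_zsmul, hφu']
        have : (c : ℝ) * c = 1 := by exact_mod_cast hcc
        simp [mul_assoc, this]
    · refine sup_le (fun l hl => ⟨hl.1, direction_mono hG.subset hl.2⟩) ?_
      rw [Submodule.span_singleton_le_iff_mem]
      exact ⟨huL, huP⟩

lemma IsPrimitiveGenerator.map_latticeOf {W : Type*} [AddCommGroup W] [Module ℝ W]
    (h : IsPrimitiveGenerator L P G u) (π : V →ₗ[ℝ] W) :
    (latticeOf L P).map (π.restrictScalars ℤ) =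
      (latticeOf L G).map (π.restrictScalars ℤ) ⊔ Submodule.span ℤ {π u} := by
  rw [h.2.2, Submodule.map_sup, Submodule.map_span, Set.image_singleton]
  rfl

end PrimitiveGenerator

/-! ### Balancing expressed by degrees of functionals -/

section BalancingCriterion

/-- The lattice of the integers in the real line. -/
def intLattice : Submodule ℤ ℝ := Submodule.span ℤ {1}

lemma mem_intLattice {x : ℝ} : x ∈ intLattice ↔ ∃ z : ℤ, x = z := by
  rw [intLattice, Submodule.mem_span_singleton]
  constructor
  · rintro ⟨z, rfl⟩; exact ⟨z, by simp⟩
  · rintro ⟨z, rfl⟩; exact ⟨z, by simp⟩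

lemma isFullLattice_intLattice : IsFullLattice intLattice := by
  constructor
  · rw [eq_top_iff]
    intro x _
    have : (1 : ℝ) ∈ Submodule.span ℝ (intLattice : Set ℝ) :=
      Submodule.subset_span (mem_intLattice.2 ⟨1, by simp⟩)
    simpa using Submodule.smul_mem _ x this
  · rw [eq_top_iff]
    intro φ _
    have h : (LinearMap.id : Module.Dual ℝ ℝ) ∈ Submodule.span ℝ
        (dualLattice intLattice : Set (Module.Dual ℝ ℝ)) := by
      apply Submodule.subset_span
      intro x hx
      exact mem_intLattice.1 hx
    have := Submodule.smul_mem _ (φ 1) h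
    convert this using 1
    ext
    simp

/-- This includes `r = 0`, where the infinite index is recorded as `0`. -/
lemma latIndex_span_singleton_intLattice {r : ℝ} (hr : r ∈ intLattice) :
    (latIndex (Submodule.span ℤ {r}) intLattice : ℝ) = |r| := by
  have h := latIndex_sup_span (N := intLattice) (J := ⊥) (φ := LinearMap.id)
    (fun x hx => mem_intLattice.1 hx) ⟨1, mem_intLattice.2 ⟨1, by simp⟩, rfl⟩ bot_le
    (by simp) hr
  have h1 : (⊥ : Submodule ℤ ℝ) = intLattice ⊓
      (LinearMap.ker (LinearMap.id : Module.Dual ℝ ℝ)).restrictScalars ℤ := by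
    ext x; simp
  rw [bot_sup_eq, ← h1] at h
  rw [h]
  simp [latIndex]

variable {V : Type*} [AddCommGroup V] [Module ℝ V] [FiniteDimensional ℝ V] {L : Submodule ℤ V}

/-- A complex is balanced along `G` if the degrees of all integral functionals which are constant
on `G` are locally constant. -/
theorem balanced_of_degree (hL : IsFullLattice L) {S : Finset (Set V)} (hS : IsPolyComplex L S)
    {w : Set V → ℤ} {k : ℤ} {G : Set V} (hG : G ∈ S) (hGd : polyDim G = k - 1) {y : V}
    (hy : RelInt y G)
    (hdeg : ∀ ψ ∈ dualLattice L, (∀ z ∈ direction G, ψ z = 0) →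
      degree (cellsOfDim S k) w L intLattice ψ y 1 =
        degree (cellsOfDim S k) w L intLattice ψ y (-1)) :
    ∃ u : Set V → V, (∀ P ∈ S, polyDim P = k → G ⊆ P → IsPrimitiveGenerator L P G (u P)) ∧
      ∑ P ∈ S with (polyDim P = k ∧ G ⊆ P), w P • u P ∈ direction G := by
  have hex : ∀ P ∈ S, polyDim P = k → G ⊆ P → ∃ u, IsPrimitiveGenerator L P G u :=
    fun P hP hd hGP => exists_primitiveGenerator hL (hS.rational P hP) (hS.rational G hG)
      (hS.isFace_of_subset hG hP hGP) (by omega)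
  choose! u hu using hex
  refine ⟨u, hu, ?_⟩
  -- A balancing sum outside the rational subspace `direction G` would be detected by an integral
  -- functional vanishing on that subspace.
  by_contra hcon
  obtain ⟨ψ, hψ, hψG, hne⟩ := ((hS.rational G hG).isRationalSubspace hL).exists_functional hL hcon
  apply hne
  -- Over `s = ±1` exactly the cells with `ψ (u P)` of the same sign as `s` contribute, each with
  -- index `|ψ (u P)|`. The difference of the two degrees is therefore `ψ` of the balancing sum.
  have key : ∀ s : ℝ, (s = 1 ∨ s = -1) → (degree (cellsOfDim S k) w L intLattice ψ y s : ℝ) =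
      ∑ P ∈ S with (polyDim P = k ∧ G ⊆ P), if 0 < s * ψ (u P) then |ψ (u P)| * w P else 0 := by
    intro s hs
    have h1 : (S.filter fun P => polyDim P = k ∧ G ⊆ P).filter (fun P => 0 < s * ψ (u P)) =
        (cellsOfDim S k).filter (fun P => y ∈ P ∧ s ∈ ψ '' tcone y P) := by
      ext P
      simp only [Finset.mem_filter, mem_cellsOfDim]
      constructor
      · rintro ⟨⟨hP, hd, hGP⟩, hpos⟩
        -- The multiple of `u P` at which `ψ` equals `s`, written with two factors that are visibly
        -- non-negative.
        refine ⟨⟨hP, hd⟩, hGP hy.1, (s * ψ (u P)) • (ψ (u P) ^ 2)⁻¹ • u P, ?_, ?_⟩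
        · apply (hS.isPoly hP).smul_mem_tcone _ hpos.le
          apply (hS.isPoly hP).smul_mem_tcone _ (by positivity)
          rw [← hy.starCone_eq hGP (hS.isPoly hP)]
          exact (hu P hP hd hGP).1
        · have : ψ (u P) ≠ 0 := by
            rintro h0; simp [h0] at hpos
          simp only [map_smul, smul_eq_mul]
          field_simp
      · rintro ⟨⟨hP, hd⟩, hyP, z, hz, hzs⟩
        have hGP := hS.subset_of_relInt hG hP hy hyP
        have hne : G ≠ P := by rintro rfl; omega
        refine ⟨⟨hP, hd, hGP⟩, ?_⟩
        obtain ⟨g, hg, t, rfl⟩ := (hu P hP hd hGP).exists_eq_add hL (hS.rational P hP)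
          ((hS.isPoly hP).mem_direction_of_mem_tcone hz)
        have ht := ((hu P hP hd hGP).add_smul_mem_tcone_iff hL (hS.rational P hP)
          (hS.isFace_of_subset hG hP hGP) hne hy hg t).1 hz
        rw [map_add, hψG g hg, map_smul, smul_eq_mul, zero_add] at hzs
        have hss : s * s = 1 := by rcases hs with rfl | rfl <;> norm_num
        have h2 : t * (s * ψ (u P)) = 1 := by rw [← hss]; nth_rewrite 2 [← hzs]; ring
        by_contra hle
        push Not at hle
        have := mul_nonpos_of_nonneg_of_nonpos ht hle
        linarith
    rw [← Finset.sum_filter, h1]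
    unfold degree
    push_cast
    refine Finset.sum_congr rfl fun P hP => ?_
    rw [← h1] at hP
    simp only [Finset.mem_filter] at hP
    obtain ⟨⟨hP, hd, hGP⟩, -⟩ := hP
    have h2 : ψ (u P) ∈ intLattice := mem_intLattice.2 (hψ _ (hu P hP hd hGP).2.1)
    congr 1
    rw [mapIndex, (hu P hP hd hGP).map_latticeOf ψ]
    have h3 : (latticeOf L G).map (ψ.restrictScalars ℤ) = ⊥ := by
      rw [eq_bot_iff]
      rintro _ ⟨l, hl, rfl⟩
      exact hψG l hl.2
    rw [h3, bot_sup_eq, latIndex_span_singleton_intLattice h2]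
  have h1 := key 1 (Or.inl rfl)
  have h2 := key (-1) (Or.inr rfl)
  rw [hdeg ψ hψ hψG, h2] at h1
  rw [map_sum]
  have h3 := sub_eq_zero.2 h1.symm
  rw [← Finset.sum_sub_distrib] at h3
  rw [← h3]
  refine Finset.sum_congr rfl fun P _ => ?_
  rw [map_zsmul, zsmul_eq_mul]
  rcases lt_trichotomy (ψ (u P)) 0 with h | h | h
  · rw [if_neg (by linarith), if_pos (by linarith), abs_of_neg h]; ring
  · rw [h]; simp
  · rw [if_pos (by linarith), if_neg (by linarith), abs_of_pos h]; ring

end BalancingCriterion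

/-! ### Independence of the degree from the generic point -/

section DegreeInvariance

variable {W U : Type*} [AddCommGroup W] [Module ℝ W] [AddCommGroup U] [Module ℝ U]

lemma RelInt.eventually_smul {P : Set W} (hP : IsPoly P) {y z : W} (hy : y ∈ P) {δ₀ : ℝ}
    (hδ₀ : 0 < δ₀) (h : RelInt (y + δ₀ • z) P) : ∀ᶠ δ : ℝ in 𝓝[>] 0, RelInt (y + δ • z) P := by
  have ht : Tendsto (fun δ : ℝ => δ / δ₀) (𝓝[>] 0) (𝓝[>] 0) := by
    rw [tendsto_nhdsWithin_iff]
    constructor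
    · have : Continuous fun δ : ℝ => δ / δ₀ := by fun_prop
      simpa using (this.tendsto 0).mono_left nhdsWithin_le_nhds
    · filter_upwards [self_mem_nhdsWithin] with δ hδ
      have hδ : 0 < δ := hδ
      exact div_pos hδ hδ₀
  filter_upwards [ht.eventually (h.eventually hP hy)] with δ hδ
  rw [add_sub_cancel_left, smul_smul, div_mul_cancel₀ _ hδ₀.ne'] at hδ
  exact hδ

lemma IsRationalSubspace.map {M : Submodule ℤ W} {N : Submodule ℤ U} {π : W →ₗ[ℝ] U}
    (hπ : ∀ x ∈ M, π x ∈ N) {D : Submodule ℝ W} (hD : IsRationalSubspace M D) :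
    IsRationalSubspace N (D.map π) := by
  refine (Submodule.map_mono hD).trans ?_
  rw [Submodule.map_span]
  refine Submodule.span_mono ?_
  rintro _ ⟨x, ⟨hx, hxD⟩, rfl⟩
  exact ⟨hπ x hx, x, hxD, rfl⟩

/-- Moving from `u` in the direction `e`, one stays inside the image of the cone of `P` at `y`. -/
def Enters (π : W →ₗ[ℝ] U) (y : W) (u e : U) (P : Set W) : Prop :=
  y ∈ P ∧ (direction P).map π = ⊤ ∧ ∃ z ∈ direction P, ∃ h ∈ direction P,
    π z = u ∧ π h = e ∧ h ∈ tcone z (tcone y P)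

variable [FiniteDimensional ℝ W] {M : Submodule ℤ W} {N : Submodule ℤ U} {S : Finset (Set W)}
  {π : W →ₗ[ℝ] U} {y : W} {K : Submodule ℝ W} {k : ℤ} {u e : U}

/-- A single lift `z + ε h` decides whether `u + ε e` lies in the image of the cone: any other lift
in `direction P` differs from it by an element of `K`, which the cone absorbs. -/
lemma eventually_mem_image_iff (hS : IsPolyComplex M S) (hK : K ≤ LinearMap.ker π)
    (hlin : HasLineality S y K) (hk : k = Module.finrank ℝ U + Module.finrank ℝ K)
    {P : Set W} (hP : P ∈ S) (hd : polyDim P = k) (hy : y ∈ P) (htop : (direction P).map π = ⊤)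
    {z h : W} (hz : z ∈ direction P) (hh : h ∈ direction P) (hzu : π z = u) (hhe : π h = e) :
    ∀ᶠ ε : ℝ in 𝓝[>] 0, (u + ε • e ∈ π '' tcone y P ↔ h ∈ tcone z (tcone y P)) := by
  have hker := inf_ker_eq_of_map_eq_top hK (hlin.le_direction hS hP hy) htop (by
      rw [hk] at hd; unfold polyDim at hd; exact_mod_cast hd)
  have hPp := hS.isPoly hP
  filter_upwards [(hPp.isPoly_tcone hy).eventually_mem_iff z h] with ε hε
  rw [← hε]
  constructor
  · rintro ⟨p, hp, hpu⟩
    have : z + ε • h - p ∈ K := by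
      rw [← hker]
      refine ⟨Submodule.sub_mem _ (Submodule.add_mem _ hz (Submodule.smul_mem _ _ hh))
        (hPp.mem_direction_of_mem_tcone hp), ?_⟩
      simp [hpu, hzu, hhe]
    have := hPp.add_mem_tcone (hlin P hP hy _ this) hp
    simpa using this
  · intro h1
    exact ⟨_, h1, by simp [hzu, hhe]⟩

lemma enters_iff (hS : IsPolyComplex M S) (hK : K ≤ LinearMap.ker π)
    (hlin : HasLineality S y K) (hk : k = Module.finrank ℝ U + Module.finrank ℝ K)
    {P : Set W} (hP : P ∈ S) (hd : polyDim P = k) (hy : y ∈ P) (htop : (direction P).map π = ⊤)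
    {z h : W} (hz : z ∈ direction P) (hh : h ∈ direction P) (hzu : π z = u) (hhe : π h = e) :
    Enters π y u e P ↔ h ∈ tcone z (tcone y P) := by
  constructor
  · rintro ⟨-, -, z', hz', h', hh', hzu', hhe', hmem⟩
    obtain ⟨ε, h1, h2⟩ := ((eventually_mem_image_iff hS hK hlin hk hP hd hy htop hz hh hzu hhe).and
      (eventually_mem_image_iff hS hK hlin hk hP hd hy htop hz' hh' hzu' hhe')).exists
    exact h1.1 (h2.2 hmem)
  · exact fun hmem => ⟨hy, htop, z, hz, h, hh, hzu, hhe, hmem⟩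

/-- By `he`, a line through `u` in the direction `e` leaves every proper image containing `u` at
once. So only cells with full image matter for small `ε`, and `Enters` decides about these. -/
lemma eventually_degree_eq (hS : IsPolyComplex M S) (w : Set W → ℤ) (hK : K ≤ LinearMap.ker π)
    (hlin : HasLineality S y K) (hk : k = Module.finrank ℝ U + Module.finrank ℝ K)
    (he : ∀ P ∈ S, y ∈ P → (direction P).map π ≠ ⊤ → u ∈ (direction P).map π →
      e ∉ (direction P).map π) :
    ∀ᶠ ε : ℝ in 𝓝[>] 0, degree (cellsOfDim S k) w M N π y (u + ε • e) =
      ∑ P ∈ cellsOfDim S k, if Enters π y u e P then mapIndex M N π P * w P else 0 := by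
  have h : ∀ᶠ ε : ℝ in 𝓝[>] 0, ∀ P ∈ cellsOfDim S k,
      ((y ∈ P ∧ u + ε • e ∈ π '' tcone y P) ↔ Enters π y u e P) := by
    rw [Filter.eventually_all_finset]
    intro P hP
    obtain ⟨hP, hd⟩ := mem_cellsOfDim.1 hP
    by_cases hy : y ∈ P
    · by_cases htop : (direction P).map π = ⊤
      · obtain ⟨z, hz, hzu⟩ : u ∈ (direction P).map π := htop ▸ trivial
        obtain ⟨h, hh, hhe⟩ : e ∈ (direction P).map π := htop ▸ trivial
        filter_upwards [eventually_mem_image_iff hS hK hlin hk hP hd hy htop hz hh hzu hhe] with ε hε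
        rw [hε, enters_iff hS hK hlin hk hP hd hy htop hz hh hzu hhe]
        simp [hy]
      · have h1 : ∀ᶠ ε : ℝ in 𝓝[>] 0, u + ε • e ∉ (direction P).map π := by
          by_cases heP : e ∈ (direction P).map π
          · refine Eventually.of_forall fun ε hmem => he P hP hy htop ?_ heP
            have := Submodule.sub_mem _ hmem (Submodule.smul_mem _ ε heP)
            simpa using this
          · exact eventually_add_smul_notMem _ _ heP
        filter_upwards [h1] with ε hε
        constructor
        · rintro ⟨-, z, hz, hzu⟩
          exact absurd ⟨z, (hS.isPoly hP).mem_direction_of_mem_tcone hz, hzu⟩ hε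
        · exact fun hE => absurd hE.2.1 htop
    · exact Eventually.of_forall fun ε => ⟨fun h => absurd h.1 hy, fun h => absurd h.1 hy⟩
  filter_upwards [h] with ε hε
  rw [degree, Finset.sum_filter]
  exact Finset.sum_congr rfl fun P hP => by simp only [hε P hP]

lemma polyDim_lt_or_eq_of_mem (hS : IsPolyComplex M S) (hK : K ≤ LinearMap.ker π)
    (hlin : HasLineality S y K) (hk : k = Module.finrank ℝ U + Module.finrank ℝ K)
    {E : Set W} (hE : E ∈ S) (hy : y ∈ E) (htop : (direction E).map π = ⊤) : k ≤ polyDim E := by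
  have := le_finrank_of_map_eq_top hK (hlin.le_direction hS hE hy) htop
  rw [hk]; unfold polyDim; exact_mod_cast this

/-- A lift of a generic `u` to the cone of a contributing cell is interior to that cone, since the
smallest face reached must have full dimension. Hence the cell is entered in every direction `e`. -/
lemma degree_eq_sum_enters (hS : IsPolyComplex M S) (w : Set W → ℤ) (hK : K ≤ LinearMap.ker π)
    (hlin : HasLineality S y K) (hk : k = Module.finrank ℝ U + Module.finrank ℝ K)
    (hu : IsGenericFor S π u) (e : U) :
    degree (cellsOfDim S k) w M N π y u =
      ∑ P ∈ cellsOfDim S k, if Enters π y u e P then mapIndex M N π P * w P else 0 := by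
  rw [degree, Finset.sum_filter]
  refine Finset.sum_congr rfl fun P hP => ?_
  obtain ⟨hP, hd⟩ := mem_cellsOfDim.1 hP
  have hPp := hS.isPoly hP
  congr 1
  apply propext
  constructor
  · rintro ⟨hy, z, hz, hzu⟩
    have htop := hu.map_eq_top hP hPp ⟨z, hz, hzu⟩
    obtain ⟨h, hh, hhe⟩ : e ∈ (direction P).map π := htop ▸ trivial
    refine ⟨hy, htop, z, hPp.mem_direction_of_mem_tcone hz, h, hh, hzu, hhe, ?_⟩
    obtain ⟨δ, h1, h2, h3⟩ := ((mem_tcone.1 hz).and ((hPp.eventually_tcone hz).and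
      (hS.eventually_mem_iff y z))).exists
    set E := faceAt (y + δ • z) P
    have hE : E ∈ S := hS.faceAt_mem hP h1
    have hx : RelInt (y + δ • z) E := hPp.relInt_faceAt h1
    have hzE := (h3 E hE).1 hx.1
    have hEp := hS.isPoly hE
    have := polyDim_lt_or_eq_of_mem hS hK hlin hk hE (hEp.mem_of_mem_tcone hzE)
      (hu.map_eq_top hE hEp ⟨z, hzE, hzu⟩)
    have hEP : E = P := hS.eq_of_polyDim hE hP (faceAt_subset _ _) (by omega)
    rw [hEP] at hx
    rw [← h2]
    exact hx.2 h hh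
  · rintro ⟨hy, -, z, hz, h, hh, hzu, hhe, hmem⟩
    exact ⟨hy, z, (hPp.isPoly_tcone hy).mem_of_mem_tcone hmem, hzu⟩

/-- A cell of codimension one whose cone at `y` has a relative interior point over `u`. -/
def IsWall (k : ℤ) (π : W →ₗ[ℝ] U) (y : W) (u : U) (E : Set W) : Prop :=
  polyDim E = k - 1 ∧ y ∈ E ∧ ∃ z, ∃ δ : ℝ, 0 < δ ∧ π z = u ∧ RelInt (y + δ • z) E

/-- The wall is the smallest face reached by the lift of `u`. It is not `P`, since an interior lift
would allow all directions, and `hcodim` excludes smaller dimensions. -/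
lemma exists_wall (hS : IsPolyComplex M S) (hK : K ≤ LinearMap.ker π)
    (hlin : HasLineality S y K) (hk : k = Module.finrank ℝ U + Module.finrank ℝ K)
    (hcodim : ∀ E ∈ S, y ∈ E → u ∈ (direction E).map π →
      Module.finrank ℝ U ≤ Module.finrank ℝ ((direction E).map π) + 1)
    {P : Set W} (hP : P ∈ S) (hd : polyDim P = k) {e' : U} (h1 : Enters π y u e P)
    (h2 : ¬ Enters π y u e' P) : ∃ E ∈ S, E ⊆ P ∧ IsWall k π y u E := by
  obtain ⟨hy, htop, z, hz, h, hh, hzu, hhe, hmem⟩ := h1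
  have hPp := hS.isPoly hP
  have hzC := (hPp.isPoly_tcone hy).mem_of_mem_tcone hmem
  obtain ⟨δ, ⟨g1, g2, g3⟩, hδ⟩ := (((mem_tcone.1 hzC).and ((hPp.eventually_tcone hzC).and
      (hS.eventually_mem_iff y z))).and self_mem_nhdsWithin).exists
  set E := faceAt (y + δ • z) P
  have hE : E ∈ S := hS.faceAt_mem hP g1
  have hx : RelInt (y + δ • z) E := hPp.relInt_faceAt g1
  have hzE := (g3 E hE).1 hx.1
  have hEp := hS.isPoly hE
  have hyE := hEp.mem_of_mem_tcone hzE
  refine ⟨E, hE, faceAt_subset _ _, ?_, hyE, z, δ, hδ, hzu, hx⟩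
  have h3 := hcodim E hE hyE ⟨z, hEp.mem_direction_of_mem_tcone hzE, hzu⟩
  have h4 := finrank_map_add_le hK (hlin.le_direction hS hE hyE)
  have h5 : k - 1 ≤ polyDim E := by unfold polyDim; omega
  have h6 : polyDim E ≤ k := hd ▸ polyDim_mono (faceAt_subset _ _)
  rcases h6.lt_or_eq with h7 | h7
  · omega
  · exfalso
    have hEP : E = P := hS.eq_of_polyDim hE hP (faceAt_subset _ _) (by omega)
    apply h2
    obtain ⟨h', hh', hhe'⟩ : e' ∈ (direction P).map π := htop ▸ trivial
    refine ⟨hy, htop, z, hz, h', hh', hzu, hhe', ?_⟩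
    rw [hEP] at hx
    rw [← g2]
    exact hx.2 h' hh'

/-- Lifts of `u` to two walls of `P` differ by an element of `K`, so an interior point of one wall
lies in the other; the dimensions agree. -/
lemma wall_unique (hS : IsPolyComplex M S) (hK : K ≤ LinearMap.ker π)
    (hlin : HasLineality S y K) (hk : k = Module.finrank ℝ U + Module.finrank ℝ K)
    {P : Set W} (hP : P ∈ S) (hd : polyDim P = k) (htop : (direction P).map π = ⊤)
    {E E' : Set W} (hE : E ∈ S) (hE' : E' ∈ S) (hEP : E ⊆ P) (hEP' : E' ⊆ P)
    (h : IsWall k π y u E) (h' : IsWall k π y u E') : E = E' := by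
  obtain ⟨hdE, hyE, z, δ, hδ, hzu, hx⟩ := h
  obtain ⟨hdE', hyE', z', δ', hδ', hzu', hx'⟩ := h'
  have hker := inf_ker_eq_of_map_eq_top hK (hlin.le_direction hS hP (hEP hyE)) htop (by
      rw [hk] at hd; unfold polyDim at hd; exact_mod_cast hd)
  have hz : z ∈ tcone y E := by
    filter_upwards [hx.eventually_smul (hS.isPoly hE) hyE hδ] with ε hε using hε.1
  have hz' : z' ∈ tcone y E' := by
    filter_upwards [hx'.eventually_smul (hS.isPoly hE') hyE' hδ'] with ε hε using hε.1
  have hzK : z' - z ∈ K := by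
    rw [← hker]
    refine ⟨Submodule.sub_mem _ ?_ ?_, by simp [hzu, hzu']⟩
    · exact direction_mono hEP' ((hS.isPoly hE').mem_direction_of_mem_tcone hz')
    · exact direction_mono hEP ((hS.isPoly hE).mem_direction_of_mem_tcone hz)
  have hz'E : z' ∈ tcone y E := by
    have := (hS.isPoly hE).add_mem_tcone (hlin E hE hyE _ hzK) hz
    simpa using this
  obtain ⟨ε, h1, h2⟩ := ((mem_tcone.1 hz'E).and
    (hx'.eventually_smul (hS.isPoly hE') hyE' hδ')).exists
  exact (hS.eq_of_polyDim hE' hE (hS.subset_of_relInt hE' hE h2 h1) (by omega)).symm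

variable [FiniteDimensional ℝ U]

/-- The change of the degree at a wall is zero, by the balancing condition. -/
lemma sum_wall_eq_zero (hM : IsFullLattice M) (hN : IsFullLattice N) (X : TropicalComplex M)
    (hπ : ∀ x ∈ M, π x ∈ N) (hK : K ≤ LinearMap.ker π)
    (hlin : HasLineality X.cells y K) (hk : X.dim = Module.finrank ℝ U + Module.finrank ℝ K)
    (hcodim : ∀ E ∈ X.cells, y ∈ E → u ∈ (direction E).map π →
      Module.finrank ℝ U ≤ Module.finrank ℝ ((direction E).map π) + 1)
    (he : ∀ P ∈ X.cells, y ∈ P → (direction P).map π ≠ ⊤ → u ∈ (direction P).map π →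
      e ∉ (direction P).map π)
    {E : Set W} (hE : E ∈ X.cells) (hwall : IsWall X.dim π y u E) :
    ∑ P ∈ cellsOfDim X.cells X.dim with E ⊆ P,
      ((if Enters π y u e P then mapIndex M N π P * X.weight P else 0) -
        (if Enters π y u (-e) P then mapIndex M N π P * X.weight P else 0)) = 0 := by
  have hS := X.isPolyComplex
  obtain ⟨hdE, hyE, z, δ, hδ, hzu, hx⟩ := hwall
  have hEp := hS.isPoly hE
  have hrel := hx.eventually_smul hEp hyE hδ
  have hzE : z ∈ tcone y E := by
    filter_upwards [hrel] with ε hε using hε.1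
  have hzEd := hEp.mem_direction_of_mem_tcone hzE
  obtain ⟨H, hHdef⟩ : ∃ H, H = (direction E).map π := ⟨_, rfl⟩
  have huH : u ∈ H := hHdef ▸ ⟨z, hzEd, hzu⟩
  have h3 := hcodim E hE hyE (hHdef ▸ huH)
  have h4 := finrank_map_add_le hK (hlin.le_direction hS hE hyE)
  rw [← hHdef] at h3 h4
  have hHd : Module.finrank ℝ (⊤ : Submodule ℝ U) = Module.finrank ℝ H + 1 := by
    rw [finrank_top]; unfold polyDim at hdE; omega
  have hHtop : H ≠ ⊤ := by
    intro h; rw [h] at hHd; omega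
  have heH : e ∉ H := by
    rw [hHdef] at hHtop huH ⊢
    exact he E hE hyE hHtop huH
  -- The image `H` of the wall is a rational hyperplane; the sign of the normalized functional `φ`
  -- with kernel `H` tells the two sides apart.
  obtain ⟨φ, hφ, hker, n, hn, -, hφn⟩ :=
    (((X.rational E hE).isRationalSubspace hM).map hπ).exists_normalized_functional hN
      hN.isRationalSubspace_top le_top (hHdef ▸ hHd)
  rw [top_inf_eq, ← hHdef] at hker
  have hφN : φ ∈ dualLattice N := fun x hx => hφ x hx trivial
  obtain ⟨v, hv, hbal⟩ := X.balanced E hE hdE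
  have hφH : ∀ x ∈ direction E, φ (π x) = 0 := fun x hx => by
    have : π x ∈ LinearMap.ker φ := by rw [hker, hHdef]; exact ⟨x, hx, rfl⟩
    exact this
  set κ : ℤ := latIndex ((latticeOf M E).map (π.restrictScalars ℤ))
    (N ⊓ (LinearMap.ker φ).restrictScalars ℤ) with hκ
  -- The factor `κ` depends only on the wall, so the indices of the adjacent cells vary only through
  -- their generators.
  have hidx : ∀ P ∈ X.cells, polyDim P = X.dim → E ⊆ P →
      (mapIndex M N π P : ℝ) = κ * |φ (π (v P))| := by
    intro P hP hd hEP
    rw [mapIndex, (hv P hP hd hEP).map_latticeOf π]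
    apply latIndex_sup_span hφN ⟨n, hn, hφn⟩
    · rintro _ ⟨l, hl, rfl⟩; exact hπ l hl.1
    · rintro _ ⟨l, hl, rfl⟩; exact hφH l hl.2
    · exact hπ _ (hv P hP hd hEP).2.1
  -- A cell adjacent to the wall is entered exactly when its generator is mapped to the side of `H`
  -- to which `e'` points. A generator mapped into `H` belongs to a cell without full image.
  have hent : ∀ e' : U, e' ∉ H → ∀ P ∈ X.cells, polyDim P = X.dim → E ⊆ P →
      (Enters π y u e' P ↔ 0 < φ e' * φ (π (v P))) := by
    intro e' he' P hP hd hEP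
    have hPr := X.rational P hP
    have hEF := hS.isFace_of_subset hE hP hEP
    have hne : E ≠ P := by rintro rfl; omega
    have hφe' : φ e' ≠ 0 := fun h0 => he' (hker ▸ h0)
    have hvP := (hv P hP hd hEP).mem_latticeOf.2
    by_cases h0 : φ (π (v P)) = 0
    · rw [h0, mul_zero]
      simp only [lt_irrefl, iff_false]
      rintro ⟨-, htop, -⟩
      apply hHtop
      rw [eq_top_iff, ← htop]
      rintro _ ⟨x, hx, rfl⟩
      obtain ⟨g, hg, t, rfl⟩ := (hv P hP hd hEP).exists_eq_add hM hPr hx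
      rw [← hker, LinearMap.mem_ker]
      simp [hφH g hg, h0]
    · have htop : (direction P).map π = ⊤ := by
        have hlt : H < (direction P).map π := by
          refine lt_of_le_of_ne (hHdef ▸ Submodule.map_mono (direction_mono hEP)) fun h => ?_
          have : π (v P) ∈ H := h ▸ ⟨v P, hvP, rfl⟩
          rw [← hker] at this
          exact h0 this
        apply Submodule.eq_top_of_finrank_eq
        have h5 := Submodule.finrank_lt_finrank_of_lt hlt
        have h6 := Submodule.finrank_le ((direction P).map π)
        rw [finrank_top] at hHd
        omega
      set c := φ e' / φ (π (v P)) with hc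
      have hg : e' - c • π (v P) ∈ H := by
        rw [← hker, LinearMap.mem_ker, map_sub, map_smul, smul_eq_mul, hc, div_mul_cancel₀ _ h0,
          sub_self]
      rw [hHdef] at hg
      obtain ⟨g, hg, hge⟩ := hg
      have hgP := direction_mono hEP hg
      rw [enters_iff hS hK hlin hk hP hd (hEP hyE) htop (direction_mono hEP hzEd)
        (Submodule.add_mem _ hgP (Submodule.smul_mem _ c hvP)) hzu (by simp [hge])]
      obtain ⟨δ', h7, h8⟩ := (hrel.and
        ((hS.isPoly hP).eventually_tcone (tcone_mono y hEP hzE))).exists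
      rw [← h8, (hv P hP hd hEP).add_smul_mem_tcone_iff hM hPr hEF hne h7 hg]
      have h9 : φ e' * φ (π (v P)) = c * φ (π (v P)) ^ 2 := by
        rw [hc]; field_simp
      have hc0 : c ≠ 0 := div_ne_zero hφe' h0
      rw [h9, mul_pos_iff_of_pos_right (by positivity)]
      exact ⟨fun h => h.lt_of_ne' hc0, le_of_lt⟩
  -- The jump at the wall is `κ · sign (φ e)` times the value of `φ ∘ π` at the balancing sum, which
  -- lies in `direction E`, where `φ ∘ π` vanishes.
  have hcast : ((∑ P ∈ cellsOfDim X.cells X.dim with E ⊆ P,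
      ((if Enters π y u e P then mapIndex M N π P * X.weight P else 0) -
        (if Enters π y u (-e) P then mapIndex M N π P * X.weight P else 0)) : ℤ) : ℝ) =
      ∑ P ∈ cellsOfDim X.cells X.dim with E ⊆ P,
        (κ * SignType.sign (φ e)) * φ (π (X.weight P • v P)) := by
    push_cast
    refine Finset.sum_congr rfl fun P hP => ?_
    simp only [Finset.mem_filter, mem_cellsOfDim] at hP
    obtain ⟨⟨hP, hd⟩, hEP⟩ := hP
    have hneg : -e ∉ H := fun h => heH (by simpa using Submodule.neg_mem _ h)
    rw [hent e heH P hP hd hEP, hent (-e) hneg P hP hd hEP, hidx P hP hd hEP]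
    have hφe : φ e ≠ 0 := fun h0 => heH (hker ▸ h0)
    rw [map_zsmul, map_zsmul, zsmul_eq_mul, map_neg]
    rcases hφe.lt_or_gt with h1 | h1 <;> rcases lt_trichotomy (φ (π (v P))) 0 with h2 | h2 | h2
    · rw [if_pos (mul_pos_of_neg_of_neg h1 h2), if_neg (by nlinarith), sign_neg h1, abs_of_neg h2]
      simp; ring
    · simp [h2]
    · rw [if_neg (by nlinarith), if_pos (by nlinarith), sign_neg h1, abs_of_pos h2]
      simp; ring
    · rw [if_neg (by nlinarith), if_pos (by nlinarith), sign_pos h1, abs_of_neg h2]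
      simp; ring
    · simp [h2]
    · rw [if_pos (by positivity), if_neg (by nlinarith), sign_pos h1, abs_of_pos h2]
      simp; ring
  have hfin : (X.cells.filter fun P => polyDim P = X.dim ∧ E ⊆ P) =
      (cellsOfDim X.cells X.dim).filter (fun P => E ⊆ P) := by
    ext P; simp [mem_cellsOfDim, and_assoc]
  rw [hfin] at hbal
  have hzero := hφH _ hbal
  rw [← Int.cast_eq_zero (α := ℝ), hcast, ← Finset.mul_sum, ← map_sum, ← map_sum, hzero, mul_zero]

/-- A cell whose contribution changes between `e` and `-e` contains exactly one wall. Grouping the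
changes by walls leaves the local cancellation `sum_wall_eq_zero`. -/
lemma sum_enters_eq (hM : IsFullLattice M) (hN : IsFullLattice N) (X : TropicalComplex M)
    (hπ : ∀ x ∈ M, π x ∈ N) (hK : K ≤ LinearMap.ker π)
    (hlin : HasLineality X.cells y K) (hk : X.dim = Module.finrank ℝ U + Module.finrank ℝ K)
    (hcodim : ∀ E ∈ X.cells, y ∈ E → u ∈ (direction E).map π →
      Module.finrank ℝ U ≤ Module.finrank ℝ ((direction E).map π) + 1)
    (he : ∀ P ∈ X.cells, y ∈ P → (direction P).map π ≠ ⊤ → u ∈ (direction P).map π →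
      e ∉ (direction P).map π) :
    (∑ P ∈ cellsOfDim X.cells X.dim,
      if Enters π y u e P then mapIndex M N π P * X.weight P else 0) =
    ∑ P ∈ cellsOfDim X.cells X.dim,
      if Enters π y u (-e) P then mapIndex M N π P * X.weight P else 0 := by
  have hS := X.isPolyComplex
  rw [← sub_eq_zero, ← Finset.sum_sub_distrib]
  set f : Set W → ℤ := fun P => (if Enters π y u e P then mapIndex M N π P * X.weight P else 0) -
        (if Enters π y u (-e) P then mapIndex M N π P * X.weight P else 0) with hf
  have h1 : ∀ P ∈ cellsOfDim X.cells X.dim, f P =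
      ∑ E ∈ X.cells with IsWall X.dim π y u E, if E ⊆ P then f P else 0 := by
    intro P hP
    obtain ⟨hP, hd⟩ := mem_cellsOfDim.1 hP
    by_cases hfP : f P = 0
    · simp [hfP]
    · have hex : (direction P).map π = ⊤ ∧ ∃ E ∈ X.cells, E ⊆ P ∧
          IsWall X.dim π y u E := by
        by_cases ha : Enters π y u e P <;> by_cases hb : Enters π y u (-e) P
        · simp [hf, ha, hb] at hfP
        · exact ⟨ha.2.1, exists_wall hS hK hlin hk hcodim hP hd ha hb⟩
        · exact ⟨hb.2.1, exists_wall hS hK hlin hk hcodim hP hd hb ha⟩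
        · simp [hf, ha, hb] at hfP
      obtain ⟨htop, E, hE, hEP, hw⟩ := hex
      rw [Finset.sum_eq_single E]
      · simp [hEP]
      · intro E' hE' hne
        obtain ⟨hE', hw'⟩ := Finset.mem_filter.1 hE'
        rw [if_neg]
        intro hEP'
        exact hne (wall_unique hS hK hlin hk hP hd htop hE' hE hEP' hEP hw' hw)
      · intro hcon
        exact absurd (Finset.mem_filter.2 ⟨hE, hw⟩) hcon
  rw [Finset.sum_congr rfl h1, Finset.sum_comm]
  refine Finset.sum_eq_zero fun E hE => ?_
  obtain ⟨hE, hw⟩ := Finset.mem_filter.1 hE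
  rw [← Finset.sum_filter]
  exact sum_wall_eq_zero hM hN X hπ hK hlin hk hcodim he hE hw

/-- The value of `f` near `t`, disregarding `f t` itself, is a locally constant function of `t` and
therefore constant. Thus the degree need not be controlled at the parameters where the path is not
generic. -/
lemma eq_of_locally_constant_punctured (f : ℝ → ℤ)
    (hf : ∀ t, ∃ c, ∀ᶠ ε : ℝ in 𝓝[>] 0, f (t + ε) = c ∧ f (t - ε) = c) (a b : ℝ)
    (ha : ∀ᶠ ε : ℝ in 𝓝[>] 0, f (a + ε) = f a) (hb : ∀ᶠ ε : ℝ in 𝓝[>] 0, f (b + ε) = f b) :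
    f a = f b := by
  choose g hg using hf
  have hloc : IsLocallyConstant g := by
    rw [IsLocallyConstant.iff_eventually_eq]
    intro t
    obtain ⟨r, hr, hr'⟩ := mem_nhdsGT_iff_exists_Ioo_subset.1 (hg t)
    have hr : 0 < r := hr
    have hball : ∀ s, |s| < r → s ≠ 0 → f (t + s) = g t := by
      intro s hs hs0
      rcases hs0.lt_or_gt with h | h
      · have := (hr' ⟨neg_pos.2 h, by rwa [← abs_of_neg h]⟩).2
        simpa using this
      · exact (hr' ⟨h, by rwa [← abs_of_pos h]⟩).1
    filter_upwards [Metric.ball_mem_nhds t hr] with s hs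
    rw [Metric.mem_ball, Real.dist_eq] at hs
    have h1 : ∀ᶠ ε : ℝ in 𝓝[>] 0, |s - t + ε| < r := by
      have hc : Continuous fun ε : ℝ => |s - t + ε| := by fun_prop
      have := hc.tendsto 0
      rw [add_zero] at this
      exact (this.mono_left nhdsWithin_le_nhds).eventually_lt_const hs
    obtain ⟨ε, h2, h3, h4⟩ := (h1.and ((hg s).and (eventually_ne_zero_right (t - s)))).exists
    have h5 := hball (s - t + ε) h2 (by intro h; apply h4; linarith)
    rw [← h3.1, ← h5]
    congr 1
    ring
  have h1 : ∀ t, (∀ᶠ ε : ℝ in 𝓝[>] 0, f (t + ε) = f t) → f t = g t := by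
    intro t ht
    obtain ⟨ε, h2, h3⟩ := (ht.and (hg t)).exists
    rw [← h2, h3.1]
  rw [h1 a ha, h1 b hb]
  exact hloc.apply_eq_of_preconnectedSpace a b

/-- The degree does not depend on the generic vector. -/
theorem degree_eq_of_generic (hM : IsFullLattice M) (hN : IsFullLattice N) (X : TropicalComplex M)
    (hπ : ∀ x ∈ M, π x ∈ N) (hK : K ≤ LinearMap.ker π)
    (hlin : HasLineality X.cells y K) (hk : X.dim = Module.finrank ℝ U + Module.finrank ℝ K)
    {u u' : U} (hu : IsGenericFor X.cells π u) (hu' : IsGenericFor X.cells π u') :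
    degree (cellsOfDim X.cells X.dim) X.weight M N π y u =
      degree (cellsOfDim X.cells X.dim) X.weight M N π y u' := by
  have hS := X.isPolyComplex
  -- The extra condition on `u'` keeps the line through `u` and `u'` away from all images of
  -- codimension at least two, so that it only crosses walls.
  have key : ∀ u u' : U, IsGenericFor X.cells π u → IsGenericFor X.cells π u' →
      (∀ E ∈ X.cells, Module.finrank ℝ ((direction E).map π) + 1 < Module.finrank ℝ U →
        u' ∉ (direction E).map π ⊔ Submodule.span ℝ {u}) →
      degree (cellsOfDim X.cells X.dim) X.weight M N π y u =
        degree (cellsOfDim X.cells X.dim) X.weight M N π y u' := by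
    intro u u' hu hu' huu'
    set e := u' - u with he
    set f : ℝ → ℤ := fun t => degree (cellsOfDim X.cells X.dim) X.weight M N π y (u + t • e)
    have hf0 : f 0 = degree (cellsOfDim X.cells X.dim) X.weight M N π y u := by simp [f]
    have hf1 : f 1 = degree (cellsOfDim X.cells X.dim) X.weight M N π y u' := by simp [f, he]
    have hcodim : ∀ t : ℝ, ∀ E ∈ X.cells, y ∈ E → u + t • e ∈ (direction E).map π →
        Module.finrank ℝ U ≤ Module.finrank ℝ ((direction E).map π) + 1 := by
      intro t E hE _ hmem
      by_contra hlt
      push Not at hlt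
      have hne : (direction E).map π ≠ ⊤ := by
        intro h; rw [h, finrank_top] at hlt; omega
      by_cases ht : t = 0
      · rw [ht, zero_smul, add_zero] at hmem
        exact hu E hE hne hmem
      · apply huu' E hE hlt
        have h1 : u' = t⁻¹ • (u + t • e) + (1 - t⁻¹) • u := by
          rw [he, smul_add, smul_smul, inv_mul_cancel₀ ht, sub_smul, one_smul, one_smul]
          abel
        rw [h1]
        exact Submodule.add_mem _ (Submodule.mem_sup_left (Submodule.smul_mem _ _ hmem))
          (Submodule.mem_sup_right (Submodule.smul_mem _ _ (Submodule.mem_span_singleton_self u)))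
    have hedir : ∀ t : ℝ, ∀ P ∈ X.cells, y ∈ P → (direction P).map π ≠ ⊤ →
        u + t • e ∈ (direction P).map π → e ∉ (direction P).map π := by
      intro t P hP _ hne hmem heP
      apply hu P hP hne
      have := Submodule.sub_mem _ hmem (Submodule.smul_mem _ t heP)
      simpa using this
    have hgen : ∀ t : ℝ, IsGenericFor X.cells π (u + t • e) →
        ∀ᶠ ε : ℝ in 𝓝[>] 0, f (t + ε) = f t := by
      intro t ht
      filter_upwards [eventually_degree_eq (N := N) hS X.weight hK hlin hk (hedir t)] with ε hε
      simp only [f]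
      rw [degree_eq_sum_enters hS X.weight hK hlin hk ht e, ← hε, add_smul, add_assoc]
    rw [← hf0, ← hf1]
    refine eq_of_locally_constant_punctured f (fun t => ?_) 0 1 (hgen 0 (by simpa using hu))
      (hgen 1 (by simpa [he] using hu'))
    have hedir' : ∀ P ∈ X.cells, y ∈ P → (direction P).map π ≠ ⊤ →
        u + t • e ∈ (direction P).map π → -e ∉ (direction P).map π := by
      intro P hP hy hne hmem heP
      exact hedir t P hP hy hne hmem (by simpa using Submodule.neg_mem _ heP)
    refine ⟨∑ P ∈ cellsOfDim X.cells X.dim,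
      if Enters π y (u + t • e) e P then mapIndex M N π P * X.weight P else 0, ?_⟩
    filter_upwards [eventually_degree_eq (N := N) hS X.weight hK hlin hk (hedir t),
      eventually_degree_eq (N := N) hS X.weight hK hlin hk hedir'] with ε h1 h2
    have h3 := sum_enters_eq hM hN X hπ hK hlin hk (hcodim t) (hedir t)
    refine ⟨?_, ?_⟩
    · simp only [f]
      rw [add_smul, ← add_assoc]
      exact h1
    · simp only [f]
      rw [h3, ← h2, sub_smul, smul_neg, sub_eq_add_neg, add_assoc]
  -- Two arbitrary generic points need not satisfy the extra condition; they are joined through a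
  -- point `v` that satisfies it with respect to both.
  obtain ⟨v, hv⟩ := exists_forall_notMem
    (X.cells.image (fun E => (direction E).map π) ∪
      (X.cells.image (fun E => (direction E).map π ⊔ Submodule.span ℝ {u}) ∪
        X.cells.image (fun E => (direction E).map π ⊔ Submodule.span ℝ {u'})))
  have hvgen : IsGenericFor X.cells π v := fun P hP hne =>
    hv _ (Finset.mem_union_left _ (Finset.mem_image_of_mem _ hP)) hne
  have hlt : ∀ (w : U) (E : Set W), Module.finrank ℝ ((direction E).map π) + 1 <
      Module.finrank ℝ U → (direction E).map π ⊔ Submodule.span ℝ {w} ≠ ⊤ := by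
    intro w E h htop
    have h1 := Submodule.finrank_add_le_finrank_add_finrank ((direction E).map π)
      (Submodule.span ℝ {w})
    rw [htop, finrank_top] at h1
    have h2 := finrank_span_le_card (R := ℝ) ({w} : Set U)
    simp at h2
    omega
  rw [key u v hu hvgen (fun E hE h => hv _ (Finset.mem_union_right _ (Finset.mem_union_left _
      (Finset.mem_image_of_mem _ hE))) (hlt u E h)),
    key u' v hu' hvgen (fun E hE h => hv _ (Finset.mem_union_right _ (Finset.mem_union_right _
      (Finset.mem_image_of_mem _ hE))) (hlt u' E h))]

end DegreeInvariance

/-! ### The degree of a product map as an iterated degree -/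

section IteratedDegree

variable {W U₁ U₂ : Type*} [AddCommGroup W] [Module ℝ W] [AddCommGroup U₁] [Module ℝ U₁]
  [AddCommGroup U₂] [Module ℝ U₂]

/-- The slices of dimension `k` of the cells with the kernel of `π`. -/
def kerSlices (S : Finset (Set W)) (π : W →ₗ[ℝ] U₁) (k : ℤ) : Finset (Set W) :=
  (S.image fun P => P ∩ (LinearMap.ker π : Set W)).filter fun E => E.Nonempty ∧ polyDim E = k

/-- A vector which is not in the images of the slices with small image. -/
def IsGenericOnSlices (S : Finset (Set W)) (π₁ : W →ₗ[ℝ] U₁) (π₂ : W →ₗ[ℝ] U₂) (v : U₂) : Prop :=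
  ∀ P ∈ S, (direction P ⊓ LinearMap.ker π₁).map π₂ ≠ ⊤ →
    v ∉ (direction P ⊓ LinearMap.ker π₁).map π₂

lemma map_prod_eq_top_iff {D : Submodule ℝ W} {π₁ : W →ₗ[ℝ] U₁} {π₂ : W →ₗ[ℝ] U₂} :
    D.map (π₁.prod π₂) = ⊤ ↔ D.map π₁ = ⊤ ∧ (D ⊓ LinearMap.ker π₁).map π₂ = ⊤ := by
  constructor
  · intro h
    constructor
    · rw [eq_top_iff]
      intro a _
      obtain ⟨x, hx, hxa⟩ : (a, (0 : U₂)) ∈ D.map (π₁.prod π₂) := h ▸ trivial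
      exact ⟨x, hx, congrArg Prod.fst hxa⟩
    · rw [eq_top_iff]
      intro b _
      obtain ⟨x, hx, hxb⟩ : ((0 : U₁), b) ∈ D.map (π₁.prod π₂) := h ▸ trivial
      exact ⟨x, ⟨hx, congrArg Prod.fst hxb⟩, congrArg Prod.snd hxb⟩
  · rintro ⟨h1, h2⟩
    rw [eq_top_iff]
    rintro ⟨a, b⟩ _
    obtain ⟨x, hx, hxa⟩ : a ∈ D.map π₁ := h1 ▸ trivial
    obtain ⟨x', ⟨hx', hker⟩, hxb⟩ : b - π₂ x ∈ (D ⊓ LinearMap.ker π₁).map π₂ := h2 ▸ trivial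
    refine ⟨x + x', D.add_mem hx hx', ?_⟩
    have hker : π₁ x' = 0 := hker
    simp [hxa, hker, hxb]

variable {M : Submodule ℤ W} {N₁ : Submodule ℤ U₁} {N₂ : Submodule ℤ U₂} {S : Finset (Set W)}
  {π₁ : W →ₗ[ℝ] U₁} {π₂ : W →ₗ[ℝ] U₂} {y : W} {K : Submodule ℝ W} {k : ℤ} {v₁ : U₁} {v₂ : U₂}

/-- This is the transversality needed to displace the point `(0, v₂)`, which need not be generic, in
the direction `(v₁, 0)`. -/
lemma notMem_map_prod (h₁ : IsGenericFor S π₁ v₁) (h₂ : IsGenericOnSlices S π₁ π₂ v₂)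
    {P : Set W} (hP : P ∈ S) (hne : (direction P).map (π₁.prod π₂) ≠ ⊤)
    (h0 : ((0 : U₁), v₂) ∈ (direction P).map (π₁.prod π₂)) :
    (v₁, (0 : U₂)) ∉ (direction P).map (π₁.prod π₂) := by
  rintro ⟨x, hx, hxv⟩
  rw [Ne, map_prod_eq_top_iff, not_and_or] at hne
  rcases hne with hne | hne
  · exact h₁ P hP hne ⟨x, hx, congrArg Prod.fst hxv⟩
  · obtain ⟨z, hz, hzv⟩ := h0
    exact h₂ P hP hne ⟨z, ⟨hz, congrArg Prod.fst hzv⟩, congrArg Prod.snd hzv⟩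

lemma eventually_isGenericFor_prod (h₁ : IsGenericFor S π₁ v₁)
    (h₂ : IsGenericOnSlices S π₁ π₂ v₂) :
    ∀ᶠ ε : ℝ in 𝓝[>] 0, IsGenericFor S (π₁.prod π₂) (ε • v₁, v₂) := by
  unfold IsGenericFor
  rw [Filter.eventually_all_finset]
  intro P hP
  by_cases htop : (direction P).map (π₁.prod π₂) = ⊤
  · exact Eventually.of_forall fun ε h => absurd htop h
  · have h3 : ∀ᶠ ε : ℝ in 𝓝[>] 0, ((0 : U₁), v₂) + ε • (v₁, (0 : U₂)) ∉
        (direction P).map (π₁.prod π₂) := by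
      by_cases hv : (v₁, (0 : U₂)) ∈ (direction P).map (π₁.prod π₂)
      · refine Eventually.of_forall fun ε hmem => ?_
        refine notMem_map_prod h₁ h₂ hP htop ?_ hv
        have := Submodule.sub_mem _ hmem (Submodule.smul_mem _ ε hv)
        simpa using this
      · exact eventually_add_smul_notMem _ _ hv
    filter_upwards [h3] with ε hε _
    simpa using hε

variable [FiniteDimensional ℝ W]

lemma direction_slice_eq {P : Set W} (htop : (direction P).map π₁ = ⊤) (hd : polyDim P = k)
    (hQ : polyDim (P ∩ LinearMap.ker π₁) = k - Module.finrank ℝ U₁) :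
    direction (P ∩ LinearMap.ker π₁) = direction P ⊓ LinearMap.ker π₁ := by
  apply Submodule.eq_of_le_of_finrank_le
  · refine le_inf (direction_mono Set.inter_subset_left) ?_
    rw [← direction_submodule (LinearMap.ker π₁)]
    exact direction_mono (Set.inter_subset_right.trans (by rw [direction_submodule]))
  · have := finrank_map_add_finrank_inf_ker (direction P) π₁
    rw [htop, finrank_top] at this
    unfold polyDim at hd hQ
    omega


lemma polyDim_slice_le {P : Set W} (htop : (direction P).map π₁ = ⊤) (hd : polyDim P = k) :
    polyDim (P ∩ LinearMap.ker π₁) ≤ k - Module.finrank ℝ U₁ := by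
  have h1 : direction (P ∩ (LinearMap.ker π₁ : Set W)) ≤ direction P ⊓ LinearMap.ker π₁ := by
    refine le_inf (direction_mono Set.inter_subset_left) ?_
    exact (direction_mono Set.inter_subset_right).trans (direction_submodule _).le
  have h2 := Submodule.finrank_mono h1
  have := finrank_map_add_finrank_inf_ker (direction P) π₁
  rw [htop, finrank_top] at this
  unfold polyDim at hd ⊢
  omega

variable [FiniteDimensional ℝ U₁]

/-- At a point reached along `z`, genericity of `v₂` forces the slice of the smallest cell to have
dimension at least `dim U₂ + dim K`. This is the largest dimension allowed by `hd`, so that slice is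
the slice of `P` and the point is interior to it. -/
lemma relInt_slice (hS : IsPolyComplex M S) (h₂ : IsGenericOnSlices S π₁ π₂ v₂)
    (hK : K ≤ LinearMap.ker π₁) (hK₂ : K ≤ LinearMap.ker π₂) (hlin : HasLineality S y K)
    {P : Set W} (hP : P ∈ S) (hy : π₁ y = 0)
    (hd : polyDim (P ∩ LinearMap.ker π₁) ≤ Module.finrank ℝ U₂ + Module.finrank ℝ K)
    {z : W} (hz : z ∈ tcone y P) (hz₁ : π₁ z = 0) (hz₂ : π₂ z = v₂) :
    polyDim (P ∩ LinearMap.ker π₁) = Module.finrank ℝ U₂ + Module.finrank ℝ K ∧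
      ∀ᶠ δ : ℝ in 𝓝[>] 0, RelInt (y + δ • z) (P ∩ LinearMap.ker π₁) := by
  have hPp := hS.isPoly hP
  have hkerp := isPoly_ker π₁
  have key : ∀ δ : ℝ, y + δ • z ∈ P → (∀ P ∈ S, (y + δ • z ∈ P ↔ z ∈ tcone y P)) →
      polyDim (P ∩ LinearMap.ker π₁) = Module.finrank ℝ U₂ + Module.finrank ℝ K ∧
        RelInt (y + δ • z) (P ∩ LinearMap.ker π₁) := by
    intro δ hx hiff
    have hxk : y + δ • z ∈ LinearMap.ker π₁ := by simp [hy, hz₁]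
    set E := faceAt (y + δ • z) P
    have hE : E ∈ S := hS.faceAt_mem hP hx
    have hxE : RelInt (y + δ • z) E := hPp.relInt_faceAt hx
    have hEp := hS.isPoly hE
    have hzE := (hiff E hE).1 hxE.1
    have hyE := hEp.mem_of_mem_tcone hzE
    have hxker := relInt_submodule _ hxk
    have hface : faceAt (y + δ • z) (P ∩ LinearMap.ker π₁) = E ∩ LinearMap.ker π₁ := by
      rw [faceAt_inter, hxker.faceAt_eq]
    have hdir : direction (E ∩ (LinearMap.ker π₁ : Set W)) = direction E ⊓ LinearMap.ker π₁ := by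
      rw [hxE.direction_inter hEp hkerp hxker, direction_submodule]
    have hmem : v₂ ∈ (direction E ⊓ LinearMap.ker π₁).map π₂ :=
      ⟨z, ⟨hEp.mem_direction_of_mem_tcone hzE, hz₁⟩, hz₂⟩
    have htop : (direction E ⊓ LinearMap.ker π₁).map π₂ = ⊤ := by
      by_contra hne
      exact h₂ E hE hne hmem
    have h3 := le_finrank_of_map_eq_top hK₂
      (le_inf (hlin.le_direction hS hE hyE) hK) htop
    rw [← hdir] at h3
    have h4 : polyDim (P ∩ LinearMap.ker π₁) ≤ polyDim (E ∩ LinearMap.ker π₁) := by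
      refine hd.trans ?_
      unfold polyDim
      exact_mod_cast h3
    have h5 : E ∩ LinearMap.ker π₁ = P ∩ LinearMap.ker π₁ :=
      (hface ▸ (hPp.inter hkerp).isFace_faceAt ⟨hx, hxk⟩ : IsFace _ _).eq_of_polyDim
        (hPp.inter hkerp) h4
    refine ⟨le_antisymm hd ?_, ?_⟩
    · rw [← h5]; unfold polyDim; exact_mod_cast h3
    · rw [← h5, ← hface]
      exact (hPp.inter hkerp).relInt_faceAt ⟨hx, hxk⟩
  have hev := (mem_tcone.1 hz).and (hS.eventually_mem_iff y z)
  obtain ⟨δ, h6, h7⟩ := hev.exists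
  refine ⟨(key δ h6 h7).1, ?_⟩
  filter_upwards [hev] with δ hδ using (key δ hδ.1 hδ.2).2

/-- The contribution of the cell `P` to the iterated degree. -/
def EntersSlice (π₁ : W →ₗ[ℝ] U₁) (π₂ : W →ₗ[ℝ] U₂) (k₂ : ℤ) (y : W) (v₁ : U₁) (v₂ : U₂)
    (P : Set W) : Prop :=
  y ∈ P ∧ polyDim (P ∩ LinearMap.ker π₁) = k₂ ∧ v₂ ∈ π₂ '' tcone y (P ∩ LinearMap.ker π₁) ∧
    ∃ x, RelInt x (P ∩ LinearMap.ker π₁) ∧ v₁ ∈ π₁ '' tcone x P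


/-- Entering from `(0, v₂)` in the direction `(v₁, 0)` can be done in two stages: move inside the
slice to a relative interior point over `v₂`, then leave the slice along a direction over `v₁`. All
interior points of the slice see the same cone of `P`. -/
lemma enters_prod_iff (hS : IsPolyComplex M S) (h₁ : IsGenericFor S π₁ v₁)
    (h₂ : IsGenericOnSlices S π₁ π₂ v₂)
    (hK : K ≤ LinearMap.ker π₁) (hK₂ : K ≤ LinearMap.ker π₂) (hlin : HasLineality S y K)
    (hk : k = Module.finrank ℝ U₁ + Module.finrank ℝ U₂ + Module.finrank ℝ K)
    {P : Set W} (hP : P ∈ S) (hd : polyDim P = k) (hy : π₁ y = 0) :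
    Enters (π₁.prod π₂) y (0, v₂) (v₁, 0) P ↔
      EntersSlice π₁ π₂ (k - Module.finrank ℝ U₁) y v₁ v₂ P := by
  have hPp := hS.isPoly hP
  have hkerp := isPoly_ker π₁
  have hQp := hPp.inter hkerp
  have hker : ∀ z, z ∈ tcone y (LinearMap.ker π₁ : Set W) ↔ π₁ z = 0 := by
    intro z
    rw [(relInt_submodule _ hy).mem_tcone_iff hkerp, direction_submodule]
    rfl
  constructor
  · rintro ⟨hyP, htop, z, hz, h, hh, hzu, hhe, hmem⟩
    have hz₁ : π₁ z = 0 := congrArg Prod.fst hzu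
    have hz₂ : π₂ z = v₂ := congrArg Prod.snd hzu
    have hzC := (hPp.isPoly_tcone hyP).mem_of_mem_tcone hmem
    have hle := polyDim_slice_le (map_prod_eq_top_iff.1 htop).1 hd
    obtain ⟨h3, h4⟩ := relInt_slice hS h₂ hK hK₂ hlin hP hy (by omega) hzC hz₁ hz₂
    refine ⟨hyP, by omega, ⟨z, ?_, hz₂⟩, ?_⟩
    · rw [tcone_inter]; exact ⟨hzC, (hker z).2 hz₁⟩
    · obtain ⟨δ, h5, h6⟩ := (h4.and (hPp.eventually_tcone hzC)).exists
      exact ⟨_, h5, h, h6 ▸ hmem, congrArg Prod.fst hhe⟩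
  · rintro ⟨hyP, hdQ, ⟨z, hz, hz₂⟩, x, hx, h, hh, hhv⟩
    have htop₁ : (direction P).map π₁ = ⊤ := by
      by_contra hne
      exact h₁ P hP hne ⟨h, hPp.mem_direction_of_mem_tcone hh, hhv⟩
    have hdir := direction_slice_eq htop₁ hd hdQ
    have hzQd := hQp.mem_direction_of_mem_tcone hz
    rw [tcone_inter] at hz
    have hz₁ := (hker z).1 hz.2
    have htop₂ : (direction P ⊓ LinearMap.ker π₁).map π₂ = ⊤ := by
      by_contra hne
      exact h₂ P hP hne ⟨z, hdir ▸ hzQd, hz₂⟩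
    obtain ⟨-, h4⟩ := relInt_slice hS h₂ hK hK₂ hlin hP hy (by omega) hz.1 hz₁ hz₂
    obtain ⟨δ, h5, h6⟩ := (h4.and (hPp.eventually_tcone hz.1)).exists
    -- The lift `h` of `v₁` is corrected along the slice, so that its second component becomes `0`
    -- while its first one is kept.
    obtain ⟨g, hg, hgh⟩ : -π₂ h ∈ (direction P ⊓ LinearMap.ker π₁).map π₂ := htop₂ ▸ trivial
    have hgk : π₁ g = 0 := hg.2
    refine ⟨hyP, map_prod_eq_top_iff.2 ⟨htop₁, htop₂⟩, z, hPp.mem_direction_of_mem_tcone hz.1,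
      h + g, Submodule.add_mem _ (hPp.mem_direction_of_mem_tcone hh) hg.1, ?_, ?_, ?_⟩
    · simp [hz₁, hz₂]
    · simp [hhv, hgk, hgh]
    · rw [← h6]
      refine hPp.add_mem_tcone ?_ (tcone_mono _ Set.inter_subset_left (h5.2 g (hdir ▸ hg)))
      rwa [← hx.tcone_eq h5 Set.inter_subset_left hPp]

/-- The degree of a product map, as an iterated degree. -/
theorem eventually_degree_prod_eq (hS : IsPolyComplex M S) (w : Set W → ℤ)
    (hπ₁ : ∀ x ∈ M, π₁ x ∈ N₁) (hπ₂ : ∀ x ∈ M, π₂ x ∈ N₂)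
    (h₁ : IsGenericFor S π₁ v₁) (h₂ : IsGenericOnSlices S π₁ π₂ v₂)
    (hK : K ≤ LinearMap.ker π₁) (hK₂ : K ≤ LinearMap.ker π₂) (hlin : HasLineality S y K)
    [FiniteDimensional ℝ U₂]
    (hk : k = Module.finrank ℝ U₁ + Module.finrank ℝ U₂ + Module.finrank ℝ K)
    (hy : π₁ y = 0) {m : Set W → ℤ}
    (hm : ∀ E ∈ kerSlices S π₁ (k - Module.finrank ℝ U₁), ∀ x, RelInt x E →
      m E = degree (cellsOfDim S k) w M N₁ π₁ x v₁) :
    ∀ᶠ ε : ℝ in 𝓝[>] 0,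
      degree (cellsOfDim S k) w M (N₁.prod N₂) (π₁.prod π₂) y (ε • v₁, v₂) =
        degree (kerSlices S π₁ (k - Module.finrank ℝ U₁)) m M N₂ π₂ y v₂ := by
  have hkerp := isPoly_ker π₁
  have hev := eventually_degree_eq (k := k) (N := N₁.prod N₂) (π := π₁.prod π₂) (u := (0, v₂))
    (e := (v₁, 0)) hS w (K := K)
    (by rw [LinearMap.ker_prod]; exact le_inf hK hK₂) hlin
    (by rw [hk, Module.finrank_prod]; push_cast; ring)
    (fun P hP _ hne h0 => notMem_map_prod h₁ h₂ hP hne h0)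
  filter_upwards [hev] with ε hε
  have heq : ((0 : U₁), v₂) + ε • (v₁, (0 : U₂)) = (ε • v₁, v₂) := by simp
  rw [heq] at hε
  rw [hε]
  set k₂ := k - Module.finrank ℝ U₁ with hk₂
  have hslice : ∀ E ∈ kerSlices S π₁ k₂, ∃ P ∈ S, E = P ∩ LinearMap.ker π₁ ∧ polyDim E = k₂ ∧
      ∃ x, RelInt x E := by
    intro E hE
    simp only [kerSlices, Finset.mem_filter, Finset.mem_image] at hE
    obtain ⟨⟨P, hP, rfl⟩, hne, hd⟩ := hE
    exact ⟨P, hP, rfl, hd, ((hS.isPoly hP).inter hkerp).exists_relInt hne⟩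
  choose! f hfS hfE hfd x hx using hslice
  -- A contributing slice `E` and a contributing cell `P` through its point `x E` satisfy `E = P ∩
  -- ker π₁`, since `E` is a face of that slice of the same dimension. This collapses the double sum
  -- over slices and cells to a sum over cells.
  have hconds : ∀ P ∈ cellsOfDim S k, ∀ E ∈ kerSlices S π₁ k₂,
      (((y ∈ E ∧ v₂ ∈ π₂ '' tcone y E) ∧ (x E ∈ P ∧ v₁ ∈ π₁ '' tcone (x E) P)) ↔
        (EntersSlice π₁ π₂ k₂ y v₁ v₂ P ∧ E = P ∩ LinearMap.ker π₁)) := by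
    intro P hP E hE
    obtain ⟨hP, hd⟩ := mem_cellsOfDim.1 hP
    have hPp := hS.isPoly hP
    constructor
    · rintro ⟨⟨hyE, hv₂⟩, hxP, hv₁⟩
      have htop := h₁.map_eq_top hP hPp hv₁
      have hle := polyDim_slice_le htop hd
      have hxE := hx E hE
      have hfEE := hfE E hE
      have hmemE : ∀ z ∈ E, z ∈ f E ∩ (LinearMap.ker π₁ : Set W) := fun z hz => by rwa [← hfEE]
      have hxf := (hmemE _ hxE.1).1
      have hxker := (hmemE _ hxE.1).2
      have hface : faceAt (x E) (P ∩ LinearMap.ker π₁) = E := by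
        rw [faceAt_inter, ← hS.faceAt_eq (hfS E hE) hP hxf hxP, ← faceAt_inter, ← hfEE,
          hxE.faceAt_eq]
      have hEQ : E = P ∩ LinearMap.ker π₁ :=
        (hface ▸ (hPp.inter hkerp).isFace_faceAt ⟨hxP, hxker⟩ : IsFace E _).eq_of_polyDim
          (hPp.inter hkerp) (by rw [hfd E hE]; exact hle)
      refine ⟨⟨?_, ?_, ?_, ?_⟩, hEQ⟩
      · rw [hEQ] at hyE; exact hyE.1
      · rw [← hEQ]; exact hfd E hE
      · rw [← hEQ]; exact hv₂
      · rw [← hEQ]; exact ⟨x E, hxE, hv₁⟩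
    · rintro ⟨⟨hyP, hdQ, hv₂, x', hx', hv₁⟩, rfl⟩
      have hxE := hx _ hE
      refine ⟨⟨⟨hyP, hy⟩, hv₂⟩, hxE.1.1, ?_⟩
      rwa [hxE.tcone_eq hx' Set.inter_subset_left hPp]
  have hrhs : degree (kerSlices S π₁ k₂) m M N₂ π₂ y v₂ =
      ∑ E ∈ kerSlices S π₁ k₂, ∑ P ∈ cellsOfDim S k,
        if EntersSlice π₁ π₂ k₂ y v₁ v₂ P ∧ E = P ∩ LinearMap.ker π₁ then
          mapIndex M N₂ π₂ E * (mapIndex M N₁ π₁ P * w P) else 0 := by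
    rw [degree, Finset.sum_filter]
    refine Finset.sum_congr rfl fun E hE => ?_
    by_cases hc : y ∈ E ∧ v₂ ∈ π₂ '' tcone y E
    · rw [if_pos hc, hm E hE (x E) (hx E hE), degree, Finset.mul_sum, Finset.sum_filter]
      refine Finset.sum_congr rfl fun P hP => ?_
      have := hconds P hP E hE
      simp only [hc, and_self, true_and] at this
      simp only [this]
    · rw [if_neg hc]
      symm
      refine Finset.sum_eq_zero fun P hP => if_neg fun h => hc ((hconds P hP E hE).2 h).1
  rw [hrhs, Finset.sum_comm]
  refine Finset.sum_congr rfl fun P hP => ?_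
  obtain ⟨hPS, hd⟩ := mem_cellsOfDim.1 hP
  have hiff := enters_prod_iff hS h₁ h₂ hK hK₂ hlin hk hPS hd hy
  rw [← hk₂] at hiff
  by_cases hR : EntersSlice π₁ π₂ k₂ y v₁ v₂ P
  · rw [if_pos (hiff.2 hR), Finset.sum_eq_single (P ∩ LinearMap.ker π₁)]
    · rw [if_pos ⟨hR, rfl⟩]
      obtain ⟨-, hdQ, -, x', hx', h, hh, hhv⟩ := hR
      have htop := h₁.map_eq_top hPS (hS.isPoly hPS) ⟨h, hh, hhv⟩
      have hdir := direction_slice_eq htop hd hdQ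
      -- The lattice of the slice is the kernel of `π₁` on the lattice of `P`, so the index of the
      -- product map is the product of the two indices.
      have h3 : latticeOf M (P ∩ LinearMap.ker π₁) =
          latticeOf M P ⊓ LinearMap.ker (π₁.restrictScalars ℤ) := by
        ext l
        simp only [mem_latticeOf, hdir, Submodule.mem_inf, and_assoc]
        rfl
      have h4 := latIndex_map_prod (latticeOf M P) (π₁.restrictScalars ℤ) (π₂.restrictScalars ℤ)
        (N₁ := N₁) (N₂ := N₂) (by rintro _ ⟨l, hl, rfl⟩; exact hπ₁ l hl.1)
        (by rintro _ ⟨l, hl, rfl⟩; exact hπ₂ l hl.1)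
      rw [← h3] at h4
      have h5 : mapIndex M (N₁.prod N₂) (π₁.prod π₂) P =
          mapIndex M N₁ π₁ P * mapIndex M N₂ π₂ (P ∩ LinearMap.ker π₁) := h4
      rw [h5]
      ring
    · intro E _ hne
      exact if_neg fun h => hne h.2
    · intro hcon
      exfalso
      apply hcon
      simp only [kerSlices, Finset.mem_filter, Finset.mem_image]
      obtain ⟨hyP, hdQ, -⟩ := hR
      exact ⟨⟨P, hPS, rfl⟩, ⟨y, hyP, hy⟩, hdQ⟩
  · rw [if_neg fun h => hR (hiff.1 h)]
    symm
    exact Finset.sum_eq_zero fun E _ => if_neg fun h => hR h.1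

end IteratedDegree

/-! ### Products of lattices and polyhedra -/

section Products

variable {V V' : Type*} [AddCommGroup V] [Module ℝ V] [AddCommGroup V'] [Module ℝ V']
  {L : Submodule ℤ V} {L' : Submodule ℤ V'}

lemma IsFullLattice.prod (hL : IsFullLattice L) (hL' : IsFullLattice L') :
    IsFullLattice (L.prod L') := by
  constructor
  · rw [eq_top_iff, ← Submodule.prod_top, ← hL.span_eq, ← hL'.span_eq]
    rintro ⟨x, y⟩ ⟨hx, hy⟩
    have h1 : LinearMap.inl ℝ V V' x ∈ Submodule.span ℝ (L.prod L' : Set (V × V')) := by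
      have := Submodule.mem_map_of_mem (f := LinearMap.inl ℝ V V') hx
      rw [Submodule.map_span] at this
      refine Submodule.span_mono ?_ this
      rintro _ ⟨l, hl, rfl⟩
      exact ⟨hl, L'.zero_mem⟩
    have h2 : LinearMap.inr ℝ V V' y ∈ Submodule.span ℝ (L.prod L' : Set (V × V')) := by
      have := Submodule.mem_map_of_mem (f := LinearMap.inr ℝ V V') hy
      rw [Submodule.map_span] at this
      refine Submodule.span_mono ?_ this
      rintro _ ⟨l, hl, rfl⟩
      exact ⟨L.zero_mem, hl⟩
    simpa using Submodule.add_mem _ h1 h2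
  · rw [eq_top_iff]
    intro φ _
    have h1 : (LinearMap.fst ℝ V V').dualMap (φ ∘ₗ LinearMap.inl ℝ V V') ∈
        Submodule.span ℝ (dualLattice (L.prod L') : Set (Module.Dual ℝ (V × V'))) := by
      have h : φ ∘ₗ LinearMap.inl ℝ V V' ∈ Submodule.span ℝ (dualLattice L : Set _) := by
        rw [hL.span_dual_eq]; trivial
      have := Submodule.mem_map_of_mem (f := (LinearMap.fst ℝ V V').dualMap) h
      rw [Submodule.map_span] at this
      refine Submodule.span_mono ?_ this
      rintro _ ⟨l, hl, rfl⟩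
      exact fun x hx => hl _ hx.1
    have h2 : (LinearMap.snd ℝ V V').dualMap (φ ∘ₗ LinearMap.inr ℝ V V') ∈
        Submodule.span ℝ (dualLattice (L.prod L') : Set (Module.Dual ℝ (V × V'))) := by
      have h : φ ∘ₗ LinearMap.inr ℝ V V' ∈ Submodule.span ℝ (dualLattice L' : Set _) := by
        rw [hL'.span_dual_eq]; trivial
      have := Submodule.mem_map_of_mem (f := (LinearMap.snd ℝ V V').dualMap) h
      rw [Submodule.map_span] at this
      refine Submodule.span_mono ?_ this
      rintro _ ⟨l, hl, rfl⟩
      exact fun x hx => hl _ hx.2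
    convert Submodule.add_mem _ h1 h2 using 1
    ext x <;> simp [Prod.mk_zero_zero]

lemma IsRationalPolyhedron.prod {P : Set V} {Q : Set V'} (hP : IsRationalPolyhedron L P)
    (hQ : IsRationalPolyhedron L' Q) : IsRationalPolyhedron (L.prod L') (P ×ˢ Q) := by
  obtain ⟨hP0, I, hI, rfl⟩ := hP
  obtain ⟨hQ0, J, hJ, rfl⟩ := hQ
  refine ⟨hP0.prod hQ0, I.image (fun p => (p.1 ∘ₗ LinearMap.fst ℝ V V', p.2)) ∪
    J.image (fun p => (p.1 ∘ₗ LinearMap.snd ℝ V V', p.2)), ?_, ?_⟩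
  · intro p hp x hx
    simp only [Finset.mem_union, Finset.mem_image] at hp
    rcases hp with ⟨q, hq, rfl⟩ | ⟨q, hq, rfl⟩
    · exact hI q hq _ hx.1
    · exact hJ q hq _ hx.2
  · ext x
    simp only [Set.mem_prod, Set.mem_ofPred_eq, Finset.mem_union, Finset.mem_image]
    constructor
    · rintro ⟨h1, h2⟩ p (⟨q, hq, rfl⟩ | ⟨q, hq, rfl⟩)
      · exact h1 q hq
      · exact h2 q hq
    · intro h
      exact ⟨fun q hq => h _ (Or.inl ⟨q, hq, rfl⟩), fun q hq => h _ (Or.inr ⟨q, hq, rfl⟩)⟩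

lemma polyDim_prod [FiniteDimensional ℝ V] [FiniteDimensional ℝ V'] {P : Set V} {Q : Set V'}
    (hP : P.Nonempty) (hQ : Q.Nonempty) : polyDim (P ×ˢ Q) = polyDim P + polyDim Q := by
  unfold polyDim
  let e : (direction P).prod (direction Q) ≃ₗ[ℝ] direction P × direction Q :=
    { toFun := fun x => (⟨x.1.1, x.2.1⟩, ⟨x.1.2, x.2.2⟩)
      invFun := fun x => ⟨(x.1.1, x.2.1), x.1.2, x.2.2⟩
      map_add' := fun _ _ => rfl
      map_smul' := fun _ _ => rfl
      left_inv := fun _ => rfl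
      right_inv := fun _ => rfl }
  rw [direction_prod hP hQ, e.finrank_eq, Module.finrank_prod]
  push_cast; rfl

lemma latticeOf_prod {P : Set V} {Q : Set V'} (hP : P.Nonempty) (hQ : Q.Nonempty) :
    latticeOf (L.prod L') (P ×ˢ Q) = (latticeOf L P).prod (latticeOf L' Q) := by
  ext x
  simp only [mem_latticeOf, direction_prod hP hQ, Submodule.mem_prod]
  tauto

lemma IsFace.prod {F P : Set V} {G Q : Set V'} (hF : IsFace F P) (hG : IsFace G Q) (hP : IsPoly P)
    (hQ : IsPoly Q) : IsFace (F ×ˢ G) (P ×ˢ Q) := by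
  obtain ⟨x, hx⟩ := (hF.isPoly hP).exists_relInt hF.1
  obtain ⟨y, hy⟩ := (hG.isPoly hQ).exists_relInt hG.1
  rw [hF.eq_faceAt hx, hG.eq_faceAt hy, ← faceAt_prod (x, y)]
  exact (hP.prod hQ).isFace_faceAt ⟨hF.subset hx.1, hG.subset hy.1⟩

lemma IsFace.exists_eq_prod {R : Set (V × V')} {P : Set V} {Q : Set V'} (h : IsFace R (P ×ˢ Q))
    (hP : IsPoly P) (hQ : IsPoly Q) : ∃ F G, IsFace F P ∧ IsFace G Q ∧ R = F ×ˢ G := by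
  obtain ⟨x, hx⟩ := (h.isPoly (hP.prod hQ)).exists_relInt h.1
  have hx' := h.subset hx.1
  exact ⟨_, _, hP.isFace_faceAt hx'.1, hQ.isFace_faceAt hx'.2, by
    rw [h.eq_faceAt hx, faceAt_prod]⟩

end Products

/-! ### Products of balanced complexes -/

section ProductComplexes

/-- The products of the cells of `S` and the cells of `T`. -/
def prodCells {V V' : Type*} (S : Finset (Set V)) (T : Finset (Set V')) : Finset (Set (V × V')) :=
  (S ×ˢ T).image fun p => p.1 ×ˢ p.2

lemma mem_prodCells {V V' : Type*} {S : Finset (Set V)} {T : Finset (Set V')} {R : Set (V × V')} :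
    R ∈ prodCells S T ↔ ∃ P ∈ S, ∃ Q ∈ T, R = P ×ˢ Q := by
  simp only [prodCells, Finset.mem_image, Finset.mem_product, Prod.exists]
  constructor
  · rintro ⟨P, Q, ⟨hP, hQ⟩, rfl⟩; exact ⟨P, hP, Q, hQ, rfl⟩
  · rintro ⟨P, hP, Q, hQ, rfl⟩; exact ⟨P, Q, ⟨hP, hQ⟩, rfl⟩

variable {V V' : Type*} [AddCommGroup V] [Module ℝ V] [AddCommGroup V'] [Module ℝ V']
  {L : Submodule ℤ V} {L' : Submodule ℤ V'}

lemma IsPolyComplex.prod {S : Finset (Set V)} {T : Finset (Set V')} (hS : IsPolyComplex L S)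
    (hT : IsPolyComplex L' T) : IsPolyComplex (L.prod L') (prodCells S T) where
  rational := by
    intro R hR
    obtain ⟨P, hP, Q, hQ, rfl⟩ := mem_prodCells.1 hR
    exact (hS.rational P hP).prod (hT.rational Q hQ)
  face_mem := by
    intro R hR F hF
    obtain ⟨P, hP, Q, hQ, rfl⟩ := mem_prodCells.1 hR
    obtain ⟨F', G', hF', hG', rfl⟩ := hF.exists_eq_prod (hS.isPoly hP) (hT.isPoly hQ)
    exact mem_prodCells.2 ⟨F', hS.face_mem P hP F' hF', G', hT.face_mem Q hQ G' hG', rfl⟩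
  inter_face := by
    intro R hR R' hR' hne
    obtain ⟨P, hP, Q, hQ, rfl⟩ := mem_prodCells.1 hR
    obtain ⟨P', hP', Q', hQ', rfl⟩ := mem_prodCells.1 hR'
    rw [Set.prod_inter_prod, Set.prod_nonempty_iff] at *
    exact (hS.inter_face P hP P' hP' hne.1).prod (hT.inter_face Q hQ Q' hQ' hne.2)
      (hS.isPoly hP) (hT.isPoly hQ)

lemma IsPrimitiveGenerator.prod_left {P F : Set V} {G : Set V'} {u : V}
    (h : IsPrimitiveGenerator L P F u) (hP : P.Nonempty) (hF : F.Nonempty) (hG : G.Nonempty) :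
    IsPrimitiveGenerator (L.prod L') (P ×ˢ G) (F ×ˢ G) (u, 0) := by
  obtain ⟨⟨t, ht, x, hx, y, hy, hu⟩, huL, hlat⟩ := h
  obtain ⟨g, hg⟩ := hG
  refine ⟨⟨t, ht, (x, g), ⟨hx, hg⟩, (y, g), ⟨hy, hg⟩, by simp [hu]⟩, ⟨huL, L'.zero_mem⟩, ?_⟩
  rw [latticeOf_prod hP ⟨g, hg⟩, latticeOf_prod hF ⟨g, hg⟩, hlat]
  ext ⟨a, b⟩
  simp only [Submodule.mem_prod, Submodule.mem_sup, Submodule.mem_span_singleton, Prod.exists]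
  constructor
  · rintro ⟨⟨c, hc, _, ⟨n, rfl⟩, h⟩, hb⟩
    exact ⟨c, b, ⟨hc, hb⟩, n • u, 0, ⟨n, by simp⟩, by simpa using h⟩
  · rintro ⟨c, d, ⟨hc, hd⟩, _, _, ⟨n, hn⟩, h⟩
    simp only [Prod.smul_mk, smul_zero, Prod.mk.injEq] at hn
    obtain ⟨rfl, rfl⟩ := hn
    simp only [Prod.mk_add_mk, add_zero, Prod.mk.injEq] at h
    obtain ⟨rfl, rfl⟩ := h
    exact ⟨⟨c, hc, _, ⟨n, rfl⟩, rfl⟩, hd⟩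

lemma IsPrimitiveGenerator.prod_right {P F : Set V'} {G : Set V} {u : V'}
    (h : IsPrimitiveGenerator L' P F u) (hP : P.Nonempty) (hF : F.Nonempty) (hG : G.Nonempty) :
    IsPrimitiveGenerator (L.prod L') (G ×ˢ P) (G ×ˢ F) (0, u) := by
  obtain ⟨⟨t, ht, x, hx, y, hy, hu⟩, huL, hlat⟩ := h
  obtain ⟨g, hg⟩ := hG
  refine ⟨⟨t, ht, (g, x), ⟨hg, hx⟩, (g, y), ⟨hg, hy⟩, by simp [hu]⟩, ⟨L.zero_mem, huL⟩, ?_⟩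
  rw [latticeOf_prod ⟨g, hg⟩ hP, latticeOf_prod ⟨g, hg⟩ hF, hlat]
  ext ⟨b, a⟩
  simp only [Submodule.mem_prod, Submodule.mem_sup, Submodule.mem_span_singleton, Prod.exists]
  constructor
  · rintro ⟨hb, ⟨c, hc, _, ⟨n, rfl⟩, h⟩⟩
    exact ⟨b, c, ⟨hb, hc⟩, 0, n • u, ⟨n, by simp⟩, by simpa using h⟩
  · rintro ⟨d, c, ⟨hd, hc⟩, _, _, ⟨n, hn⟩, h⟩
    simp only [Prod.smul_mk, smul_zero, Prod.mk.injEq] at hn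
    obtain ⟨rfl, rfl⟩ := hn
    simp only [Prod.mk_add_mk, add_zero, Prod.mk.injEq] at h
    obtain ⟨rfl, rfl⟩ := h
    exact ⟨hd, ⟨c, hc, _, ⟨n, rfl⟩, rfl⟩⟩

lemma TropicalComplex.nonempty (a : TropicalComplex L) {P : Set V} (hP : P ∈ a.cells) :
    P.Nonempty := (a.rational P hP).1

variable [FiniteDimensional ℝ V] [FiniteDimensional ℝ V']

lemma polyDim_prod_eq_iff {a : TropicalComplex L} {b : TropicalComplex L'} {P : Set V} {Q : Set V'}
    (hP : P ∈ a.cells) (hQ : Q ∈ b.cells) :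
    polyDim (P ×ˢ Q) = a.dim + b.dim ↔ polyDim P = a.dim ∧ polyDim Q = b.dim := by
  rw [polyDim_prod (a.nonempty hP) (b.nonempty hQ)]
  have h1 := a.polyDim_le hP
  have h2 := b.polyDim_le hQ
  omega

/-- A cell of codimension one in the product is maximal in one factor and of codimension one in the
other. The balancing relation of the latter factor is multiplied by the fixed weight from the
former. -/
lemma prod_balanced (a : TropicalComplex L) (b : TropicalComplex L') {R : Set (V × V')}
    (hR : R ∈ prodCells a.cells b.cells) (hd : polyDim R = a.dim + b.dim - 1) :
    ∃ u : Set (V × V') → V × V',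
      (∀ P ∈ prodCells a.cells b.cells, polyDim P = a.dim + b.dim → R ⊆ P →
        IsPrimitiveGenerator (L.prod L') P R (u P)) ∧
      ∑ P ∈ prodCells a.cells b.cells with (polyDim P = a.dim + b.dim ∧ R ⊆ P),
        (a.weight (Prod.fst '' P) * b.weight (Prod.snd '' P)) • u P ∈ direction R := by
  obtain ⟨F, hF, G, hG, rfl⟩ := mem_prodCells.1 hR
  have hFn := a.nonempty hF
  have hGn := b.nonempty hG
  rw [polyDim_prod hFn hGn] at hd
  have h1 := a.polyDim_le hF
  have h2 := b.polyDim_le hG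
  have hcases : (polyDim F = a.dim - 1 ∧ polyDim G = b.dim) ∨
      (polyDim F = a.dim ∧ polyDim G = b.dim - 1) := by omega
  rw [direction_prod hFn hGn]
  rcases hcases with ⟨hFd, hGd⟩ | ⟨hFd, hGd⟩
  · obtain ⟨u, hu, hsum⟩ := a.balanced F hF hFd
    have hset : (prodCells a.cells b.cells).filter
        (fun P => polyDim P = a.dim + b.dim ∧ F ×ˢ G ⊆ P) =
        (a.cells.filter fun P => polyDim P = a.dim ∧ F ⊆ P).image fun P => P ×ˢ G := by
      ext R
      simp only [Finset.mem_filter, Finset.mem_image, mem_prodCells]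
      constructor
      · rintro ⟨⟨P, hP, Q, hQ, rfl⟩, hd, hsub⟩
        rw [polyDim_prod_eq_iff hP hQ] at hd
        rw [Set.prod_subset_prod_iff, or_iff_left (by simp [hFn.ne_empty, hGn.ne_empty])] at hsub
        refine ⟨P, ⟨hP, hd.1, hsub.1⟩, ?_⟩
        rw [b.isPolyComplex.eq_of_polyDim hG hQ hsub.2 (by omega)]
      · rintro ⟨P, ⟨hP, hd, hsub⟩, rfl⟩
        exact ⟨⟨P, hP, G, hG, rfl⟩, (polyDim_prod_eq_iff hP hG).2 ⟨hd, hGd⟩,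
          Set.prod_mono hsub subset_rfl⟩
    refine ⟨fun R => (u (Prod.fst '' R), 0), ?_, ?_⟩
    · intro R hR hd hsub
      have hmem : R ∈ (prodCells a.cells b.cells).filter
          (fun P => polyDim P = a.dim + b.dim ∧ F ×ˢ G ⊆ P) := Finset.mem_filter.2 ⟨hR, hd, hsub⟩
      rw [hset] at hmem
      obtain ⟨P, hP, rfl⟩ := Finset.mem_image.1 hmem
      obtain ⟨hP, hd, hsub⟩ := Finset.mem_filter.1 hP
      beta_reduce
      rw [Set.fst_image_prod _ hGn]
      exact (hu P hP hd hsub).prod_left (a.nonempty hP) hFn hGn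
    · rw [hset, Finset.sum_image (by
        intro P hP P' hP' h
        have := congrArg (Prod.fst '' ·) h
        simpa [Set.fst_image_prod _ hGn] using this)]
      have : ∀ P, P ∈ (a.cells.filter fun P => polyDim P = a.dim ∧ F ⊆ P) →
          (a.weight (Prod.fst '' P ×ˢ G) * b.weight (Prod.snd '' P ×ˢ G)) •
            ((u (Prod.fst '' P ×ˢ G), 0) : V × V') =
          b.weight G • LinearMap.inl ℝ V V' (a.weight P • u P) := by
        intro P hP
        obtain ⟨hP, -⟩ := Finset.mem_filter.1 hP
        rw [Set.fst_image_prod _ hGn, Set.snd_image_prod (a.nonempty hP)]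
        simp [mul_smul, smul_comm (a.weight P)]
      rw [Finset.sum_congr rfl this, ← Finset.smul_sum, ← map_sum, ← Int.cast_smul_eq_zsmul ℝ]
      exact Submodule.smul_mem _ _ ⟨hsum, Submodule.zero_mem _⟩
  · obtain ⟨u, hu, hsum⟩ := b.balanced G hG hGd
    have hset : (prodCells a.cells b.cells).filter
        (fun P => polyDim P = a.dim + b.dim ∧ F ×ˢ G ⊆ P) =
        (b.cells.filter fun P => polyDim P = b.dim ∧ G ⊆ P).image fun P => F ×ˢ P := by
      ext R
      simp only [Finset.mem_filter, Finset.mem_image, mem_prodCells]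
      constructor
      · rintro ⟨⟨P, hP, Q, hQ, rfl⟩, hd, hsub⟩
        rw [polyDim_prod_eq_iff hP hQ] at hd
        rw [Set.prod_subset_prod_iff, or_iff_left (by simp [hFn.ne_empty, hGn.ne_empty])] at hsub
        refine ⟨Q, ⟨hQ, hd.2, hsub.2⟩, ?_⟩
        rw [a.isPolyComplex.eq_of_polyDim hF hP hsub.1 (by omega)]
      · rintro ⟨P, ⟨hP, hd, hsub⟩, rfl⟩
        exact ⟨⟨F, hF, P, hP, rfl⟩, (polyDim_prod_eq_iff hF hP).2 ⟨hFd, hd⟩,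
          Set.prod_mono subset_rfl hsub⟩
    refine ⟨fun R => (0, u (Prod.snd '' R)), ?_, ?_⟩
    · intro R hR hd hsub
      have hmem : R ∈ (prodCells a.cells b.cells).filter
          (fun P => polyDim P = a.dim + b.dim ∧ F ×ˢ G ⊆ P) := Finset.mem_filter.2 ⟨hR, hd, hsub⟩
      rw [hset] at hmem
      obtain ⟨P, hP, rfl⟩ := Finset.mem_image.1 hmem
      obtain ⟨hP, hd, hsub⟩ := Finset.mem_filter.1 hP
      beta_reduce
      rw [Set.snd_image_prod hFn]
      exact (hu P hP hd hsub).prod_right (b.nonempty hP) hGn hFn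
    · rw [hset, Finset.sum_image (by
        intro P hP P' hP' h
        have := congrArg (Prod.snd '' ·) h
        simpa [Set.snd_image_prod hFn] using this)]
      have : ∀ P, P ∈ (b.cells.filter fun P => polyDim P = b.dim ∧ G ⊆ P) →
          (a.weight (Prod.fst '' F ×ˢ P) * b.weight (Prod.snd '' F ×ˢ P)) •
            ((0, u (Prod.snd '' F ×ˢ P)) : V × V') =
          a.weight F • LinearMap.inr ℝ V V' (b.weight P • u P) := by
        intro P hP
        obtain ⟨hP, -⟩ := Finset.mem_filter.1 hP
        rw [Set.snd_image_prod hFn, Set.fst_image_prod _ (b.nonempty hP)]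
        simp [mul_smul]
      rw [Finset.sum_congr rfl this, ← Finset.smul_sum, ← map_sum, ← Int.cast_smul_eq_zsmul ℝ]
      exact Submodule.smul_mem _ _ ⟨Submodule.zero_mem _, hsum⟩

/-- The product of two balanced complexes. -/
def TropicalComplex.prod (a : TropicalComplex L) (b : TropicalComplex L') :
    TropicalComplex (L.prod L') where
  dim := a.dim + b.dim
  cells := prodCells a.cells b.cells
  weight := fun R => a.weight (Prod.fst '' R) * b.weight (Prod.snd '' R)
  rational := (a.isPolyComplex.prod b.isPolyComplex).rational
  face_mem := (a.isPolyComplex.prod b.isPolyComplex).face_mem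
  inter_face := (a.isPolyComplex.prod b.isPolyComplex).inter_face
  pure := by
    intro R hR
    obtain ⟨P, hP, Q, hQ, rfl⟩ := mem_prodCells.1 hR
    obtain ⟨P', hP', hPP', hd⟩ := a.pure P hP
    obtain ⟨Q', hQ', hQQ', hd'⟩ := b.pure Q hQ
    exact ⟨P' ×ˢ Q', mem_prodCells.2 ⟨P', hP', Q', hQ', rfl⟩, Set.prod_mono hPP' hQQ',
      (polyDim_prod_eq_iff hP' hQ').2 ⟨hd, hd'⟩⟩
  weight_ne_zero := by
    intro R hR hd
    obtain ⟨P, hP, Q, hQ, rfl⟩ := mem_prodCells.1 hR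
    rw [polyDim_prod_eq_iff hP hQ] at hd
    rw [Set.fst_image_prod _ (b.nonempty hQ), Set.snd_image_prod (a.nonempty hP)]
    exact mul_ne_zero (a.weight_ne_zero P hP hd.1) (b.weight_ne_zero Q hQ hd.2)
  balanced := fun R hR hd => prod_balanced a b hR hd

lemma TropicalComplex.weight_prod (a : TropicalComplex L) (b : TropicalComplex L') {P : Set V}
    {Q : Set V'} (hP : P ∈ a.cells) (hQ : Q ∈ b.cells) :
    (a.prod b).weight (P ×ˢ Q) = a.weight P * b.weight Q := by
  change a.weight _ * b.weight _ = _
  rw [Set.fst_image_prod _ (b.nonempty hQ), Set.snd_image_prod (a.nonempty hP)]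

lemma TropicalComplex.cellsOfDim_prod (a : TropicalComplex L) (b : TropicalComplex L') :
    cellsOfDim (a.prod b).cells (a.prod b).dim = prodCells a.maxCells b.maxCells := by
  ext R
  simp only [mem_cellsOfDim, TropicalComplex.prod, mem_prodCells, mem_maxCells]
  constructor
  · rintro ⟨⟨P, hP, Q, hQ, rfl⟩, hd⟩
    rw [polyDim_prod_eq_iff hP hQ] at hd
    exact ⟨P, ⟨hP, hd.1⟩, Q, ⟨hQ, hd.2⟩, rfl⟩
  · rintro ⟨P, ⟨hP, hd⟩, Q, ⟨hQ, hd'⟩, rfl⟩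
    exact ⟨⟨P, hP, Q, hQ, rfl⟩, (polyDim_prod_eq_iff hP hQ).2 ⟨hd, hd'⟩⟩

lemma TropicalComplex.sum_cellsOfDim_prod (a : TropicalComplex L) (b : TropicalComplex L')
    (f : Set (V × V') → ℤ) :
    ∑ R ∈ cellsOfDim (a.prod b).cells (a.prod b).dim, f R =
      ∑ p ∈ a.maxCells ×ˢ b.maxCells, f (p.1 ×ˢ p.2) := by
  rw [cellsOfDim_prod, prodCells, Finset.sum_image]
  rintro ⟨P, Q⟩ h ⟨P', Q'⟩ h' heq
  simp only [Finset.coe_product, Set.mem_prod, Finset.mem_coe, mem_maxCells] at h h'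
  have := (Set.prod_eq_prod_iff_of_nonempty
    ((a.nonempty h.1.1).prod (b.nonempty h.2.1))).1 heq
  simp [this]

end ProductComplexes

/-! ### Transport of degrees along injective linear maps -/

section Transport

variable {W W' U : Type*} [AddCommGroup W] [Module ℝ W] [AddCommGroup W'] [Module ℝ W']
  [AddCommGroup U] [Module ℝ U] {f : W' →ₗ[ℝ] W}

lemma direction_image (f : W' →ₗ[ℝ] W) (P : Set W') : direction (f '' P) = (direction P).map f :=
  (AffineMap.map_vectorSpan f.toAffineMap).symm

lemma polyDim_image (hf : Function.Injective f) (P : Set W') : polyDim (f '' P) = polyDim P := by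
  unfold polyDim
  rw [direction_image, (Submodule.equivMapOfInjective f hf _).finrank_eq]

lemma tcone_image (hf : Function.Injective f) (y : W') (P : Set W') :
    tcone (f y) (f '' P) = f '' tcone y P := by
  ext z
  constructor
  · intro hz
    obtain ⟨ε, ⟨x, hx, hxε⟩, hε⟩ := ((mem_tcone.1 hz).and self_mem_nhdsWithin).exists
    have hε : 0 < ε := hε
    have hz' : z = f (ε⁻¹ • (x - y)) := by
      rw [map_smul, map_sub, hxε, add_sub_cancel_left, smul_smul, inv_mul_cancel₀ hε.ne', one_smul]
    refine ⟨_, ?_, hz'.symm⟩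
    rw [mem_tcone]
    filter_upwards [mem_tcone.1 hz] with δ hδ
    rw [hz', ← map_smul, ← map_add, hf.mem_set_image] at hδ
    exact hδ
  · rintro ⟨z, hz, rfl⟩
    rw [mem_tcone]
    filter_upwards [mem_tcone.1 hz] with δ hδ
    exact ⟨_, hδ, by simp⟩

lemma relInt_image (hf : Function.Injective f) {y : W'} {P : Set W'} :
    RelInt (f y) (f '' P) ↔ RelInt y P := by
  unfold RelInt
  rw [direction_image, tcone_image hf, hf.mem_set_image]
  refine and_congr_right fun _ => ⟨fun h z hz => ?_, ?_⟩
  · exact hf.mem_set_image.1 (h _ (Submodule.mem_map_of_mem hz))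
  · rintro h _ ⟨z, hz, rfl⟩
    exact ⟨z, h z hz, rfl⟩

lemma latticeOf_image {M : Submodule ℤ W} {M' : Submodule ℤ W'}
    (hM : ∀ x, f x ∈ M ↔ x ∈ M') (P : Set W') :
    latticeOf M (f '' P) = (latticeOf M' P).map (f.restrictScalars ℤ) := by
  ext x
  simp only [mem_latticeOf, direction_image, Submodule.mem_map]
  constructor
  · rintro ⟨hx, z, hz, rfl⟩
    exact ⟨z, ⟨(hM z).1 hx, hz⟩, rfl⟩
  · rintro ⟨z, ⟨h1, h2⟩, rfl⟩
    exact ⟨(hM z).2 h1, z, h2, rfl⟩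

/-- The degree is compatible with injective linear maps. -/
lemma degree_image (hf : Function.Injective f) {M : Submodule ℤ W} {M' : Submodule ℤ W'}
    (hM : ∀ x, f x ∈ M ↔ x ∈ M') (S : Finset (Set W')) (w : Set W → ℤ) (N : Submodule ℤ U)
    (π : W →ₗ[ℝ] U) (y : W') (u : U) :
    degree (S.image fun P => f '' P) w M N π (f y) u =
      degree S (fun P => w (f '' P)) M' N (π ∘ₗ f) y u := by
  unfold degree
  rw [Finset.sum_filter, Finset.sum_filter, Finset.sum_image hf.image_injective.injOn]
  refine Finset.sum_congr rfl fun P _ => ?_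
  have h1 : (f y ∈ f '' P ∧ u ∈ π '' tcone (f y) (f '' P)) ↔
      (y ∈ P ∧ u ∈ (π ∘ₗ f) '' tcone y P) := by
    rw [hf.mem_set_image, tcone_image hf, Set.image_image]
    rfl
  have h2 : mapIndex M N π (f '' P) = mapIndex M' N (π ∘ₗ f) P := by
    rw [mapIndex, mapIndex, latticeOf_image hM, ← Submodule.map_comp]
    rfl
  simp only [h1, h2]

lemma degree_congr {S : Finset (Set W)} {w w' : Set W → ℤ} (h : ∀ P ∈ S, w P = w' P)
    (M : Submodule ℤ W) (N : Submodule ℤ U) (π : W →ₗ[ℝ] U) (y : W) (u : U) :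
    degree S w M N π y u = degree S w' M N π y u :=
  Finset.sum_congr rfl fun P hP => by rw [h P (Finset.mem_filter.1 hP).1]

lemma degree_subset {S S' : Finset (Set W)} {w : Set W → ℤ} (h : S' ⊆ S)
    (hw : ∀ P ∈ S, P ∉ S' → w P = 0)
    (M : Submodule ℤ W) (N : Submodule ℤ U) (π : W →ₗ[ℝ] U) (y : W) (u : U) :
    degree S' w M N π y u = degree S w M N π y u := by
  refine Finset.sum_subset (Finset.filter_subset_filter _ h) fun P hP hP' => ?_
  simp only [Finset.mem_filter, not_and] at hP hP'
  rw [hw P hP.1 fun hmem => hP' hmem hP.2.1 hP.2.2, mul_zero]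

end Transport

/-! ### Intersections of the cells of two complexes -/

section CellInters

variable {V : Type*} [AddCommGroup V] [Module ℝ V] {L : Submodule ℤ V}

lemma IsRationalPolyhedron.inter {P Q : Set V} (hP : IsRationalPolyhedron L P)
    (hQ : IsRationalPolyhedron L Q) (hne : (P ∩ Q).Nonempty) : IsRationalPolyhedron L (P ∩ Q) := by
  obtain ⟨-, I, hI, rfl⟩ := hP
  obtain ⟨-, J, hJ, rfl⟩ := hQ
  refine ⟨hne, I ∪ J, ?_, ?_⟩
  · intro p hp
    rcases Finset.mem_union.1 hp with h | h
    · exact hI p h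
    · exact hJ p h
  · ext x
    simp only [Set.mem_inter_iff, Set.mem_ofPred_eq, Finset.mem_union, or_imp, forall_and]

/-- The two supporting functionals have a common minimiser, so their sum is minimal on `P ∩ Q`
exactly where both are. -/
lemma IsFace.inter {F P G Q : Set V} (hF : IsFace F P) (hG : IsFace G Q) (hne : (F ∩ G).Nonempty) :
    IsFace (F ∩ G) (P ∩ Q) := by
  obtain ⟨-, u, rfl⟩ := hF
  obtain ⟨-, u', rfl⟩ := hG
  refine ⟨hne, u + u', ?_⟩
  obtain ⟨z, hz, hz'⟩ := hne
  ext x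
  simp only [Set.mem_inter_iff, Set.mem_ofPred_eq, LinearMap.add_apply] at hz hz' ⊢
  constructor
  · rintro ⟨⟨h1, h2⟩, h3, h4⟩
    exact ⟨⟨h1, h3⟩, fun y hy => add_le_add (h2 y hy.1) (h4 y hy.2)⟩
  · rintro ⟨⟨h1, h2⟩, h3⟩
    have h4 := h3 z ⟨hz.1, hz'.1⟩
    have h5 := hz.2 x h1
    have h6 := hz'.2 x h2
    refine ⟨⟨h1, fun y hy => ?_⟩, h2, fun y hy => ?_⟩
    · have := hz.2 y hy; linarith
    · have := hz'.2 y hy; linarith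

/-- The non-empty intersections of a cell of `S` and a cell of `T`. -/
def cellInters {V : Type*} (S T : Finset (Set V)) : Finset (Set V) :=
  ((S ×ˢ T).image fun p => p.1 ∩ p.2).filter Set.Nonempty

lemma mem_cellInters {V : Type*} {S T : Finset (Set V)} {F : Set V} :
    F ∈ cellInters S T ↔ F.Nonempty ∧ ∃ P ∈ S, ∃ Q ∈ T, F = P ∩ Q := by
  simp only [cellInters, Finset.mem_filter, Finset.mem_image, Finset.mem_product, Prod.exists]
  constructor
  · rintro ⟨⟨P, Q, ⟨hP, hQ⟩, rfl⟩, hne⟩; exact ⟨hne, P, hP, Q, hQ, rfl⟩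
  · rintro ⟨hne, P, hP, Q, hQ, rfl⟩; exact ⟨⟨P, Q, ⟨hP, hQ⟩, rfl⟩, hne⟩

lemma IsPolyComplex.cellInters {S T : Finset (Set V)} (hS : IsPolyComplex L S)
    (hT : IsPolyComplex L T) : IsPolyComplex L (cellInters S T) where
  rational := by
    intro F hF
    obtain ⟨hne, P, hP, Q, hQ, rfl⟩ := mem_cellInters.1 hF
    exact (hS.rational P hP).inter (hT.rational Q hQ) hne
  face_mem := by
    intro F hF G hG
    obtain ⟨hne, P, hP, Q, hQ, rfl⟩ := mem_cellInters.1 hF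
    have hp := (hS.isPoly hP).inter (hT.isPoly hQ)
    obtain ⟨y, hy⟩ := (hG.isPoly hp).exists_relInt hG.1
    have hyPQ := hG.subset hy.1
    exact mem_cellInters.2 ⟨hG.1, _, hS.faceAt_mem hP hyPQ.1, _, hT.faceAt_mem hQ hyPQ.2, by
      rw [hG.eq_faceAt hy, faceAt_inter]⟩
  inter_face := by
    intro F hF G hG hne
    obtain ⟨-, P, hP, Q, hQ, rfl⟩ := mem_cellInters.1 hF
    obtain ⟨-, P', hP', Q', hQ', rfl⟩ := mem_cellInters.1 hG
    rw [Set.inter_inter_inter_comm] at hne ⊢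
    exact (hS.inter_face P hP P' hP' (hne.mono Set.inter_subset_left)).inter
      (hT.inter_face Q hQ Q' hQ' (hne.mono Set.inter_subset_right)) hne

lemma subset_left_of_mem_cellInters {S T : Finset (Set V)} (hS : IsPolyComplex L S) {F : Set V}
    (hF : F ∈ cellInters S T) {y : V} (hy : RelInt y F) {P : Set V} (hP : P ∈ S) (hyP : y ∈ P) :
    F ⊆ P := by
  obtain ⟨-, P', hP', Q, hQ, rfl⟩ := mem_cellInters.1 hF
  exact hS.subset_of_relInt_of_subset hP hP' hy Set.inter_subset_left hyP

lemma subset_right_of_mem_cellInters {S T : Finset (Set V)} (hT : IsPolyComplex L T) {F : Set V}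
    (hF : F ∈ cellInters S T) {y : V} (hy : RelInt y F) {Q : Set V} (hQ : Q ∈ T) (hyQ : y ∈ Q) :
    F ⊆ Q := by
  obtain ⟨-, P, hP, Q', hQ', rfl⟩ := mem_cellInters.1 hF
  exact hT.subset_of_relInt_of_subset hQ hQ' hy Set.inter_subset_right hyQ

end CellInters

/-! ### Multiplicities as degrees of the difference map -/

section LocalMultiplicity

variable {V : Type*} [AddCommGroup V] [Module ℝ V] {L : Submodule ℤ V}

/-- The difference map. -/
def diffMap (V : Type*) [AddCommGroup V] [Module ℝ V] : V × V →ₗ[ℝ] V :=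
  LinearMap.fst ℝ V V - LinearMap.snd ℝ V V

@[simp] lemma diffMap_apply (x : V × V) : diffMap V x = x.1 - x.2 := rfl

/-- The diagonal embedding. -/
def diagMap (V : Type*) [AddCommGroup V] [Module ℝ V] : V →ₗ[ℝ] V × V :=
  LinearMap.id.prod LinearMap.id

@[simp] lemma diagMap_apply (x : V) : diagMap V x = (x, x) := rfl

lemma diagMap_injective : Function.Injective (diagMap V) := fun _ _ h => congrArg Prod.fst h

lemma map_diffMap_direction_prod {P Q : Set V} (hP : P.Nonempty) (hQ : Q.Nonempty) :
    (direction (P ×ˢ Q)).map (diffMap V) = direction P ⊔ direction Q := by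
  rw [direction_prod hP hQ]
  ext x
  simp only [Submodule.mem_map, Submodule.mem_prod, Submodule.mem_sup, diffMap_apply, Prod.exists]
  constructor
  · rintro ⟨y, z, ⟨hy, hz⟩, rfl⟩
    exact ⟨y, hy, -z, Submodule.neg_mem _ hz, by abel⟩
  · rintro ⟨y, hy, z, hz, rfl⟩
    exact ⟨y, -z, ⟨hy, Submodule.neg_mem _ hz⟩, by abel⟩

lemma mapIndex_diffMap_prod {P Q : Set V} (hP : P.Nonempty) (hQ : Q.Nonempty) :
    mapIndex (L.prod L) L (diffMap V) (P ×ˢ Q) = latIndex (latticeOf L P ⊔ latticeOf L Q) L := by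
  rw [mapIndex, latticeOf_prod hP hQ]
  congr 1
  ext x
  simp only [Submodule.mem_map, Submodule.mem_prod, Submodule.mem_sup, Prod.exists]
  constructor
  · rintro ⟨y, z, ⟨hy, hz⟩, rfl⟩
    exact ⟨y, hy, -z, Submodule.neg_mem _ hz, by simp [sub_eq_add_neg]⟩
  · rintro ⟨y, hy, z, hz, rfl⟩
    exact ⟨y, -z, ⟨hy, Submodule.neg_mem _ hz⟩, by simp⟩

lemma mem_diffMap_image_tcone {P Q : Set V} {y v : V} :
    v ∈ diffMap V '' tcone (y, y) (P ×ˢ Q) ↔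
      (tcone y P ∩ (fun x => x + v) '' tcone y Q).Nonempty := by
  rw [tcone_prod]
  constructor
  · rintro ⟨⟨z, z'⟩, ⟨hz, hz'⟩, rfl⟩
    exact ⟨z, hz, z', hz', by simp⟩
  · rintro ⟨_, hz, z', hz', rfl⟩
    exact ⟨(z' + v, z'), ⟨hz, hz'⟩, by simp⟩

lemma map_diagMap_le_ker (D : Submodule ℝ V) : D.map (diagMap V) ≤ LinearMap.ker (diffMap V) := by
  rintro _ ⟨z, -, rfl⟩
  simp

lemma finrank_map_diagMap (D : Submodule ℝ V) :
    Module.finrank ℝ (D.map (diagMap V)) = Module.finrank ℝ D :=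
  (Submodule.equivMapOfInjective _ diagMap_injective D).finrank_eq.symm

lemma exists_isGenericFor {W U : Type*} [AddCommGroup W] [Module ℝ W] [AddCommGroup U] [Module ℝ U]
    (S : Finset (Set W)) (π : W →ₗ[ℝ] U) : ∃ u, IsGenericFor S π u := by
  obtain ⟨u, hu⟩ := exists_forall_notMem (S.image fun P => (direction P).map π)
  exact ⟨u, fun P hP => hu _ (Finset.mem_image_of_mem _ hP)⟩

variable [FiniteDimensional ℝ V]

/-- The multiplicity of the stable intersection at a point, with a given displacement vector. -/
def localMult (a b : TropicalComplex L) (v y : V) : ℤ :=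
  degree (cellsOfDim (a.prod b).cells (a.prod b).dim) (a.prod b).weight (L.prod L) L (diffMap V)
    (y, y) v

/-- Reduction to the diagonal: the cone of `P` meets the displaced cone of `Q` when `v` is a
difference of vectors in the two cones, and `L_P + L_Q` is the image of the product lattice under
the difference map. -/
lemma displacedMult_eq_localMult {a b : TropicalComplex L} {F : Set V} {y : V} (hy : RelInt y F)
    (ha : ∀ P ∈ a.cells, y ∈ P → F ⊆ P) (hb : ∀ Q ∈ b.cells, y ∈ Q → F ⊆ Q) (v : V) :
    TropicalComplex.displacedMult a b v F = localMult a b v y := by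
  unfold TropicalComplex.displacedMult localMult degree
  rw [Finset.sum_filter, Finset.sum_filter, a.sum_cellsOfDim_prod b]
  refine Finset.sum_congr rfl fun p hp => ?_
  obtain ⟨hP, hQ⟩ := Finset.mem_product.1 hp
  have hP := (a.mem_maxCells.1 hP).1
  have hQ := (b.mem_maxCells.1 hQ).1
  rw [mapIndex_diffMap_prod (a.nonempty hP) (b.nonempty hQ), a.weight_prod b hP hQ,
    mem_diffMap_image_tcone]
  have h1 : F ⊆ p.1 ↔ y ∈ p.1 := ⟨fun h => h hy.1, ha _ hP⟩
  have h2 : F ⊆ p.2 ↔ y ∈ p.2 := ⟨fun h => h hy.1, hb _ hQ⟩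
  by_cases h : y ∈ p.1 ∧ y ∈ p.2
  · rw [hy.starCone_eq (h1.2 h.1) (a.isPoly hP), hy.starCone_eq (h2.2 h.2) (b.isPoly hQ)]
    simp only [h1, h2, Set.mem_prod, and_assoc, mul_assoc, latIndex]
  · rw [if_neg (by rw [h1, h2]; tauto), if_neg (by simp only [Set.mem_prod]; tauto)]

lemma displacedMult_eq_of_mem_cellInters {a b : TropicalComplex L} {F : Set V} {y : V}
    (hF : F ∈ cellInters a.cells b.cells) (hy : RelInt y F) (v : V) :
    TropicalComplex.displacedMult a b v F = localMult a b v y :=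
  displacedMult_eq_localMult hy
    (fun _ hP => subset_left_of_mem_cellInters a.isPolyComplex hF hy hP)
    (fun _ hQ => subset_right_of_mem_cellInters b.isPolyComplex hF hy hQ) v

lemma isGeneric_iff {a b : TropicalComplex L} {v : V} :
    TropicalComplex.IsGeneric a b v ↔ IsGenericFor (a.prod b).cells (diffMap V) v := by
  constructor
  · intro h R hR
    obtain ⟨P, hP, Q, hQ, rfl⟩ := mem_prodCells.1 hR
    rw [map_diffMap_direction_prod (a.nonempty hP) (b.nonempty hQ)]
    exact h P hP Q hQ
  · intro h P hP Q hQ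
    have := h _ (mem_prodCells.2 ⟨P, hP, Q, hQ, rfl⟩)
    rwa [map_diffMap_direction_prod (a.nonempty hP) (b.nonempty hQ)] at this

lemma exists_isGeneric (a b : TropicalComplex L) : ∃ v, TropicalComplex.IsGeneric a b v := by
  simp only [isGeneric_iff]
  exact exists_isGenericFor _ _

/-- Cells through an interior point of `F` contain `F`, so all product cones there contain the
diagonal copy of `direction F`. This is the space `K` of the degree theorems, and it lies in the
kernel of the difference map. -/
lemma hasLineality_diag {a b : TropicalComplex L} {F : Set V} {y : V}
    (hF : F ∈ cellInters a.cells b.cells) (hy : RelInt y F) :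
    HasLineality (a.prod b).cells (y, y) ((direction F).map (diagMap V)) := by
  rintro R hR hyR _ ⟨z, hz, rfl⟩
  obtain ⟨P, hP, Q, hQ, rfl⟩ := mem_prodCells.1 hR
  rw [tcone_prod]
  exact ⟨tcone_mono _ (subset_left_of_mem_cellInters a.isPolyComplex hF hy hP hyR.1) (hy.2 z hz),
    tcone_mono _ (subset_right_of_mem_cellInters b.isPolyComplex hF hy hQ hyR.2) (hy.2 z hz)⟩

/-- The expected dimension of `F` is precisely what makes the dimension of `a × b` equal to the
dimension of the target plus that of `K`. -/
lemma localMult_eq_of_isGeneric (hL : IsFullLattice L) {a b : TropicalComplex L} {F : Set V} {y : V}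
    (hF : F ∈ cellInters a.cells b.cells) (hy : RelInt y F)
    (hd : polyDim F = a.dim + b.dim - Module.finrank ℝ V) {v v' : V}
    (hv : TropicalComplex.IsGeneric a b v) (hv' : TropicalComplex.IsGeneric a b v') :
    localMult a b v y = localMult a b v' y := by
  refine degree_eq_of_generic (hL.prod hL) hL (a.prod b) (fun x hx => L.sub_mem hx.1 hx.2)
    (map_diagMap_le_ker _) (hasLineality_diag hF hy) ?_ (isGeneric_iff.1 hv) (isGeneric_iff.1 hv')
  rw [finrank_map_diagMap]
  change a.dim + b.dim = _
  unfold polyDim at hd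
  omega

/-- A contributing pair would have full image under the difference map and a kernel containing the
diagonal of `direction F`; for `F` this large its dimension would exceed `a.dim + b.dim`. -/
lemma localMult_eq_zero {a b : TropicalComplex L} {F : Set V} {y : V}
    (hF : F ∈ cellInters a.cells b.cells) (hy : RelInt y F)
    (hd : a.dim + b.dim - Module.finrank ℝ V < polyDim F) {v : V}
    (hv : TropicalComplex.IsGeneric a b v) : localMult a b v y = 0 := by
  refine Finset.sum_eq_zero fun R hR => ?_
  exfalso
  simp only [Finset.mem_filter, mem_cellsOfDim] at hR
  obtain ⟨⟨hR, hRd⟩, hyR, hvR⟩ := hR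
  have hS := (a.prod b).isPolyComplex
  have htop := (isGeneric_iff.1 hv).map_eq_top hR (hS.isPoly hR) hvR
  have := le_finrank_of_map_eq_top (map_diagMap_le_ker _)
    ((hasLineality_diag hF hy).le_direction hS hR hyR) htop
  rw [finrank_map_diagMap] at this
  change _ = a.dim + b.dim at hRd
  unfold polyDim at hd hRd
  omega

end LocalMultiplicity

/-! ### Existence of the stable intersection of two complexes -/

section Existence

variable {V : Type*} [AddCommGroup V] [Module ℝ V] {L : Submodule ℤ V}

/-- The maximal cells of the stable intersection. -/
def stableMaxCells (a b : TropicalComplex L) (v : V) : Finset (Set V) :=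
  (cellInters a.cells b.cells).filter fun F =>
    polyDim F = a.dim + b.dim - Module.finrank ℝ V ∧ TropicalComplex.displacedMult a b v F ≠ 0

lemma mem_stableMaxCells {a b : TropicalComplex L} {v : V} {F : Set V} :
    F ∈ stableMaxCells a b v ↔ F ∈ cellInters a.cells b.cells ∧
      polyDim F = a.dim + b.dim - Module.finrank ℝ V ∧
        TropicalComplex.displacedMult a b v F ≠ 0 := by
  simp [stableMaxCells]

/-- The cells of the stable intersection. -/
def stableCells (a b : TropicalComplex L) (v : V) : Finset (Set V) :=
  (cellInters a.cells b.cells).filter fun G => ∃ F ∈ stableMaxCells a b v, G ⊆ F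

lemma mem_stableCells {a b : TropicalComplex L} {v : V} {G : Set V} :
    G ∈ stableCells a b v ↔ G ∈ cellInters a.cells b.cells ∧ ∃ F ∈ stableMaxCells a b v, G ⊆ F := by
  simp [stableCells]

lemma isPolyComplex_stableCells (a b : TropicalComplex L) (v : V) :
    IsPolyComplex L (stableCells a b v) := by
  have h := a.isPolyComplex.cellInters b.isPolyComplex
  constructor
  · exact fun P hP => h.rational P (mem_stableCells.1 hP).1
  · intro P hP F hF
    obtain ⟨hP, G, hG, hPG⟩ := mem_stableCells.1 hP
    exact mem_stableCells.2 ⟨h.face_mem P hP F hF, G, hG, hF.subset.trans hPG⟩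
  · exact fun P hP Q hQ => h.inter_face P (mem_stableCells.1 hP).1 Q (mem_stableCells.1 hQ).1

lemma prod_inter_ker_diffMap (P Q : Set V) :
    P ×ˢ Q ∩ (LinearMap.ker (diffMap V) : Set (V × V)) = diagMap V '' (P ∩ Q) := by
  ext ⟨x, y⟩
  simp only [Set.mem_inter_iff, Set.mem_prod, SetLike.mem_coe, LinearMap.mem_ker, diffMap_apply,
    sub_eq_zero, Set.mem_image, diagMap_apply, Prod.mk.injEq]
  constructor
  · rintro ⟨⟨hx, hy⟩, rfl⟩; exact ⟨x, ⟨hx, hy⟩, rfl, rfl⟩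
  · rintro ⟨z, ⟨hx, hy⟩, rfl, rfl⟩; exact ⟨⟨hx, hy⟩, rfl⟩

lemma map_eq_bot_of_ne_top {W : Type*} [AddCommGroup W] [Module ℝ W] (D : Submodule ℝ W)
    (ψ : Module.Dual ℝ W) (h : D.map ψ ≠ ⊤) : D.map ψ = ⊥ :=
  (eq_bot_or_eq_top _).resolve_right h

lemma TropicalComplex.cells_eq_of_maxCells {c c' : TropicalComplex L}
    (h : c.maxCells = c'.maxCells) : c.cells = c'.cells := by
  have key : ∀ c c' : TropicalComplex L, c.maxCells = c'.maxCells → c.cells ⊆ c'.cells := by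
    intro c c' h P hP
    obtain ⟨Q, hQ, hPQ, hd⟩ := c.pure P hP
    have hQ' := c.mem_maxCells.2 ⟨hQ, hd⟩
    rw [h, mem_maxCells] at hQ'
    exact c'.face_mem Q hQ'.1 P (c.isPolyComplex.isFace_of_subset hP hQ hPQ)
  exact (key c c' h).antisymm (key c' c h.symm)

lemma kerSlices_prodCells (S T : Finset (Set V)) (k : ℤ) :
    kerSlices (prodCells S T) (diffMap V) k =
      (cellsOfDim (cellInters S T) k).image fun F => diagMap V '' F := by
  ext E
  simp only [kerSlices, Finset.mem_filter, Finset.mem_image, mem_prodCells, mem_cellsOfDim,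
    mem_cellInters]
  constructor
  · rintro ⟨⟨_, ⟨P, hP, Q, hQ, rfl⟩, rfl⟩, hne, hd⟩
    rw [prod_inter_ker_diffMap] at hne hd ⊢
    rw [polyDim_image diagMap_injective] at hd
    exact ⟨_, ⟨⟨Set.image_nonempty.1 hne, P, hP, Q, hQ, rfl⟩, hd⟩, rfl⟩
  · rintro ⟨_, ⟨⟨hne, P, hP, Q, hQ, rfl⟩, hd⟩, rfl⟩
    rw [polyDim_image diagMap_injective, Set.image_nonempty]
    exact ⟨⟨_, ⟨P, hP, Q, hQ, rfl⟩, prod_inter_ker_diffMap P Q⟩, hne, hd⟩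

variable [FiniteDimensional ℝ V]

lemma cellsOfDim_stableCells (a b : TropicalComplex L) (v : V) :
    cellsOfDim (stableCells a b v) (a.dim + b.dim - Module.finrank ℝ V) = stableMaxCells a b v := by
  ext F
  rw [mem_cellsOfDim, mem_stableCells]
  constructor
  · rintro ⟨⟨hF, G, hG, hFG⟩, hd⟩
    obtain ⟨hG', hGd, -⟩ := mem_stableMaxCells.1 hG
    rwa [(a.isPolyComplex.cellInters b.isPolyComplex).eq_of_polyDim hF hG' hFG (by omega)]
  · intro hF
    exact ⟨⟨(mem_stableMaxCells.1 hF).1, F, hF, subset_rfl⟩, (mem_stableMaxCells.1 hF).2.1⟩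

/-- The stable intersection is balanced. -/
lemma stableCells_balanced (hL : IsFullLattice L) (a b : TropicalComplex L) {v : V}
    (hv : TropicalComplex.IsGeneric a b v) {G : Set V} (hG : G ∈ stableCells a b v)
    (hd : polyDim G = a.dim + b.dim - Module.finrank ℝ V - 1) :
    ∃ u : Set V → V, (∀ P ∈ stableCells a b v, polyDim P = a.dim + b.dim - Module.finrank ℝ V →
        G ⊆ P → IsPrimitiveGenerator L P G (u P)) ∧
      ∑ P ∈ stableCells a b v with (polyDim P = a.dim + b.dim - Module.finrank ℝ V ∧ G ⊆ P),
        TropicalComplex.displacedMult a b v P • u P ∈ direction G := by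
  have hS := isPolyComplex_stableCells a b v
  obtain ⟨y, hy⟩ := (hS.isPoly hG).exists_relInt (hS.rational G hG).1
  refine balanced_of_degree hL hS hG hd hy fun ψ hψ hψG => ?_
  have hGI := (mem_stableCells.1 hG).1
  set X := a.prod b
  set Ψ : V × V →ₗ[ℝ] ℝ := ψ ∘ₗ LinearMap.fst ℝ V V
  -- The target of `Ψ` is a line, so a proper image is zero and every non-zero value is generic.
  have hgen : ∀ s : ℝ, s ≠ 0 → IsGenericOnSlices X.cells (diffMap V) Ψ s := by
    intro s hs P _ hne hmem
    rw [map_eq_bot_of_ne_top _ _ hne] at hmem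
    exact hs hmem
  have hK := map_diagMap_le_ker (direction G)
  have hK₂ : (direction G).map (diagMap V) ≤ LinearMap.ker Ψ := by
    rintro _ ⟨z, hz, rfl⟩
    exact hψG z hz
  have hlin := hasLineality_diag hGI hy
  have hΨ : ∀ x ∈ L.prod L, Ψ x ∈ intLattice := fun x hx => mem_intLattice.2 (hψ _ hx.1)
  have hdiff : ∀ x ∈ L.prod L, diffMap V x ∈ L := fun x hx => L.sub_mem hx.1 hx.2
  have hk : X.dim = Module.finrank ℝ V + Module.finrank ℝ ℝ +
      Module.finrank ℝ ((direction G).map (diagMap V)) := by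
    rw [finrank_map_diagMap, Module.finrank_self]
    unfold polyDim at hd
    change a.dim + b.dim = _
    push_cast
    omega
  -- Slicing `a × b` with the kernel of the difference map gives the cells of the intersection,
  -- weighted by their multiplicities. So the degree of `ψ` on the stable intersection is a degree
  -- on the product, which is known to be balanced.
  have key : ∀ s : ℝ, s ≠ 0 → ∀ᶠ ε : ℝ in 𝓝[>] 0,
      degree (cellsOfDim X.cells X.dim) X.weight (L.prod L) (L.prod intLattice)
        ((diffMap V).prod Ψ) (y, y) (ε • v, s) =
      degree (cellsOfDim (stableCells a b v) (a.dim + b.dim - Module.finrank ℝ V))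
        (TropicalComplex.displacedMult a b v) L intLattice ψ y s := by
    intro s hs
    have h1 := eventually_degree_prod_eq X.isPolyComplex X.weight hdiff hΨ (isGeneric_iff.1 hv)
      (hgen s hs) hK hK₂ hlin hk (by simp)
      (m := fun E => TropicalComplex.displacedMult a b v (Prod.fst '' E)) (by
        intro E hE x hx
        change E ∈ kerSlices (prodCells a.cells b.cells) _ _ at hE
        rw [kerSlices_prodCells] at hE
        obtain ⟨F, hF, rfl⟩ := Finset.mem_image.1 hE
        obtain ⟨x, -, rfl⟩ := hx.1
        rw [relInt_image diagMap_injective] at hx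
        have : Prod.fst '' (diagMap V '' F) = F := by simp [Set.image_image]
        rw [this, displacedMult_eq_of_mem_cellInters (mem_cellsOfDim.1 hF).1 hx]
        rfl)
    filter_upwards [h1] with ε hε
    rw [hε]
    change degree (kerSlices (prodCells a.cells b.cells) _ _) _ _ _ _ (diagMap V y) _ = _
    rw [kerSlices_prodCells, degree_image diagMap_injective (M' := L) (by simp),
      cellsOfDim_stableCells]
    have : ∀ F : Set V, Prod.fst '' (diagMap V '' F) = F := fun F => by simp [Set.image_image]
    simp only [this]
    symm
    refine degree_subset ?_ ?_ _ _ _ _ _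
    · intro F hF
      obtain ⟨h1, h2, -⟩ := mem_stableMaxCells.1 hF
      exact mem_cellsOfDim.2 ⟨h1, h2⟩
    -- An intersection of the expected dimension that is not a maximal cell has multiplicity `0`, so
    -- adding it changes nothing.
    · intro F hF hF'
      obtain ⟨h1, h2⟩ := mem_cellsOfDim.1 hF
      by_contra hne
      exact hF' (mem_stableMaxCells.2 ⟨h1, h2, hne⟩)
  have hgenp : ∀ s : ℝ, s ≠ 0 → ∀ᶠ ε : ℝ in 𝓝[>] 0,
      IsGenericFor X.cells ((diffMap V).prod Ψ) (ε • v, s) :=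
    fun s hs => eventually_isGenericFor_prod (isGeneric_iff.1 hv) (hgen s hs)
  have h1 : (1 : ℝ) ≠ 0 := one_ne_zero
  have h2 : (-1 : ℝ) ≠ 0 := by norm_num
  -- With one `ε` for both signs, the two degrees are taken over generic points for the same map on
  -- the product; the invariance of the degree identifies them.
  obtain ⟨ε, ⟨h3, h4⟩, h5, h6⟩ := (((key 1 h1).and (key (-1) h2)).and
    ((hgenp 1 h1).and (hgenp (-1) h2))).exists
  rw [← h3, ← h4]
  refine degree_eq_of_generic (hL.prod hL) (hL.prod isFullLattice_intLattice) X
    (fun x hx => ⟨hdiff x hx, hΨ x hx⟩) (K := (direction G).map (diagMap V)) ?_ hlin ?_ h5 h6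
  · rw [LinearMap.ker_prod]; exact le_inf hK hK₂
  · rw [hk, Module.finrank_prod]; push_cast; ring

/-- The stable intersection of two complexes, for a given generic displacement vector. -/
def stableComplex (hL : IsFullLattice L) (a b : TropicalComplex L) {v : V}
    (hv : TropicalComplex.IsGeneric a b v) : TropicalComplex L where
  dim := a.dim + b.dim - Module.finrank ℝ V
  cells := stableCells a b v
  weight := TropicalComplex.displacedMult a b v
  rational := (isPolyComplex_stableCells a b v).rational
  face_mem := (isPolyComplex_stableCells a b v).face_mem
  inter_face := (isPolyComplex_stableCells a b v).inter_face
  pure := by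
    intro P hP
    obtain ⟨-, F, hF, hPF⟩ := mem_stableCells.1 hP
    rw [← cellsOfDim_stableCells, mem_cellsOfDim] at hF
    exact ⟨F, hF.1, hPF, hF.2⟩
  weight_ne_zero := by
    intro P hP hd
    have := mem_cellsOfDim.2 ⟨hP, hd⟩
    rw [cellsOfDim_stableCells] at this
    exact (mem_stableMaxCells.1 this).2.2
  balanced := fun _ hG hd => stableCells_balanced hL a b hv hG hd

lemma maxCells_stableComplex (hL : IsFullLattice L) (a b : TropicalComplex L) {v : V}
    (hv : TropicalComplex.IsGeneric a b v) :
    (stableComplex hL a b hv).maxCells = stableMaxCells a b v :=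
  cellsOfDim_stableCells a b v

lemma displacedMult_eq_of_isGeneric (hL : IsFullLattice L) {a b : TropicalComplex L} {F : Set V}
    (hF : F ∈ cellInters a.cells b.cells)
    (hd : polyDim F = a.dim + b.dim - Module.finrank ℝ V) {v v' : V}
    (hv : TropicalComplex.IsGeneric a b v) (hv' : TropicalComplex.IsGeneric a b v') :
    TropicalComplex.displacedMult a b v F = TropicalComplex.displacedMult a b v' F := by
  have h := a.isPolyComplex.cellInters b.isPolyComplex
  obtain ⟨y, hy⟩ := (h.isPoly hF).exists_relInt (h.rational F hF).1
  rw [displacedMult_eq_of_mem_cellInters hF hy, displacedMult_eq_of_mem_cellInters hF hy,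
    localMult_eq_of_isGeneric hL hF hy hd hv hv']

lemma isStableIntersection_stableComplex (hL : IsFullLattice L) (a b : TropicalComplex L) {v : V}
    (hv : TropicalComplex.IsGeneric a b v) :
    TropicalComplex.IsStableIntersection a b (stableComplex hL a b hv) := by
  refine ⟨rfl, fun v' hv' => ⟨fun F => ?_, fun F hF => ?_⟩⟩
  · rw [maxCells_stableComplex, mem_stableMaxCells, mem_cellInters]
    constructor
    · rintro ⟨⟨hne, h⟩, hd, hm⟩
      rw [displacedMult_eq_of_isGeneric hL (mem_cellInters.2 ⟨hne, h⟩) hd hv hv'] at hm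
      exact ⟨h, hne, hd, hm⟩
    · rintro ⟨h, hne, hd, hm⟩
      rw [displacedMult_eq_of_isGeneric hL (mem_cellInters.2 ⟨hne, h⟩) hd hv' hv] at hm
      exact ⟨⟨hne, h⟩, hd, hm⟩
  · rw [maxCells_stableComplex, mem_stableMaxCells] at hF
    exact displacedMult_eq_of_isGeneric hL hF.1 hF.2.1 hv hv'

lemma TropicalComplex.mk_eq_of_maxCells {c c' : TropicalComplex L} (hd : c.dim = c'.dim)
    (h : c.maxCells = c'.maxCells) (hw : ∀ F ∈ c.maxCells, c.weight F = c'.weight F) :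
    TropicalCycle.mk c = TropicalCycle.mk c' := by
  have hc := cells_eq_of_maxCells h
  refine Quot.sound ⟨hd, ?_, fun P hP => ⟨P, hc ▸ hP, subset_rfl⟩, fun P' hP' P hP hPP' => ?_⟩
  · unfold support; rw [hc]
  · rw [hw P' hP']
    rw [h, mem_maxCells] at hP'
    rw [mem_maxCells] at hP
    rw [c'.isPolyComplex.eq_of_polyDim hP'.1 hP.1 hPP' (by omega)]

lemma TropicalComplex.IsStableIntersection.mk_eq {a b c c' : TropicalComplex L}
    (h : IsStableIntersection a b c) (h' : IsStableIntersection a b c') :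
    TropicalCycle.mk c = TropicalCycle.mk c' := by
  obtain ⟨v, hv⟩ := exists_isGeneric a b
  have hd : c.dim = c'.dim := h.1.trans h'.1.symm
  have hm : c.maxCells = c'.maxCells := by
    ext F
    rw [(h.2 v hv).1, (h'.2 v hv).1, hd]
  exact mk_eq_of_maxCells hd hm fun F hF =>
    ((h.2 v hv).2 F hF).trans ((h'.2 v hv).2 F (hm ▸ hF)).symm

end Existence

/-! ### The stable intersection of cycles -/

section Invariance

variable {V : Type*} [AddCommGroup V] [Module ℝ V] {L : Submodule ℤ V}

/-- A polyhedron in the support of a complex: near a given point it meets the relative interior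
of a cell which is at least as large. -/
lemma IsPolyComplex.exists_relInt_cell {S : Finset (Set V)} (hS : IsPolyComplex L S) {F : Set V}
    (hF : IsPoly F) (hsub : F ⊆ ⋃ P ∈ S, P) {y : V} (hy : y ∈ F) :
    ∃ G ∈ S, y ∈ G ∧ direction F ≤ direction G ∧ ∃ x, RelInt x F ∧ RelInt x G := by
  -- The direction `z` avoids the linear space of every cell that does not contain `direction F`, so
  -- the cell reached along `z` must contain it.
  obtain ⟨z, -, hzT, hz⟩ := hF.exists_generic_direction hy (S.image direction)
  obtain ⟨δ, h1, h2⟩ := (hz.and (hS.eventually_mem_iff y z)).exists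
  obtain ⟨P, hP, hxP⟩ := Set.mem_iUnion₂.1 (hsub h1.1)
  have hG := hS.faceAt_mem hP hxP
  have hGp := hS.isPoly hG
  have hx := (hS.isPoly hP).relInt_faceAt hxP
  have hzG := (h2 _ hG).1 hx.1
  refine ⟨_, hG, hGp.mem_of_mem_tcone hzG, ?_, _, h1, hx⟩
  by_contra hle
  exact hzT _ (Finset.mem_image_of_mem _ hG) hle (hGp.mem_direction_of_mem_tcone hzG)

lemma RelInt.of_subset {x : V} {F G : Set V} (hx : RelInt x F) (h : F ⊆ G)
    (hd : direction G ≤ direction F) : RelInt x G :=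
  ⟨h hx.1, fun z hz => tcone_mono x h (hx.2 z (hd hz))⟩

lemma TropicalComplex.mem_support {a : TropicalComplex L} {x : V} :
    x ∈ a.support ↔ ∃ P ∈ a.cells, x ∈ P := by simp [support]

lemma exists_isGeneric_pair (a a' b : TropicalComplex L) :
    ∃ v, TropicalComplex.IsGeneric a b v ∧ TropicalComplex.IsGeneric a' b v := by
  obtain ⟨v, hv⟩ := exists_forall_notMem
    (((a.cells ∪ a'.cells) ×ˢ b.cells).image fun p => direction p.1 ⊔ direction p.2)
  refine ⟨v, fun P hP Q hQ => hv _ (Finset.mem_image.2 ⟨(P, Q), ?_, rfl⟩),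
    fun P hP Q hQ => hv _ (Finset.mem_image.2 ⟨(P, Q), ?_, rfl⟩)⟩ <;>
  simp [hP, hQ]

lemma displacedMult_comm (a b : TropicalComplex L) (v : V) (F : Set V) :
    TropicalComplex.displacedMult b a v F = TropicalComplex.displacedMult a b (-v) F := by
  unfold TropicalComplex.displacedMult
  refine Finset.sum_nbij' Prod.swap Prod.swap ?_ ?_ (fun _ _ => rfl) (fun _ _ => rfl) ?_
  · rintro ⟨Q, P⟩ h
    simp only [Finset.mem_filter, Finset.mem_product, Prod.swap] at h ⊢
    obtain ⟨⟨h1, h2⟩, h3, h4, _, h5, x, hx, rfl⟩ := h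
    exact ⟨⟨h2, h1⟩, h4, h3, x, hx, x + v, h5, by simp⟩
  · rintro ⟨P, Q⟩ h
    simp only [Finset.mem_filter, Finset.mem_product, Prod.swap] at h ⊢
    obtain ⟨⟨h1, h2⟩, h3, h4, _, h5, x, hx, rfl⟩ := h
    exact ⟨⟨h2, h1⟩, h4, h3, x, hx, x + -v, h5, by simp⟩
  · rintro ⟨Q, P⟩ h
    simp only [Prod.swap]
    rw [sup_comm]
    ring

lemma isGeneric_comm {a b : TropicalComplex L} {v : V} :
    TropicalComplex.IsGeneric b a v ↔ TropicalComplex.IsGeneric a b (-v) := by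
  constructor
  · intro h P hP Q hQ
    rw [neg_mem_iff, sup_comm]
    exact h Q hQ P hP
  · intro h Q hQ P hP
    have := h P hP Q hQ
    rwa [neg_mem_iff, sup_comm] at this

lemma TropicalComplex.IsStableIntersection.symm {a b c : TropicalComplex L}
    (h : IsStableIntersection a b c) : IsStableIntersection b a c := by
  refine ⟨by rw [h.1]; ring, fun v hv => ?_⟩
  obtain ⟨h1, h2⟩ := h.2 (-v) (isGeneric_comm.1 hv)
  simp only [displacedMult_comm a b]
  refine ⟨fun F => (h1 F).trans (and_congr_left fun _ => ?_), h2⟩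
  constructor
  · rintro ⟨P, hP, Q, hQ, rfl⟩; exact ⟨Q, hQ, P, hP, Set.inter_comm _ _⟩
  · rintro ⟨Q, hQ, P, hP, rfl⟩; exact ⟨P, hP, Q, hQ, Set.inter_comm _ _⟩

variable [FiniteDimensional ℝ V]

/-- A refinement of `a` refines `a × b`, so this is the invariance of the degree of the difference
map under refinement. -/
lemma localMult_eq_of_refines {a a' b : TropicalComplex L} (h : a'.Refines a) {F : Set V} {y : V}
    (hF : F ∈ cellInters a'.cells b.cells) (hy : RelInt y F)
    (hd : polyDim F = a'.dim + b.dim - Module.finrank ℝ V) {v : V}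
    (hv : TropicalComplex.IsGeneric a b v) (hv' : TropicalComplex.IsGeneric a' b v) :
    localMult a' b v y = localMult a b v y := by
  obtain ⟨hdim, hsupp, hcells, hw⟩ := h
  have hdim' : (a'.prod b).dim = (a.prod b).dim := by
    change a'.dim + b.dim = a.dim + b.dim
    rw [hdim]
  unfold localMult
  rw [hdim']
  refine degree_eq_of_refines (a.prod b).isPolyComplex (a'.prod b).isPolyComplex (a.prod b).pure
    ?_ ?_ ?_ (map_diagMap_le_ker _) (hasLineality_diag hF hy) ?_ (isGeneric_iff.1 hv)
    (isGeneric_iff.1 hv')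
  · intro R hR
    obtain ⟨P', hP', Q, hQ, rfl⟩ := mem_prodCells.1 hR
    obtain ⟨P, hP, hPP'⟩ := hcells P' hP'
    exact ⟨_, mem_prodCells.2 ⟨P, hP, Q, hQ, rfl⟩, Set.prod_mono hPP' subset_rfl⟩
  · intro R hR x hx
    obtain ⟨P, hP, Q, hQ, rfl⟩ := mem_prodCells.1 hR
    have h1 : x.1 ∈ a.support := TropicalComplex.mem_support.2 ⟨P, hP, hx.1⟩
    rw [← hsupp, TropicalComplex.mem_support] at h1
    obtain ⟨P', hP', hxP'⟩ := h1
    exact Set.mem_iUnion₂.2 ⟨_, mem_prodCells.2 ⟨P', hP', Q, hQ, rfl⟩, hxP', hx.2⟩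
  · intro R' hR' R hR hd' hd'' hsub
    obtain ⟨P', hP', Q', hQ', rfl⟩ := mem_prodCells.1 hR'
    obtain ⟨P, hP, Q, hQ, rfl⟩ := mem_prodCells.1 hR
    rw [Set.prod_subset_prod_iff' ((a'.nonempty hP').prod (b.nonempty hQ'))] at hsub
    rw [a'.weight_prod b hP' hQ', a.weight_prod b hP hQ]
    rw [← hdim'] at hd'
    have h1 := (polyDim_prod_eq_iff hP' hQ').1 hd'
    have h2 := (polyDim_prod_eq_iff hP hQ).1 hd''
    rw [hw P' (a'.mem_maxCells.2 ⟨hP', h1.1⟩) P (a.mem_maxCells.2 ⟨hP, h2.1⟩) hsub.1,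
      b.isPolyComplex.eq_of_polyDim hQ' hQ hsub.2 (by omega)]
  · rw [finrank_map_diagMap, ← hdim']
    change a'.dim + b.dim = _
    unfold polyDim at hd
    omega

lemma mem_stableMaxCells_of_localMult {a b : TropicalComplex L} {v : V}
    (hv : TropicalComplex.IsGeneric a b v) {F : Set V} (hF : F ∈ cellInters a.cells b.cells)
    {x : V} (hx : RelInt x F) (hd : a.dim + b.dim - Module.finrank ℝ V ≤ polyDim F)
    (hm : localMult a b v x ≠ 0) : F ∈ stableMaxCells a b v := by
  refine mem_stableMaxCells.2 ⟨hF, ?_, ?_⟩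
  · by_contra hne
    exact hm (localMult_eq_zero hF hx (by omega) hv)
  · rwa [displacedMult_eq_of_mem_cellInters hF hx]

/-- With a displacement vector generic for both structures, local multiplicities at a common
interior point agree. So the maximal cells of the two stable intersections cover each other and
carry equal weights. -/
lemma stableComplex_refines (hL : IsFullLattice L) {a a' b : TropicalComplex L} (h : a'.Refines a)
    {v : V} (hv : TropicalComplex.IsGeneric a b v) (hv' : TropicalComplex.IsGeneric a' b v) :
    (stableComplex hL a' b hv').Refines (stableComplex hL a b hv) := by
  have hS := a.isPolyComplex.cellInters b.isPolyComplex
  have hS' := a'.isPolyComplex.cellInters b.isPolyComplex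
  have hdim := h.1
  have hcell : ∀ F' ∈ cellInters a'.cells b.cells, ∃ F ∈ cellInters a.cells b.cells, F' ⊆ F := by
    intro F' hF'
    obtain ⟨hne, P', hP', Q, hQ, rfl⟩ := mem_cellInters.1 hF'
    obtain ⟨P, hP, hPP'⟩ := h.2.2.1 P' hP'
    have hsub := Set.inter_subset_inter_left Q hPP'
    exact ⟨_, mem_cellInters.2 ⟨hne.mono hsub, P, hP, Q, hQ, rfl⟩, hsub⟩
  have hmax : ∀ F' ∈ stableMaxCells a' b v, ∃ F ∈ stableMaxCells a b v, F' ⊆ F := by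
    intro F' hF'
    obtain ⟨hF'c, hd, hm⟩ := mem_stableMaxCells.1 hF'
    obtain ⟨x, hx⟩ := (hS'.isPoly hF'c).exists_relInt (hS'.rational _ hF'c).1
    obtain ⟨F₀, hF₀, hsub⟩ := hcell F' hF'c
    -- The smallest coarse cell at an interior point of `F'` contains `F'`. Its multiplicity is that
    -- of `F'`, hence non-zero, which excludes a dimension above the expected one.
    have hF := hS.faceAt_mem hF₀ (hsub hx.1)
    have hxF := (hS.isPoly hF₀).relInt_faceAt (hsub hx.1)
    have hsub' := hS.subset_of_relInt_of_subset hF hF₀ hx hsub hxF.1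
    refine ⟨_, mem_stableMaxCells_of_localMult hv hF hxF ?_ ?_, hsub'⟩
    · have := polyDim_mono hsub'
      omega
    · rwa [← localMult_eq_of_refines h hF'c hx hd hv hv',
        ← displacedMult_eq_of_mem_cellInters hF'c hx]
  have hcells : ∀ P' ∈ (stableComplex hL a' b hv').cells,
      ∃ P ∈ (stableComplex hL a b hv).cells, P' ⊆ P := by
    intro P' hP'
    obtain ⟨-, F', hF', hsub⟩ := mem_stableCells.1 hP'
    obtain ⟨F, hF, hsub'⟩ := hmax F' hF'
    exact ⟨F, mem_stableCells.2 ⟨(mem_stableMaxCells.1 hF).1, F, hF, subset_rfl⟩,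
      hsub.trans hsub'⟩
  refine ⟨?_, ?_, hcells, ?_⟩
  · change a'.dim + b.dim - _ = a.dim + b.dim - _
    rw [hdim]
  · ext y
    simp only [TropicalComplex.mem_support]
    constructor
    · rintro ⟨P', hP', hy⟩
      obtain ⟨P, hP, hsub⟩ := hcells P' hP'
      exact ⟨P, hP, hsub hy⟩
    · rintro ⟨P, hP, hy⟩
      obtain ⟨-, F, hF, hsub⟩ := mem_stableCells.1 hP
      obtain ⟨hFc, hd, hm⟩ := mem_stableMaxCells.1 hF
      have hcov : F ⊆ ⋃ F' ∈ cellInters a'.cells b.cells, F' := by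
        intro z hz
        obtain ⟨-, P, hP, Q, hQ, rfl⟩ := mem_cellInters.1 hFc
        have h1 : z ∈ a.support := TropicalComplex.mem_support.2 ⟨P, hP, hz.1⟩
        rw [← h.2.1, TropicalComplex.mem_support] at h1
        obtain ⟨P', hP', hzP'⟩ := h1
        exact Set.mem_iUnion₂.2 ⟨P' ∩ Q, mem_cellInters.2 ⟨⟨z, hzP', hz.2⟩, P', hP', Q, hQ, rfl⟩,
          hzP', hz.2⟩
      -- The fine cells cover `F`; one of them through `y` spans the same directions as `F` and
      -- shares an interior point with it, so it inherits the non-zero multiplicity.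
      obtain ⟨F', hF', hyF', hle, x, hxF, hxF'⟩ :=
        hS'.exists_relInt_cell (hS.isPoly hFc) hcov (hsub hy)
      obtain ⟨F₀, hF₀, hsub₀⟩ := hcell F' hF'
      have hsub' := hS.subset_of_relInt_of_subset hFc hF₀ hxF' hsub₀ hxF.1
      have hd' : polyDim F' = a'.dim + b.dim - Module.finrank ℝ V := by
        rw [hdim, ← hd]
        unfold polyDim
        rw [le_antisymm (direction_mono hsub') hle]
      refine ⟨F', mem_stableCells.2 ⟨hF', F', mem_stableMaxCells.2 ⟨hF', hd', ?_⟩, subset_rfl⟩,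
        hyF'⟩
      rwa [displacedMult_eq_of_mem_cellInters hF' hxF',
        localMult_eq_of_refines h hF' hxF' hd' hv hv', ← displacedMult_eq_of_mem_cellInters hFc hxF]
  · intro F' hF' F hF hsub
    rw [maxCells_stableComplex, mem_stableMaxCells] at hF hF'
    obtain ⟨hF'c, hd', -⟩ := hF'
    obtain ⟨hFc, hd, -⟩ := hF
    obtain ⟨x, hx⟩ := (hS'.isPoly hF'c).exists_relInt (hS'.rational _ hF'c).1
    have hxF := hx.of_subset hsub (direction_eq_of_polyDim hsub (by omega)).ge
    change TropicalComplex.displacedMult a' b v F' = TropicalComplex.displacedMult a b v F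
    rw [displacedMult_eq_of_mem_cellInters hF'c hx, displacedMult_eq_of_mem_cellInters hFc hxF,
      localMult_eq_of_refines h hF'c hx hd' hv hv']

namespace TropicalCycle

/-- The stable intersection of two complexes, as a cycle. -/
def stable (hL : IsFullLattice L) (a b : TropicalComplex L) : TropicalCycle L :=
  mk (stableComplex hL a b (exists_isGeneric a b).choose_spec)

lemma mk_eq_stable (hL : IsFullLattice L) {a b c : TropicalComplex L}
    (h : TropicalComplex.IsStableIntersection a b c) : mk c = stable hL a b :=
  h.mk_eq (isStableIntersection_stableComplex hL a b _)

lemma stable_comm (hL : IsFullLattice L) (a b : TropicalComplex L) :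
    stable hL a b = stable hL b a :=
  mk_eq_stable hL (isStableIntersection_stableComplex hL a b _).symm

lemma stable_eq_of_refines (hL : IsFullLattice L) {a a' : TropicalComplex L} (h : a'.Refines a)
    (b : TropicalComplex L) : stable hL a' b = stable hL a b := by
  obtain ⟨v, hv, hv'⟩ := exists_isGeneric_pair a a' b
  rw [← mk_eq_stable hL (isStableIntersection_stableComplex hL a b hv),
    ← mk_eq_stable hL (isStableIntersection_stableComplex hL a' b hv')]
  exact Quot.sound (stableComplex_refines hL h hv hv')

/-- The stable intersection of two cycles. -/
def stableCycle (hL : IsFullLattice L) : TropicalCycle L → TropicalCycle L → TropicalCycle L :=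
  Quot.lift₂ (stable hL)
    (fun a b b' h => by
      rw [stable_comm hL a, stable_comm hL a]; exact stable_eq_of_refines hL h a)
    (fun _ _ b h => stable_eq_of_refines hL h b)

/-- The relation on cycles is the graph of `stableCycle`, which gives existence and uniqueness at
once and computes the chosen value `stableIntersection`. -/
lemma isStableIntersection_iff (hL : IsFullLattice L) {A B C : TropicalCycle L} :
    IsStableIntersection A B C ↔ C = stableCycle hL A B := by
  constructor
  · rintro ⟨a, b, c, rfl, rfl, rfl, h⟩
    exact mk_eq_stable hL h
  · rintro rfl
    induction A using Quot.ind with | _ a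
    induction B using Quot.ind with | _ b
    exact ⟨a, b, _, rfl, rfl, rfl, isStableIntersection_stableComplex hL a b _⟩

lemma hasStableIntersection (hL : IsFullLattice L) (A B : TropicalCycle L) :
    HasStableIntersection A B :=
  ⟨_, (isStableIntersection_iff hL).2 rfl, fun _ h => (isStableIntersection_iff hL).1 h⟩

lemma stableIntersection_eq (hL : IsFullLattice L) (A B : TropicalCycle L) :
    stableIntersection A B = stableCycle hL A B :=
  (isStableIntersection_iff hL).1
    (Classical.epsilon_spec ⟨_, (isStableIntersection_iff hL).2 rfl⟩)

lemma stableCycle_mk (hL : IsFullLattice L) {a b c : TropicalComplex L}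
    (h : TropicalComplex.IsStableIntersection a b c) :
    stableCycle hL (mk a) (mk b) = mk c := (mk_eq_stable hL h).symm

lemma stableCycle_comm (hL : IsFullLattice L) (A B : TropicalCycle L) :
    stableCycle hL A B = stableCycle hL B A := by
  induction A using Quot.ind with | _ a
  induction B using Quot.ind with | _ b
  exact stable_comm hL a b

end TropicalCycle

end Invariance

/-! ### Degrees and automorphisms of the target lattice -/

section DegreeEquiv

variable {W U : Type*} [AddCommGroup W] [Module ℝ W] [AddCommGroup U] [Module ℝ U]

/-- The degree does not change under automorphisms of the lattice in the target. -/
lemma degree_comp_equiv {N : Submodule ℤ U} (g : U ≃ₗ[ℝ] U) (hg : ∀ x, g x ∈ N ↔ x ∈ N)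
    (S : Finset (Set W)) (w : Set W → ℤ) (M : Submodule ℤ W) (π : W →ₗ[ℝ] U) (y : W) (u : U) :
    degree S w M N (g.toLinearMap ∘ₗ π) y (g u) = degree S w M N π y u := by
  unfold degree
  rw [Finset.sum_filter, Finset.sum_filter]
  refine Finset.sum_congr rfl fun P _ => ?_
  have h1 : (y ∈ P ∧ g u ∈ (g.toLinearMap ∘ₗ π) '' tcone y P) ↔ (y ∈ P ∧ u ∈ π '' tcone y P) := by
    simp
  have h2 : mapIndex M N (g.toLinearMap ∘ₗ π) P = mapIndex M N π P := by
    have hN : N.toAddSubgroup.map (g : U →+ U) = N.toAddSubgroup := by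
      ext x
      constructor
      · rintro ⟨z, hz, rfl⟩; exact (hg z).2 hz
      · intro hx
        exact ⟨g.symm x, (hg _).1 (by simpa using hx), by simp⟩
    unfold mapIndex latIndex
    rw [← AddSubgroup.relIndex_map_map_of_injective (f := (g : U →+ U))
      ((latticeOf M P).map (π.restrictScalars ℤ)).toAddSubgroup N.toAddSubgroup g.injective, hN]
    congr 2
    ext x
    simp [Submodule.mem_map]
  simp only [h1, h2]

lemma isGenericFor_comp_equiv {S : Finset (Set W)} {π : W →ₗ[ℝ] U} (g : U ≃ₗ[ℝ] U) {u : U} :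
    IsGenericFor S (g.toLinearMap ∘ₗ π) (g u) ↔ IsGenericFor S π u := by
  refine forall₂_congr fun P _ => ?_
  rw [Submodule.map_comp]
  have h1 : ((direction P).map π).map g.toLinearMap = ⊤ ↔ (direction P).map π = ⊤ := by
    constructor
    · intro h
      apply Submodule.map_injective_of_injective (f := g.toLinearMap) g.injective
      rw [h, Submodule.map_top, g.range]
    · intro h
      rw [h, Submodule.map_top, g.range]
  have h2 : g u ∈ ((direction P).map π).map g.toLinearMap ↔ u ∈ (direction P).map π := by
    constructor
    · rintro ⟨x, hx, h⟩; exact g.injective h ▸ hx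
    · exact fun h => ⟨u, h, rfl⟩
  rw [Ne, h1, h2]

lemma isGenericFor_image {W' : Type*} [AddCommGroup W'] [Module ℝ W'] {f : W' →ₗ[ℝ] W}
    {S : Finset (Set W')} {π : W →ₗ[ℝ] U} {u : U} :
    IsGenericFor (S.image fun P => f '' P) π u ↔ IsGenericFor S (π ∘ₗ f) u := by
  simp only [IsGenericFor, Finset.forall_mem_image, direction_image, Submodule.map_comp]

end DegreeEquiv

/-! ### Iterated stable intersections on the triple product -/

section Triple

variable {V : Type*} [AddCommGroup V] [Module ℝ V] {L : Submodule ℤ V}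

/-- The difference of the first two components. -/
def diffMap₁₂ (V : Type*) [AddCommGroup V] [Module ℝ V] : (V × V) × V →ₗ[ℝ] V :=
  diffMap V ∘ₗ LinearMap.fst ℝ (V × V) V

/-- The difference of the first and the last component. -/
def diffMap₁₃ (V : Type*) [AddCommGroup V] [Module ℝ V] : (V × V) × V →ₗ[ℝ] V :=
  LinearMap.fst ℝ V V ∘ₗ LinearMap.fst ℝ (V × V) V - LinearMap.snd ℝ (V × V) V

/-- The embedding which doubles the first component. -/
def diagMap₁₂ (V : Type*) [AddCommGroup V] [Module ℝ V] : V × V →ₗ[ℝ] (V × V) × V :=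
  (diagMap V).prodMap LinearMap.id

@[simp] lemma diffMap₁₂_apply (x : (V × V) × V) : diffMap₁₂ V x = x.1.1 - x.1.2 := rfl
@[simp] lemma diffMap₁₃_apply (x : (V × V) × V) : diffMap₁₃ V x = x.1.1 - x.2 := rfl
@[simp] lemma diagMap₁₂_apply (x : V × V) : diagMap₁₂ V x = ((x.1, x.1), x.2) := rfl

lemma diagMap₁₂_injective : Function.Injective (diagMap₁₂ V) := by
  rintro ⟨x, y⟩ ⟨x', y'⟩ h
  simp only [diagMap₁₂_apply, Prod.mk.injEq] at h
  rw [h.1.1, h.2]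

lemma diagMap₁₂_image_diag (D : Submodule ℝ V) :
    (D.map (diagMap V)).map (diagMap₁₂ V) ≤ LinearMap.ker (diffMap₁₂ V) ∧
    (D.map (diagMap V)).map (diagMap₁₂ V) ≤ LinearMap.ker (diffMap₁₃ V) := by
  constructor <;> rintro _ ⟨_, ⟨z, -, rfl⟩, rfl⟩ <;> simp

lemma prod_inter_ker_diffMap₁₂ (P Q R : Set V) :
    (P ×ˢ Q) ×ˢ R ∩ (LinearMap.ker (diffMap₁₂ V) : Set ((V × V) × V)) =
      diagMap₁₂ V '' ((P ∩ Q) ×ˢ R) := by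
  ext ⟨⟨x, y⟩, z⟩
  simp only [Set.mem_inter_iff, Set.mem_prod, SetLike.mem_coe, LinearMap.mem_ker, diffMap₁₂_apply,
    sub_eq_zero, Set.mem_image, diagMap₁₂_apply, Prod.mk.injEq, Prod.exists]
  constructor
  · rintro ⟨⟨⟨hx, hy⟩, hz⟩, rfl⟩; exact ⟨x, z, ⟨⟨hx, hy⟩, hz⟩, ⟨rfl, rfl⟩, rfl⟩
  · rintro ⟨x', z', ⟨⟨hx, hy⟩, hz⟩, ⟨rfl, rfl⟩, rfl⟩; exact ⟨⟨⟨hx, hy⟩, hz⟩, rfl⟩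

lemma kerSlices_prodCells₃ {S T R : Finset (Set V)} (hR : ∀ Q ∈ R, Q.Nonempty) (k : ℤ) :
    kerSlices (prodCells (prodCells S T) R) (diffMap₁₂ V) k =
      (cellsOfDim (prodCells (cellInters S T) R) k).image fun F => diagMap₁₂ V '' F := by
  ext E
  simp only [kerSlices, Finset.mem_filter, Finset.mem_image, mem_cellsOfDim]
  constructor
  · rintro ⟨⟨_, hX, rfl⟩, hne, hd⟩
    obtain ⟨_, hPQ, C, hC, rfl⟩ := mem_prodCells.1 hX
    obtain ⟨P, hP, Q, hQ, rfl⟩ := mem_prodCells.1 hPQ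
    rw [prod_inter_ker_diffMap₁₂] at hne hd ⊢
    rw [polyDim_image diagMap₁₂_injective] at hd
    exact ⟨_, ⟨mem_prodCells.2 ⟨P ∩ Q, mem_cellInters.2
      ⟨(Set.prod_nonempty_iff.1 (Set.image_nonempty.1 hne)).1, P, hP, Q, hQ, rfl⟩, C, hC, rfl⟩,
      hd⟩, rfl⟩
  · rintro ⟨_, ⟨hX, hd⟩, rfl⟩
    obtain ⟨_, hPQ, C, hC, rfl⟩ := mem_prodCells.1 hX
    obtain ⟨hne, P, hP, Q, hQ, rfl⟩ := mem_cellInters.1 hPQ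
    rw [polyDim_image diagMap₁₂_injective, Set.image_nonempty]
    exact ⟨⟨_, mem_prodCells.2 ⟨P ×ˢ Q, mem_prodCells.2 ⟨P, hP, Q, hQ, rfl⟩, C, hC, rfl⟩,
      prod_inter_ker_diffMap₁₂ P Q C⟩, hne.prod (hR C hC), hd⟩

lemma finrank_map_diagMap₃ (D : Submodule ℝ V) :
    Module.finrank ℝ ((D.map (diagMap V)).map (diagMap₁₂ V)) = Module.finrank ℝ D := by
  rw [← finrank_map_diagMap D]
  exact (Submodule.equivMapOfInjective (diagMap₁₂ V) diagMap₁₂_injective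
    (D.map (diagMap V))).finrank_eq.symm

variable [FiniteDimensional ℝ V]

/-- The degree of a product of complexes under a map which factors over the first projection. -/
lemma degree_prod_fst {V₁ V₂ U : Type*} [AddCommGroup V₁] [Module ℝ V₁] [FiniteDimensional ℝ V₁]
    [AddCommGroup V₂] [Module ℝ V₂] [FiniteDimensional ℝ V₂] [AddCommGroup U] [Module ℝ U]
    {L₁ : Submodule ℤ V₁} {L₂ : Submodule ℤ V₂} (X : TropicalComplex L₁) (c : TropicalComplex L₂)
    (N : Submodule ℤ U) (π : V₁ →ₗ[ℝ] U) (x : V₁) (z : V₂) (u : U) :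
    degree (cellsOfDim (X.prod c).cells (X.prod c).dim) (X.prod c).weight (L₁.prod L₂) N
        (π ∘ₗ LinearMap.fst ℝ V₁ V₂) (x, z) u =
      degree (cellsOfDim X.cells X.dim) X.weight L₁ N π x u *
        ∑ R ∈ c.maxCells with z ∈ R, c.weight R := by
  unfold degree
  rw [Finset.sum_filter, X.sum_cellsOfDim_prod c, Finset.sum_mul_sum, ← Finset.sum_product',
    ← Finset.filter_product, Finset.sum_filter]
  refine Finset.sum_congr rfl fun p hp => ?_
  obtain ⟨hP, hR⟩ := Finset.mem_product.1 hp
  have hP := (X.mem_maxCells.1 hP).1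
  have hR := (c.mem_maxCells.1 hR).1
  have h1 : ((x, z) ∈ p.1 ×ˢ p.2 ∧
      u ∈ (π ∘ₗ LinearMap.fst ℝ V₁ V₂) '' tcone (x, z) (p.1 ×ˢ p.2)) ↔
      ((x ∈ p.1 ∧ u ∈ π '' tcone x p.1) ∧ z ∈ p.2) := by
    rw [tcone_prod]
    constructor
    · rintro ⟨⟨hx, hz⟩, ⟨t, s⟩, ⟨ht, -⟩, rfl⟩
      exact ⟨⟨hx, t, ht, rfl⟩, hz⟩
    · rintro ⟨⟨hx, t, ht, rfl⟩, hz⟩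
      exact ⟨⟨hx, hz⟩, (t, 0), ⟨ht, IsPoly.zero_mem_tcone hz⟩, rfl⟩
  have h2 : mapIndex (L₁.prod L₂) N (π ∘ₗ LinearMap.fst ℝ V₁ V₂) (p.1 ×ˢ p.2) =
      mapIndex L₁ N π p.1 := by
    unfold mapIndex
    rw [latticeOf_prod (X.nonempty hP) (c.nonempty hR)]
    congr 1
    ext t
    simp only [Submodule.mem_map, Submodule.mem_prod, Prod.exists]
    constructor
    · rintro ⟨s, r, ⟨hs, -⟩, rfl⟩; exact ⟨s, hs, rfl⟩
    · rintro ⟨s, hs, rfl⟩; exact ⟨s, 0, ⟨hs, Submodule.zero_mem _⟩, rfl⟩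
  simp only [h1, h2, X.weight_prod c hP hR]
  split_ifs <;> ring

/-- The cells of a triple intersection. -/
lemma hasLineality_triple {a b c : TropicalComplex L} {F : Set V} {y : V}
    (hF : F ∈ cellInters (cellInters a.cells b.cells) c.cells) (hy : RelInt y F) :
    HasLineality ((a.prod b).prod c).cells ((y, y), y)
      (((direction F).map (diagMap V)).map (diagMap₁₂ V)) := by
  rintro R hR hyR _ ⟨_, ⟨z, hz, rfl⟩, rfl⟩
  obtain ⟨PQ, hPQ, C, hC, rfl⟩ := mem_prodCells.1 hR
  obtain ⟨P, hP, Q, hQ, rfl⟩ := mem_prodCells.1 hPQ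
  obtain ⟨⟨hyP, hyQ⟩, hyC⟩ := hyR
  have hz' := hy.2 z hz
  have hab := a.isPolyComplex.cellInters b.isPolyComplex
  have h1 : P ∩ Q ∈ cellInters a.cells b.cells :=
    mem_cellInters.2 ⟨⟨y, hyP, hyQ⟩, P, hP, Q, hQ, rfl⟩
  have h2 := subset_left_of_mem_cellInters hab hF hy h1 ⟨hyP, hyQ⟩
  have h3 := subset_right_of_mem_cellInters c.isPolyComplex hF hy hC hyC
  rw [tcone_prod, tcone_prod]
  exact ⟨⟨tcone_mono _ (h2.trans Set.inter_subset_left) hz',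
    tcone_mono _ (h2.trans Set.inter_subset_right) hz'⟩, tcone_mono _ h3 hz'⟩

lemma isGenericFor_diffMap₁₂ {a b : TropicalComplex L} (c : TropicalComplex L) {v : V}
    (hv : TropicalComplex.IsGeneric a b v) :
    IsGenericFor ((a.prod b).prod c).cells (diffMap₁₂ V) v := by
  intro R hR
  obtain ⟨PQ, hPQ, C, hC, rfl⟩ := mem_prodCells.1 hR
  have h : (direction (PQ ×ˢ C)).map (diffMap₁₂ V) = (direction PQ).map (diffMap V) := by
    rw [diffMap₁₂, Submodule.map_comp, direction_prod ((a.prod b).nonempty hPQ) (c.nonempty hC),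
      Submodule.prod_map_fst]
  rw [h]
  exact isGeneric_iff.1 hv PQ hPQ

/-- The multiplicities of an iterated stable intersection are degrees of the triple product. -/
theorem eventually_degree_triple (hL : IsFullLattice L) (a b c : TropicalComplex L) {v w : V}
    (hv : TropicalComplex.IsGeneric a b v)
    (hw : IsGenericOnSlices ((a.prod b).prod c).cells (diffMap₁₂ V) (diffMap₁₃ V) w)
    {F : Set V} (hF : F ∈ cellInters (cellInters a.cells b.cells) c.cells) {y : V}
    (hy : RelInt y F)
    (hd : polyDim F = a.dim + b.dim + c.dim - 2 * Module.finrank ℝ V) :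
    ∀ᶠ ε : ℝ in 𝓝[>] 0,
      degree (cellsOfDim ((a.prod b).prod c).cells ((a.prod b).prod c).dim)
        ((a.prod b).prod c).weight ((L.prod L).prod L) (L.prod L)
        ((diffMap₁₂ V).prod (diffMap₁₃ V)) ((y, y), y) (ε • v, w) =
      localMult (stableComplex hL a b hv) c w y := by
  set X := (a.prod b).prod c
  set ab := stableComplex hL a b hv
  have hab := a.isPolyComplex.cellInters b.isPolyComplex
  -- The local degree of the slice `G × R`: besides the multiplicity of `G` it counts all maximal
  -- cells of `c` containing `R`, as `R` need not be maximal itself.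
  set m : Set ((V × V) × V) → ℤ := fun E =>
    TropicalComplex.displacedMult a b v (Prod.fst '' (diagMap₁₂ V ⁻¹' E)) *
      ∑ R ∈ c.maxCells with Prod.snd '' (diagMap₁₂ V ⁻¹' E) ⊆ R, c.weight R with hm
  have hm_apply : ∀ G ∈ cellInters a.cells b.cells, ∀ R ∈ c.cells,
      m (diagMap₁₂ V '' (G ×ˢ R)) = TropicalComplex.displacedMult a b v G *
        ∑ R' ∈ c.maxCells with R ⊆ R', c.weight R' := by
    intro G hG R hR
    rw [hm]
    beta_reduce
    rw [diagMap₁₂_injective.preimage_image, Set.fst_image_prod _ (c.nonempty hR),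
      Set.snd_image_prod (hab.rational G hG).1]
  have h1 := eventually_degree_prod_eq (N₁ := L) (N₂ := L) X.isPolyComplex X.weight
    (fun x hx => L.sub_mem hx.1.1 hx.1.2) (fun x hx => L.sub_mem hx.1.1 hx.2)
    (isGenericFor_diffMap₁₂ c hv) hw (diagMap₁₂_image_diag (direction F)).1
    (diagMap₁₂_image_diag (direction F)).2 (hasLineality_triple hF hy) (k := X.dim) (by
      rw [finrank_map_diagMap₃]
      change a.dim + b.dim + c.dim = _
      unfold polyDim at hd
      omega) (by simp) (m := m) (by
      intro E hE x hx
      change E ∈ kerSlices (prodCells (prodCells a.cells b.cells) c.cells) _ _ at hE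
      rw [kerSlices_prodCells₃ fun Q hQ => c.nonempty hQ] at hE
      obtain ⟨GR, hGR, rfl⟩ := Finset.mem_image.1 hE
      obtain ⟨G, hG, R, hR, rfl⟩ := mem_prodCells.1 (mem_cellsOfDim.1 hGR).1
      obtain ⟨⟨x, z⟩, -, rfl⟩ := hx.1
      rw [relInt_image diagMap₁₂_injective] at hx
      have hxG : RelInt x G := ⟨hx.1.1, fun t ht => by
        have := hx.2 (t, 0) (by
          rw [direction_prod ⟨_, hx.1.1⟩ ⟨_, hx.1.2⟩]; exact ⟨ht, Submodule.zero_mem _⟩)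
        rw [tcone_prod] at this
        exact this.1⟩
      have hzR : RelInt z R := ⟨hx.1.2, fun t ht => by
        have := hx.2 (0, t) (by
          rw [direction_prod ⟨_, hx.1.1⟩ ⟨_, hx.1.2⟩]; exact ⟨Submodule.zero_mem _, ht⟩)
        rw [tcone_prod] at this
        exact this.2⟩
      rw [hm_apply G hG R hR, displacedMult_eq_of_mem_cellInters hG hxG]
      refine Eq.trans ?_ (degree_prod_fst (a.prod b) c L (diffMap V) (x, x) z v).symm
      unfold localMult
      congr 2
      refine Finset.filter_congr fun R' hR' => ⟨fun h => h hzR.1, fun h => ?_⟩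
      exact c.isPolyComplex.subset_of_relInt hR (c.mem_maxCells.1 hR').1 hzR h)
  filter_upwards [h1] with ε hε
  rw [hε]
  change degree (kerSlices (prodCells (prodCells a.cells b.cells) c.cells) _ _) _ _ _ _
    (diagMap₁₂ V (y, y)) _ = _
  rw [kerSlices_prodCells₃ fun Q hQ => c.nonempty hQ,
    degree_image diagMap₁₂_injective (M' := L.prod L) (by
      rintro ⟨s, t⟩; simp [Submodule.mem_prod])]
  unfold localMult
  have hcells : ∀ E ∈ cellsOfDim (ab.prod c).cells (ab.prod c).dim,
      ∃ G ∈ stableMaxCells a b v, ∃ R ∈ c.maxCells, E = G ×ˢ R := by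
    intro E hE
    rw [TropicalComplex.cellsOfDim_prod, maxCells_stableComplex] at hE
    exact mem_prodCells.1 hE
  symm
  refine (degree_congr (w' := fun P => m (diagMap₁₂ V '' P)) ?_ _ _ _ _ _).trans
    (degree_subset ?_ ?_ _ _ _ _ _)
  · intro E hE
    obtain ⟨G, hG, R, hR, rfl⟩ := hcells E hE
    have hR' := c.mem_maxCells.1 hR
    have hG' : G ∈ ab.maxCells := by rwa [maxCells_stableComplex]
    rw [ab.weight_prod c (ab.mem_maxCells.1 hG').1 hR'.1,
      hm_apply G (mem_stableMaxCells.1 hG).1 R hR'.1]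
    -- For a maximal `R` the sum in `m` reduces to the weight of `R`.
    have : c.maxCells.filter (fun R' => R ⊆ R') = {R} := by
      ext R''
      simp only [Finset.mem_filter, Finset.mem_singleton]
      constructor
      · rintro ⟨h2, h3⟩
        have h2 := c.mem_maxCells.1 h2
        exact (c.isPolyComplex.eq_of_polyDim hR'.1 h2.1 h3 (by omega)).symm
      · rintro rfl; exact ⟨hR, subset_rfl⟩
    rw [this, Finset.sum_singleton]
    rfl
  · intro E hE
    obtain ⟨G, hG, R, hR, rfl⟩ := hcells E hE
    have hR' := c.mem_maxCells.1 hR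
    have hG' := mem_stableMaxCells.1 hG
    refine mem_cellsOfDim.2 ⟨mem_prodCells.2 ⟨G, hG'.1, R, hR'.1, rfl⟩, ?_⟩
    rw [polyDim_prod (hab.rational G hG'.1).1 (c.nonempty hR'.1), hG'.2.1, hR'.2]
    change _ = a.dim + b.dim + c.dim - _
    ring
  -- The remaining slices have multiplicity zero: if `G` has a non-zero multiplicity it has the
  -- expected dimension, and then the total dimension forces `R` to be maximal.
  · intro E hE hE'
    obtain ⟨hE, hEd⟩ := mem_cellsOfDim.1 hE
    obtain ⟨G, hG, R, hR, rfl⟩ := mem_prodCells.1 hE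
    rw [hm_apply G hG R hR]
    rw [polyDim_prod (hab.rational G hG).1 (c.nonempty hR)] at hEd
    change _ = a.dim + b.dim + c.dim - _ at hEd
    have hRd := c.polyDim_le hR
    obtain ⟨x, hx⟩ := (hab.isPoly hG).exists_relInt (hab.rational G hG).1
    by_cases hzero : localMult a b v x = 0
    · rw [displacedMult_eq_of_mem_cellInters hG hx, hzero, zero_mul]
    · exfalso
      have hGm := mem_stableMaxCells_of_localMult hv hG hx (by omega) hzero
      apply hE'
      rw [TropicalComplex.cellsOfDim_prod, maxCells_stableComplex]
      refine mem_prodCells.2 ⟨G, hGm, R, c.mem_maxCells.2 ⟨hR, ?_⟩, rfl⟩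
      have := (mem_stableMaxCells.1 hGm).2.1
      omega

end Triple

/-! ### Associativity by rotating the triple product -/

lemma cellInters_rot {V : Type*} (S T R : Finset (Set V)) :
    cellInters (cellInters S T) R = cellInters (cellInters T R) S := by
  ext F
  simp only [mem_cellInters]
  constructor
  · rintro ⟨hne, _, ⟨-, P, hP, Q, hQ, rfl⟩, C, hC, rfl⟩
    have : P ∩ Q ∩ C = Q ∩ C ∩ P := by rw [Set.inter_assoc, Set.inter_comm]
    rw [this] at hne ⊢
    exact ⟨hne, _, ⟨hne.mono Set.inter_subset_left, Q, hQ, C, hC, rfl⟩, P, hP, rfl⟩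
  · rintro ⟨hne, _, ⟨-, Q, hQ, C, hC, rfl⟩, P, hP, rfl⟩
    have : P ∩ Q ∩ C = Q ∩ C ∩ P := by rw [Set.inter_assoc, Set.inter_comm]
    rw [← this] at hne ⊢
    exact ⟨hne, _, ⟨hne.mono Set.inter_subset_left, P, hP, Q, hQ, rfl⟩, C, hC, rfl⟩

section Associativity

variable {V : Type*} [AddCommGroup V] [Module ℝ V] {L : Submodule ℤ V}

/-- The cyclic rotation of three components. -/
def rotMap (V : Type*) [AddCommGroup V] [Module ℝ V] : (V × V) × V →ₗ[ℝ] (V × V) × V :=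
  ((LinearMap.snd ℝ V V ∘ₗ LinearMap.fst ℝ (V × V) V).prod (LinearMap.snd ℝ (V × V) V)).prod
    (LinearMap.fst ℝ V V ∘ₗ LinearMap.fst ℝ (V × V) V)

@[simp] lemma rotMap_apply (x : (V × V) × V) : rotMap V x = ((x.1.2, x.2), x.1.1) := rfl

lemma rotMap_injective : Function.Injective (rotMap V) := by
  rintro ⟨⟨x, y⟩, z⟩ ⟨⟨x', y'⟩, z'⟩ h
  simp only [rotMap_apply, Prod.mk.injEq] at h
  simp [h]

lemma rotMap_image (P Q R : Set V) : rotMap V '' ((P ×ˢ Q) ×ˢ R) = (Q ×ˢ R) ×ˢ P := by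
  ext ⟨⟨x, y⟩, z⟩
  constructor
  · rintro ⟨⟨⟨p, q⟩, r⟩, ⟨⟨hp, hq⟩, hr⟩, h⟩
    simp only [rotMap_apply, Prod.mk.injEq] at h
    obtain ⟨⟨rfl, rfl⟩, rfl⟩ := h
    exact ⟨⟨hq, hr⟩, hp⟩
  · rintro ⟨⟨hq, hr⟩, hp⟩
    exact ⟨((z, x), y), ⟨⟨hp, hq⟩, hr⟩, rfl⟩

/-- The change of the differences under the rotation of the components. -/
def rotDiff (V : Type*) [AddCommGroup V] [Module ℝ V] : (V × V) ≃ₗ[ℝ] V × V where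
  toFun x := (x.2 - x.1, -x.1)
  invFun x := (-x.2, x.1 - x.2)
  map_add' x y := by ext <;> simp <;> abel
  map_smul' c x := by ext <;> simp [smul_sub]
  left_inv x := by ext <;> simp
  right_inv x := by ext <;> simp

lemma rotDiff_mem (x : V × V) : rotDiff V x ∈ L.prod L ↔ x ∈ L.prod L := by
  change x.2 - x.1 ∈ L ∧ -x.1 ∈ L ↔ x.1 ∈ L ∧ x.2 ∈ L
  rw [neg_mem_iff]
  constructor
  · rintro ⟨h1, h2⟩
    exact ⟨h2, by simpa using L.add_mem h1 h2⟩
  · rintro ⟨h1, h2⟩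
    exact ⟨L.sub_mem h2 h1, h1⟩

lemma diffMaps_comp_rotMap : ((diffMap₁₂ V).prod (diffMap₁₃ V)) ∘ₗ rotMap V =
    (rotDiff V).toLinearMap ∘ₗ ((diffMap₁₂ V).prod (diffMap₁₃ V)) := by
  refine LinearMap.ext fun x => ?_
  change (x.1.2 - x.2, x.1.2 - x.1.1) = ((x.1.1 - x.2) - (x.1.1 - x.1.2), -(x.1.1 - x.1.2))
  ext <;> simp

lemma exists_generic_triple (D c : TropicalComplex L) (S : Finset (Set ((V × V) × V))) :
    ∃ w, TropicalComplex.IsGeneric D c w ∧ IsGenericOnSlices S (diffMap₁₂ V) (diffMap₁₃ V) w := by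
  obtain ⟨w, hw⟩ := exists_forall_notMem
    ((D.cells ×ˢ c.cells).image (fun p => direction p.1 ⊔ direction p.2) ∪
      S.image fun P => (direction P ⊓ LinearMap.ker (diffMap₁₂ V)).map (diffMap₁₃ V))
  refine ⟨w, fun P hP Q hQ => hw _ (Finset.mem_union_left _ (Finset.mem_image.2
    ⟨(P, Q), by simp [hP, hQ], rfl⟩)), fun P hP => hw _ (Finset.mem_union_right _
      (Finset.mem_image_of_mem _ hP))⟩

variable [FiniteDimensional ℝ V]

lemma cells_rot (a b c : TropicalComplex L) :
    ((b.prod c).prod a).cells = ((a.prod b).prod c).cells.image fun R => rotMap V '' R := by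
  ext R
  change R ∈ prodCells (prodCells b.cells c.cells) a.cells ↔
    R ∈ (prodCells (prodCells a.cells b.cells) c.cells).image _
  simp only [Finset.mem_image, mem_prodCells]
  constructor
  · rintro ⟨_, ⟨Q, hQ, C, hC, rfl⟩, P, hP, rfl⟩
    exact ⟨_, ⟨_, ⟨P, hP, Q, hQ, rfl⟩, C, hC, rfl⟩, rotMap_image P Q C⟩
  · rintro ⟨_, ⟨_, ⟨P, hP, Q, hQ, rfl⟩, C, hC, rfl⟩, rfl⟩
    exact ⟨_, ⟨Q, hQ, C, hC, rfl⟩, P, hP, rotMap_image P Q C⟩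

lemma cellsOfDim_rot (a b c : TropicalComplex L) :
    cellsOfDim ((b.prod c).prod a).cells ((b.prod c).prod a).dim =
      (cellsOfDim ((a.prod b).prod c).cells ((a.prod b).prod c).dim).image
        fun R => rotMap V '' R := by
  have hd : ((b.prod c).prod a).dim = ((a.prod b).prod c).dim := by
    change b.dim + c.dim + a.dim = a.dim + b.dim + c.dim
    ring
  rw [hd]
  ext R
  rw [mem_cellsOfDim, cells_rot]
  simp only [Finset.mem_image, mem_cellsOfDim]
  constructor
  · rintro ⟨⟨R, hR, rfl⟩, hd⟩
    exact ⟨R, ⟨hR, by rwa [polyDim_image rotMap_injective] at hd⟩, rfl⟩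
  · rintro ⟨R, ⟨hR, hd⟩, rfl⟩
    exact ⟨⟨R, hR, rfl⟩, by rwa [polyDim_image rotMap_injective]⟩

lemma weight_rot (a b c : TropicalComplex L) {R : Set ((V × V) × V)}
    (hR : R ∈ ((a.prod b).prod c).cells) :
    ((b.prod c).prod a).weight (rotMap V '' R) = ((a.prod b).prod c).weight R := by
  obtain ⟨PQ, hPQ, C, hC, rfl⟩ := mem_prodCells.1 hR
  obtain ⟨P, hP, Q, hQ, rfl⟩ := mem_prodCells.1 hPQ
  rw [rotMap_image, (b.prod c).weight_prod a (mem_prodCells.2 ⟨Q, hQ, C, hC, rfl⟩) hP,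
    b.weight_prod c hQ hC, (a.prod b).weight_prod c hPQ hC, a.weight_prod b hP hQ]
  ring

lemma degree_rot (a b c : TropicalComplex L) (y : V) (u : V × V) :
    degree (cellsOfDim ((b.prod c).prod a).cells ((b.prod c).prod a).dim)
        ((b.prod c).prod a).weight ((L.prod L).prod L) (L.prod L)
        ((diffMap₁₂ V).prod (diffMap₁₃ V)) ((y, y), y) (rotDiff V u) =
      degree (cellsOfDim ((a.prod b).prod c).cells ((a.prod b).prod c).dim)
        ((a.prod b).prod c).weight ((L.prod L).prod L) (L.prod L)
        ((diffMap₁₂ V).prod (diffMap₁₃ V)) ((y, y), y) u := by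
  rw [cellsOfDim_rot]
  change degree _ _ _ _ _ (rotMap V ((y, y), y)) _ = _
  rw [degree_image rotMap_injective (M' := (L.prod L).prod L) (by
      intro x; simp only [rotMap_apply, Submodule.mem_prod]; tauto),
    diffMaps_comp_rotMap, degree_comp_equiv (rotDiff V) rotDiff_mem]
  exact degree_congr (fun R hR => weight_rot a b c (mem_cellsOfDim.1 hR).1) _ _ _ _ _

lemma isGenericFor_rot {a b c : TropicalComplex L} {u : V × V} :
    IsGenericFor ((b.prod c).prod a).cells ((diffMap₁₂ V).prod (diffMap₁₃ V)) (rotDiff V u) ↔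
      IsGenericFor ((a.prod b).prod c).cells ((diffMap₁₂ V).prod (diffMap₁₃ V)) u := by
  rw [cells_rot, isGenericFor_image, diffMaps_comp_rotMap, isGenericFor_comp_equiv]

/-- The multiplicities of the two iterated stable intersections agree. -/
theorem localMult_assoc (hL : IsFullLattice L) (a b c : TropicalComplex L) {v w v' w' : V}
    (hv : TropicalComplex.IsGeneric a b v) (hv' : TropicalComplex.IsGeneric b c v')
    (hw : IsGenericOnSlices ((a.prod b).prod c).cells (diffMap₁₂ V) (diffMap₁₃ V) w)
    (hw' : IsGenericOnSlices ((b.prod c).prod a).cells (diffMap₁₂ V) (diffMap₁₃ V) w')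
    {F : Set V} (hF : F ∈ cellInters (cellInters a.cells b.cells) c.cells) {y : V}
    (hy : RelInt y F)
    (hd : polyDim F = a.dim + b.dim + c.dim - 2 * Module.finrank ℝ V) :
    localMult (stableComplex hL a b hv) c w y = localMult (stableComplex hL b c hv') a w' y := by
  have h1 := (eventually_degree_triple hL a b c hv hw hF hy hd).and
    (eventually_isGenericFor_prod (isGenericFor_diffMap₁₂ c hv) hw)
  rw [cellInters_rot] at hF
  have h2 := (eventually_degree_triple hL b c a hv' hw' hF hy (by omega)).and
    (eventually_isGenericFor_prod (isGenericFor_diffMap₁₂ a hv') hw')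
  rw [← cellInters_rot] at hF
  -- One `ε` makes both multiplicities degrees over generic points. The rotation, which acts on the
  -- differences by the lattice automorphism `rotDiff`, moves the second degree to the first triple
  -- product, where the generic point does not matter.
  obtain ⟨ε, ⟨h3, h4⟩, h5, h6⟩ := (h1.and h2).exists
  rw [← h3, ← h5]
  obtain ⟨u, hu⟩ := (rotDiff V).surjective (ε • v', w')
  rw [← hu] at h6 ⊢
  rw [isGenericFor_rot] at h6
  rw [degree_rot]
  refine degree_eq_of_generic ((hL.prod hL).prod hL) (hL.prod hL) _
    (fun x hx => ⟨L.sub_mem hx.1.1 hx.1.2, L.sub_mem hx.1.1 hx.2⟩)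
    (K := ((direction F).map (diagMap V)).map (diagMap₁₂ V)) ?_ (hasLineality_triple hF hy) ?_ h4 h6
  · rw [LinearMap.ker_prod]
    exact le_inf (diagMap₁₂_image_diag _).1 (diagMap₁₂_image_diag _).2
  · rw [finrank_map_diagMap₃, Module.finrank_prod]
    change a.dim + b.dim + c.dim = _
    unfold polyDim at hd
    push_cast
    omega

/-- A non-zero multiplicity provides a cell of `D` and a cell of `c` through `y`. Their smallest
faces at `y` intersect in `F`, because such faces do not depend on the cells chosen. -/
lemma mem_cellInters_of_localMult {a b c D : TropicalComplex L} {F : Set V} {y w : V}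
    (hF : F ∈ cellInters (cellInters a.cells b.cells) c.cells) (hy : RelInt y F)
    (hD : D.cells ⊆ cellInters a.cells b.cells) (hm : localMult D c w y ≠ 0) :
    F ∈ cellInters D.cells c.cells := by
  have hab := a.isPolyComplex.cellInters b.isPolyComplex
  obtain ⟨R, hR, -⟩ := Finset.exists_ne_zero_of_sum_ne_zero hm
  simp only [Finset.mem_filter, mem_cellsOfDim] at hR
  obtain ⟨⟨hR, -⟩, hyR, -⟩ := hR
  obtain ⟨P, hP, Q, hQ, rfl⟩ := mem_prodCells.1 hR
  obtain ⟨hne, G, hG, C, hC, rfl⟩ := mem_cellInters.1 hF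
  refine mem_cellInters.2 ⟨hne, _, D.isPolyComplex.faceAt_mem hP hyR.1, _,
    c.isPolyComplex.faceAt_mem hQ hyR.2, ?_⟩
  rw [hab.faceAt_eq (hD hP) hG hyR.1 hy.1.1, c.isPolyComplex.faceAt_eq hQ hC hyR.2 hy.1.2,
    ← faceAt_inter, hy.faceAt_eq]

lemma mem_stableMaxCells_iff_triple (hL : IsFullLattice L) {a b c : TropicalComplex L} {v w : V}
    (hv : TropicalComplex.IsGeneric a b v) {F : Set V} {y : V} (hy : RelInt y F) :
    F ∈ stableMaxCells (stableComplex hL a b hv) c w ↔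
      F ∈ cellInters (cellInters a.cells b.cells) c.cells ∧
        polyDim F = a.dim + b.dim + c.dim - 2 * Module.finrank ℝ V ∧
        localMult (stableComplex hL a b hv) c w y ≠ 0 := by
  have hD : (stableComplex hL a b hv).cells ⊆ cellInters a.cells b.cells :=
    fun P hP => (mem_stableCells.1 hP).1
  have hdim : (stableComplex hL a b hv).dim + c.dim - Module.finrank ℝ V =
      a.dim + b.dim + c.dim - 2 * Module.finrank ℝ V := by
    change a.dim + b.dim - Module.finrank ℝ V + c.dim - Module.finrank ℝ V = _
    ring
  rw [mem_stableMaxCells, hdim]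
  constructor
  · rintro ⟨hF, hd, hm⟩
    rw [displacedMult_eq_of_mem_cellInters hF hy] at hm
    obtain ⟨hne, P, hP, Q, hQ, hPQ⟩ := mem_cellInters.1 hF
    exact ⟨mem_cellInters.2 ⟨hne, P, hD hP, Q, hQ, hPQ⟩, hd, hm⟩
  · rintro ⟨hF, hd, hm⟩
    have hF' := mem_cellInters_of_localMult hF hy hD hm
    exact ⟨hF', hd, by rwa [displacedMult_eq_of_mem_cellInters hF' hy]⟩

/-- The stable intersection is associative. -/
theorem TropicalCycle.stableCycle_assoc (hL : IsFullLattice L) (A B C : TropicalCycle L) :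
    stableCycle hL (stableCycle hL A B) C = stableCycle hL A (stableCycle hL B C) := by
  obtain ⟨a, rfl⟩ : ∃ a, mk a = A := Quot.exists_rep A
  obtain ⟨b, rfl⟩ : ∃ b, mk b = B := Quot.exists_rep B
  obtain ⟨c, rfl⟩ : ∃ c, mk c = C := Quot.exists_rep C
  -- After this exchange the second product is `(B · C) · A`, a cyclic rotation of the first one.
  rw [stableCycle_comm hL (mk a) (stableCycle hL _ _)]
  obtain ⟨v, hv⟩ := exists_isGeneric a b
  obtain ⟨v', hv'⟩ := exists_isGeneric b c
  have h1 : stableCycle hL (mk a) (mk b) = mk (stableComplex hL a b hv) :=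
    stableCycle_mk hL (isStableIntersection_stableComplex hL a b hv)
  have h2 : stableCycle hL (mk b) (mk c) = mk (stableComplex hL b c hv') :=
    stableCycle_mk hL (isStableIntersection_stableComplex hL b c hv')
  rw [h1, h2]
  obtain ⟨w, hw, hws⟩ := exists_generic_triple (stableComplex hL a b hv) c
    ((a.prod b).prod c).cells
  obtain ⟨w', hw', hws'⟩ := exists_generic_triple (stableComplex hL b c hv') a
    ((b.prod c).prod a).cells
  have h3 : stableCycle hL (mk (stableComplex hL a b hv)) (mk c) = _ :=
    stableCycle_mk hL (isStableIntersection_stableComplex hL _ c hw)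
  have h4 : stableCycle hL (mk (stableComplex hL b c hv')) (mk a) = _ :=
    stableCycle_mk hL (isStableIntersection_stableComplex hL _ a hw')
  rw [h3, h4]
  have hmax : stableMaxCells (stableComplex hL a b hv) c w =
      stableMaxCells (stableComplex hL b c hv') a w' := by
    ext F
    by_cases hex : ∃ y, RelInt y F
    · obtain ⟨y, hy⟩ := hex
      rw [mem_stableMaxCells_iff_triple hL hv hy, mem_stableMaxCells_iff_triple hL hv' hy,
        ← cellInters_rot a.cells b.cells c.cells]
      refine and_congr_right fun hF => ?_
      have : b.dim + c.dim + a.dim = a.dim + b.dim + c.dim := by ring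
      rw [this]
      refine and_congr_right fun hd => ?_
      rw [localMult_assoc hL a b c hv hv' hws hws' hF hy hd]
    -- A set without relative interior points is not a polyhedron, so it is a maximal cell on
    -- neither side.
    · have hno : ∀ D E : TropicalComplex L, ∀ u, F ∉ stableMaxCells D E u := by
        intro D E u hF
        have h := D.isPolyComplex.cellInters E.isPolyComplex
        have hF := (mem_stableMaxCells.1 hF).1
        exact hex ((h.isPoly hF).exists_relInt (h.rational F hF).1)
      exact iff_of_false (hno _ _ _) (hno _ _ _)
  refine TropicalComplex.mk_eq_of_maxCells ?_ ?_ ?_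
  · change a.dim + b.dim - _ + c.dim - _ = b.dim + c.dim - _ + a.dim - _
    ring
  · rw [maxCells_stableComplex, maxCells_stableComplex, hmax]
  · intro F hF
    rw [maxCells_stableComplex] at hF
    have hF' := hmax ▸ hF
    have hFc := (mem_stableMaxCells.1 hF).1
    have h := (stableComplex hL a b hv).isPolyComplex.cellInters c.isPolyComplex
    obtain ⟨y, hy⟩ := (h.isPoly hFc).exists_relInt (h.rational F hFc).1
    obtain ⟨hF₃, hd, -⟩ := (mem_stableMaxCells_iff_triple hL hv hy).1 hF
    change TropicalComplex.displacedMult _ _ _ F = TropicalComplex.displacedMult _ _ _ F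
    rw [displacedMult_eq_of_mem_cellInters hFc hy,
      displacedMult_eq_of_mem_cellInters (mem_stableMaxCells.1 hF').1 hy,
      localMult_assoc hL a b c hv hv' hws hws' hF₃ hy hd]

end Associativity

/-! ### Equality of cycles in terms of supports and weights -/

section Equivalence

variable {V : Type*} [AddCommGroup V] [Module ℝ V] {L : Submodule ℤ V}

namespace TropicalComplex

/-- Two complexes have the same dimension, support, and weights at generic points. -/
def Agrees (a a' : TropicalComplex L) : Prop :=
  a.dim = a'.dim ∧ a.support = a'.support ∧ ∀ P ∈ a.maxCells, ∀ P' ∈ a'.maxCells,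
    (P ∩ P').Nonempty → polyDim (P ∩ P') = a.dim → a.weight P = a'.weight P'

lemma Agrees.symm {a a' : TropicalComplex L} (h : a.Agrees a') : a'.Agrees a :=
  ⟨h.1.symm, h.2.1.symm, fun P hP P' hP' hne hd => by
    rw [Set.inter_comm] at hne hd
    exact (h.2.2 P' hP' P hP hne (hd.trans h.1.symm)).symm⟩

lemma subset_support {a : TropicalComplex L} {P : Set V} (hP : P ∈ a.cells) : P ⊆ a.support :=
  fun _ hx => mem_support.2 ⟨P, hP, hx⟩

lemma exists_cell_of_mem_cellInters {a a' : TropicalComplex L} {F : Set V} (hF : F ∈ cellInters a.cells a'.cells) :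
    ∃ P ∈ a.cells, F ⊆ P := by
  obtain ⟨-, P, hP, Q, hQ, rfl⟩ := mem_cellInters.1 hF
  exact ⟨P, hP, Set.inter_subset_left⟩

variable [FiniteDimensional ℝ V]

lemma eq_of_subset_inter {a : TropicalComplex L} {P Q G : Set V} (hP : P ∈ a.maxCells)
    (hQ : Q ∈ a.maxCells) (hGP : G ⊆ P) (hGQ : G ⊆ Q) (hne : G.Nonempty) (hd : polyDim G = a.dim) :
    P = Q := by
  rw [mem_maxCells] at hP hQ
  have h1 := polyDim_mono (Set.subset_inter hGP hGQ)
  have hne' : (P ∩ Q).Nonempty := hne.mono (Set.subset_inter hGP hGQ)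
  have h2 := (a.inter_face P hP.1 Q hQ.1 hne').eq_of_polyDim (a.isPoly hP.1) (by omega)
  rw [Set.inter_comm] at h1 hne'
  have h3 := (a.inter_face Q hQ.1 P hP.1 hne').eq_of_polyDim (a.isPoly hQ.1) (by omega)
  rw [← h2, Set.inter_comm, h3]

lemma Agrees.refl (a : TropicalComplex L) : a.Agrees a :=
  ⟨rfl, rfl, fun P hP P' hP' hne hd => by
    rw [eq_of_subset_inter hP hP' Set.inter_subset_left Set.inter_subset_right hne hd]⟩

/-- Where `P` and `Q` overlap in full dimension, a maximal cell of the middle complex shares an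
interior point with the overlap; the weights are compared through it. -/
lemma Agrees.trans {a b c : TropicalComplex L} (h : a.Agrees b) (h' : b.Agrees c) :
    a.Agrees c := by
  refine ⟨h.1.trans h'.1, h.2.1.trans h'.2.1, fun P hP Q hQ ⟨y, hy⟩ hd => ?_⟩
  have hP' := a.mem_maxCells.1 hP
  have hQ' := c.mem_maxCells.1 hQ
  have hp := (a.isPoly hP'.1).inter (c.isPoly hQ'.1)
  have hsub : P ∩ Q ⊆ ⋃ R ∈ b.cells, R := by
    refine Set.inter_subset_left.trans ((subset_support hP'.1).trans ?_)
    rw [h.2.1]; rfl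
  obtain ⟨G, hG, -, hle, x, hx, hxG⟩ := b.isPolyComplex.exists_relInt_cell hp hsub hy
  have hdG : polyDim G = b.dim := by
    refine le_antisymm (b.polyDim_le hG) ?_
    rw [← h.1, ← hd]
    unfold polyDim
    exact_mod_cast Submodule.finrank_mono hle
  have hGm := b.mem_maxCells.2 ⟨hG, hdG⟩
  have hdir : direction (P ∩ Q ∩ G) = direction (P ∩ Q) := by
    rw [hx.direction_inter hp (b.isPoly hG) hxG, inf_eq_left.2 hle]
  have hxm := hx.inter hp (b.isPoly hG) hxG
  have hd' : polyDim (P ∩ Q ∩ G) = a.dim := by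
    rw [← hd]; unfold polyDim; rw [hdir]
  have h1 : P ∩ Q ∩ G ⊆ P ∩ G := Set.inter_subset_inter_left _ Set.inter_subset_left
  have h2 : P ∩ Q ∩ G ⊆ G ∩ Q := fun x hx => ⟨hx.2, hx.1.2⟩
  have h3 := polyDim_mono h1
  have h4 := polyDim_mono h2
  have h5 : polyDim (P ∩ G) ≤ polyDim G := polyDim_mono Set.inter_subset_right
  have h6 : polyDim (G ∩ Q) ≤ polyDim G := polyDim_mono Set.inter_subset_left
  have h7 := h.1
  rw [h.2.2 P hP G hGm ⟨x, h1 hxm.1⟩ (by omega), h'.2.2 G hGm Q hQ ⟨x, h2 hxm.1⟩ (by omega)]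

lemma Refines.agrees {a' a : TropicalComplex L} (h : a'.Refines a) : a'.Agrees a := by
  refine ⟨h.1, h.2.1, fun P' hP' P hP hne hd => h.2.2.2 P' hP' P hP ?_⟩
  have hP'' := a'.mem_maxCells.1 hP'
  obtain ⟨P₁, hP₁, hsub⟩ := h.2.2.1 P' hP''.1
  have h1 := polyDim_mono hsub
  have h2 := a.polyDim_le hP₁
  have h3 := h.1
  have hP₁m := a.mem_maxCells.2 ⟨hP₁, by omega⟩
  rw [eq_of_subset_inter hP hP₁m Set.inter_subset_right (Set.inter_subset_left.trans hsub) hne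
    (by omega)]
  exact hsub

/-- `Agrees` is an equivalence relation that contains refinement, so it contains the relation
generated by refinement. -/
lemma agrees_of_mk_eq {a a' : TropicalComplex L} (h : TropicalCycle.mk a = TropicalCycle.mk a') :
    a.Agrees a' := by
  have hr := Quot.eqvGen_exact h
  clear h
  induction hr with
  | rel _ _ h => exact h.agrees
  | refl => exact Agrees.refl _
  | symm _ _ _ h => exact h.symm
  | trans _ _ _ _ _ h h' => exact h.trans h'

variable {a a' : TropicalComplex L}

/-- The weight of a cell of the common refinement. -/
def commonWeight (a : TropicalComplex L) (G : Set V) : ℤ :=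
  if h : ∃ P ∈ a.maxCells, G ⊆ P then a.weight h.choose else 0

lemma commonWeight_eq {P G : Set V} (hP : P ∈ a.maxCells) (hGP : G ⊆ P) (hne : G.Nonempty)
    (hd : polyDim G = a.dim) : a.commonWeight G = a.weight P := by
  have h : ∃ P ∈ a.maxCells, G ⊆ P := ⟨P, hP, hGP⟩
  rw [commonWeight, dif_pos h]
  rw [eq_of_subset_inter h.choose_spec.1 hP h.choose_spec.2 hGP hne hd]

lemma Agrees.subset_iUnion_cellInters (h : a.Agrees a') {P : Set V} (hP : P ∈ a.cells) :
    P ⊆ ⋃ G ∈ cellInters a.cells a'.cells, G := by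
  intro x hx
  have h1 := subset_support hP hx
  rw [h.2.1, mem_support] at h1
  obtain ⟨Q, hQ, hxQ⟩ := h1
  exact Set.mem_iUnion₂.2 ⟨P ∩ Q, mem_cellInters.2 ⟨⟨x, hx, hxQ⟩, P, hP, Q, hQ, rfl⟩, hx, hxQ⟩

lemma exists_maxCell_of_mem_cellInters {F : Set V} (hF : F ∈ cellInters a.cells a'.cells) :
    ∃ P ∈ a.maxCells, F ⊆ P := by
  obtain ⟨P, hP, hFP⟩ := exists_cell_of_mem_cellInters hF
  obtain ⟨Q, hQ, hPQ, hd⟩ := a.pure P hP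
  exact ⟨Q, a.mem_maxCells.2 ⟨hQ, hd⟩, hFP.trans hPQ⟩

lemma Agrees.pure_cellInters (h : a.Agrees a') {F : Set V}
    (hF : F ∈ cellInters a.cells a'.cells) :
    ∃ G ∈ cellInters a.cells a'.cells, F ⊆ G ∧ polyDim G = a.dim := by
  have hS := a.isPolyComplex.cellInters a'.isPolyComplex
  obtain ⟨y, hy⟩ := (hS.isPoly hF).exists_relInt (hS.rational F hF).1
  obtain ⟨P, hP, hFP⟩ := exists_maxCell_of_mem_cellInters hF
  have hP := a.mem_maxCells.1 hP
  obtain ⟨G, hG, hyG, hle, -⟩ := hS.exists_relInt_cell (a.isPoly hP.1)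
    (h.subset_iUnion_cellInters hP.1) (hFP hy.1)
  refine ⟨G, hG, hS.subset_of_relInt hF hG hy hyG, le_antisymm ?_ ?_⟩
  · obtain ⟨Q, hQ, hGQ⟩ := exists_cell_of_mem_cellInters hG
    exact (polyDim_mono hGQ).trans (a.polyDim_le hQ)
  · rw [← hP.2]
    unfold polyDim
    exact_mod_cast Submodule.finrank_mono hle

/-- The degrees of functionals on the refinement equal those on `a`, which coincide over `1` and
`-1` because `a` is balanced. -/
lemma Agrees.balanced_cellInters (hL : IsFullLattice L) (h : a.Agrees a') {G : Set V}
    (hG : G ∈ cellInters a.cells a'.cells) (hd : polyDim G = a.dim - 1) :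
    ∃ u : Set V → V, (∀ P ∈ cellInters a.cells a'.cells, polyDim P = a.dim → G ⊆ P →
        IsPrimitiveGenerator L P G (u P)) ∧
      ∑ P ∈ cellInters a.cells a'.cells with (polyDim P = a.dim ∧ G ⊆ P),
        a.commonWeight P • u P ∈ direction G := by
  have hS := a.isPolyComplex.cellInters a'.isPolyComplex
  obtain ⟨y, hy⟩ := (hS.isPoly hG).exists_relInt (hS.rational G hG).1
  refine balanced_of_degree hL hS hG hd hy fun ψ hψ hψG => ?_
  have hgen : ∀ (T : Finset (Set V)) (s : ℝ), s ≠ 0 → IsGenericFor T ψ s := by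
    intro T s hs P _ hne hmem
    rw [map_eq_bot_of_ne_top _ _ hne] at hmem
    exact hs hmem
  have hk : a.dim = Module.finrank ℝ ℝ + Module.finrank ℝ (direction G) := by
    unfold polyDim at hd
    rw [Module.finrank_self]
    push_cast
    omega
  have key : ∀ s : ℝ, s ≠ 0 →
      degree (cellsOfDim (cellInters a.cells a'.cells) a.dim) a.commonWeight L intLattice ψ y s =
        degree (cellsOfDim a.cells a.dim) a.weight L intLattice ψ y s := by
    intro s hs
    refine degree_eq_of_refines a.isPolyComplex hS a.pure
      (fun F hF => exists_cell_of_mem_cellInters hF)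
      (fun P hP => h.subset_iUnion_cellInters hP) ?_ hψG ?_ hk (hgen _ s hs) (hgen _ s hs)
    · intro F hF P hP hFd hPd hFP
      exact commonWeight_eq (a.mem_maxCells.2 ⟨hP, hPd⟩) hFP (hS.rational F hF).1 hFd
    · intro P hP hyP z hz
      exact tcone_mono y (hS.subset_of_relInt hG hP hy hyP) (hy.2 z hz)
  rw [key 1 one_ne_zero, key (-1) (by norm_num)]
  refine degree_eq_of_generic hL isFullLattice_intLattice a
    (fun x hx => mem_intLattice.2 (hψ x hx)) hψG ?_ hk (hgen _ _ one_ne_zero)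
    (hgen _ _ (by norm_num))
  intro P hP hyP z hz
  exact tcone_mono y (subset_left_of_mem_cellInters a.isPolyComplex hG hy hP hyP) (hy.2 z hz)

/-- The common refinement of two complexes which agree. -/
def Agrees.commonRefinement (hL : IsFullLattice L) (h : a.Agrees a') : TropicalComplex L where
  dim := a.dim
  cells := cellInters a.cells a'.cells
  weight := a.commonWeight
  rational := (a.isPolyComplex.cellInters a'.isPolyComplex).rational
  face_mem := (a.isPolyComplex.cellInters a'.isPolyComplex).face_mem
  inter_face := (a.isPolyComplex.cellInters a'.isPolyComplex).inter_face
  pure := fun _ hF => h.pure_cellInters hF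
  weight_ne_zero := by
    intro F hF hd
    obtain ⟨P, hP, hFP⟩ := exists_maxCell_of_mem_cellInters hF
    rw [commonWeight_eq hP hFP (mem_cellInters.1 hF).1 hd]
    exact a.weight_ne_zero P (a.mem_maxCells.1 hP).1 (a.mem_maxCells.1 hP).2
  balanced := fun _ hG hd => h.balanced_cellInters hL hG hd

lemma Agrees.commonRefinement_refines (hL : IsFullLattice L) (h : a.Agrees a') :
    (h.commonRefinement hL).Refines a ∧ (h.commonRefinement hL).Refines a' := by
  have hsupp : (h.commonRefinement hL).support = a.support := by
    ext x
    constructor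
    · intro hx
      obtain ⟨F, hF, hxF⟩ := mem_support.1 hx
      obtain ⟨P, hP, hFP⟩ := exists_cell_of_mem_cellInters hF
      exact mem_support.2 ⟨P, hP, hFP hxF⟩
    · intro hx
      obtain ⟨P, hP, hxP⟩ := mem_support.1 hx
      exact h.subset_iUnion_cellInters hP hxP
  refine ⟨⟨rfl, hsupp, fun F hF => exists_cell_of_mem_cellInters hF, ?_⟩,
    h.1, hsupp.trans h.2.1, ?_, ?_⟩
  · intro F hF P hP hFP
    obtain ⟨hF, hd⟩ := mem_maxCells _ |>.1 hF
    exact commonWeight_eq hP hFP (mem_cellInters.1 hF).1 hd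
  · intro F hF
    obtain ⟨-, P, hP, Q, hQ, rfl⟩ := mem_cellInters.1 hF
    exact ⟨Q, hQ, Set.inter_subset_right⟩
  · intro F hF Q hQ hFQ
    obtain ⟨hF, hd⟩ := mem_maxCells _ |>.1 hF
    obtain ⟨P, hP, hFP⟩ := exists_maxCell_of_mem_cellInters hF
    have hne := (mem_cellInters.1 hF).1
    have hd : polyDim F = a.dim := hd
    have hsub := Set.subset_inter hFP hFQ
    refine (commonWeight_eq hP hFP hne hd).trans (h.2.2 P hP Q hQ (hne.mono hsub) ?_)
    refine le_antisymm ?_ (hd.symm.le.trans (polyDim_mono hsub))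
    exact (polyDim_mono Set.inter_subset_left).trans (a.mem_maxCells.1 hP).2.le

lemma Agrees.mk_eq (hL : IsFullLattice L) (h : a.Agrees a') :
    TropicalCycle.mk a = TropicalCycle.mk a' :=
  (Quot.sound (h.commonRefinement_refines hL).1).symm.trans
    (Quot.sound (h.commonRefinement_refines hL).2)

end TropicalComplex

end Equivalence

/-! ### Recession cones -/

section Recession

variable {V : Type*} [AddCommGroup V] [Module ℝ V]

lemma mem_recession {P : Set V} {v : V} :
    v ∈ recession P ↔ ∀ x ∈ P, ∀ t : ℝ, 0 ≤ t → x + t • v ∈ P := Iff.rfl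

lemma recession_eq {I : Finset (Module.Dual ℝ V × ℝ)} {x : V}
    (hx : x ∈ {x : V | ∀ p ∈ I, p.2 ≤ p.1 x}) :
    recession {x : V | ∀ p ∈ I, p.2 ≤ p.1 x} = {v | ∀ p ∈ I, 0 ≤ p.1 v} := by
  ext v
  rw [mem_recession]
  simp only [Set.mem_ofPred_eq] at hx ⊢
  constructor
  · intro h p hp
    by_contra hneg
    push Not at hneg
    -- At this parameter the functional has dropped to `p.2 - 1`.
    have h1 := h x hx ((p.1 x - p.2 + 1) / (-p.1 v))
      (div_nonneg (by linarith [hx p hp]) (by linarith)) p hp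
    rw [map_add, map_smul, smul_eq_mul, div_mul_eq_mul_div, div_neg, mul_div_assoc,
      div_self hneg.ne] at h1
    linarith
  · intro h y hy t ht p hp
    rw [map_add, map_smul, smul_eq_mul]
    have := mul_nonneg ht (h p hp)
    linarith [hy p hp]

lemma IsPoly.recession_inter {P Q : Set V} (hP : IsPoly P) (hQ : IsPoly Q)
    (hne : (P ∩ Q).Nonempty) : recession (P ∩ Q) = recession P ∩ recession Q := by
  obtain ⟨I, rfl⟩ := hP
  obtain ⟨J, rfl⟩ := hQ
  obtain ⟨x, hx, hx'⟩ := hne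
  rw [recession_eq hx, recession_eq hx']
  have h : {x : V | ∀ p ∈ I, p.2 ≤ p.1 x} ∩ {x : V | ∀ p ∈ J, p.2 ≤ p.1 x} =
      {x : V | ∀ p ∈ I ∪ J, p.2 ≤ p.1 x} := by
    ext z
    simp only [Set.mem_inter_iff, Set.mem_ofPred_eq, Finset.mem_union, or_imp, forall_and]
  have hxx : x ∈ {x : V | ∀ p ∈ I ∪ J, p.2 ≤ p.1 x} := h ▸ ⟨hx, hx'⟩
  rw [h, recession_eq hxx]
  ext z
  simp only [Set.mem_inter_iff, Set.mem_ofPred_eq, Finset.mem_union, or_imp, forall_and]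

lemma IsPoly.recession_mono {P Q : Set V} (hP : IsPoly P) (hQ : IsPoly Q) (h : P ⊆ Q)
    (hne : P.Nonempty) : recession P ⊆ recession Q := by
  have h1 := hP.recession_inter hQ (by rwa [Set.inter_eq_left.2 h])
  rw [Set.inter_eq_left.2 h] at h1
  rw [h1]
  exact Set.inter_subset_right

lemma add_mem_of_mem_recession {P : Set V} {x w : V} (hx : x ∈ P) (hw : w ∈ recession P) :
    x + w ∈ P := by
  simpa using mem_recession.1 hw x hx 1 zero_le_one

lemma exists_sub_of_mem_span (τ : PointedCone ℝ V) {s : V}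
    (hs : s ∈ Submodule.span ℝ (τ : Set V)) : ∃ w ∈ τ, ∃ w' ∈ τ, s = w - w' := by
  induction hs using Submodule.span_induction with
  | mem x hx => exact ⟨x, hx, 0, τ.zero_mem, by simp⟩
  | zero => exact ⟨0, τ.zero_mem, 0, τ.zero_mem, by simp⟩
  | add x y _ _ hx hy =>
    obtain ⟨w, hw, w', hw', rfl⟩ := hx
    obtain ⟨z, hz, z', hz', rfl⟩ := hy
    exact ⟨w + z, τ.add_mem hw hz, w' + z', τ.add_mem hw' hz', by abel⟩
  | smul c x _ hx =>
    obtain ⟨w, hw, w', hw', rfl⟩ := hx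
    rcases le_total 0 c with hc | hc
    · exact ⟨c • w, τ.smul_mem hc hw, c • w', τ.smul_mem hc hw', by rw [smul_sub]⟩
    · have hc' : 0 ≤ -c := by linarith
      exact ⟨(-c) • w', τ.smul_mem hc' hw', (-c) • w, τ.smul_mem hc' hw, by
        rw [neg_smul, neg_smul, smul_sub]; abel⟩

end Recession

/-! ### Images of polyhedra in an orbit -/

section OrbitImage

variable {V : Type*} [AddCommGroup V] [Module ℝ V] {L : Submodule ℤ V} {τ : PointedCone ℝ V}
  {P Q F : Set V}

lemma orbitProj_eq_zero_iff {x : V} :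
    orbitProj τ x = 0 ↔ x ∈ Submodule.span ℝ (τ : Set V) := Submodule.Quotient.mk_eq_zero _

lemma orbitProj_eq_iff {x y : V} :
    orbitProj τ x = orbitProj τ y ↔ x - y ∈ Submodule.span ℝ (τ : Set V) :=
  Submodule.Quotient.eq _

lemma ker_orbitProj : LinearMap.ker (orbitProj τ) = Submodule.span ℝ (τ : Set V) :=
  Submodule.ker_mkQ _

lemma orbitProj_surjective : Function.Surjective (orbitProj τ) := Submodule.mkQ_surjective _

lemma orbitProj_eq_zero_of_mem {w : V} (hw : w ∈ τ) : orbitProj τ w = 0 :=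
  orbitProj_eq_zero_iff.2 (Submodule.subset_span hw)

/-- Two points with equal image differ by a difference of two vectors of `τ`. Adding these to the
respective points gives a common point, and neither set is left. -/
lemma orbitProj_image_inter (hP : (τ : Set V) ⊆ recession P) (hQ : (τ : Set V) ⊆ recession Q) :
    orbitProj τ '' (P ∩ Q) = orbitProj τ '' P ∩ orbitProj τ '' Q := by
  refine (Set.image_inter_subset _ _ _).antisymm ?_
  rintro _ ⟨⟨x, hx, rfl⟩, x', hx', h⟩
  obtain ⟨w, hw, w', hw', hs⟩ := exists_sub_of_mem_span τ (orbitProj_eq_iff.1 h)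
  have h1 : x' + w' = x + w := by
    rw [← sub_eq_zero] at hs ⊢
    rw [← hs]; abel
  refine ⟨x + w, ⟨add_mem_of_mem_recession hx (hP hw),
    h1 ▸ add_mem_of_mem_recession hx' (hQ hw')⟩, ?_⟩
  rw [map_add, orbitProj_eq_zero_of_mem hw, add_zero]

lemma span_le_direction (hne : P.Nonempty) (hP : (τ : Set V) ⊆ recession P) :
    Submodule.span ℝ (τ : Set V) ≤ direction P := by
  obtain ⟨x, hx⟩ := hne
  refine Submodule.span_le.2 fun w hw => ?_
  have := vsub_mem_vectorSpan ℝ (add_mem_of_mem_recession hx (hP hw)) hx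
  simpa using this

lemma polyDim_orbitProj_image [FiniteDimensional ℝ V] (hne : P.Nonempty)
    (hP : (τ : Set V) ⊆ recession P) :
    polyDim (orbitProj τ '' P) = polyDim P - Module.finrank ℝ (Submodule.span ℝ (τ : Set V)) := by
  have h := finrank_map_add_finrank_inf_ker (direction P) (orbitProj τ)
  rw [ker_orbitProj, inf_eq_right.2 (span_le_direction hne hP), ← direction_image] at h
  unfold polyDim
  omega

/-- Only the inequalities that vanish on `τ` survive. The others are non-negative on `τ` and
positive at a suitable vector `w` of `τ`, so they are satisfied after moving far along `w`, which
does not change the image. -/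
lemma orbitProj_mem_image_iff {I : Finset (Module.Dual ℝ V × ℝ)}
    (hne : {x : V | ∀ p ∈ I, p.2 ≤ p.1 x}.Nonempty)
    (hP : (τ : Set V) ⊆ recession {x : V | ∀ p ∈ I, p.2 ≤ p.1 x}) {x : V} :
    orbitProj τ x ∈ orbitProj τ '' {x : V | ∀ p ∈ I, p.2 ≤ p.1 x} ↔
      ∀ p ∈ I, (∀ z ∈ τ, p.1 z = 0) → p.2 ≤ p.1 x := by
  obtain ⟨x₀, hx₀⟩ := hne
  rw [recession_eq hx₀] at hP
  constructor
  · rintro ⟨x', hx', h⟩ p hp hpτ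
    have h1 : Submodule.span ℝ (τ : Set V) ≤ LinearMap.ker p.1 :=
      Submodule.span_le.2 fun z hz => hpτ z hz
    have h2 : p.1 (x' - x) = 0 := h1 (orbitProj_eq_iff.1 h)
    rw [map_sub, sub_eq_zero] at h2
    exact h2 ▸ hx' p hp
  intro hx
  have hw : ∃ w ∈ τ, ∀ p ∈ I, (∃ z ∈ τ, p.1 z ≠ 0) → 0 < p.1 w := by
    have key : ∀ J : Finset (Module.Dual ℝ V × ℝ), J ⊆ I →
        ∃ w ∈ τ, ∀ p ∈ J, (∃ z ∈ τ, p.1 z ≠ 0) → 0 < p.1 w := by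
      intro J
      induction J using Finset.induction_on with
      | empty => exact fun _ => ⟨0, τ.zero_mem, by simp⟩
      | insert q J _ ih =>
        intro hJ
        obtain ⟨w, hw, hwJ⟩ := ih ((Finset.subset_insert _ _).trans hJ)
        by_cases hq : ∃ z ∈ τ, q.1 z ≠ 0
        · obtain ⟨z, hz, hqz⟩ := hq
          refine ⟨w + z, τ.add_mem hw hz, fun p hp hpz => ?_⟩
          rw [map_add]
          have h1 := hP hw p (hJ hp)
          have h2 := hP hz p (hJ hp)
          rcases Finset.mem_insert.1 hp with rfl | hp
          · have := lt_of_le_of_ne h2 hqz.symm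
            linarith
          · have := hwJ p hp hpz
            linarith
        · refine ⟨w, hw, fun p hp hpz => ?_⟩
          rcases Finset.mem_insert.1 hp with rfl | hp
          · exact absurd hpz hq
          · exact hwJ p hp hpz
    exact key I subset_rfl
  obtain ⟨w, hwτ, hw⟩ := hw
  have hev : ∀ᶠ t : ℝ in atTop, ∀ p ∈ I, p.2 ≤ p.1 (x + t • w) := by
    rw [Filter.eventually_all_finset]
    intro p hp
    by_cases hpτ : ∀ z ∈ τ, p.1 z = 0
    · refine Eventually.of_forall fun t => ?_
      rw [map_add, map_smul, hpτ w hwτ, smul_zero, add_zero]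
      exact hx p hp hpτ
    · push Not at hpτ
      have hpos := hw p hp hpτ
      filter_upwards [eventually_ge_atTop ((p.2 - p.1 x) / p.1 w)] with t ht
      rw [div_le_iff₀ hpos] at ht
      rw [map_add, map_smul, smul_eq_mul]
      linarith
  obtain ⟨t, ht⟩ := hev.exists
  refine ⟨x + t • w, ht, ?_⟩
  rw [map_add, map_smul, orbitProj_eq_zero_of_mem hwτ, smul_zero, add_zero]

lemma isRationalPolyhedron_orbitProj_image (h : IsRationalPolyhedron L P)
    (hP : (τ : Set V) ⊆ recession P) :
    IsRationalPolyhedron (orbitLattice L τ) (orbitProj τ '' P) := by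
  obtain ⟨hne, I, hI, rfl⟩ := h
  have hker : ∀ p : Module.Dual ℝ V, (∀ z ∈ τ, p z = 0) →
      Submodule.span ℝ (τ : Set V) ≤ LinearMap.ker p :=
    fun p hp => Submodule.span_le.2 fun z hz => hp z hz
  refine ⟨hne.image _, (I.filter fun p => ∀ z ∈ τ, p.1 z = 0).image (fun p =>
    (if h : Submodule.span ℝ (τ : Set V) ≤ LinearMap.ker p.1 then
      (Submodule.span ℝ (τ : Set V)).liftQ p.1 h else 0, p.2)), ?_, ?_⟩
  · intro q hq y hy
    obtain ⟨p, hp, rfl⟩ := Finset.mem_image.1 hq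
    obtain ⟨hpI, hpτ⟩ := Finset.mem_filter.1 hp
    obtain ⟨l, hl, rfl⟩ := hy
    rw [dif_pos (hker p.1 hpτ)]
    exact hI p hpI l hl
  · ext y
    obtain ⟨x, rfl⟩ := orbitProj_surjective y
    rw [orbitProj_mem_image_iff hne hP]
    constructor
    · intro hx q hq
      obtain ⟨p, hp, rfl⟩ := Finset.mem_image.1 hq
      obtain ⟨hpI, hpτ⟩ := Finset.mem_filter.1 hp
      rw [dif_pos (hker p.1 hpτ)]
      exact hx p hpI hpτ
    · intro hy p hp hpτ
      have := hy _ (Finset.mem_image_of_mem _ (Finset.mem_filter.2 ⟨hp, hpτ⟩))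
      rw [dif_pos (hker p.1 hpτ)] at this
      exact this

/-- The supporting functional is constant on `F`, which is stable under adding vectors of `τ`; so it
vanishes on `τ` and descends to the orbit. -/
lemma isFace_orbitProj_image (h : IsFace F P) (hF : (τ : Set V) ⊆ recession F) :
    IsFace (orbitProj τ '' F) (orbitProj τ '' P) := by
  obtain ⟨⟨x₀, hx₀⟩, u, rfl⟩ := h
  have hu : Submodule.span ℝ (τ : Set V) ≤ LinearMap.ker u := by
    refine Submodule.span_le.2 fun w hw => ?_
    have h1 := add_mem_of_mem_recession hx₀ (hF hw)
    have h2 := h1.2 x₀ hx₀.1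
    have h3 := hx₀.2 _ h1.1
    rw [map_add] at h2 h3
    change u w = 0
    linarith
  refine ⟨⟨_, x₀, hx₀, rfl⟩, (Submodule.span ℝ (τ : Set V)).liftQ u hu, ?_⟩
  ext y
  constructor
  · rintro ⟨x, hx, rfl⟩
    refine ⟨⟨x, hx.1, rfl⟩, ?_⟩
    rintro _ ⟨z, hz, rfl⟩
    exact hx.2 z hz
  · rintro ⟨⟨x, hx, rfl⟩, h⟩
    exact ⟨x, ⟨hx, fun z hz => h _ ⟨z, hz, rfl⟩⟩, rfl⟩

lemma IsFace.exists_of_orbitProj_image {G : Set (Orbit τ)} (h : IsFace G (orbitProj τ '' P))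
    (hP : (τ : Set V) ⊆ recession P) :
    ∃ F, IsFace F P ∧ (τ : Set V) ⊆ recession F ∧ orbitProj τ '' F = G := by
  obtain ⟨⟨y, hy⟩, u, rfl⟩ := h
  obtain ⟨⟨x, hx, rfl⟩, hmin⟩ := hy
  have key : ∀ z, z ∈ P → (∀ t ∈ orbitProj τ '' P, u (orbitProj τ z) ≤ u t) →
      ∀ t ∈ P, (u ∘ₗ orbitProj τ) z ≤ (u ∘ₗ orbitProj τ) t :=
    fun z _ h t ht => h _ ⟨t, ht, rfl⟩
  refine ⟨{z | z ∈ P ∧ ∀ t ∈ P, (u ∘ₗ orbitProj τ) z ≤ (u ∘ₗ orbitProj τ) t},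
    ⟨⟨x, hx, key x hx hmin⟩, _, rfl⟩, ?_, ?_⟩
  · intro w hw z hz t ht
    refine ⟨hP hw z hz.1 t ht, fun s hs => ?_⟩
    have : (u ∘ₗ orbitProj τ) w = 0 := by simp [orbitProj_eq_zero_of_mem hw]
    rw [map_add, map_smul, this, smul_zero, add_zero]
    exact hz.2 s hs
  · ext y
    constructor
    · rintro ⟨z, hz, rfl⟩
      refine ⟨⟨z, hz.1, rfl⟩, ?_⟩
      rintro _ ⟨t, ht, rfl⟩
      exact hz.2 t ht
    · rintro ⟨⟨z, hz, rfl⟩, h⟩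
      exact ⟨z, ⟨hz, key z hz h⟩, rfl⟩

lemma starCone_orbitProj_image :
    starCone (orbitProj τ '' F) (orbitProj τ '' P) = orbitProj τ '' starCone F P := by
  ext z
  constructor
  · rintro ⟨t, ht, _, ⟨x, hx, rfl⟩, _, ⟨y, hy, rfl⟩, rfl⟩
    exact ⟨_, ⟨t, ht, x, hx, y, hy, rfl⟩, by simp⟩
  · rintro ⟨_, ⟨t, ht, x, hx, y, hy, rfl⟩, rfl⟩
    exact ⟨t, ht, _, ⟨x, hx, rfl⟩, _, ⟨y, hy, rfl⟩, by simp⟩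

/-- The kernel of the projection lies in `direction P`, so a lattice vector whose image is parallel
to the image of `P` is itself parallel to `P`. -/
lemma latticeOf_orbitProj_image (hne : P.Nonempty) (hP : (τ : Set V) ⊆ recession P) :
    latticeOf (orbitLattice L τ) (orbitProj τ '' P) =
      (latticeOf L P).map ((orbitProj τ).restrictScalars ℤ) := by
  ext y
  rw [mem_latticeOf, direction_image]
  constructor
  · rintro ⟨⟨l, hl, rfl⟩, d, hd, hdl⟩
    refine ⟨l, ⟨hl, ?_⟩, rfl⟩
    have h1 := span_le_direction hne hP (orbitProj_eq_iff.1 hdl)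
    have h2 := Submodule.sub_mem _ hd h1
    rwa [sub_sub_cancel] at h2
  · rintro ⟨l, ⟨hl, hlP⟩, rfl⟩
    exact ⟨⟨l, hl, rfl⟩, l, hlP, rfl⟩

lemma IsPrimitiveGenerator.orbitProj_image {u : V} (h : IsPrimitiveGenerator L P F u)
    (hPn : P.Nonempty) (hFn : F.Nonempty) (hP : (τ : Set V) ⊆ recession P)
    (hF : (τ : Set V) ⊆ recession F) :
    IsPrimitiveGenerator (orbitLattice L τ) (orbitProj τ '' P) (orbitProj τ '' F)
      (orbitProj τ u) := by
  refine ⟨?_, ⟨u, h.2.1, rfl⟩, ?_⟩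
  · rw [starCone_orbitProj_image]
    exact ⟨u, h.1, rfl⟩
  · rw [latticeOf_orbitProj_image hPn hP, latticeOf_orbitProj_image hFn hF, h.map_latticeOf]

/-- If the integral functionals on the orbit did not span, they would have a common zero `x ≠ 0`.
Rationality of the span of `τ` provides an integral functional that descends and does not vanish at
`x`. -/
lemma isFullLattice_orbitLattice [FiniteDimensional ℝ V] (hL : IsFullLattice L)
    (hτ : IsRationalSubspace L (Submodule.span ℝ (τ : Set V))) :
    IsFullLattice (orbitLattice L τ) := by
  constructor
  · have : (orbitLattice L τ : Set (Orbit τ)) = orbitProj τ '' L := rfl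
    rw [this, ← Submodule.map_span, hL.span_eq, Submodule.map_top]
    exact LinearMap.range_eq_top.2 orbitProj_surjective
  · by_contra hne
    obtain ⟨f, hf0, hf⟩ := Submodule.exists_dual_map_eq_bot_of_lt_top (lt_top_iff_ne_top.2 hne)
      inferInstance
    obtain ⟨x, rfl⟩ := (Module.evalEquiv ℝ (Orbit τ)).surjective f
    have hx0 : x ≠ 0 := by rintro rfl; simp at hf0
    obtain ⟨z, rfl⟩ := orbitProj_surjective x
    obtain ⟨φ, hφ, hφ0, hφz⟩ := hτ.exists_functional hL (x := z)
      (fun h => hx0 (orbitProj_eq_zero_iff.2 h))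
    apply hφz
    have hk : Submodule.span ℝ (τ : Set V) ≤ LinearMap.ker φ := fun t ht => hφ0 t ht
    have hmem : (Submodule.span ℝ (τ : Set V)).liftQ φ hk ∈
        Submodule.span ℝ (dualLattice (orbitLattice L τ) : Set (Module.Dual ℝ (Orbit τ))) := by
      apply Submodule.subset_span
      rintro _ ⟨l, hl, rfl⟩
      exact hφ l hl
    have := Submodule.mem_map_of_mem (f := Module.evalEquiv ℝ (Orbit τ) (orbitProj τ z)) hmem
    rw [hf] at this
    exact this

end OrbitImage

/-! ### The boundary of a balanced complex -/

section BoundaryComplex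

variable {V : Type*} [AddCommGroup V] [Module ℝ V] {L : Submodule ℤ V}

namespace TropicalComplex

variable {a b : TropicalComplex L} {τ : PointedCone ℝ V} {P Q : Set V}

/-- The cells whose recession cone contains `τ`. -/
def cellsAlong (a : TropicalComplex L) (τ : PointedCone ℝ V) : Finset (Set V) :=
  a.cells.filter fun P => (τ : Set V) ⊆ recession P

lemma mem_cellsAlong : P ∈ a.cellsAlong τ ↔ P ∈ a.cells ∧ (τ : Set V) ⊆ recession P := by
  simp [cellsAlong]

lemma mem_cellsAlong_of_subset (hP : P ∈ a.cellsAlong τ) (hQ : Q ∈ a.cells) (h : P ⊆ Q) :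
    Q ∈ a.cellsAlong τ := by
  rw [mem_cellsAlong] at hP ⊢
  exact ⟨hQ, hP.2.trans ((a.isPoly hP.1).recession_mono (a.isPoly hQ) h (a.nonempty hP.1))⟩

/-- The cells of the boundary. -/
def boundaryCells (a : TropicalComplex L) (τ : PointedCone ℝ V) : Finset (Set (Orbit τ)) :=
  (a.cellsAlong τ).image fun P => orbitProj τ '' P

lemma mem_boundaryCells {R : Set (Orbit τ)} :
    R ∈ a.boundaryCells τ ↔ ∃ P ∈ a.cellsAlong τ, orbitProj τ '' P = R := by
  simp [boundaryCells]

variable [FiniteDimensional ℝ V]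

/-- If the image of `P` is contained in that of `Q`, then `P ∩ Q` has the same image as `P`, hence
the same dimension; as a face of `P` it is then `P`. -/
lemma orbitProj_image_subset_iff (hP : P ∈ a.cellsAlong τ) (hQ : Q ∈ a.cellsAlong τ) :
    orbitProj τ '' P ⊆ orbitProj τ '' Q ↔ P ⊆ Q := by
  refine ⟨fun h => ?_, fun h => Set.image_mono h⟩
  rw [mem_cellsAlong] at hP hQ
  have h1 := orbitProj_image_inter hP.2 hQ.2
  rw [Set.inter_eq_left.2 h] at h1
  have hne : (P ∩ Q).Nonempty := by
    rw [← Set.image_nonempty (f := orbitProj τ), h1]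
    exact (a.nonempty hP.1).image _
  have h2 : (τ : Set V) ⊆ recession (P ∩ Q) := by
    rw [(a.isPoly hP.1).recession_inter (a.isPoly hQ.1) hne]
    exact Set.subset_inter hP.2 hQ.2
  have h3 := polyDim_orbitProj_image hne h2
  have h4 := polyDim_orbitProj_image (a.nonempty hP.1) hP.2
  rw [h1] at h3
  have h5 := (a.inter_face P hP.1 Q hQ.1 hne).eq_of_polyDim (a.isPoly hP.1) (by omega)
  exact Set.inter_eq_left.1 h5

lemma orbitProj_image_injOn : Set.InjOn (fun P : Set V => orbitProj τ '' P) (a.cellsAlong τ) :=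
  fun _ hP _ hQ h => ((orbitProj_image_subset_iff hP hQ).1 (le_of_eq h)).antisymm
    ((orbitProj_image_subset_iff hQ hP).1 (le_of_eq h.symm))

/-- The cell of `a` along `τ` with a given image in the orbit. -/
def liftCell (a : TropicalComplex L) (τ : PointedCone ℝ V) (R : Set (Orbit τ)) : Set V :=
  if h : ∃ P ∈ a.cellsAlong τ, orbitProj τ '' P = R then h.choose else ∅

lemma liftCell_eq (hP : P ∈ a.cellsAlong τ) : a.liftCell τ (orbitProj τ '' P) = P := by
  have h : ∃ Q ∈ a.cellsAlong τ, orbitProj τ '' Q = orbitProj τ '' P := ⟨P, hP, rfl⟩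
  rw [liftCell, dif_pos h]
  exact orbitProj_image_injOn h.choose_spec.1 hP h.choose_spec.2

lemma polyDim_orbitProj_image_cell (hP : P ∈ a.cellsAlong τ) :
    polyDim (orbitProj τ '' P) = polyDim P - Module.finrank ℝ (Submodule.span ℝ (τ : Set V)) :=
  polyDim_orbitProj_image (a.nonempty (mem_cellsAlong.1 hP).1) (mem_cellsAlong.1 hP).2

/-- All cells containing `F` have `τ` in their recession cones, so no neighbour of `F` is lost and
the balancing relation can be projected. -/
lemma boundary_balanced {R : Set (Orbit τ)} (hR : R ∈ a.boundaryCells τ)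
    (hd : polyDim R = a.dim - Module.finrank ℝ (Submodule.span ℝ (τ : Set V)) - 1) :
    ∃ u : Set (Orbit τ) → Orbit τ,
      (∀ P ∈ a.boundaryCells τ,
        polyDim P = a.dim - Module.finrank ℝ (Submodule.span ℝ (τ : Set V)) → R ⊆ P →
          IsPrimitiveGenerator (orbitLattice L τ) P R (u P)) ∧
      ∑ P ∈ a.boundaryCells τ with
          (polyDim P = a.dim - Module.finrank ℝ (Submodule.span ℝ (τ : Set V)) ∧ R ⊆ P),
        a.weight (a.liftCell τ P) • u P ∈ direction R := by
  obtain ⟨F, hF, rfl⟩ := mem_boundaryCells.1 hR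
  have hF' := mem_cellsAlong.1 hF
  rw [polyDim_orbitProj_image_cell hF] at hd
  obtain ⟨u, hu, hsum⟩ := a.balanced F hF'.1 (by omega)
  refine ⟨fun R => orbitProj τ (u (a.liftCell τ R)), ?_, ?_⟩
  · intro R hR hd hsub
    obtain ⟨P, hP, rfl⟩ := mem_boundaryCells.1 hR
    have hP' := mem_cellsAlong.1 hP
    rw [polyDim_orbitProj_image_cell hP] at hd
    rw [orbitProj_image_subset_iff hF hP] at hsub
    beta_reduce
    rw [liftCell_eq hP]
    exact (hu P hP'.1 (by omega) hsub).orbitProj_image (a.nonempty hP'.1) (a.nonempty hF'.1)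
      hP'.2 hF'.2
  · have hset : (a.boundaryCells τ).filter (fun R =>
          polyDim R = a.dim - Module.finrank ℝ (Submodule.span ℝ (τ : Set V)) ∧
            orbitProj τ '' F ⊆ R) =
        (a.cells.filter fun P => polyDim P = a.dim ∧ F ⊆ P).image fun P => orbitProj τ '' P := by
      ext R
      simp only [Finset.mem_filter, Finset.mem_image, mem_boundaryCells]
      constructor
      · rintro ⟨⟨P, hP, rfl⟩, hd, hsub⟩
        rw [polyDim_orbitProj_image_cell hP] at hd
        rw [orbitProj_image_subset_iff hF hP] at hsub
        exact ⟨P, ⟨(mem_cellsAlong.1 hP).1, by omega, hsub⟩, rfl⟩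
      · rintro ⟨P, ⟨hP, hd, hsub⟩, rfl⟩
        have hP' := mem_cellsAlong_of_subset hF hP hsub
        refine ⟨⟨P, hP', rfl⟩, ?_, Set.image_mono hsub⟩
        rw [polyDim_orbitProj_image_cell hP', hd]
    have halong : ∀ P ∈ a.cells.filter (fun P => polyDim P = a.dim ∧ F ⊆ P),
        P ∈ a.cellsAlong τ := by
      intro P hP
      obtain ⟨hP, -, hsub⟩ := Finset.mem_filter.1 hP
      exact mem_cellsAlong_of_subset hF hP hsub
    rw [hset, Finset.sum_image fun P hP Q hQ h =>
      orbitProj_image_injOn (halong P hP) (halong Q hQ) h]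
    have : ∀ P ∈ a.cells.filter (fun P => polyDim P = a.dim ∧ F ⊆ P),
        a.weight (a.liftCell τ (orbitProj τ '' P)) •
          orbitProj τ (u (a.liftCell τ (orbitProj τ '' P))) = orbitProj τ (a.weight P • u P) := by
      intro P hP
      rw [liftCell_eq (halong P hP), map_zsmul]
    rw [Finset.sum_congr rfl this, ← map_sum, direction_image]
    exact Submodule.mem_map_of_mem hsum

/-- The boundary of a complex in an orbit. -/
def boundary (a : TropicalComplex L) (τ : PointedCone ℝ V) :
    TropicalComplex (orbitLattice L τ) where
  dim := a.dim - Module.finrank ℝ (Submodule.span ℝ (τ : Set V))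
  cells := a.boundaryCells τ
  weight := fun R => a.weight (a.liftCell τ R)
  rational := by
    intro R hR
    obtain ⟨P, hP, rfl⟩ := mem_boundaryCells.1 hR
    rw [mem_cellsAlong] at hP
    exact isRationalPolyhedron_orbitProj_image (a.rational P hP.1) hP.2
  face_mem := by
    intro R hR G hG
    obtain ⟨P, hP, rfl⟩ := mem_boundaryCells.1 hR
    rw [mem_cellsAlong] at hP
    obtain ⟨F, hF, hFτ, rfl⟩ := hG.exists_of_orbitProj_image hP.2
    exact mem_boundaryCells.2 ⟨F, mem_cellsAlong.2 ⟨a.face_mem P hP.1 F hF, hFτ⟩, rfl⟩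
  inter_face := by
    intro R hR R' hR' hne
    obtain ⟨P, hP, rfl⟩ := mem_boundaryCells.1 hR
    obtain ⟨Q, hQ, rfl⟩ := mem_boundaryCells.1 hR'
    rw [mem_cellsAlong] at hP hQ
    rw [← orbitProj_image_inter hP.2 hQ.2] at hne ⊢
    rw [Set.image_nonempty] at hne
    refine isFace_orbitProj_image (a.inter_face P hP.1 Q hQ.1 hne) ?_
    rw [(a.isPoly hP.1).recession_inter (a.isPoly hQ.1) hne]
    exact Set.subset_inter hP.2 hQ.2
  pure := by
    intro R hR
    obtain ⟨P, hP, rfl⟩ := mem_boundaryCells.1 hR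
    obtain ⟨Q, hQ, hPQ, hd⟩ := a.pure P (mem_cellsAlong.1 hP).1
    have hQ' := mem_cellsAlong_of_subset hP hQ hPQ
    exact ⟨_, mem_boundaryCells.2 ⟨Q, hQ', rfl⟩, Set.image_mono hPQ, by
      rw [polyDim_orbitProj_image_cell hQ', hd]⟩
  weight_ne_zero := by
    intro R hR hd
    obtain ⟨P, hP, rfl⟩ := mem_boundaryCells.1 hR
    rw [polyDim_orbitProj_image_cell hP] at hd
    rw [liftCell_eq hP]
    exact a.weight_ne_zero P (mem_cellsAlong.1 hP).1 (by omega)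
  balanced := fun _ hR hd => boundary_balanced hR hd

end TropicalComplex

end BoundaryComplex

/-! ### Boundaries commute with stable intersections of complexes -/

section BoundaryProduct

variable {V : Type*} [AddCommGroup V] [Module ℝ V] {L : Submodule ℤ V} {τ : PointedCone ℝ V}
  {P Q F : Set V}

lemma add_mem_starCone (hne : F.Nonempty) (hFP : F ⊆ P) (hP : (τ : Set V) ⊆ recession P) {z w : V}
    (hz : z ∈ starCone F P) (hw : w ∈ τ) : z + w ∈ starCone F P := by
  obtain ⟨t, ht, x, hx, y, hy, rfl⟩ := hz
  rcases ht.eq_or_lt with rfl | ht'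
  · obtain ⟨y', hy'⟩ := hne
    exact ⟨1, zero_le_one, y' + w, add_mem_of_mem_recession (hFP hy') (hP hw), y', hy', by simp⟩
  · refine ⟨t, ht, x + t⁻¹ • w, hP hw x hx _ (by positivity), y, hy, ?_⟩
    rw [add_sub_right_comm, smul_add, smul_smul, mul_inv_cancel₀ ht'.ne', one_smul]

/-- The star cones absorb `τ`, so a coincidence modulo the span of `τ` can be moved to a true
coincidence upstairs. -/
lemma orbitProj_starCone_inter_nonempty (hne : F.Nonempty) (hFP : F ⊆ P) (hFQ : F ⊆ Q)
    (hP : (τ : Set V) ⊆ recession P) (hQ : (τ : Set V) ⊆ recession Q) (v : V) :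
    (starCone (orbitProj τ '' F) (orbitProj τ '' P) ∩
      (fun x => x + orbitProj τ v) '' starCone (orbitProj τ '' F) (orbitProj τ '' Q)).Nonempty ↔
    (starCone F P ∩ (fun x => x + v) '' starCone F Q).Nonempty := by
  rw [starCone_orbitProj_image, starCone_orbitProj_image]
  constructor
  · rintro ⟨_, ⟨z, hz, rfl⟩, _, ⟨z', hz', rfl⟩, h⟩
    beta_reduce at h
    rw [← map_add] at h
    obtain ⟨w, hw, w', hw', hs⟩ := exists_sub_of_mem_span τ (orbitProj_eq_iff.1 h)
    have h1 : (z' + w') + v = z + w := by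
      rw [← sub_eq_zero] at hs ⊢
      rw [← hs]; abel
    exact ⟨z + w, add_mem_starCone hne hFP hP hz hw, z' + w', add_mem_starCone hne hFQ hQ hz' hw',
      h1⟩
  · rintro ⟨_, hz, z', hz', rfl⟩
    exact ⟨_, ⟨_, hz, rfl⟩, _, ⟨z', hz', rfl⟩, by simp⟩

/-- The lattice of `P` already contains all lattice vectors killed by the projection, so passing to
the quotient preserves the index. -/
lemma relIndex_orbitLattice (hPn : P.Nonempty) (hQn : Q.Nonempty)
    (hP : (τ : Set V) ⊆ recession P) (hQ : (τ : Set V) ⊆ recession Q) :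
    (latticeOf (orbitLattice L τ) (orbitProj τ '' P) ⊔
        latticeOf (orbitLattice L τ) (orbitProj τ '' Q)).toAddSubgroup.relIndex
          (orbitLattice L τ).toAddSubgroup =
      (latticeOf L P ⊔ latticeOf L Q).toAddSubgroup.relIndex L.toAddSubgroup := by
  rw [latticeOf_orbitProj_image hPn hP, latticeOf_orbitProj_image hQn hQ, ← Submodule.map_sup]
  set A := latticeOf L P ⊔ latticeOf L Q
  set f : V →+ Orbit τ := (orbitProj τ).toAddMonoidHom
  have h1 : (A.map ((orbitProj τ).restrictScalars ℤ)).toAddSubgroup = A.toAddSubgroup.map f := rfl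
  have h2 : (orbitLattice L τ).toAddSubgroup = L.toAddSubgroup.map f := rfl
  have hAL : A ≤ L := sup_le (fun _ h => h.1) (fun _ h => h.1)
  rw [h1, h2, ← AddSubgroup.relIndex_comap, ← AddSubgroup.inf_relIndex_right]
  congr 1
  ext x
  constructor
  · rintro ⟨⟨y, hy, hyx⟩, hx⟩
    have hyA : y ∈ A := hy
    have h3 : y - x ∈ Submodule.span ℝ (τ : Set V) := orbitProj_eq_iff.1 hyx
    have h4 : y - x ∈ A :=
      Submodule.mem_sup_left ⟨L.sub_mem (hAL hyA) hx, span_le_direction hPn hP h3⟩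
    have h5 := A.sub_mem hyA h4
    rwa [sub_sub_cancel] at h5
  · exact fun hx => ⟨⟨x, hx, rfl⟩, hAL hx⟩

section

variable {a b : TropicalComplex L}

lemma TropicalComplex.isFace_inter_left (hF : F ∈ cellInters a.cells b.cells) (hP : P ∈ a.cells)
    (hne : (F ∩ P).Nonempty) : IsFace (F ∩ P) F := by
  obtain ⟨hne', P₀, hP₀, Q₀, hQ₀, rfl⟩ := mem_cellInters.1 hF
  have h1 : P₀ ∩ Q₀ ∩ P = (P₀ ∩ P) ∩ (Q₀ ∩ Q₀) := by ext; simp only [Set.mem_inter_iff]; tauto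
  rw [h1] at hne ⊢
  exact (a.inter_face P₀ hP₀ P hP (hne.mono Set.inter_subset_left)).inter
    (b.inter_face Q₀ hQ₀ Q₀ hQ₀ (hne.mono Set.inter_subset_right)) hne

lemma TropicalComplex.isFace_inter_right (hF : F ∈ cellInters a.cells b.cells) (hQ : Q ∈ b.cells)
    (hne : (F ∩ Q).Nonempty) : IsFace (F ∩ Q) F := by
  obtain ⟨hne', P₀, hP₀, Q₀, hQ₀, rfl⟩ := mem_cellInters.1 hF
  have h1 : P₀ ∩ Q₀ ∩ Q = (P₀ ∩ P₀) ∩ (Q₀ ∩ Q) := by ext; simp only [Set.mem_inter_iff]; tauto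
  rw [h1] at hne ⊢
  exact (a.inter_face P₀ hP₀ P₀ hP₀ (hne.mono Set.inter_subset_left)).inter
    (b.inter_face Q₀ hQ₀ Q hQ (hne.mono Set.inter_subset_right)) hne

end

variable [FiniteDimensional ℝ V]

namespace TropicalComplex

variable {a b : TropicalComplex L}

lemma mem_maxCells_boundary {R : Set (Orbit τ)} :
    R ∈ (a.boundary τ).maxCells ↔ ∃ P ∈ a.maxCells, (τ : Set V) ⊆ recession P ∧
      orbitProj τ '' P = R := by
  rw [mem_maxCells]
  change R ∈ a.boundaryCells τ ∧
    polyDim R = a.dim - Module.finrank ℝ (Submodule.span ℝ (τ : Set V)) ↔ _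
  rw [mem_boundaryCells]
  constructor
  · rintro ⟨⟨P, hP, rfl⟩, hd⟩
    rw [polyDim_orbitProj_image_cell hP] at hd
    rw [mem_cellsAlong] at hP
    exact ⟨P, a.mem_maxCells.2 ⟨hP.1, by omega⟩, hP.2, rfl⟩
  · rintro ⟨P, hP, hPτ, rfl⟩
    rw [mem_maxCells] at hP
    have hP' := mem_cellsAlong.2 ⟨hP.1, hPτ⟩
    exact ⟨⟨P, hP', rfl⟩, by rw [polyDim_orbitProj_image_cell hP', hP.2]⟩

lemma weight_boundary (hP : P ∈ a.cells) (hPτ : (τ : Set V) ⊆ recession P) :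
    (a.boundary τ).weight (orbitProj τ '' P) = a.weight P := by
  change a.weight (a.liftCell τ _) = _
  rw [liftCell_eq (mem_cellsAlong.2 ⟨hP, hPτ⟩)]

/-- The span of `τ` lies in `direction P`, so `π_τ(v)` lies in a sum of projected directions only if
`v` lies in the sum upstairs. -/
lemma isGeneric_boundary {v : V} (hv : IsGeneric a b v) :
    IsGeneric (a.boundary τ) (b.boundary τ) (orbitProj τ v) := by
  intro R hR R' hR' hne hmem
  obtain ⟨P, hP, rfl⟩ := mem_boundaryCells.1 hR
  obtain ⟨Q, hQ, rfl⟩ := mem_boundaryCells.1 hR'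
  rw [mem_cellsAlong] at hP hQ
  rw [direction_image, direction_image, ← Submodule.map_sup] at hne hmem
  obtain ⟨z, hz, hzv⟩ := hmem
  have h1 : v ∈ direction P ⊔ direction Q := by
    have h2 := Submodule.mem_sup_left (T := direction Q)
      (span_le_direction (a.nonempty hP.1) hP.2 (orbitProj_eq_iff.1 hzv))
    have h3 := Submodule.sub_mem _ hz h2
    rwa [sub_sub_cancel] at h3
  have h4 : direction P ⊔ direction Q = ⊤ := by
    by_contra hne'
    exact hv P hP.1 Q hQ.1 hne' h1
  rw [h4, Submodule.map_top] at hne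
  exact hne (LinearMap.range_eq_top.2 orbitProj_surjective)

lemma subset_of_orbitProj_image_subset (hF : IsPoly F) (hFn : F.Nonempty) (hP : IsPoly P)
    (hFτ : (τ : Set V) ⊆ recession F) (hPτ : (τ : Set V) ⊆ recession P)
    (hface : (F ∩ P).Nonempty → IsFace (F ∩ P) F) (h : orbitProj τ '' F ⊆ orbitProj τ '' P) :
    F ⊆ P := by
  have h1 := orbitProj_image_inter hFτ hPτ
  rw [Set.inter_eq_left.2 h] at h1
  have hne : (F ∩ P).Nonempty := by
    rw [← Set.image_nonempty (f := orbitProj τ), h1]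
    exact hFn.image _
  have h4 : (τ : Set V) ⊆ recession (F ∩ P) := by
    rw [hF.recession_inter hP hne]
    exact Set.subset_inter hFτ hPτ
  have h5 := polyDim_orbitProj_image hne h4
  have h6 := polyDim_orbitProj_image hFn hFτ
  rw [h1] at h5
  exact Set.inter_eq_left.1 ((hface hne).eq_of_polyDim hF (by omega))

/-- Every cell containing `F` has `τ` in its recession cone, so the pairs of cells around `F`
correspond to those around its image, with the same indices, weights and meeting condition. -/
lemma displacedMult_boundary (hF : F ∈ cellInters a.cells b.cells)
    (hFτ : (τ : Set V) ⊆ recession F) (v : V) :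
    displacedMult (a.boundary τ) (b.boundary τ) (orbitProj τ v) (orbitProj τ '' F) =
      displacedMult a b v F := by
  have hab := a.isPolyComplex.cellInters b.isPolyComplex
  have hFp := hab.isPoly hF
  have hFn := (hab.rational F hF).1
  have hτ : ∀ c : TropicalComplex L, ∀ P ∈ c.cells, F ⊆ P → (τ : Set V) ⊆ recession P :=
    fun c P hP h => hFτ.trans (hFp.recession_mono (c.isPoly hP) h hFn)
  unfold displacedMult
  symm
  refine Finset.sum_nbij (fun p => (orbitProj τ '' p.1, orbitProj τ '' p.2)) ?_ ?_ ?_ ?_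
  · rintro ⟨P, Q⟩ h
    simp only [Finset.mem_filter, Finset.mem_product] at h ⊢
    obtain ⟨⟨hP, hQ⟩, hFP, hFQ, h⟩ := h
    have hPτ := hτ a P (a.mem_maxCells.1 hP).1 hFP
    have hQτ := hτ b Q (b.mem_maxCells.1 hQ).1 hFQ
    exact ⟨⟨mem_maxCells_boundary.2 ⟨P, hP, hPτ, rfl⟩, mem_maxCells_boundary.2 ⟨Q, hQ, hQτ, rfl⟩⟩,
      Set.image_mono hFP, Set.image_mono hFQ,
      (orbitProj_starCone_inter_nonempty hFn hFP hFQ hPτ hQτ v).2 h⟩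
  · rintro ⟨P, Q⟩ h ⟨P', Q'⟩ h' heq
    simp only [Finset.mem_coe, Finset.mem_filter, Finset.mem_product] at h h'
    obtain ⟨⟨hP, hQ⟩, hFP, hFQ, -⟩ := h
    obtain ⟨⟨hP', hQ'⟩, hFP', hFQ', -⟩ := h'
    have hP := (a.mem_maxCells.1 hP).1
    have hQ := (b.mem_maxCells.1 hQ).1
    have hP' := (a.mem_maxCells.1 hP').1
    have hQ' := (b.mem_maxCells.1 hQ').1
    simp only [Prod.mk.injEq] at heq ⊢
    exact ⟨orbitProj_image_injOn (mem_cellsAlong.2 ⟨hP, hτ a P hP hFP⟩)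
        (mem_cellsAlong.2 ⟨hP', hτ a P' hP' hFP'⟩) heq.1,
      orbitProj_image_injOn (mem_cellsAlong.2 ⟨hQ, hτ b Q hQ hFQ⟩)
        (mem_cellsAlong.2 ⟨hQ', hτ b Q' hQ' hFQ'⟩) heq.2⟩
  · rintro ⟨R, R'⟩ h
    simp only [Finset.mem_coe, Finset.mem_filter, Finset.mem_product, mem_maxCells_boundary] at h
    obtain ⟨⟨⟨P, hP, hPτ, rfl⟩, Q, hQ, hQτ, rfl⟩, hFP, hFQ, h⟩ := h
    have hP' := (a.mem_maxCells.1 hP).1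
    have hQ' := (b.mem_maxCells.1 hQ).1
    have hFP' := subset_of_orbitProj_image_subset hFp hFn (a.isPoly hP') hFτ hPτ
      (isFace_inter_left hF hP') hFP
    have hFQ' := subset_of_orbitProj_image_subset hFp hFn (b.isPoly hQ') hFτ hQτ
      (isFace_inter_right hF hQ') hFQ
    refine ⟨(P, Q), ?_, rfl⟩
    simp only [Finset.mem_coe, Finset.mem_filter, Finset.mem_product]
    exact ⟨⟨hP, hQ⟩, hFP', hFQ',
      (orbitProj_starCone_inter_nonempty hFn hFP' hFQ' hPτ hQτ v).1 h⟩
  · rintro ⟨P, Q⟩ h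
    simp only [Finset.mem_filter, Finset.mem_product] at h
    obtain ⟨⟨hP, hQ⟩, hFP, hFQ, -⟩ := h
    have hP' := (a.mem_maxCells.1 hP).1
    have hQ' := (b.mem_maxCells.1 hQ).1
    have hPτ := hτ a P hP' hFP
    have hQτ := hτ b Q hQ' hFQ
    rw [weight_boundary hP' hPτ, weight_boundary hQ' hQτ,
      relIndex_orbitLattice (a.nonempty hP') (b.nonempty hQ') hPτ hQτ]

/-- The boundary of a stable intersection is the stable intersection of the boundaries. -/
theorem mk_boundary_stableComplex (hL : IsFullLattice L)
    (hτ : IsFullLattice (orbitLattice L τ)) {v : V} (hv : IsGeneric a b v) :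
    TropicalCycle.mk ((stableComplex hL a b hv).boundary τ) =
      TropicalCycle.stableCycle hτ (TropicalCycle.mk (a.boundary τ))
        (TropicalCycle.mk (b.boundary τ)) := by
  rw [TropicalCycle.stableCycle_mk hτ (isStableIntersection_stableComplex hτ _ _
    (isGeneric_boundary hv))]
  have hab := a.isPolyComplex.cellInters b.isPolyComplex
  have hfin : (Module.finrank ℝ (Orbit τ) : ℤ) =
      Module.finrank ℝ V - Module.finrank ℝ (Submodule.span ℝ (τ : Set V)) := by
    have := Submodule.finrank_quotient_add_finrank (Submodule.span ℝ (τ : Set V))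
    rw [← this]
    push_cast
    ring
  have hda : (a.boundary τ).dim =
    a.dim - Module.finrank ℝ (Submodule.span ℝ (τ : Set V)) := rfl
  have hdb : (b.boundary τ).dim =
    b.dim - Module.finrank ℝ (Submodule.span ℝ (τ : Set V)) := rfl
  have hmax : ((stableComplex hL a b hv).boundary τ).maxCells =
      stableMaxCells (a.boundary τ) (b.boundary τ) (orbitProj τ v) := by
    ext R
    rw [mem_maxCells_boundary, maxCells_stableComplex, mem_stableMaxCells, mem_cellInters]
    constructor
    · rintro ⟨F, hF, hFτ, rfl⟩
      obtain ⟨hF, hd, hm⟩ := mem_stableMaxCells.1 hF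
      have hFn := (mem_cellInters.1 hF).1
      refine ⟨⟨hFn.image _, ?_⟩, ?_, ?_⟩
      · obtain ⟨-, P, hP, Q, hQ, rfl⟩ := mem_cellInters.1 hF
        rw [(a.isPoly hP).recession_inter (b.isPoly hQ) hFn, Set.subset_inter_iff] at hFτ
        exact ⟨_, mem_boundaryCells.2 ⟨P, mem_cellsAlong.2 ⟨hP, hFτ.1⟩, rfl⟩, _,
          mem_boundaryCells.2 ⟨Q, mem_cellsAlong.2 ⟨hQ, hFτ.2⟩, rfl⟩,
          orbitProj_image_inter hFτ.1 hFτ.2⟩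
      · rw [polyDim_orbitProj_image hFn hFτ, hda, hdb]
        omega
      · rwa [displacedMult_boundary hF hFτ]
    · rintro ⟨⟨hne, R₁, hR₁, R₂, hR₂, rfl⟩, hd, hm⟩
      obtain ⟨P, hP, rfl⟩ := mem_boundaryCells.1 hR₁
      obtain ⟨Q, hQ, rfl⟩ := mem_boundaryCells.1 hR₂
      rw [mem_cellsAlong] at hP hQ
      rw [← orbitProj_image_inter hP.2 hQ.2] at hne hd hm ⊢
      rw [Set.image_nonempty] at hne
      have hF : P ∩ Q ∈ cellInters a.cells b.cells :=
        mem_cellInters.2 ⟨hne, P, hP.1, Q, hQ.1, rfl⟩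
      have hFτ : (τ : Set V) ⊆ recession (P ∩ Q) := by
        rw [(a.isPoly hP.1).recession_inter (b.isPoly hQ.1) hne]
        exact Set.subset_inter hP.2 hQ.2
      rw [displacedMult_boundary hF hFτ] at hm
      rw [polyDim_orbitProj_image hne hFτ, hda, hdb] at hd
      exact ⟨_, mem_stableMaxCells.2 ⟨hF, by omega, hm⟩, hFτ, rfl⟩
  refine mk_eq_of_maxCells ?_ ?_ ?_
  · change a.dim + b.dim - _ - _ = a.dim - _ + (b.dim - _) - _
    omega
  · rw [maxCells_stableComplex, hmax]
  · intro R hR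
    obtain ⟨F, hF, hFτ, rfl⟩ := mem_maxCells_boundary.1 hR
    rw [weight_boundary ((mem_maxCells _).1 hF).1 hFτ]
    rw [maxCells_stableComplex] at hF
    exact (displacedMult_boundary (mem_stableMaxCells.1 hF).1 hFτ v).symm

end TropicalComplex

end BoundaryProduct

/-! ### Farkas' lemma -/

section Farkas

variable {V : Type*} [AddCommGroup V] [Module ℝ V]

lemma nonneg_of_mem_hull {s : Set (Module.Dual ℝ V)} {g : Module.Dual ℝ V} {x : V}
    (hg : g ∈ PointedCone.hull ℝ s) (hx : ∀ f ∈ s, 0 ≤ f x) : 0 ≤ g x := by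
  induction hg using Submodule.span_induction with
  | mem f hf => exact hx f hf
  | zero => simp
  | add f g _ _ hf hg => exact add_nonneg hf hg
  | smul c f _ hf => exact mul_nonneg c.2 hf

/-- **Farkas' lemma**. -/
lemma farkas {ι : Type*} (J : Finset ι) : ∀ (f : ι → Module.Dual ℝ V) (g : Module.Dual ℝ V),
    (∀ x, (∀ i ∈ J, 0 ≤ f i x) → 0 ≤ g x) →
    ∃ c : ι → ℝ, (∀ i ∈ J, 0 ≤ c i) ∧ g = ∑ i ∈ J, c i • f i := by
  induction J using Finset.induction_on with
  | empty =>
    intro f g h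
    refine ⟨0, by simp, ?_⟩
    ext x
    have h1 := h x (by simp)
    have h2 := h (-x) (by simp)
    rw [map_neg] at h2
    simp only [Finset.sum_empty, LinearMap.zero_apply]
    linarith
  | insert j J hj ih =>
    intro f g h
    by_cases hJ : ∀ x, (∀ i ∈ J, 0 ≤ f i x) → 0 ≤ g x
    · obtain ⟨c, hc, rfl⟩ := ih f g hJ
      refine ⟨fun i => if i = j then 0 else c i, fun i hi => ?_, ?_⟩
      · beta_reduce
        split_ifs with hij
        · exact le_rfl
        · exact hc i ((Finset.mem_insert.1 hi).resolve_left hij)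
      · rw [Finset.sum_insert hj]
        beta_reduce
        rw [if_pos rfl, zero_smul, zero_add]
        refine Finset.sum_congr rfl fun i hi => ?_
        rw [if_neg (ne_of_mem_of_not_mem hi hj)]
    push Not at hJ
    obtain ⟨x₁, hx₁, hg₁⟩ := hJ
    have hf₁ : f j x₁ < 0 := by
      by_contra hneg
      push Not at hneg
      have := h x₁ fun i hi => (Finset.mem_insert.1 hi).elim (fun e => e ▸ hneg) (hx₁ i)
      linarith
    -- A point where the inequalities in `J` do not imply `0 ≤ g`, scaled so that `f j` takes the
    -- value `-1`.
    obtain ⟨x₀, hx₀, hg₀, hf₀⟩ : ∃ x₀, (∀ i ∈ J, 0 ≤ f i x₀) ∧ g x₀ < 0 ∧ f j x₀ = -1 := by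
      have hpos : 0 < (-f j x₁)⁻¹ := inv_pos.2 (by linarith)
      refine ⟨(-f j x₁)⁻¹ • x₁, fun i hi => ?_, ?_, ?_⟩
      · rw [map_smul]
        exact mul_nonneg hpos.le (hx₁ i hi)
      · rw [map_smul]
        exact mul_neg_of_pos_of_neg hpos hg₁
      · rw [map_smul, smul_eq_mul, inv_neg, neg_mul, inv_mul_cancel₀ hf₁.ne]
    -- The projection `x ↦ x + f j x • x₀` onto the kernel of `f j` eliminates the inequality `j`;
    -- the induction hypothesis is applied to the functionals pulled back along it.
    obtain ⟨c, hc, hgc⟩ := ih (fun i => f i + f i x₀ • f j) (g + g x₀ • f j) (by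
      intro x hx
      have := h (x + f j x • x₀) (by
        intro i hi
        rw [map_add, map_smul, smul_eq_mul]
        rcases Finset.mem_insert.1 hi with rfl | hi
        · rw [hf₀]; linarith
        · have := hx i hi
          simp only [LinearMap.add_apply, LinearMap.smul_apply, smul_eq_mul] at this
          linarith)
      rw [map_add, map_smul, smul_eq_mul] at this
      simp only [LinearMap.add_apply, LinearMap.smul_apply, smul_eq_mul]
      linarith)
    -- The coefficient of `f j` collects the correction terms; it is non-negative because `f k x₀ ≥
    -- 0` and `g x₀ < 0`.
    refine ⟨fun i => if i = j then ∑ k ∈ J, c k * f k x₀ - g x₀ else c i, fun i hi => ?_, ?_⟩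
    · beta_reduce
      split_ifs with hij
      · have := Finset.sum_nonneg fun k hk => mul_nonneg (hc k hk) (hx₀ k hk)
        linarith
      · exact hc i ((Finset.mem_insert.1 hi).resolve_left hij)
    · rw [Finset.sum_insert hj]
      beta_reduce
      rw [if_pos rfl]
      have h1 : ∑ i ∈ J, (if i = j then ∑ k ∈ J, c k * f k x₀ - g x₀ else c i) • f i =
          ∑ i ∈ J, c i • f i :=
        Finset.sum_congr rfl fun i hi => by rw [if_neg (ne_of_mem_of_not_mem hi hj)]
      rw [h1, ← add_left_inj (g x₀ • f j), hgc]
      simp only [smul_add, Finset.sum_add_distrib, smul_smul, ← Finset.sum_smul]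
      module

lemma mem_hull_of_nonneg {s : Set (Module.Dual ℝ V)} (hs : s.Finite) {g : Module.Dual ℝ V}
    (h : ∀ x, (∀ f ∈ s, 0 ≤ f x) → 0 ≤ g x) : g ∈ PointedCone.hull ℝ s := by
  obtain ⟨c, hc, rfl⟩ := farkas hs.toFinset id g (by simpa using h)
  exact sum_mem fun f hf => PointedCone.smul_mem _ (hc f hf)
    (Submodule.subset_span (hs.mem_toFinset.1 hf))

end Farkas

/-! ### Simplicial cones and their faces -/

section SimplicialCone

variable {V : Type*} [AddCommGroup V] [Module ℝ V] {ι : Type*} [Fintype ι]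
  {b : Module.Basis ι ℝ V} {I J : Set ι} {κ : PointedCone ℝ V}

lemma mem_hull_basis {x : V} : x ∈ PointedCone.hull ℝ (b '' I) ↔
    (∀ i, 0 ≤ b.coord i x) ∧ ∀ i ∉ I, b.coord i x = 0 := by
  constructor
  · intro hx
    induction hx using Submodule.span_induction with
    | mem x hx =>
      obtain ⟨j, hj, rfl⟩ := hx
      simp only [Module.Basis.coord_apply, Module.Basis.repr_self, Finsupp.single_apply]
      refine ⟨fun i => by split_ifs <;> norm_num, fun i hi => if_neg ?_⟩
      rintro rfl
      exact hi hj
    | zero => simp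
    | add x y _ _ hx hy =>
      refine ⟨fun i => ?_, fun i hi => ?_⟩
      · rw [map_add]; exact add_nonneg (hx.1 i) (hy.1 i)
      · rw [map_add, hx.2 i hi, hy.2 i hi, add_zero]
    | smul c x _ hx =>
      have hc : ∀ i, b.coord i (c • x) = c.1 * b.coord i x := fun i =>
        map_smul (b.coord i) c.1 x
      refine ⟨fun i => ?_, fun i hi => ?_⟩
      · rw [hc]; exact mul_nonneg c.2 (hx.1 i)
      · rw [hc, hx.2 i hi, mul_zero]
  · rintro ⟨h0, h1⟩
    rw [← b.sum_repr x]
    refine sum_mem fun i _ => ?_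
    by_cases hi : i ∈ I
    · exact PointedCone.smul_mem _ (h0 i) (Submodule.subset_span ⟨i, hi, rfl⟩)
    · have : b.repr x i = 0 := h1 i hi
      rw [this, zero_smul]
      exact zero_mem _

/-- A face of a simplicial cone is generated by the generators that it contains. -/
lemma isFaceOf_hull_basis (h : κ.IsFaceOf (PointedCone.hull ℝ (b '' I))) :
    κ = PointedCone.hull ℝ (b '' {i | i ∈ I ∧ b i ∈ κ}) := by
  refine le_antisymm (fun x hx => ?_) (Submodule.span_le.2 ?_)
  · have hx' := mem_hull_basis.1 (h.le hx)
    refine mem_hull_basis.2 ⟨hx'.1, fun i hi => ?_⟩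
    by_contra hne
    have hiI : i ∈ I := by
      by_contra hiI
      exact hne (hx'.2 i hiI)
    refine hi ⟨hiI, ?_⟩
    have hpos : 0 < b.coord i x := lt_of_le_of_ne (hx'.1 i) (Ne.symm hne)
    have hmem : ∀ j, b.repr x j • b j ∈ PointedCone.hull ℝ (b '' I) := by
      intro j
      by_cases hj : j ∈ I
      · exact PointedCone.smul_mem _ (hx'.1 j) (Submodule.subset_span ⟨j, hj, rfl⟩)
      · have : b.repr x j = 0 := hx'.2 j hj
        rw [this, zero_smul]
        exact zero_mem _
    have h2 : b.repr x i • b i ∈ κ := by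
      refine h.mem_of_sum_mem (f := fun j => b.repr x j • b j) hmem ?_ i
      rwa [b.sum_repr]
    have h3 := κ.smul_mem (inv_nonneg.2 hpos.le) h2
    rwa [← Module.Basis.coord_apply, smul_smul, inv_mul_cancel₀ (ne_of_gt hpos), one_smul] at h3
  · rintro _ ⟨i, hi, rfl⟩
    exact hi.2

end SimplicialCone

/-! ### Supporting and separating functionals of simplicial cones -/

section SimplicialFan

variable {V : Type*} [AddCommGroup V] [Module ℝ V] {ι : Type*} [Fintype ι]
  {b : Module.Basis ι ℝ V} {I : Set ι} {κ σ : PointedCone ℝ V}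

/-- A functional which is non-negative on a simplicial cone and vanishes exactly on a given face. -/
lemma exists_supporting (h : κ.IsFaceOf (PointedCone.hull ℝ (b '' I))) :
    ∃ u : Module.Dual ℝ V, (∀ x ∈ PointedCone.hull ℝ (b '' I), 0 ≤ u x) ∧
      ∀ x ∈ PointedCone.hull ℝ (b '' I), u x = 0 ↔ x ∈ κ := by
  set J := {i | i ∈ I ∧ b i ∈ κ} with hJ
  have hκ : κ = PointedCone.hull ℝ (b '' J) := isFaceOf_hull_basis h
  have hev : ∀ x, (∑ i ∈ Finset.univ.filter (· ∉ J), b.coord i) x =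
      ∑ i ∈ Finset.univ.filter (· ∉ J), b.coord i x := fun x => by simp
  -- The coordinates are non-negative on the cone, so their sum over the indices outside the face
  -- vanishes only if each of them does.
  refine ⟨∑ i ∈ Finset.univ.filter (· ∉ J), b.coord i, fun x hx => ?_, fun x hx => ?_⟩
  · rw [hev]
    exact Finset.sum_nonneg fun i _ => (mem_hull_basis.1 hx).1 i
  · rw [hev, Finset.sum_eq_zero_iff_of_nonneg fun i _ => (mem_hull_basis.1 hx).1 i]
    have hmem : x ∈ κ ↔ x ∈ PointedCone.hull ℝ (b '' J) := by rw [← hκ]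
    rw [hmem, mem_hull_basis]
    simp only [Finset.mem_filter, Finset.mem_univ, true_and]
    exact ⟨fun h => ⟨(mem_hull_basis.1 hx).1, h⟩, fun h => h.2⟩

/-- On generators where `u` vanishes `f` is already non-negative; on the others a large multiple of
`u` compensates. Thus a functional that is non-negative on a face becomes a coordinate on the chart
of the whole cone. -/
lemma exists_add_smul_nonneg {u f : Module.Dual ℝ V}
    (hu : ∀ x ∈ PointedCone.hull ℝ (b '' I), 0 ≤ u x)
    (huκ : ∀ x ∈ PointedCone.hull ℝ (b '' I), u x = 0 ↔ x ∈ κ) (hf : ∀ x ∈ κ, 0 ≤ f x) :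
    ∃ N : ℝ, 0 ≤ N ∧ ∀ x ∈ PointedCone.hull ℝ (b '' I), 0 ≤ (f + N • u) x := by
  have hgen : ∀ i ∈ I, b i ∈ PointedCone.hull ℝ (b '' I) :=
    fun i hi => Submodule.subset_span ⟨i, hi, rfl⟩
  have hN : ∀ i, 0 ≤ |f (b i)| / |u (b i)| := fun i => by positivity
  refine ⟨∑ i, |f (b i)| / |u (b i)|, Finset.sum_nonneg fun i _ => hN i, fun x hx => ?_⟩
  induction hx using Submodule.span_induction with
  | mem x hx =>
    obtain ⟨i, hi, rfl⟩ := hx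
    rw [LinearMap.add_apply, LinearMap.smul_apply, smul_eq_mul]
    have h0 := hu _ (hgen i hi)
    rcases h0.eq_or_lt with h0 | h0
    · rw [← h0, mul_zero, add_zero]
      exact hf _ ((huκ _ (hgen i hi)).1 h0.symm)
    · have h1 : |f (b i)| / |u (b i)| ≤ ∑ i, |f (b i)| / |u (b i)| :=
        Finset.single_le_sum (f := fun i => |f (b i)| / |u (b i)|) (fun i _ => hN i)
          (Finset.mem_univ i)
      have h2 := mul_le_mul_of_nonneg_right h1 h0.le
      rw [abs_of_pos h0, div_mul_cancel₀ _ h0.ne'] at h2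
      have := neg_abs_le (f (b i))
      linarith
  | zero => simp
  | add x y _ _ hx hy => rw [map_add]; exact add_nonneg hx hy
  | smul c x _ hx =>
    have hc : (f + (∑ i, |f (b i)| / |u (b i)|) • u) (c • x) =
        c.1 * (f + (∑ i, |f (b i)| / |u (b i)|) • u) x := map_smul _ c.1 x
    rw [hc]
    exact mul_nonneg c.2 hx

/-- If a polyhedral cone does not meet the interior of a simplicial cone, some combination of its
inequalities separates them. -/
lemma exists_separating {A : Set (Module.Dual ℝ V)} (hA : A.Finite)
    (h : ∀ x, (∀ f ∈ A, 0 ≤ f x) → x ∈ PointedCone.hull ℝ (b '' I) → ∃ i ∈ I, b.coord i x ≤ 0) :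
    ∃ g ∈ PointedCone.hull ℝ A, (∀ x ∈ PointedCone.hull ℝ (b '' I), g x ≤ 0) ∧
      ∃ x ∈ PointedCone.hull ℝ (b '' I), g x ≠ 0 := by
  -- Otherwise each coordinate in `I` would be positive at some point of both cones, and the sum of
  -- these points would contradict `h`.
  have h1 : ∃ i ∈ I, ∀ x, (∀ f ∈ A, 0 ≤ f x) → x ∈ PointedCone.hull ℝ (b '' I) →
      0 ≤ (-b.coord i) x := by
    by_contra hcon
    push Not at hcon
    have h2 : ∀ i, ∃ x, (∀ f ∈ A, 0 ≤ f x) ∧ x ∈ PointedCone.hull ℝ (b '' I) ∧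
        (i ∈ I → 0 < b.coord i x) := by
      intro i
      by_cases hi : i ∈ I
      · obtain ⟨x, hx, hx', h⟩ := hcon i hi
        rw [LinearMap.neg_apply] at h
        exact ⟨x, hx, hx', fun _ => by linarith⟩
      · exact ⟨0, by simp, zero_mem _, fun h => absurd h hi⟩
    choose x hxA hxI hxi using h2
    obtain ⟨i, hi, hneg⟩ := h (∑ i, x i)
      (fun f hf => by rw [map_sum]; exact Finset.sum_nonneg fun i _ => hxA i f hf)
      (sum_mem fun i _ => hxI i)
    rw [map_sum] at hneg
    have := Finset.single_le_sum (f := fun j => b.coord i (x j))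
      (fun j _ => (mem_hull_basis.1 (hxI j)).1 i) (Finset.mem_univ i)
    have := hxi i hi
    linarith
  obtain ⟨i, hi, h1⟩ := h1
  set B : Set (Module.Dual ℝ V) := Set.range b.coord ∪ (fun i => -b.coord i) '' Iᶜ with hB
  have hBfin : B.Finite := (Set.finite_range _).union ((Set.toFinite _).image _)
  have hBI : ∀ x, (∀ f ∈ B, 0 ≤ f x) ↔ x ∈ PointedCone.hull ℝ (b '' I) := by
    intro x
    rw [mem_hull_basis]
    constructor
    · intro hx
      refine ⟨fun i => hx _ (Or.inl ⟨i, rfl⟩), fun i hi => ?_⟩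
      have h2 := hx _ (Or.inl ⟨i, rfl⟩)
      have h3 := hx _ (Or.inr ⟨i, hi, rfl⟩)
      rw [LinearMap.neg_apply] at h3
      linarith
    · rintro ⟨hx, hx'⟩ f (⟨i, rfl⟩ | ⟨i, hi, rfl⟩)
      · exact hx i
      · rw [LinearMap.neg_apply, hx' i hi, neg_zero]
  -- Farkas' lemma for the two systems together writes `-b.coord i` as `g + m` with `g` from `A` and
  -- `m` non-negative on the simplicial cone; hence `g ≤ -b.coord i` there.
  have h2 := mem_hull_of_nonneg (hA.union hBfin) (g := -b.coord i) (fun x hx => h1 x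
    (fun f hf => hx f (Or.inl hf)) ((hBI x).1 fun f hf => hx f (Or.inr hf)))
  have h3 : PointedCone.hull ℝ (A ∪ B) = PointedCone.hull ℝ A ⊔ PointedCone.hull ℝ B :=
    Submodule.span_union _ _
  rw [h3] at h2
  obtain ⟨g, hg, m, hm, hgm⟩ := Submodule.mem_sup.1 h2
  have hle : ∀ x ∈ PointedCone.hull ℝ (b '' I), g x ≤ -b.coord i x := by
    intro x hx
    have h4 := nonneg_of_mem_hull hm ((hBI x).2 hx)
    have h5 := LinearMap.congr_fun hgm x
    rw [LinearMap.add_apply, LinearMap.neg_apply] at h5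
    linarith
  refine ⟨g, hg, fun x hx => ?_, b i, Submodule.subset_span ⟨i, hi, rfl⟩, ?_⟩
  · have := (mem_hull_basis.1 hx).1 i
    linarith [hle x hx]
  · have := hle (b i) (Submodule.subset_span ⟨i, hi, rfl⟩)
    simp only [Module.Basis.coord_apply, Module.Basis.repr_self, Finsupp.single_eq_same] at this
    linarith

lemma mem_intrinsicInterior_hull_basis [TopologicalSpace V] [IsTopologicalAddGroup V]
    [ContinuousSMul ℝ V] [T2Space V] {x : V}
    (hx : x ∈ PointedCone.hull ℝ (b '' I)) (hpos : ∀ i ∈ I, 0 < b.coord i x) :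
    x ∈ intrinsicInterior ℝ (PointedCone.hull ℝ (b '' I) : Set V) := by
  have : FiniteDimensional ℝ V := b.finiteDimensional_of_finite
  set κ := PointedCone.hull ℝ (b '' I) with hκ
  have hsub : (κ : Set V) ⊆ (⨅ i ∈ Iᶜ, LinearMap.ker (b.coord i) : Submodule ℝ V) := by
    intro z hz
    rw [SetLike.mem_coe]
    simp only [Submodule.mem_iInf]
    exact fun i hi => (mem_hull_basis.1 hz).2 i hi
  have haff : ∀ z ∈ affineSpan ℝ (κ : Set V), ∀ i ∉ I, b.coord i z = 0 := by
    intro z hz i hi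
    have h1 : affineSpan ℝ (κ : Set V) ≤
        (⨅ i ∈ Iᶜ, LinearMap.ker (b.coord i)).toAffineSubspace := affineSpan_le.2 hsub
    have h2 : z ∈ ⨅ i ∈ Iᶜ, LinearMap.ker (b.coord i) := h1 hz
    simp only [Submodule.mem_iInf] at h2
    exact h2 i hi
  refine mem_intrinsicInterior.2 ⟨⟨x, subset_affineSpan ℝ _ hx⟩, ?_, rfl⟩
  rw [mem_interior]
  refine ⟨Subtype.val ⁻¹' ⋂ i ∈ I, {z | 0 < b.coord i z}, ?_, ?_, ?_⟩
  · rintro ⟨z, hz⟩ hz'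
    simp only [Set.mem_preimage, Set.mem_iInter, Set.mem_ofPred_eq] at hz'
    refine mem_hull_basis.2 ⟨fun i => ?_, haff z hz⟩
    by_cases hi : i ∈ I
    · exact (hz' i hi).le
    · exact (haff z hz i hi).ge
  · refine IsOpen.preimage continuous_subtype_val ((Set.toFinite I).isOpen_biInter fun i _ => ?_)
    exact isOpen_lt continuous_const (b.coord i).continuous_of_finiteDimensional
  · simpa using hpos

end SimplicialFan

/-! ### Coordinates and limits in the tropical toric variety -/

section Eval

variable {V : Type*} [AddCommGroup V] [Module ℝ V] {L : Submodule ℤ V} {κ : PointedCone ℝ V}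
  {u : Module.Dual ℝ V}

namespace UnimodularFan

lemma evalOrbit_orbitProj (h : ∀ x ∈ κ, u x = 0) (x : V) :
    evalOrbit κ (orbitProj κ x) u = (u x : EReal) := by
  have h' : Submodule.span ℝ (κ : Set V) ≤ LinearMap.ker u := Submodule.span_le.2 fun z hz => h z hz
  rw [evalOrbit, dif_pos h']
  rfl

lemma evalOrbit_eq_top (h : ¬ ∀ x ∈ κ, u x = 0) (y : Orbit κ) : evalOrbit κ y u = ⊤ := by
  rw [evalOrbit, dif_neg]
  exact fun h' => h fun x hx => h' (Submodule.subset_span hx)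

variable {Δ : UnimodularFan L} {σ τ : Δ.cones}

lemma isFaceOf_bot (σ : Δ.cones) : (⊥ : PointedCone ℝ V).IsFaceOf σ.1 := by
  have := Δ.inter_face σ.1 σ.2 ⊥ Δ.bot_mem
  rwa [inf_bot_eq] at this

lemma evalOrbit_bot (x : V) (u : Module.Dual ℝ V) :
    evalOrbit ⊥ (orbitProj ⊥ x) u = (u x : EReal) :=
  evalOrbit_orbitProj (fun z hz => by rw [(Submodule.mem_bot _).1 hz, map_zero]) x

lemma isOpen_chart_evalOrbit {u : Module.Dual ℝ V} (hu : u ∈ dualCone σ.1) {s : Set EReal}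
    (hs : IsOpen s) :
    @IsOpen _ (Δ.chartTopology σ) {p | evalOrbit p.1.cone.1 p.1.point u ∈ s} := by
  let := Δ.chartTopology σ
  have h1 : Continuous (Δ.chartMap σ) := continuous_induced_dom
  exact hs.preimage ((continuous_apply (⟨u, hu⟩ : dualCone σ.1)).comp h1)

/-- In the chart of `τ`, a coordinate `u` is constant along the ray if it vanishes on `τ`, and tends
to `∞` otherwise. These are its values at the limit point. -/
lemma tendsto_embed (τ : Δ.cones) {x w : V}
    (hw : ∀ u ∈ dualCone τ.1, 0 < u w ∨ ∀ z ∈ τ.1, u z = 0) (hwτ : w ∈ τ.1) :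
    Tendsto (fun t : ℝ => Δ.embed (x + t • w)) atTop (𝓝 ⟨τ, orbitProj τ.1 x⟩) := by
  have h1 : @Continuous _ _ (Δ.chartTopology τ) _ (Subtype.val : Δ.chart τ → Δ.Variety) :=
    continuous_iff_coinduced_le.2 (le_iSup (fun σ : Δ.cones =>
      (Δ.chartTopology σ).coinduced Subtype.val) τ)
  let := Δ.chartTopology τ
  set p : Δ.chart τ := ⟨⟨τ, orbitProj τ.1 x⟩, PointedCone.IsFaceOf.refl _⟩
  set f : ℝ → Δ.chart τ := fun t => ⟨Δ.embed (x + t • w), isFaceOf_bot τ⟩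
  have h2 : Tendsto f atTop (@nhds _ (Δ.chartTopology τ) p) := by
    rw [nhds_induced, tendsto_comap_iff, tendsto_pi_nhds]
    rintro ⟨u, hu⟩
    have h3 : ∀ t : ℝ, Δ.chartMap τ (f t) ⟨u, hu⟩ = ((u x + t * u w : ℝ) : EReal) := by
      intro t
      have h4 : u (x + t • w) = u x + t * u w := by rw [map_add, map_smul, smul_eq_mul]
      exact h4 ▸ evalOrbit_bot (x + t • w) u
    simp only [Function.comp_def, h3]
    by_cases hz : ∀ z ∈ τ.1, u z = 0
    · rw [hz w hwτ]
      have : Δ.chartMap τ p ⟨u, hu⟩ = (u x : EReal) := evalOrbit_orbitProj hz x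
      rw [this]
      simp
    · have : Δ.chartMap τ p ⟨u, hu⟩ = ⊤ := evalOrbit_eq_top hz _
      rw [this, EReal.tendsto_nhds_top_iff_real]
      intro c
      have hpos := (hw u hu).resolve_right hz
      filter_upwards [eventually_gt_atTop ((c - u x) / u w)] with t ht
      rw [div_lt_iff₀ hpos] at ht
      exact_mod_cast (by linarith : c < u x + t * u w)
  exact (h1.tendsto p).comp h2

end UnimodularFan

end Eval

/-! ### Regular cones -/

/-- A cone generated by a part of a real basis which consists of lattice vectors. -/
def IsRegularCone {V : Type*} [AddCommGroup V] [Module ℝ V] (L : Submodule ℤ V)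
    (σ : PointedCone ℝ V) : Prop :=
  ∃ (r : ℕ) (b : Module.Basis (Fin r) ℝ V) (I : Set (Fin r)), (∀ i, b i ∈ L) ∧
    σ = PointedCone.hull ℝ (b '' I)

section RegularCone

variable {V : Type*} [AddCommGroup V] [Module ℝ V] {L : Submodule ℤ V} {σ : PointedCone ℝ V}

lemma IsRegularCone.isRationalSubspace (h : IsRegularCone L σ) :
    IsRationalSubspace L (Submodule.span ℝ (σ : Set V)) := by
  obtain ⟨r, b, I, hb, rfl⟩ := h
  refine Submodule.span_le.2 fun x hx => ?_
  induction hx using Submodule.span_induction with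
  | mem x hx =>
    obtain ⟨i, hi, rfl⟩ := hx
    exact Submodule.subset_span ⟨hb i,
      Submodule.subset_span (Submodule.subset_span ⟨i, hi, rfl⟩)⟩
  | zero => exact zero_mem _
  | add x y _ _ hx hy => exact add_mem hx hy
  | smul c x _ hx => exact Submodule.smul_mem _ c.1 hx

/-- A vector in the relative interior of the cone. -/
lemma IsRegularCone.exists_interior (h : IsRegularCone L σ) :
    ∃ w ∈ σ, ∀ u : Module.Dual ℝ V, (∀ x ∈ σ, 0 ≤ u x) → 0 < u w ∨ ∀ z ∈ σ, u z = 0 := by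
  obtain ⟨r, b, I, -, rfl⟩ := h
  have hgen : ∀ i ∈ I, b i ∈ PointedCone.hull ℝ (b '' I) :=
    fun i hi => Submodule.subset_span ⟨i, hi, rfl⟩
  have hgen' : ∀ i ∈ Finset.univ.filter (· ∈ I), b i ∈ PointedCone.hull ℝ (b '' I) :=
    fun i hi => hgen i (Finset.mem_filter.1 hi).2
  refine ⟨∑ i ∈ Finset.univ.filter (· ∈ I), b i, sum_mem hgen', fun u hu => ?_⟩
  rw [map_sum]
  have hnn : ∀ i ∈ Finset.univ.filter (· ∈ I), 0 ≤ u (b i) := fun i hi => hu _ (hgen' i hi)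
  rcases (Finset.sum_nonneg hnn).lt_or_eq with h | h
  · exact Or.inl h
  refine Or.inr fun z hz => ?_
  have h0 := (Finset.sum_eq_zero_iff_of_nonneg hnn).1 h.symm
  induction hz using Submodule.span_induction with
  | mem x hx =>
    obtain ⟨i, hi, rfl⟩ := hx
    exact h0 i (by simpa using hi)
  | zero => simp
  | add x y _ _ hx hy => rw [map_add, hx, hy, add_zero]
  | smul c x _ hx =>
    have hc : u (c • x) = c.1 * u x := map_smul u c.1 x
    rw [hc, hx, mul_zero]

end RegularCone

/-! ### Closures of cells and boundaries of cycles -/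

section Closure

variable {V : Type*} [AddCommGroup V] [Module ℝ V] {L : Submodule ℤ V}

lemma exists_lower_bound {I : Finset (Module.Dual ℝ V × ℝ)} {g : Module.Dual ℝ V}
    (hg : g ∈ PointedCone.hull ℝ (Prod.fst '' (I : Set (Module.Dual ℝ V × ℝ)))) :
    ∃ c : ℝ, ∀ x, (∀ p ∈ I, p.2 ≤ p.1 x) → c ≤ g x := by
  induction hg using Submodule.span_induction with
  | mem f hf =>
    obtain ⟨p, hp, rfl⟩ := hf
    exact ⟨p.2, fun x hx => hx p hp⟩
  | zero => exact ⟨0, fun x _ => le_rfl⟩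
  | add f g _ _ hf hg =>
    obtain ⟨c, hc⟩ := hf
    obtain ⟨d, hd⟩ := hg
    exact ⟨c + d, fun x hx => add_le_add (hc x hx) (hd x hx)⟩
  | smul a f _ hf =>
    obtain ⟨c, hc⟩ := hf
    exact ⟨a.1 * c, fun x hx => mul_le_mul_of_nonneg_left (hc x hx) a.2⟩

namespace UnimodularFan

variable (Δ : UnimodularFan L)

/-- The points of the orbits `O(κ)`, for `κ` in the recession cone of `P`, in the image of `P`. -/
def extension (P : Set V) : Set Δ.Variety :=
  {p | (p.cone.1 : Set V) ⊆ recession P ∧ p.point ∈ orbitProj p.cone.1 '' P}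

variable {Δ}

/-- Over a neighbourhood of a point in the orbit of a face `κ` of `σ`, only faces of `κ` occur. -/
lemma vanish_of_evalOrbit_lt {σ : Δ.cones} {κ : PointedCone ℝ V} {u : Module.Dual ℝ V}
    (hu : ∀ x ∈ σ.1, u x = 0 ↔ x ∈ κ) {p : Δ.chart σ} {c : ℝ}
    (h : evalOrbit p.1.cone.1 p.1.point u < c) : p.1.cone.1 ≤ κ := by
  intro x hx
  by_contra hxκ
  have hne : ¬ ∀ x ∈ p.1.cone.1, u x = 0 := fun h' => hxκ ((hu x (p.2.le hx)).1 (h' x hx))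
  rw [evalOrbit_eq_top hne] at h
  exact absurd h (by simp)

/-- The point `π_τ(x)` is the limit of a ray from `x` along an interior vector of `τ`, and this ray
stays in `P`. -/
lemma subset_boundarySet (hΔ : ∀ σ ∈ Δ.cones, IsRegularCone L σ) (τ : Δ.cones) {P : Set V}
    (hP : (τ.1 : Set V) ⊆ recession P) : orbitProj τ.1 '' P ⊆ Δ.boundarySet τ P := by
  rintro _ ⟨x, hx, rfl⟩
  obtain ⟨w, hw, hwu⟩ := (hΔ τ.1 τ.2).exists_interior
  refine mem_closure_of_tendsto (tendsto_embed τ hwu hw) ?_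
  filter_upwards [eventually_ge_atTop 0] with t ht
  exact ⟨_, hP hw x hx t ht, rfl⟩

lemma embed_mem_extension {P : Set V} {x : V} (hx : x ∈ P) : Δ.embed x ∈ Δ.extension P := by
  refine ⟨fun w hw => ?_, x, hx, rfl⟩
  have hw0 : w = 0 := (Submodule.mem_bot _).1 hw
  rw [hw0]
  exact fun y hy t _ => by rwa [smul_zero, add_zero]

lemma finrank_orbit [FiniteDimensional ℝ V] (τ : PointedCone ℝ V) : Module.finrank ℝ (Orbit τ) +
    Module.finrank ℝ (Submodule.span ℝ (τ : Set V)) = Module.finrank ℝ V :=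
  Submodule.finrank_quotient_add_finrank _

/-- The support is prescribed as a closure, and the weights come from structures of `A` which agree.
A full-dimensional overlap of cells in the orbit lifts to a full-dimensional overlap of cells of
`A`, where the weights coincide. -/
lemma IsBoundary.unique [FiniteDimensional ℝ V] (hΔ : ∀ σ ∈ Δ.cones, IsRegularCone L σ) (hL : IsFullLattice L) {τ : Δ.cones}
    {A : TropicalCycle L} {B B' : TropicalCycle (orbitLattice L τ.1)} (h : Δ.IsBoundary τ A B)
    (h' : Δ.IsBoundary τ A B') : B = B' := by
  obtain ⟨a, b, ha, rfl, hs, hd, hbij, hw⟩ := h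
  obtain ⟨a', b', ha', rfl, hs', hd', hbij', hw'⟩ := h'
  have hagree := TropicalComplex.agrees_of_mk_eq (ha.trans ha'.symm)
  have hτ := isFullLattice_orbitLattice hL (hΔ τ.1 τ.2).isRationalSubspace
  have hrk := finrank_orbit τ.1
  refine TropicalComplex.Agrees.mk_eq hτ ⟨?_, ?_, ?_⟩
  · have := hagree.1
    omega
  · rw [hs, hs', hagree.2.1]
  · intro R hR R' hR' hne hdim
    rw [TropicalComplex.mem_maxCells] at hR hR'
    obtain ⟨P, ⟨hP, hPτ⟩, rfl⟩ := hbij.2.2 hR.1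
    obtain ⟨P', ⟨hP', hPτ'⟩, rfl⟩ := hbij'.2.2 hR'.1
    beta_reduce at hR hR' hne hdim ⊢
    have h1 := polyDim_orbitProj_image (a.nonempty hP) hPτ
    have h2 := polyDim_orbitProj_image (a'.nonempty hP') hPτ'
    rw [← orbitProj_image_inter hPτ hPτ'] at hne hdim
    rw [Set.image_nonempty] at hne
    have hτ' : (τ.1 : Set V) ⊆ recession (P ∩ P') := by
      rw [(a.isPoly hP).recession_inter (a'.isPoly hP') hne]
      exact Set.subset_inter hPτ hPτ'
    have h3 := polyDim_orbitProj_image hne hτ'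
    have hPm : P ∈ a.maxCells := a.mem_maxCells.2 ⟨hP, by have := hR.2; omega⟩
    have hPm' : P' ∈ a'.maxCells := a'.mem_maxCells.2 ⟨hP', by have := hR'.2; omega⟩
    rw [hw P hPm hPτ, hw' P' hPm' hPτ']
    exact hagree.2.2 P hPm P' hPm' hne (by omega)

lemma boundary_eq [FiniteDimensional ℝ V] (hΔ : ∀ σ ∈ Δ.cones, IsRegularCone L σ) (hL : IsFullLattice L) {τ : Δ.cones}
    {A : TropicalCycle L} {B : TropicalCycle (orbitLattice L τ.1)} (h : Δ.IsBoundary τ A B) :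
    Δ.boundary τ A = B :=
  IsBoundary.unique hΔ hL (Classical.epsilon_spec (p := Δ.IsBoundary τ A) ⟨B, h⟩) h

variable [TopologicalSpace V] [IsTopologicalAddGroup V] [ContinuousSMul ℝ V] [T2Space V]

/-- The complement is open in each chart. Near a point of `O(κ)`, a functional that vanishes exactly
on `κ` stays finite, so only orbits of faces of `κ` occur. If `κ ⊆ ρ(P)`, a violated inequality
separates the point. If not, compatibility makes the interior of `κ` miss `ρ(P)`, and Farkas' lemma
yields a coordinate that is infinite at the point but bounded on `P` nearby. -/
lemma isClosed_extension (hΔ : ∀ σ ∈ Δ.cones, IsRegularCone L σ) {P : Set V} (hP : IsPoly P)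
    (hne : P.Nonempty)
    (hc : ∀ σ ∈ Δ.cones, (σ : Set V) ⊆ recession P ∨
      intrinsicInterior ℝ (σ : Set V) ∩ recession P = ∅) : IsClosed (Δ.extension P) := by
  refine isClosed_iSup_iff.2 fun σ => ?_
  rw [isClosed_coinduced]
  let := Δ.chartTopology σ
  rw [← isOpen_compl_iff, isOpen_iff_forall_mem_open]
  rintro ⟨⟨κ, y⟩, hκσ⟩ hq
  obtain ⟨r, b, I, -, hσ⟩ := hΔ σ.1 σ.2
  have hκσ' : κ.1.IsFaceOf σ.1 := hκσ
  obtain ⟨u, hu, huκ⟩ := exists_supporting (hσ ▸ hκσ')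
  rw [← hσ] at hu huκ
  have hu0 : ∀ x ∈ κ.1, u x = 0 := fun x hx => (huκ x (hκσ'.le hx)).2 hx
  obtain ⟨z, rfl⟩ := orbitProj_surjective y
  have hadd : ∀ f : Module.Dual ℝ V, (∀ x ∈ κ.1, 0 ≤ f x) →
      ∃ N : ℝ, 0 ≤ N ∧ f + N • u ∈ dualCone σ.1 := by
    intro f hf
    obtain ⟨N, hN, h⟩ := exists_add_smul_nonneg (b := b) (I := I) (u := u) (κ := κ.1) (f := f)
      (hσ ▸ hu) (hσ ▸ huκ) hf
    exact ⟨N, hN, hσ ▸ h⟩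
  obtain ⟨A, rfl⟩ := hP
  obtain ⟨x₀, hx₀⟩ := hne
  have hrec := recession_eq hx₀
  by_cases hκ : (κ.1 : Set V) ⊆ recession {x : V | ∀ p ∈ A, p.2 ≤ p.1 x}
  · have hz : orbitProj κ.1 z ∉ orbitProj κ.1 '' {x : V | ∀ p ∈ A, p.2 ≤ p.1 x} :=
      fun h => hq ⟨hκ, h⟩
    rw [orbitProj_mem_image_iff ⟨x₀, hx₀⟩ hκ] at hz
    push Not at hz
    obtain ⟨f, hfA, hf0, hfz⟩ := hz
    obtain ⟨N, hN, hfu⟩ := hadd f.1 fun x hx => (hf0 x hx).ge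
    have hfu0 : ∀ x ∈ κ.1, (f.1 + N • u) x = 0 := fun x hx => by simp [hf0 x hx, hu0 x hx]
    -- `η` is the amount by which the inequality fails at `z`. Since `f = (f + N u) - N u`, the
    -- bounds on the two coordinates allow `f` to grow by less than `η / 2 + N δ ≤ η`.
    set η := f.2 - f.1 z with hη
    have hηpos : 0 < η := by linarith
    set δ := η / (2 * (N + 1)) with hδ
    have hδpos : 0 < δ := by positivity
    have hNδ : N * δ ≤ η / 2 := by
      rw [hδ, mul_div_assoc', div_le_div_iff₀ (by positivity) (by positivity)]
      nlinarith
    refine ⟨{p | evalOrbit p.1.cone.1 p.1.point u ∈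
          Set.Ioo ((u z - δ : ℝ) : EReal) ((u z + 1 : ℝ) : EReal)} ∩
        {p | evalOrbit p.1.cone.1 p.1.point (f.1 + N • u) ∈
          Set.Iio (((f.1 + N • u) z + η / 2 : ℝ) : EReal)}, ?_,
      (isOpen_chart_evalOrbit hu isOpen_Ioo).inter (isOpen_chart_evalOrbit hfu isOpen_Iio), ?_, ?_⟩
    · rintro p ⟨hp1, hp2⟩ ⟨-, x, hx, hxp⟩
      have hpκ := vanish_of_evalOrbit_lt huκ hp1.2
      simp only [Set.mem_ofPred_eq, ← hxp] at hp1 hp2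
      rw [evalOrbit_orbitProj fun x hx => hu0 x (hpκ hx)] at hp1
      rw [evalOrbit_orbitProj fun x hx => hfu0 x (hpκ hx)] at hp2
      have h1 := EReal.coe_lt_coe_iff.1 hp1.1
      have h2 := EReal.coe_lt_coe_iff.1 hp2
      have h3 := hx f hfA
      simp only [LinearMap.add_apply, LinearMap.smul_apply, smul_eq_mul] at h2
      nlinarith [mul_le_mul_of_nonneg_left h1.le hN]
    · change evalOrbit κ.1 (orbitProj κ.1 z) u ∈ Set.Ioo ((u z - δ : ℝ) : EReal) ((u z + 1 : ℝ) : EReal)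
      rw [evalOrbit_orbitProj hu0]
      exact ⟨EReal.coe_lt_coe_iff.2 (by linarith), EReal.coe_lt_coe_iff.2 (by linarith)⟩
    · change evalOrbit κ.1 (orbitProj κ.1 z) (f.1 + N • u) ∈ Set.Iio (((f.1 + N • u) z + η / 2 : ℝ) : EReal)
      rw [evalOrbit_orbitProj hfu0]
      exact EReal.coe_lt_coe_iff.2 (by linarith)
  · obtain ⟨s, e, J, -, hκe⟩ := hΔ κ.1 κ.2
    have hint := (hc κ.1 κ.2).resolve_left hκ
    obtain ⟨g, hg, hgκ, hgne⟩ := exists_separating (b := e) (I := J)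
        (A := Prod.fst '' (A : Set (Module.Dual ℝ V × ℝ))) (A.finite_toSet.image _) (by
      intro x hx hxJ
      by_contra hneg
      push Not at hneg
      have h1 := mem_intrinsicInterior_hull_basis hxJ hneg
      rw [← hκe] at h1
      refine Set.eq_empty_iff_forall_notMem.1 hint x ⟨h1, ?_⟩
      rw [hrec]
      exact fun p hp => hx _ ⟨p, hp, rfl⟩)
    rw [← hκe] at hgκ hgne
    obtain ⟨c, hc⟩ := exists_lower_bound hg
    -- The coordinate `-g + N u` is infinite at the given point because `g` does not vanish on `κ`,
    -- while on `P` near that point it is at most `-c + N (u z + 1)`.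
    obtain ⟨N, hN, hgu⟩ := hadd (-g) fun x hx => by
      rw [LinearMap.neg_apply]; linarith [hgκ x hx]
    refine ⟨{p | evalOrbit p.1.cone.1 p.1.point u ∈ Set.Iio ((u z + 1 : ℝ) : EReal)} ∩
        {p | evalOrbit p.1.cone.1 p.1.point (-g + N • u) ∈
          Set.Ioi ((-c + N * (u z + 1) : ℝ) : EReal)}, ?_,
      (isOpen_chart_evalOrbit hu isOpen_Iio).inter (isOpen_chart_evalOrbit hgu isOpen_Ioi), ?_, ?_⟩
    · rintro p ⟨hp1, hp2⟩ ⟨hpr, x, hx, hxp⟩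
      have hpκ := vanish_of_evalOrbit_lt huκ hp1
      have hp0 : ∀ x ∈ p.1.cone.1, (-g + N • u) x = 0 := by
        intro w hw
        have hw' := hpr hw
        rw [hrec] at hw'
        have h1 : 0 ≤ g w := nonneg_of_mem_hull hg (by
          rintro _ ⟨p, hp, rfl⟩
          exact hw' p hp)
        have h2 := hgκ w (hpκ hw)
        have h3 := hu0 w (hpκ hw)
        simp only [LinearMap.add_apply, LinearMap.smul_apply, LinearMap.neg_apply, smul_eq_mul, h3]
        linarith
      simp only [Set.mem_ofPred_eq, ← hxp] at hp1 hp2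
      rw [evalOrbit_orbitProj fun x hx => hu0 x (hpκ hx)] at hp1
      rw [evalOrbit_orbitProj hp0] at hp2
      have h1 := EReal.coe_lt_coe_iff.1 hp1
      have h2 := EReal.coe_lt_coe_iff.1 hp2
      have h3 := hc x hx
      simp only [LinearMap.add_apply, LinearMap.smul_apply, LinearMap.neg_apply, smul_eq_mul] at h2
      nlinarith [mul_le_mul_of_nonneg_left h1.le hN]
    · change evalOrbit κ.1 (orbitProj κ.1 z) u ∈ Set.Iio ((u z + 1 : ℝ) : EReal)
      rw [evalOrbit_orbitProj hu0]
      exact EReal.coe_lt_coe_iff.2 (by linarith)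
    · change evalOrbit κ.1 (orbitProj κ.1 z) (-g + N • u) ∈ Set.Ioi ((-c + N * (u z + 1) : ℝ) : EReal)
      rw [evalOrbit_eq_top]
      · exact EReal.coe_lt_top _
      · intro h
        obtain ⟨x, hx, hgx⟩ := hgne
        have := h x hx
        simp only [LinearMap.add_apply, LinearMap.smul_apply, LinearMap.neg_apply, smul_eq_mul,
          hu0 x hx] at this
        exact hgx (by linarith)

variable [FiniteDimensional ℝ V]

/-- One inclusion comes from limits of rays inside the cells. For the other, the finite union of the
closed extensions of the cells contains the embedded support, hence its closure. -/
lemma support_boundary (hΔ : ∀ σ ∈ Δ.cones, IsRegularCone L σ) (τ : Δ.cones)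
    (a : TropicalComplex L)
    (hc : ∀ P ∈ a.cells, ∀ σ ∈ Δ.cones, (σ : Set V) ⊆ recession P ∨
      intrinsicInterior ℝ (σ : Set V) ∩ recession P = ∅) :
    (a.boundary τ.1).support = Δ.boundarySet τ a.support := by
  ext y
  rw [TropicalComplex.mem_support]
  constructor
  · rintro ⟨R, hR, hy⟩
    obtain ⟨P, hP, rfl⟩ := TropicalComplex.mem_boundaryCells.1 hR
    rw [TropicalComplex.mem_cellsAlong] at hP
    exact closure_mono (Set.image_mono (TropicalComplex.subset_support hP.1))
      (subset_boundarySet hΔ τ hP.2 hy)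
  · intro hy
    have h1 : IsClosed (⋃ P ∈ a.cells, Δ.extension P) :=
      a.cells.finite_toSet.isClosed_biUnion fun P hP =>
        isClosed_extension hΔ (a.isPoly hP) (a.nonempty hP) (hc P hP)
    have h2 : Δ.embed '' a.support ⊆ ⋃ P ∈ a.cells, Δ.extension P := by
      rintro _ ⟨x, hx, rfl⟩
      obtain ⟨P, hP, hxP⟩ := TropicalComplex.mem_support.1 hx
      exact Set.mem_biUnion hP (embed_mem_extension hxP)
    obtain ⟨P, hP, hPy⟩ := Set.mem_iUnion₂.1 (closure_minimal h2 h1 hy)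
    exact ⟨_, TropicalComplex.mem_boundaryCells.2
      ⟨P, TropicalComplex.mem_cellsAlong.2 ⟨hP, hPy.1⟩, rfl⟩, hPy.2⟩

lemma isBoundary_boundary (hΔ : ∀ σ ∈ Δ.cones, IsRegularCone L σ) (τ : Δ.cones)
    (a : TropicalComplex L)
    (hc : ∀ P ∈ a.cells, ∀ σ ∈ Δ.cones, (σ : Set V) ⊆ recession P ∨
      intrinsicInterior ℝ (σ : Set V) ∩ recession P = ∅) :
    Δ.IsBoundary τ (TropicalCycle.mk a) (TropicalCycle.mk (a.boundary τ.1)) := by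
  refine ⟨a, a.boundary τ.1, rfl, rfl, support_boundary hΔ τ a hc, ?_, ⟨?_, ?_, ?_⟩, ?_⟩
  · have h1 := finrank_orbit τ.1
    have h2 : (a.boundary τ.1).dim =
      a.dim - Module.finrank ℝ (Submodule.span ℝ (τ.1 : Set V)) := rfl
    omega
  · exact fun P hP => TropicalComplex.mem_boundaryCells.2
      ⟨P, TropicalComplex.mem_cellsAlong.2 hP, rfl⟩
  · exact fun P hP Q hQ h => TropicalComplex.orbitProj_image_injOn
      (TropicalComplex.mem_cellsAlong.2 hP) (TropicalComplex.mem_cellsAlong.2 hQ) h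
  · intro R hR
    obtain ⟨P, hP, rfl⟩ := TropicalComplex.mem_boundaryCells.1 hR
    exact ⟨P, TropicalComplex.mem_cellsAlong.1 hP, rfl⟩
  · exact fun P hP hPτ => TropicalComplex.weight_boundary (a.mem_maxCells.1 hP).1 hPτ

end UnimodularFan

end Closure

/-! ### The integer lattice -/

section StdLattice

lemma span_stdLattice (n : ℕ) : Submodule.span ℝ (stdLattice n : Set (Fin n → ℝ)) = ⊤ := by
  rw [stdLattice, Submodule.span_span_of_tower, (Pi.basisFun ℝ (Fin n)).span_eq]

lemma isFullLattice_stdLattice (n : ℕ) : IsFullLattice (stdLattice n) := by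
  refine ⟨span_stdLattice n, ?_⟩
  rw [eq_top_iff, ← (Pi.basisFun ℝ (Fin n)).dualBasis.span_eq, Submodule.span_le]
  rintro _ ⟨i, rfl⟩
  refine Submodule.subset_span fun x hx => ?_
  rw [Module.Basis.coe_dualBasis]
  induction hx using Submodule.span_induction with
  | mem x hx =>
    obtain ⟨j, rfl⟩ := hx
    exact ⟨if j = i then 1 else 0, by
      simp [Pi.basisFun_apply, Pi.single_apply, eq_comm]⟩
  | zero => exact ⟨0, by simp⟩
  | add x y _ _ hx hy =>
    obtain ⟨a, ha⟩ := hx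
    obtain ⟨b, hb⟩ := hy
    exact ⟨a + b, by rw [map_add, ha, hb]; push_cast; rfl⟩
  | smul c x _ hx =>
    obtain ⟨a, ha⟩ := hx
    exact ⟨c * a, by rw [map_zsmul, ha, zsmul_eq_mul]; push_cast; rfl⟩

lemma IsUnimodularCone.isRegularCone {n : ℕ} {σ : PointedCone ℝ (Fin n → ℝ)}
    (h : IsUnimodularCone (stdLattice n) σ) : IsRegularCone (stdLattice n) σ := by
  obtain ⟨r, b, I, rfl⟩ := h
  have : DiscreteTopology (stdLattice n) :=
    inferInstanceAs (DiscreteTopology (Submodule.span ℤ (Set.range (Pi.basisFun ℝ (Fin n)))))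
  have : IsZLattice ℝ (stdLattice n) := ⟨span_stdLattice n⟩
  have hb : ∀ i, b.ofZLatticeBasis ℝ (stdLattice n) i = b i := fun i => by simp
  refine ⟨r, b.ofZLatticeBasis ℝ (stdLattice n), I, fun i => ?_, ?_⟩
  · rw [hb]
    exact (b i).2
  · simp only [hb]

end StdLattice

/-! ### Compatibility of stable intersections with the fan -/

section Compatible

variable {V : Type*} [AddCommGroup V] [Module ℝ V] {L : Submodule ℤ V} [FiniteDimensional ℝ V]
  [TopologicalSpace V]

namespace UnimodularFan

variable {Δ : UnimodularFan L}

/-- The cells are intersections of cells, and the recession cone of a non-empty intersection is the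
intersection of the recession cones; the dichotomy passes to it. -/
lemma compatible_stableComplex (hL : IsFullLattice L) {a b : TropicalComplex L} {v : V}
    (hv : TropicalComplex.IsGeneric a b v)
    (ha : ∀ P ∈ a.cells, ∀ σ ∈ Δ.cones, (σ : Set V) ⊆ recession P ∨
      intrinsicInterior ℝ (σ : Set V) ∩ recession P = ∅)
    (hb : ∀ P ∈ b.cells, ∀ σ ∈ Δ.cones, (σ : Set V) ⊆ recession P ∨
      intrinsicInterior ℝ (σ : Set V) ∩ recession P = ∅) :
    ∀ P ∈ (stableComplex hL a b hv).cells, ∀ σ ∈ Δ.cones, (σ : Set V) ⊆ recession P ∨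
      intrinsicInterior ℝ (σ : Set V) ∩ recession P = ∅ := by
  intro F hF σ hσ
  obtain ⟨hne, P, hP, Q, hQ, rfl⟩ := mem_cellInters.1 (mem_stableCells.1 hF).1
  rw [(a.isPoly hP).recession_inter (b.isPoly hQ) hne]
  rcases ha P hP σ hσ with h | h
  · rcases hb Q hQ σ hσ with h' | h'
    · exact Or.inl (Set.subset_inter h h')
    · refine Or.inr (Set.subset_empty_iff.1 (h' ▸ ?_))
      exact Set.inter_subset_inter_right _ Set.inter_subset_right
  · refine Or.inr (Set.subset_empty_iff.1 (h ▸ ?_))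
    exact Set.inter_subset_inter_right _ Set.inter_subset_left

lemma IsCompatible.stableCycle {A B : TropicalCycle L} (hL : IsFullLattice L) (hA : Δ.IsCompatible A)
    (hB : Δ.IsCompatible B) : Δ.IsCompatible (TropicalCycle.stableCycle hL A B) := by
  obtain ⟨a, rfl, ha⟩ := hA
  obtain ⟨b, rfl, hb⟩ := hB
  obtain ⟨v, hv⟩ := exists_isGeneric a b
  exact ⟨stableComplex hL a b hv,
    (TropicalCycle.stableCycle_mk hL (isStableIntersection_stableComplex hL a b hv)).symm,
    compatible_stableComplex hL hv ha hb⟩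

end UnimodularFan

end Compatible

/-! ### Boundaries of stable intersections of cycles -/

section Main

variable {V : Type*} [AddCommGroup V] [Module ℝ V] {L : Submodule ℤ V} [FiniteDimensional ℝ V]
  [TopologicalSpace V] [IsTopologicalAddGroup V] [ContinuousSMul ℝ V] [T2Space V]
  {Δ : UnimodularFan L} {A B : TropicalCycle L}

namespace UnimodularFan

lemma IsCompatible.hasBoundary (hΔ : ∀ σ ∈ Δ.cones, IsRegularCone L σ) (hL : IsFullLattice L)
    (hA : Δ.IsCompatible A) (τ : Δ.cones) : Δ.HasBoundary τ A := by
  obtain ⟨a, rfl, ha⟩ := hA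
  exact ⟨_, isBoundary_boundary hΔ τ a ha,
    fun B hB => IsBoundary.unique hΔ hL hB (isBoundary_boundary hΔ τ a ha)⟩

/-- The boundary is compatible with stable intersections. -/
theorem boundary_stableCycle (hΔ : ∀ σ ∈ Δ.cones, IsRegularCone L σ) (hL : IsFullLattice L)
    (hA : Δ.IsCompatible A) (hB : Δ.IsCompatible B) (τ : Δ.cones)
    (hτ : IsFullLattice (orbitLattice L τ.1)) :
    Δ.boundary τ (TropicalCycle.stableCycle hL A B) =
      TropicalCycle.stableCycle hτ (Δ.boundary τ A) (Δ.boundary τ B) := by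
  obtain ⟨a, rfl, ha⟩ := hA
  obtain ⟨b, rfl, hb⟩ := hB
  obtain ⟨v, hv⟩ := exists_isGeneric a b
  rw [TropicalCycle.stableCycle_mk hL (isStableIntersection_stableComplex hL a b hv),
    boundary_eq hΔ hL (isBoundary_boundary hΔ τ _ (compatible_stableComplex hL hv ha hb)),
    boundary_eq hΔ hL (isBoundary_boundary hΔ τ a ha),
    boundary_eq hΔ hL (isBoundary_boundary hΔ τ b hb)]
  exact TropicalComplex.mk_boundary_stableComplex hL hτ hv

end UnimodularFan

end Main

end Tropical

end

/-! ### The proposition -/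

open Tropical
theorem proposition3p8 (n : ℕ) (Δ : UnimodularFan (stdLattice n)) (hΔ : Δ.IsComplete)
    (l m : ℕ) (S₁ S₂ : TropicalCycle (stdLattice n))
    (hl : S₁.dim = (n : ℤ) - l) (hm : S₂.dim = (n : ℤ) - m)
    (h₁ : Δ.IsCompatible S₁) (h₂ : Δ.IsCompatible S₂) :
    S₁.HasStableIntersection S₂ ∧
    Δ.IsCompatible (S₁.stableIntersection S₂) ∧
    (∀ τ : Δ.cones,
      Δ.HasBoundary τ S₁ ∧ Δ.HasBoundary τ S₂ ∧ Δ.HasBoundary τ (S₁.stableIntersection S₂) ∧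
      (Δ.boundary τ S₁).HasStableIntersection (Δ.boundary τ S₂) ∧
      Δ.boundary τ (S₁.stableIntersection S₂) =
        (Δ.boundary τ S₁).stableIntersection (Δ.boundary τ S₂)) ∧
    (∀ (k : ℤ) (γ : Δ.Cycle), γ.HasDim k →
      γ.HasCompactifiedIntersection S₁ ∧
      (γ.compactifiedIntersection S₁).HasCompactifiedIntersection S₂ ∧
      γ.HasCompactifiedIntersection (S₁.stableIntersection S₂) ∧
      (γ.compactifiedIntersection S₁).compactifiedIntersection S₂ =
        γ.compactifiedIntersection (S₁.stableIntersection S₂)) := by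
  have hL := isFullLattice_stdLattice n
  have hreg : ∀ σ ∈ Δ.cones, IsRegularCone (stdLattice n) σ :=
    fun σ hσ => (Δ.unimodular σ hσ).isRegularCone
  -- The theory of stable intersections was developed for any full lattice, so it applies in every
  -- orbit.
  have hτ : ∀ τ : Δ.cones, IsFullLattice (orbitLattice (stdLattice n) τ.1) :=
    fun τ => isFullLattice_orbitLattice hL (hreg τ.1 τ.2).isRationalSubspace
  have h₁₂ := h₁.stableCycle hL h₂
  rw [← TropicalCycle.stableIntersection_eq] at h₁₂
  have hb₁ := h₁.hasBoundary hreg hL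
  have hb₂ := h₂.hasBoundary hreg hL
  have hb₁₂ := h₁₂.hasBoundary hreg hL
  have hprod : ∀ τ : Δ.cones, Δ.boundary τ (S₁.stableIntersection S₂) =
      (Δ.boundary τ S₁).stableIntersection (Δ.boundary τ S₂) := by
    intro τ
    rw [TropicalCycle.stableIntersection_eq hL, TropicalCycle.stableIntersection_eq (hτ τ)]
    exact UnimodularFan.boundary_stableCycle hreg hL h₁ h₂ τ (hτ τ)
  have hst : ∀ (τ : Δ.cones) (A B : TropicalCycle (orbitLattice (stdLattice n) τ.1)),
      A.HasStableIntersection B := fun τ => TropicalCycle.hasStableIntersection (hτ τ)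
  refine ⟨TropicalCycle.hasStableIntersection hL S₁ S₂, h₁₂,
    fun τ => ⟨hb₁ τ, hb₂ τ, hb₁₂ τ, hst τ _ _, hprod τ⟩, fun k γ _ =>
    ⟨fun τ => ⟨hb₁ τ, hst τ _ _⟩, fun τ => ⟨hb₂ τ, hst τ _ _⟩, fun τ => ⟨hb₁₂ τ, hst τ _ _⟩, ?_⟩⟩
  funext τ
  simp only [UnimodularFan.Cycle.compactifiedIntersection]
  -- Once the boundary of the product is the product of the boundaries, what remains is
  -- associativity in `O(τ)`.
  rw [hprod τ]
  simp only [TropicalCycle.stableIntersection_eq (hτ τ)]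
  exact TropicalCycle.stableCycle_assoc (hτ τ) _ _ _
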